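/- Let $M$ be a smooth manifold without boundary, $\omega$ a smooth closed 2-form on $M$, and $\sigma:E\to M$ an oriented smooth real vector bundle of rank $n\ge 0$ with a smooth bundle metric $g$. Let $\nabla$ be a smooth connection on $E$ compatible with $g$ and let $\Phi$ be a smooth section of $\mathrm{End}(E)$ that is skew-adjoint for $g$. Let $\widetilde E=\sigma^*E\to E$, $\widetilde\omega=\sigma^*\omega$, $\widetilde\nabla=\sigma^*\nabla$, $\widetilde\Phi=\sigma^*\Phi$, $\widetilde g=\sigma^*g$ be the pullbacks to the total space, with $\widetilde\nabla$ extended to $\widetilde E$-valued forms by $\widetilde\nabla(\eta\otimes w)=d\eta\otimes w+(-1)^{|\eta|}\eta\wedge\widetilde\nabla w$. On pairs of $\widetilde E$-valued forms on $E$ put $$\widetilde{\mathbb A}(\alpha,\beta)=(\widetilde\nabla\alpha+\widetilde\omega\wedge\beta,\ \widetilde\Phi\alpha-\widetilde\nabla\beta),$$ and on pairs of real-valued forms in $\Omega^i(E)\oplus\Omega^{i-1}(E)$ put $$d^{\widetilde\omega}(\alpha,\beta)=(d\alpha+\widetilde\omega\wedge\beta,\ -d\beta).$$ Let $\mathbf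 v$ be the tautological section of $\widetilde E$, so $\mathbf v(y)=y$ for $y\in E$. For a local orthonormal frame $e_1,\dots,e_n$ of $E$ with lifts $\widetilde e_i=\sigma^*e_i$, put $$Q=\sum_{i<j}\widetilde g\big(\widetilde\nabla^2\widetilde e_i+\widetilde\omega\wedge\widetilde\Phi\widetilde e_i,\widetilde e_j\big)\otimes(\widetilde e_i\wedge\widetilde e_j),\qquad S=\sum_{i<j}\widetilde g\big(\widetilde\Phi\widetilde\nabla\widetilde e_i-\widetilde\nabla\widetilde\Phi\widetilde e_i,\widetilde e_j\big)\otimes(\widetilde e_i\wedge\widetilde e_j)$$ (these are globally defined), and $$\mathcal A=\big(\tfrac12|\mathbf v|^2,0\big)+\widetilde{\mathbb A}(\mathbf v,0)-(Q,S)\in\Omega^*(E,\Lambda^*\widetilde E)\oplus\Omega^*(E,\Lambda^*\widetilde E).$$ Pairs of $\Lambda^*\widetilde E$-valued forms are multiplied by the wedge product determined by $$(\alpha\otimes x,\beta\otimes y)\wedge(\gamma\otimes u,\delta\otimes w)=\Big((-1)^{|x||\gamma|}(\alpha\wedge\gamma)\otimes(x\wedge u),\ (-1)^{|y||\gamma|}(\beta\wedge\gamma)\otimes(y\wedge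 u)+(-1)^{|\alpha|+|x|(|\delta|+1)}(\alpha\wedge\delta)\otimes(x\wedge w)\Big),$$ with unit $(1,0)$, and $e^{-\mathcal A}=\sum_{j\ge0}\frac1{j!}(-\mathcal A)^{j}$ (a pointwise convergent series). The Berezin integral $\int^B:\Omega^*(E,\Lambda^*\widetilde E)\to\Omega^*(E)$ takes the coefficient of $\widetilde e_1\wedge\dots\wedge\widetilde e_n$ for an oriented orthonormal frame, and it is applied to each component of a pair. Put $$\mathcal U=(-1)^{n(n+1)/2}\Big(\frac1{2\pi}\Big)^{n/2}\int^B e^{-\mathcal A}.$$ Then $\mathcal U$ is a pair of smooth forms in $\Omega^n(E)\oplus\Omega^{n-1}(E)$ (with $\Omega^{-1}=0$), and it is closed: $d^{\widetilde\omega}\mathcal U=0$. The integrals of its components along the fibers of $E$, oriented by the orientation of $E$, converge, and $$\int_{E/M}\mathcal U=(1,0),$$ where $\int_{E/M}:\Omega^{k}(E)\to\Omega^{k-n}(M)$ is integration along the fiber (zero for $k<n$), applied to each component of a pair. -/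

import Mathlib

open Bundle Manifold
open scoped ContDiff Topology

namespace MappingConeThom

/-! ### Pointwise multilinear algebra -/

section Algebra

variable {T A B C W : Type*} [AddCommGroup T] [Module ℝ T]
  [AddCommGroup A] [Module ℝ A] [AddCommGroup B] [Module ℝ B] [AddCommGroup C] [Module ℝ C]
  [NormedAddCommGroup W] [InnerProductSpace ℝ W]

/-- The wedge product of an `A`-valued alternating `k`-form and a `B`-valued alternating `l`-form
with respect to a bilinear map `μ : A × B → C`; it is the sum over `(k, l)`-shuffles
`(a ∧ b)(v₁, …, vₖ₊ₗ) = ∑ sign(s) μ(a(v_{s 1}, …, v_{s k}), b(v_{s (k+1)}, …, v_{s (k+l)}))`. -/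
noncomputable def wedge (μ : A →ₗ[ℝ] B →ₗ[ℝ] C) {k l : ℕ}
    (a : T [⋀^Fin k]→ₗ[ℝ] A) (b : T [⋀^Fin l]→ₗ[ℝ] B) : T [⋀^Fin (k + l)]→ₗ[ℝ] C :=
  ((TensorProduct.lift μ).compAlternatingMap (a.domCoprod b)).domDomCongr finSumFinEquiv

/-- `θ ∧ b` for a real-valued 2-form `θ` and a vector-valued `k`-form `b`. -/
noncomputable def wedgeTwo {k : ℕ} (θ : T [⋀^Fin 2]→ₗ[ℝ] ℝ) (b : T [⋀^Fin k]→ₗ[ℝ] B) :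
    T [⋀^Fin (k + 2)]→ₗ[ℝ] B :=
  (wedge (LinearMap.lsmul ℝ B) θ b).domDomCongr (finCongr (Nat.add_comm 2 k))

variable (T W) in
/-- The algebra `⨁ₖ Λᵏ T* ⊗ Λ* W`, an element being the family of its components, where the
component of form degree `k` is an alternating `k`-form on `T` with values in `Λ* W`. (The
components with `k > dim T` vanish.) -/
abbrev LForm : Type _ := ∀ k : ℕ, T [⋀^Fin k]→ₗ[ℝ] ExteriorAlgebra ℝ W

/-- The sign involution `x ↦ (-1)^{|x|} x` of `Λ* W`. -/
noncomputable def signInv : ExteriorAlgebra ℝ W →ₗ[ℝ] ExteriorAlgebra ℝ W :=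
  (CliffordAlgebra.involute (Q := (0 : QuadraticForm ℝ W))).toLinearMap

variable (W) in
/-- The bilinear map `(x, u) ↦ (-1)^{|x| l} x ∧ u` on `Λ* W`. -/
noncomputable def signedMul (l : ℕ) :
    ExteriorAlgebra ℝ W →ₗ[ℝ] ExteriorAlgebra ℝ W →ₗ[ℝ] ExteriorAlgebra ℝ W :=
  (LinearMap.mul ℝ (ExteriorAlgebra ℝ W)).comp (signInv ^ l)

/-- The product `(α ⊗ x) ∧ (γ ⊗ u) = (-1)^{|x||γ|} (α ∧ γ) ⊗ (x ∧ u)`. -/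
noncomputable def gmul (a b : LForm T W) : LForm T W := fun m =>
  ∑ k : Fin (m + 1), (wedge (signedMul W (m - k)) (a k) (b (m - k))).domDomCongr
    (finCongr (Nat.add_sub_of_le (Nat.le_of_lt_succ k.2)))

/-- The automorphism `α ⊗ x ↦ (-1)^{|α|+|x|} α ⊗ x`. -/
noncomputable def totalSign (a : LForm T W) : LForm T W := fun k =>
  (-1 : ℝ) ^ k • signInv.compAlternatingMap (a k)

/-- The wedge product on pairs,
`(α⊗x, β⊗y) ∧ (γ⊗u, δ⊗v) = ((-1)^{|x||γ|} (α∧γ)⊗(x∧u),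
  (-1)^{|y||γ|} (β∧γ)⊗(y∧u) + (-1)^{|α|+|x|(|δ|+1)} (α∧δ)⊗(x∧v))`. -/
noncomputable def pairMul (a b : LForm T W × LForm T W) : LForm T W × LForm T W :=
  (gmul a.1 b.1, gmul a.2 b.1 + gmul (totalSign a.1) b.2)

/-- An element of `Λ* W`, as an element of form degree `0`. -/
noncomputable def ofZero (x : ExteriorAlgebra ℝ W) : LForm T W :=
  Pi.single 0 (AlternatingMap.constOfIsEmpty ℝ T (Fin 0) x)

/-- Powers for the wedge product of pairs; the unit is `(1, 0)`. -/
noncomputable def pairPow (a : LForm T W × LForm T W) : ℕ → LForm T W × LForm T W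
  | 0 => (ofZero 1, 0)
  | j + 1 => pairMul a (pairPow a j)

/-- The sum of a series in a real vector space with respect to its module topology (for a finite
dimensional space: its unique Hausdorff vector space topology). -/
noncomputable def vsum {X : Type*} [AddCommGroup X] [Module ℝ X] (f : ℕ → X) : X :=
  letI : TopologicalSpace X := moduleTopology ℝ X
  ∑' j, f j

/-- The exponential `∑ⱼ aʲ / j!` of a pair, where powers are taken for the wedge product of
pairs. -/
noncomputable def pairExp (a : LForm T W × LForm T W) : LForm T W × LForm T W :=
  (fun k => vsum fun j => (j.factorial : ℝ)⁻¹ • (pairPow a j).1 k,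
   fun k => vsum fun j => (j.factorial : ℝ)⁻¹ • (pairPow a j).2 k)

/-- The linear form `Λ* W → ℝ` that gives the coefficient of `e₁ ∧ ⋯ ∧ eₙ`, where `e₁, …, eₙ` is an
oriented orthonormal basis of `W`: it is zero on `Λʳ W` for `r ≠ n`, and it is the volume form on
`Λⁿ W`. -/
noncomputable def topCoeff {n : ℕ} [Fact (Module.finrank ℝ W = n)]
    (o : Orientation ℝ W (Fin n)) : ExteriorAlgebra ℝ W →ₗ[ℝ] ℝ :=
  ExteriorAlgebra.liftAlternating
    (Pi.single (M := fun r : ℕ => W [⋀^Fin r]→ₗ[ℝ] ℝ) n o.volumeForm)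

end Algebra

theorem continuous_of_finiteDim {T : Type*} [AddCommGroup T] [Module ℝ T] [TopologicalSpace T]
    [IsTopologicalAddGroup T] [ContinuousSMul ℝ T] [T2Space T] [FiniteDimensional ℝ T] {k : ℕ}
    (a : T [⋀^Fin k]→ₗ[ℝ] ℝ) : Continuous fun v : Fin k → T => a v := by
  let b := Module.finBasis ℝ T
  have h : (fun v : Fin k → T => a v) =
      fun v => ∑ f : Fin k → Fin (Module.finrank ℝ T),
        (∏ i, b.coord (f i) (v i)) * a (fun i => b (f i)) := by
    funext v
    have hv : v = fun i => ∑ j, b.repr (v i) j • b j := by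
      funext i
      exact (b.sum_repr (v i)).symm
    conv_lhs => rw [hv]
    change a.toMultilinearMap _ = _
    rw [MultilinearMap.map_sum]
    refine Finset.sum_congr rfl fun f _ => ?_
    rw [MultilinearMap.map_smul_univ]
    rfl
  rw [h]
  refine continuous_finsetSum _ fun f _ => Continuous.mul ?_ continuous_const
  refine continuous_finsetProd _ fun i _ => ?_
  exact (LinearMap.continuous_of_finiteDimensional (b.coord (f i))).comp (continuous_apply i)

/-- An alternating map on a finite dimensional space is continuous. -/
noncomputable def toCont {T : Type*} [AddCommGroup T] [Module ℝ T] [TopologicalSpace T]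
    [IsTopologicalAddGroup T] [ContinuousSMul ℝ T] [T2Space T] [FiniteDimensional ℝ T] {k : ℕ}
    (a : T [⋀^Fin k]→ₗ[ℝ] ℝ) : T [⋀^Fin k]→L[ℝ] ℝ :=
  { a with
    cont := continuous_of_finiteDim a }

/-! ### Differential forms on a manifold without boundary -/

section Forms

variable {E H : Type*} [NormedAddCommGroup E] [NormedSpace ℝ E] [TopologicalSpace H]
  (I : ModelWithCorners ℝ E H) (N : Type*) [TopologicalSpace N] [ChartedSpace H N]

/-- Real-valued differential `k`-forms on `N` (not necessarily smooth). -/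
abbrev DForm (k : ℕ) : Type _ := ∀ x : N, TangentSpace I x [⋀^Fin k]→L[ℝ] ℝ

variable {N}

/-- The local expression of a form in the preferred chart at `x₀`. -/
noncomputable def inChart {k : ℕ} (α : DForm I N k) (x₀ : N) (y : E) : E [⋀^Fin k]→L[ℝ] ℝ :=
  (α ((extChartAt I x₀).symm y)).compContinuousLinearMap
    (mfderiv 𝓘(ℝ, E) I (extChartAt I x₀).symm y)

/-- Smoothness of a form: its local expressions in charts are smooth. -/
def IsSmoothForm {k : ℕ} (α : DForm I N k) : Prop :=
  ∀ x₀ : N, ContDiffOn ℝ ∞ (inChart I α x₀) (extChartAt I x₀).target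

/-- The exterior derivative, computed at `x` in the preferred chart at `x`. -/
noncomputable def extD {k : ℕ} (α : DForm I N k) : DForm I N (k + 1) := fun x =>
  (extDeriv (inChart I α x) (extChartAt I x x)).compContinuousLinearMap
    (mfderiv I 𝓘(ℝ, E) (extChartAt I x) x)

instance [FiniteDimensional ℝ E] (x : N) : FiniteDimensional ℝ (TangentSpace I x) :=
  inferInstanceAs (FiniteDimensional ℝ E)

instance (x : N) : T2Space (TangentSpace I x) :=
  inferInstanceAs (T2Space E)

/-- The mapping cone differential
`d^θ (α, β) = (dα + θ ∧ β, -dβ)` on `Ω*(N) ⊕ Ω*(N)`, for a 2-form `θ`. It maps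
`Ωⁱ ⊕ Ωⁱ⁻¹` to `Ωⁱ⁺¹ ⊕ Ωⁱ`. -/
noncomputable def coneD [FiniteDimensional ℝ E] (θ : DForm I N 2)
    (a : (∀ k, DForm I N k) × (∀ k, DForm I N k)) :
    (∀ k, DForm I N k) × (∀ k, DForm I N k) :=
  (fun k => match k with
    | 0 => 0
    | 1 => extD I (a.1 0)
    | k + 2 => fun x => extD I (a.1 (k + 1)) x
        + toCont (wedgeTwo (θ x).toAlternatingMap (a.2 k x).toAlternatingMap),
   fun k => match k with
    | 0 => 0
    | k + 1 => -extD I (a.2 k))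

/-- The pair belongs to `Ωⁿ(N) ⊕ Ωⁿ⁻¹(N)`, with `Ω⁻¹ = 0`. -/
def IsPairOfDegree (n : ℕ) (a : (∀ k, DForm I N k) × (∀ k, DForm I N k)) : Prop :=
  (∀ k, IsSmoothForm I (a.1 k)) ∧ (∀ k, IsSmoothForm I (a.2 k)) ∧
    (∀ k, k ≠ n → a.1 k = 0) ∧ (∀ k, k + 1 ≠ n → a.2 k = 0)

end Forms

/-! ### The vector bundle, its total space, and the Thom form -/

section Bundle

variable {EM H M : Type*} [NormedAddCommGroup EM] [NormedSpace ℝ EM]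
  [TopologicalSpace H] (I : ModelWithCorners ℝ EM H) [TopologicalSpace M] [ChartedSpace H M]
  {n : ℕ} {V : M → Type*} [TopologicalSpace (TotalSpace (EuclideanSpace ℝ (Fin n)) V)]
  [∀ x, NormedAddCommGroup (V x)] [∀ x, InnerProductSpace ℝ (V x)]
  [FiberBundle (EuclideanSpace ℝ (Fin n)) V] [VectorBundle ℝ (EuclideanSpace ℝ (Fin n)) V]

variable (n V) in
/-- The total space of the bundle. -/
abbrev Tot : Type _ := TotalSpace (EuclideanSpace ℝ (Fin n)) V

variable (n) in
/-- The model with corners of the total space. -/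
noncomputable abbrev totI : ModelWithCorners ℝ (EM × EuclideanSpace ℝ (Fin n))
    (ModelProd H (EuclideanSpace ℝ (Fin n))) :=
  I.prod 𝓘(ℝ, EuclideanSpace ℝ (Fin n))

variable (n) in
/-- The identification of a fibre with `ℝⁿ` given by the preferred trivialization near it. -/
noncomputable def fiberEquiv (x : M) : V x ≃ₗ[ℝ] EuclideanSpace ℝ (Fin n) :=
  (trivializationAt (EuclideanSpace ℝ (Fin n)) V x).linearEquivAt ℝ x
    (mem_baseSet_trivializationAt _ _ x)

theorem fiber_finiteDimensional {M : Type*} [TopologicalSpace M] (n : ℕ) {V : M → Type*}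
    [TopologicalSpace (TotalSpace (EuclideanSpace ℝ (Fin n)) V)]
    [∀ x, NormedAddCommGroup (V x)] [∀ x, InnerProductSpace ℝ (V x)]
    [FiberBundle (EuclideanSpace ℝ (Fin n)) V] [VectorBundle ℝ (EuclideanSpace ℝ (Fin n)) V]
    (x : M) : FiniteDimensional ℝ (V x) :=
  (fiberEquiv n x).symm.finiteDimensional

theorem fiber_finrank (x : M) : Module.finrank ℝ (V x) = n := by
  rw [(fiberEquiv n x).finrank_eq, finrank_euclideanSpace_fin]

/-- A family of orientations of the fibres is an orientation of the bundle if it is locally constant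
in local trivializations. -/
def IsBundleOrientation (o : ∀ x, Orientation ℝ (V x) (Fin n)) : Prop :=
  ∀ x₀ : M, ∀ᶠ x in 𝓝 x₀,
    ∀ hx : x ∈ (trivializationAt (EuclideanSpace ℝ (Fin n)) V x₀).baseSet,
      Orientation.map (Fin n)
        ((trivializationAt (EuclideanSpace ℝ (Fin n)) V x₀).linearEquivAt ℝ x hx) (o x)
      = Orientation.map (Fin n) (fiberEquiv n x₀) (o x₀)

/-- A local orthonormal frame `e₁, …, eₙ` of the bundle near `x₀`, obtained by the Gram-Schmidt
process from the preferred local trivialization. (It need not be oriented: the objects built from it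
below are invariant under all orthogonal changes of frame.) -/
noncomputable def orthoFrame (x₀ : M) (i : Fin n) (y : M) : V y :=
  InnerProductSpace.gramSchmidtNormed ℝ
    (fun j => (trivializationAt (EuclideanSpace ℝ (Fin n)) V x₀).localFrame
      (EuclideanSpace.basisFun (Fin n) ℝ).toBasis j y) i

/-- The derivative `dσ` of the projection `σ` of the total space to the base. -/
noncomputable def dProj (p : Tot n V) :
    TangentSpace (totI I n) p →L[ℝ] TangentSpace I p.proj :=
  mfderiv (totI I n) I (TotalSpace.proj : Tot n V → M) p

/-- The pullback of a differential form on the base to the total space. -/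
noncomputable def pullForm {k : ℕ} (α : DForm I M k) : DForm (totI I n) (Tot n V) k := fun p =>
  (α p.proj).compContinuousLinearMap (dProj I p)

variable (n V) in
/-- Differential `k`-forms on the total space with values in the pulled back bundle. -/
abbrev TForm (k : ℕ) : Type _ :=
  ∀ p : Tot n V, TangentSpace (totI I n) p [⋀^Fin k]→ₗ[ℝ] V p.proj

/-- A section of the pulled back bundle, as a bundle-valued `0`-form. -/
noncomputable def ofSection (w : ∀ p : Tot n V, V p.proj) : TForm I n V 0 := fun p =>
  AlternatingMap.constOfIsEmpty ℝ (TangentSpace (totI I n) p) (Fin 0) (w p)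

/-- A bundle endomorphism, acting on bundle-valued forms. -/
noncomputable def actForm (Φ : ∀ x, V x →L[ℝ] V x) {k : ℕ} (α : TForm I n V k) : TForm I n V k :=
  fun p => (Φ p.proj).toLinearMap.compAlternatingMap (α p)

/-- The covariant derivative on bundle-valued forms on the total space that is induced by the
pullback of a connection on the bundle. At a point over `x₀`, with the orthonormal frame `eᵢ`
near `x₀`, one writes `α = ∑ᵢ ηᵢ ⊗ σ*eᵢ` with `ηᵢ = g(eᵢ, α)`; then
`∇α = ∑ᵢ (dηᵢ ⊗ σ*eᵢ + (-1)ᵏ ηᵢ ∧ ∇σ*eᵢ)`, where `∇σ*eᵢ = σ*(∇eᵢ)` for the pullback connection. -/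
noncomputable def pullNabla [FiniteDimensional ℝ EM]
    (cov : CovariantDerivative I (EuclideanSpace ℝ (Fin n)) V)
    {k : ℕ} (α : TForm I n V k) : TForm I n V (k + 1) := fun p =>
  let η (i : Fin n) : DForm (totI I n) (Tot n V) k := fun q =>
    toCont ((innerSL ℝ (orthoFrame p.proj i q.proj)).toLinearMap.compAlternatingMap (α q))
  ∑ i : Fin n,
    ((LinearMap.toSpanSingleton ℝ (V p.proj) (orthoFrame p.proj i p.proj)).compAlternatingMap
        (extD (totI I n) (η i) p).toAlternatingMap
      + (-1 : ℝ) ^ k • wedge (LinearMap.lsmul ℝ (V p.proj)) (η i p).toAlternatingMap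
          (AlternatingMap.ofSubsingleton ℝ _ _ (0 : Fin 1)
            ((cov (orthoFrame p.proj i) p.proj).comp (dProj I p)).toLinearMap))

/-- The mapping cone covariant derivative
`(α, β) ↦ (∇α + σ*ω ∧ β, Φα - ∇β)` on pairs of bundle-valued forms on the total space. -/
noncomputable def coneNabla [FiniteDimensional ℝ EM] (om : DForm I M 2)
    (cov : CovariantDerivative I (EuclideanSpace ℝ (Fin n)) V) (Φ : ∀ x, V x →L[ℝ] V x)
    (a : (∀ k, TForm I n V k) × (∀ k, TForm I n V k)) :
    (∀ k, TForm I n V k) × (∀ k, TForm I n V k) :=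
  (fun k => match k with
    | 0 => 0
    | 1 => pullNabla I cov (a.1 0)
    | k + 2 => fun p => pullNabla I cov (a.1 (k + 1)) p
        + wedgeTwo (pullForm I om p).toAlternatingMap (a.2 k p),
   fun k => match k with
    | 0 => actForm I Φ (a.1 0)
    | k + 1 => actForm I Φ (a.1 (k + 1)) - pullNabla I cov (a.2 k))

/-- The value at `p` of a family of bundle-valued forms, seen in `⨁ₖ Λᵏ T* ⊗ Λ¹`. -/
noncomputable def toLForm (α : ∀ k, TForm I n V k) (p : Tot n V) :
    LForm (TangentSpace (totI I n) p) (V p.proj) := fun k =>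
  (ExteriorAlgebra.ι ℝ).compAlternatingMap (α k p)

/-- For bundle-valued forms `τ₁, …, τₙ` of degree `k` and an orthonormal basis `e₁, …, eₙ` of the
fibre, the element `∑_{i < j} g(τᵢ, eⱼ) ⊗ (eᵢ ∧ eⱼ)` of `Λᵏ T* ⊗ Λ²`. -/
noncomputable def skewSum {T W : Type*} [AddCommGroup T] [Module ℝ T] [NormedAddCommGroup W]
    [InnerProductSpace ℝ W] {k : ℕ} (τ : Fin n → T [⋀^Fin k]→ₗ[ℝ] W) (e : Fin n → W) :
    T [⋀^Fin k]→ₗ[ℝ] ExteriorAlgebra ℝ W :=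
  ∑ i : Fin n, ∑ j ∈ Finset.Ioi i,
    (LinearMap.toSpanSingleton ℝ (ExteriorAlgebra ℝ W)
        (ExteriorAlgebra.ι ℝ (e i) * ExteriorAlgebra.ι ℝ (e j))).compAlternatingMap
      ((innerSL ℝ (e j)).toLinearMap.compAlternatingMap (τ i))

/-- The lift `σ*eᵢ` to the total space of the orthonormal frame near `x₀`. -/
noncomputable def liftFrame (x₀ : M) (i : Fin n) : TForm I n V 0 :=
  ofSection I fun q => orthoFrame x₀ i q.proj

/-- `Q = ∑_{i<j} g(∇²eᵢ + ω ∧ Φeᵢ, eⱼ) ⊗ (eᵢ ∧ eⱼ)` on the total space. -/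
noncomputable def formQ [FiniteDimensional ℝ EM] (om : DForm I M 2)
    (cov : CovariantDerivative I (EuclideanSpace ℝ (Fin n)) V) (Φ : ∀ x, V x →L[ℝ] V x)
    (p : Tot n V) : TangentSpace (totI I n) p [⋀^Fin 2]→ₗ[ℝ] ExteriorAlgebra ℝ (V p.proj) :=
  skewSum
    (fun i => pullNabla I cov (pullNabla I cov (liftFrame I p.proj i)) p
      + wedgeTwo (pullForm I om p).toAlternatingMap (actForm I Φ (liftFrame I p.proj i) p))
    (fun i => orthoFrame p.proj i p.proj)

/-- `S = ∑_{i<j} g(Φ∇eᵢ - ∇Φeᵢ, eⱼ) ⊗ (eᵢ ∧ eⱼ)` on the total space. -/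
noncomputable def formS [FiniteDimensional ℝ EM]
    (cov : CovariantDerivative I (EuclideanSpace ℝ (Fin n)) V) (Φ : ∀ x, V x →L[ℝ] V x)
    (p : Tot n V) : TangentSpace (totI I n) p [⋀^Fin 1]→ₗ[ℝ] ExteriorAlgebra ℝ (V p.proj) :=
  skewSum
    (fun i => actForm I Φ (pullNabla I cov (liftFrame I p.proj i)) p
      - pullNabla I cov (actForm I Φ (liftFrame I p.proj i)) p)
    (fun i => orthoFrame p.proj i p.proj)

/-- The tautological section of the pulled back bundle, as an inhomogeneous bundle-valued form. -/
noncomputable def tautological : ∀ k, TForm I n V k :=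
  fun k => match k with
    | 0 => ofSection I fun p => p.2
    | _ + 1 => 0

/-- The pair `𝒜 = (|v|²/2, 0) + 𝔸(v, 0) - (Q, S)` at the point `p`. -/
noncomputable def pairA [FiniteDimensional ℝ EM] (om : DForm I M 2)
    (cov : CovariantDerivative I (EuclideanSpace ℝ (Fin n)) V) (Φ : ∀ x, V x →L[ℝ] V x)
    (p : Tot n V) :
    LForm (TangentSpace (totI I n) p) (V p.proj) ×
      LForm (TangentSpace (totI I n) p) (V p.proj) :=
  (ofZero (algebraMap ℝ _ (1 / 2 * ‖p.2‖ ^ 2)), 0)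
    + (toLForm I (coneNabla I om cov Φ (tautological I, 0)).1 p,
        toLForm I (coneNabla I om cov Φ (tautological I, 0)).2 p)
    - (Pi.single 2 (formQ I om cov Φ p), Pi.single 1 (formS I cov Φ p))

/-- The Berezin integral of a form on the total space with values in the exterior bundle. -/
noncomputable def berezin [FiniteDimensional ℝ EM] (o : ∀ x, Orientation ℝ (V x) (Fin n))
    (a : ∀ p : Tot n V, LForm (TangentSpace (totI I n) p) (V p.proj)) :
    ∀ k, DForm (totI I n) (Tot n V) k := fun k p =>
  haveI : Fact (Module.finrank ℝ (V p.proj) = n) := ⟨fiber_finrank p.proj⟩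
  toCont ((topCoeff (o p.proj)).compAlternatingMap (a p k))

/-- The pair `𝒰 = (-1)^{n(n+1)/2} (1/2π)^{n/2} ∫ᴮ e^{-𝒜}`. -/
noncomputable def thomPair [FiniteDimensional ℝ EM] (o : ∀ x, Orientation ℝ (V x) (Fin n))
    (om : DForm I M 2) (cov : CovariantDerivative I (EuclideanSpace ℝ (Fin n)) V)
    (Φ : ∀ x, V x →L[ℝ] V x) :
    (∀ k, DForm (totI I n) (Tot n V) k) × (∀ k, DForm (totI I n) (Tot n V) k) :=
  ((-1 : ℝ) ^ (n * (n + 1) / 2) * (1 / (2 * Real.pi)) ^ ((n : ℝ) / 2)) •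
    (berezin I o fun p => (pairExp (-pairA I om cov Φ p)).1,
     berezin I o fun p => (pairExp (-pairA I om cov Φ p)).2)

/-! ### Integration along the fibre -/

/-- The vector tangent to the fibre at `(x, v)` given by `w`. -/
noncomputable def vertLift (x : M) (v w : V x) :
    TangentSpace (totI I n) (⟨x, v⟩ : Tot n V) :=
  mfderiv 𝓘(ℝ, V x) (totI I n) (fun u : V x => (⟨x, u⟩ : Tot n V)) v w

/-- A lift to `(x, v)` of a tangent vector `X` of the base at `x`: the image of `X` under the
derivative of a local section through `(x, v)`. -/
noncomputable def baseLift (x : M) (v : V x) (X : TangentSpace I x) :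
    TangentSpace (totI I n) (⟨x, v⟩ : Tot n V) :=
  mfderiv I (totI I n)
    (fun y : M => (⟨y, FiberBundle.extend (EuclideanSpace ℝ (Fin n)) v y⟩ : Tot n V)) x X

/-- The function on the fibre over `x` to be integrated: for an `(l + n)`-form `α` and tangent
vectors `X₁, …, Xₗ` of the base at `x`, it is
`v ↦ α(X₁, …, Xₗ, e₁, …, eₙ)` at the point `(x, v)`, where `X₁, …, Xₗ` are lifted to `(x, v)` (the
value does not depend on the lifts) and `e₁, …, eₙ` are vertical vectors forming an oriented
orthonormal basis (for an orthonormal basis that is not oriented, the factor `vol(e₁, …, eₙ) = -1`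
corrects the sign). -/
noncomputable def fiberIntegrand (o : ∀ x, Orientation ℝ (V x) (Fin n)) {l : ℕ}
    (α : DForm (totI I n) (Tot n V) (l + n)) (x : M) (X : Fin l → TangentSpace I x) (v : V x) : ℝ :=
  haveI : FiniteDimensional ℝ (V x) := fiber_finiteDimensional n x
  haveI : Fact (Module.finrank ℝ (V x) = n) := ⟨fiber_finrank x⟩
  let e : Fin n → V x := (stdOrthonormalBasis ℝ (V x)).reindex (finCongr (fiber_finrank x))
  (o x).volumeForm e *
    α ⟨x, v⟩ (Fin.append (fun i => baseLift I x v (X i)) (fun i => vertLift I x v (e i)))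

/-- The integrals along the fibres of an inhomogeneous form converge. -/
def FiberIntegrable (o : ∀ x, Orientation ℝ (V x) (Fin n))
    (α : ∀ k, DForm (totI I n) (Tot n V) k) : Prop :=
  ∀ (l : ℕ) (x : M) (X : Fin l → TangentSpace I x),
    haveI : FiniteDimensional ℝ (V x) := fiber_finiteDimensional n x
    letI : MeasurableSpace (V x) := borel (V x)
    haveI : BorelSpace (V x) := ⟨rfl⟩
    MeasureTheory.Integrable (fiberIntegrand I o (α (l + n)) x X) MeasureTheory.volume

/-- Integration along the fibre `Ω*(E) → Ω*⁻ⁿ(M)`. The component of degree `l` of the result, at `x`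
and evaluated at tangent vectors `X₁, …, Xₗ`, is the integral over the fibre, with its Euclidean
Lebesgue measure, of the component of degree `l + n`. Components of degree less than `n` are mapped
to zero. -/
noncomputable def fiberIntegral (o : ∀ x, Orientation ℝ (V x) (Fin n))
    (α : ∀ k, DForm (totI I n) (Tot n V) k) (l : ℕ) (x : M) (X : Fin l → TangentSpace I x) : ℝ :=
  haveI : FiniteDimensional ℝ (V x) := fiber_finiteDimensional n x
  letI : MeasurableSpace (V x) := borel (V x)
  haveI : BorelSpace (V x) := ⟨rfl⟩
  ∫ v : V x, fiberIntegrand I o (α (l + n)) x X v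

end Bundle

end MappingConeThom

/-!
# The Thom form of the mapping cone

A pair `(α, β)` is encoded by the single element `α + κβ` of the exterior algebra generated by the
coordinate differentials of the total space, the vectors of a local orthonormal frame and one more
odd generator `κ`, to be thought of as a primitive of `ω`. In this algebra the wedge product of pairs
is the product (`realizePair_pairMul`), the differential of the mapping cone is the odd derivation
`coneDiff`, that is `d + ω ∂/∂κ`, and the connection form `θ` and the endomorphism `φ` unite to the
skew-symmetric matrix `T = θ + κφ` of a superconnection. The operator `𝔸` becomes `coneDiff + T`, and
its square is the curvature matrix of `T`, so that `Q + κS` is the curvature, contracted with the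
frame (`coneCov_coneCov`, `sum_curv_mul_comps`, `realizePair_nilPair`). The definitions use at each
point a frame that depends on the point; the formulas do not depend on the orthonormal frame
(`sum_change_of_frame`, `sum_Ioi_change_of_frame`), and hence hold in a fixed smooth frame.

*Closedness.* Extend `coneDiff` to a derivation `der` of the whole algebra by
`eᵢ ↦ ∑ⱼ Tᵢⱼ eⱼ + zᵢ`, where the `zᵢ` are the coordinates of the tautological section: the connection
plus contraction with `𝐯`. The Bianchi identity and the skewness of `T` show that `der` annihilates
`𝒜` (`bianchi_sum`, `der_halfSq_add_nilPart`), and therefore also `exp (-𝒜)`, because `𝒜` is even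
(`delta_exp`). The Berezin integral intertwines `der` and `coneDiff`: it kills contractions with the
frame, and the diagonal of `T` vanishes (`berez_der`). Hence the Berezin integral of `exp (-𝒜)` is
closed under `coneDiff` (`coneDiff_berez_exp`), and the contraction with `κ` separates this equation
into the two components of `d^ω 𝒰 = 0` (`contDiffAt_locSum_thomPair`, `coneD_eq_zero_of_locSum`).

*Convergence and degrees.* At each point `𝒜` is the sum of the scalar `½|𝐯|²` and of a nilpotent
pair, so its exponential is `exp (-½|𝐯|²)` times a polynomial (`pairExp_add_scalar`). The form degree
and the exterior degree of all terms are equal, up to the shift in the second component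
(`IsBalanced`), which is why the Berezin integral only sees the form degrees `n` and `n - 1`.

*Fibre integral.* On vertical vectors `θ`, the pullback of `ω`, and the curvature vanish, and `κ` may
be set to zero: `𝒜` restricts to `½|𝐯|² + ∑ᵢ dxⁱ eᵢ` (`map_restrictGen_nilPart`). The Berezin integral
of `exp (-∑ᵢ dxⁱ eᵢ)` is `(-1)^{n(n+1)/2} dx¹ ⋯ dxⁿ` (`berez_exp_neg_sum`), so `𝒰` restricts to the
normalized Gaussian density (`thomPair_vertLift`), whose integral is `1`. All other fibre integrals
vanish for reasons of degree.
-/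

namespace MappingConeThom

/-! ### Parity and contraction on exterior algebras -/

section GradedAlgebra

variable {G G' : Type*} [AddCommGroup G] [Module ℝ G] [AddCommGroup G'] [Module ℝ G']

/-- The parity automorphism `x ↦ (-1)^{|x|} x` of an exterior algebra, as an algebra
homomorphism. -/
noncomputable abbrev parity : ExteriorAlgebra ℝ G →ₐ[ℝ] ExteriorAlgebra ℝ G :=
  CliffordAlgebra.involute (Q := (0 : QuadraticForm ℝ G))

/-- Contraction of an exterior algebra with a linear form on its generating space. -/
noncomputable abbrev contr (d : Module.Dual ℝ G) : ExteriorAlgebra ℝ G →ₗ[ℝ] ExteriorAlgebra ℝ G :=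
  CliffordAlgebra.contractLeft (Q := (0 : QuadraticForm ℝ G)) d

theorem parity_ι (v : G) : parity (ExteriorAlgebra.ι ℝ v) = -ExteriorAlgebra.ι ℝ v :=
  CliffordAlgebra.involute_ι v

theorem parity_parity (x : ExteriorAlgebra ℝ G) : parity (parity x) = x :=
  CliffordAlgebra.involute_involute x

theorem contr_ι_mul (d : Module.Dual ℝ G) (v : G) (x : ExteriorAlgebra ℝ G) :
    contr d (ExteriorAlgebra.ι ℝ v * x) = d v • x - ExteriorAlgebra.ι ℝ v * contr d x :=
  CliffordAlgebra.contractLeft_ι_mul d v x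

theorem contr_ι (d : Module.Dual ℝ G) (v : G) :
    contr d (ExteriorAlgebra.ι ℝ v) = algebraMap ℝ _ (d v) :=
  CliffordAlgebra.contractLeft_ι _ d v

theorem contr_algebraMap (d : Module.Dual ℝ G) (r : ℝ) :
    contr d (algebraMap ℝ (ExteriorAlgebra ℝ G) r) = 0 :=
  CliffordAlgebra.contractLeft_algebraMap _ d r

theorem contr_one (d : Module.Dual ℝ G) : contr d (1 : ExteriorAlgebra ℝ G) = 0 :=
  CliffordAlgebra.contractLeft_one _ d

theorem contr_contr (d d' : Module.Dual ℝ G) (x : ExteriorAlgebra ℝ G) :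
    contr d (contr d' x) = -contr d' (contr d x) :=
  CliffordAlgebra.contractLeft_comm (Q := (0 : QuadraticForm ℝ G)) d d' x

theorem contr_contr_self (d : Module.Dual ℝ G) (x : ExteriorAlgebra ℝ G) :
    contr d (contr d x) = 0 :=
  CliffordAlgebra.contractLeft_contractLeft (Q := (0 : QuadraticForm ℝ G)) d x

theorem left_induction {P : ExteriorAlgebra ℝ G → Prop} (x : ExteriorAlgebra ℝ G)
    (h0 : ∀ r : ℝ, P (algebraMap ℝ _ r)) (hadd : ∀ x y, P x → P y → P (x + y))
    (hmul : ∀ x (v : G), P x → P (ExteriorAlgebra.ι ℝ v * x)) : P x :=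
  CliffordAlgebra.left_induction (Q := (0 : QuadraticForm ℝ G)) h0 hadd hmul x

theorem ι_mul_eq (v : G) (x : ExteriorAlgebra ℝ G) :
    ExteriorAlgebra.ι ℝ v * x = parity x * ExteriorAlgebra.ι ℝ v := by
  induction x using left_induction with
  | h0 r => rw [AlgHom.commutes, Algebra.commutes]
  | hadd x y hx hy => rw [mul_add, hx, hy, map_add, add_mul]
  | hmul x w hx =>
    rw [map_mul, parity_ι, mul_assoc (-_), ← hx, ← mul_assoc, ← mul_assoc,
      eq_neg_of_add_eq_zero_left (ExteriorAlgebra.ι_add_mul_swap v w), neg_mul, neg_mul, neg_mul]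

/-- An even element of an exterior algebra is central. -/
theorem even_comm {x : ExteriorAlgebra ℝ G} (hx : parity x = x) (y : ExteriorAlgebra ℝ G) :
    x * y = y * x := by
  induction y using left_induction with
  | h0 r => rw [Algebra.commutes]
  | hadd y z hy hz => rw [mul_add, hy, hz, add_mul]
  | hmul y v hy => rw [← mul_assoc, mul_assoc _ y, ← hy, ← mul_assoc, ι_mul_eq v x, hx]

theorem odd_mul_eq {x : ExteriorAlgebra ℝ G} (hx : parity x = -x) (y : ExteriorAlgebra ℝ G) :
    x * y = parity y * x := by
  induction y using left_induction with
  | h0 r => rw [AlgHom.commutes, Algebra.commutes]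
  | hadd y z hy hz => rw [mul_add, hy, hz, map_add, add_mul]
  | hmul y v hy =>
    rw [← mul_assoc, map_mul, parity_ι, mul_assoc (-_), ← hy, ← mul_assoc]
    congr 1
    rw [neg_mul, ι_mul_eq v x, hx, neg_mul, neg_neg]

theorem odd_anticomm {x y : ExteriorAlgebra ℝ G} (hx : parity x = -x) (hy : parity y = -y) :
    x * y = -(y * x) := by
  rw [odd_mul_eq hx, hy, neg_mul]

theorem odd_sq {x : ExteriorAlgebra ℝ G} (hx : parity x = -x) : x * x = 0 := by
  have h := odd_anticomm hx hx
  have h2 : (2 : ℝ) • (x * x) = 0 := by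
    rw [two_smul]; nth_rewrite 1 [h]; exact neg_add_cancel _
  exact (smul_eq_zero.1 h2).resolve_left two_ne_zero

/-- Contraction is an antiderivation. -/
theorem contr_mul (d : Module.Dual ℝ G) (x y : ExteriorAlgebra ℝ G) :
    contr d (x * y) = contr d x * y + parity x * contr d y := by
  induction x using left_induction with
  | h0 r => 
    rw [contr_algebraMap, AlgHom.commutes, zero_mul, zero_add, ← Algebra.smul_def, map_smul,
      Algebra.smul_def]
  | hadd x z hx hz => simp only [add_mul, map_add, hx, hz]; abel
  | hmul x v hx =>
    rw [mul_assoc, contr_ι_mul, contr_ι_mul, hx, map_mul, parity_ι, sub_mul, mul_add,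
      smul_mul_assoc, neg_mul, neg_mul, mul_assoc, mul_assoc]
    abel

theorem contr_parity (d : Module.Dual ℝ G) (x : ExteriorAlgebra ℝ G) :
    contr d (parity x) = -parity (contr d x) := by
  induction x using left_induction with
  | h0 r => rw [AlgHom.commutes, contr_algebraMap, map_zero, neg_zero]
  | hadd x y hx hy => simp only [map_add, hx, hy]; abel
  | hmul x v hx =>
    rw [map_mul, parity_ι, neg_mul, map_neg, contr_ι_mul, contr_ι_mul, hx, map_sub, map_mul,
      parity_ι, map_smul]
    simp only [mul_neg, neg_mul, sub_neg_eq_add]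

theorem contr_map (f : G →ₗ[ℝ] G') (d : Module.Dual ℝ G') (x : ExteriorAlgebra ℝ G) :
    contr d (ExteriorAlgebra.map f x) = ExteriorAlgebra.map f (contr (d ∘ₗ f) x) := by
  induction x using left_induction with
  | h0 r => rw [AlgHom.commutes, contr_algebraMap, contr_algebraMap, map_zero]
  | hadd x y hx hy => simp only [map_add, hx, hy]
  | hmul x v hx =>
    rw [map_mul, ExteriorAlgebra.map_apply_ι, contr_ι_mul, contr_ι_mul, hx, map_sub, map_mul,
      ExteriorAlgebra.map_apply_ι, map_smul]
    rfl

theorem parity_map (f : G →ₗ[ℝ] G') (x : ExteriorAlgebra ℝ G) :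
    parity (ExteriorAlgebra.map f x) = ExteriorAlgebra.map f (parity x) := by
  induction x using left_induction with
  | h0 r => simp only [AlgHom.commutes]
  | hadd x y hx hy => simp only [map_add, hx, hy]
  | hmul x v hx =>
    simp only [map_mul, ExteriorAlgebra.map_apply_ι, parity_ι, hx, map_neg]

theorem parity_ιMulti {k : ℕ} (v : Fin k → G) :
    parity (ExteriorAlgebra.ιMulti ℝ k v) = (-1 : ℝ) ^ k • ExteriorAlgebra.ιMulti ℝ k v := by
  induction k with
  | zero => simp
  | succ k ih =>
    rw [ExteriorAlgebra.ιMulti_succ_apply, map_mul, parity_ι, ih, pow_succ, neg_mul,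
      mul_smul_comm]
    simp

/-- Moving an element past a product of generators. -/
theorem mul_ιMulti {k : ℕ} (v : Fin k → G) (x : ExteriorAlgebra ℝ G) :
    (parity ^ k) x * ExteriorAlgebra.ιMulti ℝ k v = ExteriorAlgebra.ιMulti ℝ k v * x := by
  induction k generalizing x with
  | zero => simp
  | succ k ih =>
    rw [ExteriorAlgebra.ιMulti_succ_apply, mul_assoc, ← ih, ← mul_assoc, ← mul_assoc, ι_mul_eq,
      ← AlgHom.mul_apply, ← pow_succ']

instance [FiniteDimensional ℝ G] : FiniteDimensional ℝ (ExteriorAlgebra ℝ G) :=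
  (Module.finBasis ℝ G).ExteriorAlgebra.finiteDimensional_of_finite

end GradedAlgebra

/-! ### Realization of alternating forms in an exterior algebra -/

section Realize

variable {T A B C G ι : Type*} [AddCommGroup T] [Module ℝ T]
  [AddCommGroup A] [Module ℝ A] [AddCommGroup B] [Module ℝ B] [AddCommGroup C] [Module ℝ C]
  [AddCommGroup G] [Module ℝ G] [Fintype ι]

open scoped Nat in
/-- The wedge product as a sum over all permutations, instead of the shuffles of its definition. -/
theorem factorial_smul_wedge_apply (μ : A →ₗ[ℝ] B →ₗ[ℝ] C) {k l : ℕ}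
    (a : T [⋀^Fin k]→ₗ[ℝ] A) (b : T [⋀^Fin l]→ₗ[ℝ] B) (v : Fin (k + l) → T) :
    ((k ! : ℝ) * (l ! : ℝ)) • wedge μ a b v = ∑ σ : Equiv.Perm (Fin k ⊕ Fin l),
      ((Equiv.Perm.sign σ : ℤ) : ℝ) • μ (a fun i => v (finSumFinEquiv (σ (Sum.inl i))))
        (b fun i => v (finSumFinEquiv (σ (Sum.inr i)))) := by
  have h := congrArg (fun f => TensorProduct.lift μ (f (v ∘ finSumFinEquiv)))
    (MultilinearMap.domCoprod_alternization_eq a b)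
  simp only [Fintype.card_fin, AlternatingMap.smul_apply, map_nsmul] at h
  have h2 : (k ! * l !) • (TensorProduct.lift μ) (a.domCoprod b (v ∘ finSumFinEquiv))
      = ((k ! : ℝ) * (l ! : ℝ)) • wedge μ a b v := by
    rw [← Nat.cast_mul, Nat.cast_smul_eq_nsmul]
    rfl
  rw [← h2, ← h, MultilinearMap.alternatization_apply, map_sum]
  refine Finset.sum_congr rfl fun σ _ => ?_
  rw [Units.smul_def, map_zsmul, Int.cast_smul_eq_zsmul]
  congr 1

open scoped Nat in
/-- The element `(1/k!) ∑_I ε_{I₁} ⋯ ε_{Iₖ} ρ(a(b_{I₁}, …, b_{Iₖ}))` of an exterior algebra that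
realizes an `A`-valued alternating `k`-form `a`, for a family of vectors `b`, generators `ε` that
play the role of the dual family, and a linear map `ρ` that realizes the values. -/
noncomputable def realize (b : ι → T) (ε : ι → G) (ρ : A →ₗ[ℝ] ExteriorAlgebra ℝ G) (k : ℕ) :
    (T [⋀^Fin k]→ₗ[ℝ] A) →ₗ[ℝ] ExteriorAlgebra ℝ G where
  toFun a := (k ! : ℝ)⁻¹ • ∑ I : Fin k → ι, ExteriorAlgebra.ιMulti ℝ k (ε ∘ I) * ρ (a (b ∘ I))
  map_add' a a' := by
    simp [mul_add, Finset.sum_add_distrib]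
  map_smul' r a := by
    simp only [AlternatingMap.smul_apply, map_smul, mul_smul_comm, ← Finset.smul_sum,
      RingHom.id_apply]
    rw [smul_comm]

open scoped Nat in
theorem realize_apply (b : ι → T) (ε : ι → G) (ρ : A →ₗ[ℝ] ExteriorAlgebra ℝ G) (k : ℕ)
    (a : T [⋀^Fin k]→ₗ[ℝ] A) :
    realize b ε ρ k a =
      (k ! : ℝ)⁻¹ • ∑ I : Fin k → ι, ExteriorAlgebra.ιMulti ℝ k (ε ∘ I) * ρ (a (b ∘ I)) := rfl

theorem realize_zero_form (b : ι → T) (ε : ι → G) (ρ : A →ₗ[ℝ] ExteriorAlgebra ℝ G)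
    (a : T [⋀^Fin 0]→ₗ[ℝ] A) : realize b ε ρ 0 a = ρ (a ![]) := by
  rw [realize_apply, Fintype.sum_unique]
  simp [Matrix.empty_eq]

theorem realize_one_form (b : ι → T) (ε : ι → G) (ρ : A →ₗ[ℝ] ExteriorAlgebra ℝ G)
    (a : T [⋀^Fin 1]→ₗ[ℝ] A) :
    realize b ε ρ 1 a = ∑ i, ExteriorAlgebra.ι ℝ (ε i) * ρ (a fun _ => b i) := by
  rw [realize_apply, ← (Equiv.funUnique (Fin 1) ι).symm.sum_comp]
  simp
  rfl

theorem realize_comp (b : ι → T) (ε : ι → G) (ρ : B →ₗ[ℝ] ExteriorAlgebra ℝ G) (f : A →ₗ[ℝ] B)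
    (k : ℕ) (a : T [⋀^Fin k]→ₗ[ℝ] A) :
    realize b ε ρ k (f.compAlternatingMap a) = realize b ε (ρ ∘ₗ f) k a := rfl

theorem realize_domDomCongr (b : ι → T) (ε : ι → G) (ρ : A →ₗ[ℝ] ExteriorAlgebra ℝ G) {k l : ℕ}
    (h : k = l) (a : T [⋀^Fin k]→ₗ[ℝ] A) :
    realize b ε ρ l (a.domDomCongr (finCongr h)) = realize b ε ρ k a := by
  subst h; rfl

theorem ιMulti_perm {ι' κ : Type*} [Fintype κ] [DecidableEq κ] {k : ℕ} (ε : ι' → G)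
    (e : κ ≃ Fin k) (I : κ → ι') (σ : Equiv.Perm κ) :
    ExteriorAlgebra.ιMulti ℝ k (ε ∘ I ∘ σ ∘ e.symm) =
      ((Equiv.Perm.sign σ : ℤ) : ℝ) • ExteriorAlgebra.ιMulti ℝ k (ε ∘ I ∘ e.symm) := by
  have h := AlternatingMap.map_perm (ExteriorAlgebra.ιMulti ℝ k) (ε ∘ I ∘ e.symm)
    ((e.symm.trans σ).trans e)
  have h2 : (ε ∘ I ∘ e.symm) ∘ ((e.symm.trans σ).trans e) = ε ∘ I ∘ σ ∘ e.symm := by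
    funext i; simp
  have h3 : Equiv.Perm.sign ((e.symm.trans σ).trans e) = Equiv.Perm.sign σ :=
    Equiv.Perm.sign_symm_trans_trans σ e
  rw [h2, h3, Units.smul_def, ← Int.cast_smul_eq_zsmul ℝ] at h
  exact h

open scoped Nat in
/-- Realization turns wedge products into products of the exterior algebra, as soon as it does so
for the values, once the generators have been moved to the left. -/
theorem realize_wedge (b : ι → T) (ε : ι → G) {k l : ℕ} (μ : A →ₗ[ℝ] B →ₗ[ℝ] C)
    (ρA : A →ₗ[ℝ] ExteriorAlgebra ℝ G) (ρB : B →ₗ[ℝ] ExteriorAlgebra ℝ G)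
    (ρC : C →ₗ[ℝ] ExteriorAlgebra ℝ G)
    (h : ∀ (x : A) (y : B) (v : Fin l → G),
      ρA x * (ExteriorAlgebra.ιMulti ℝ l v * ρB y) = ExteriorAlgebra.ιMulti ℝ l v * ρC (μ x y))
    (α : T [⋀^Fin k]→ₗ[ℝ] A) (β : T [⋀^Fin l]→ₗ[ℝ] B) :
    realize b ε ρC (k + l) (wedge μ α β) = realize b ε ρA k α * realize b ε ρB l β := by
  have hk : ((k ! : ℝ) * (l ! : ℝ)) ≠ 0 := by positivity
  have hkl : ((k + l) ! : ℝ) ≠ 0 := by positivity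
  -- the contribution of each permutation is the same, by reindexing the sum over `I`
  have key : ∀ σ : Equiv.Perm (Fin k ⊕ Fin l),
      ∑ I : Fin (k + l) → ι, ExteriorAlgebra.ιMulti ℝ (k + l) (ε ∘ I) *
        ρC (((Equiv.Perm.sign σ : ℤ) : ℝ) •
          μ (α fun i => (b ∘ I) (finSumFinEquiv (σ (Sum.inl i))))
            (β fun i => (b ∘ I) (finSumFinEquiv (σ (Sum.inr i)))))
      = (∑ I : Fin k → ι, ExteriorAlgebra.ιMulti ℝ k (ε ∘ I) * ρA (α (b ∘ I))) *
        ∑ J : Fin l → ι, ExteriorAlgebra.ιMulti ℝ l (ε ∘ J) * ρB (β (b ∘ J)) := by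
    intro σ
    rw [Finset.sum_mul_sum, ← Finset.sum_product', Finset.univ_product_univ]
    let e1 : (Fin (k + l) → ι) ≃ (Fin k ⊕ Fin l → ι) :=
      Equiv.arrowCongr finSumFinEquiv.symm (Equiv.refl ι)
    let e2 : (Fin k ⊕ Fin l → ι) ≃ (Fin k ⊕ Fin l → ι) := Equiv.arrowCongr σ.symm (Equiv.refl ι)
    let e3 : (Fin k ⊕ Fin l → ι) ≃ (Fin k → ι) × (Fin l → ι) := Equiv.sumArrowEquivProdArrow _ _ _
    refine Fintype.sum_equiv ((e1.trans e2).trans e3) _ _ fun I => ?_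
    have hI : I = (fun x => Sum.elim (((e1.trans e2).trans e3) I).1
        (((e1.trans e2).trans e3) I).2 x) ∘ σ.symm ∘ finSumFinEquiv.symm := by
      funext i
      simp only [Function.comp_apply]
      rcases hx : σ.symm (finSumFinEquiv.symm i) with j | j <;>
      · simp only [Sum.elim_inl, Sum.elim_inr]
        have : i = finSumFinEquiv (σ (σ.symm (finSumFinEquiv.symm i))) := by simp
        rw [this, hx]
        rfl
    generalize ((e1.trans e2).trans e3) I = P at hI
    obtain ⟨I1, I2⟩ := P
    subst hI
    have hε : ExteriorAlgebra.ιMulti ℝ (k + l)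
        (ε ∘ (fun x => Sum.elim I1 I2 x) ∘ σ.symm ∘ finSumFinEquiv.symm)
        = ((Equiv.Perm.sign σ : ℤ) : ℝ) •
          (ExteriorAlgebra.ιMulti ℝ k (ε ∘ I1) * ExteriorAlgebra.ιMulti ℝ l (ε ∘ I2)) := by
      rw [ExteriorAlgebra.ιMulti_mul_ιMulti]
      have h1 := ιMulti_perm ε finSumFinEquiv (fun x => Sum.elim I1 I2 x) σ.symm
      rw [Equiv.Perm.sign_symm] at h1
      rw [h1]
      congr 2
      funext i
      refine Fin.addCases (fun j => ?_) (fun j => ?_) i <;> simp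
    dsimp only
    rw [hε]
    have e4 : ∀ i, (b ∘ (fun x => Sum.elim I1 I2 x) ∘ σ.symm ∘ finSumFinEquiv.symm)
        (finSumFinEquiv (σ (Sum.inl i))) = (b ∘ I1) i := by intro i; simp
    have e5 : ∀ i, (b ∘ (fun x => Sum.elim I1 I2 x) ∘ σ.symm ∘ finSumFinEquiv.symm)
        (finSumFinEquiv (σ (Sum.inr i))) = (b ∘ I2) i := by intro i; simp
    simp only [e4, e5]
    have hs : (((Equiv.Perm.sign σ : ℤ) : ℝ)) * ((Equiv.Perm.sign σ : ℤ) : ℝ) = 1 := by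
      rw [← Int.cast_mul, ← Units.val_mul, Int.units_mul_self]; simp
    rw [map_smul, smul_mul_smul_comm, hs, one_smul, mul_assoc, ← h, ← mul_assoc]
  have h1 : ((k ! : ℝ) * (l ! : ℝ)) • realize b ε ρC (k + l) (wedge μ α β) =
      (∑ I : Fin k → ι, ExteriorAlgebra.ιMulti ℝ k (ε ∘ I) * ρA (α (b ∘ I))) *
        ∑ J : Fin l → ι, ExteriorAlgebra.ιMulti ℝ l (ε ∘ J) * ρB (β (b ∘ J)) := by
    rw [← map_smul, realize_apply]
    conv_lhs =>
      simp only [AlternatingMap.smul_apply, factorial_smul_wedge_apply, map_sum, Finset.mul_sum]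
    rw [Finset.sum_comm, Finset.sum_congr rfl fun σ _ => key σ, Finset.sum_const, Finset.card_univ,
      Fintype.card_perm, Fintype.card_sum, Fintype.card_fin, Fintype.card_fin,
      ← Nat.cast_smul_eq_nsmul ℝ, smul_smul, inv_mul_cancel₀ hkl, one_smul]
  rw [realize_apply b ε ρA, realize_apply b ε ρB, smul_mul_smul_comm, ← h1, smul_smul,
    ← mul_inv, inv_mul_cancel₀ hk, one_smul]

open scoped Nat in
theorem realize_alternatizeUncurryFin (b : ι → T) (ε : ι → G) (ρ : A →ₗ[ℝ] ExteriorAlgebra ℝ G)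
    {k : ℕ} (f : T →ₗ[ℝ] T [⋀^Fin k]→ₗ[ℝ] A) :
    realize b ε ρ (k + 1) (AlternatingMap.alternatizeUncurryFin f) =
      ∑ a, ExteriorAlgebra.ι ℝ (ε a) * realize b ε ρ k (f (b a)) := by
  have key : ∀ i : Fin (k + 1), ∑ I : Fin (k + 1) → ι,
      ExteriorAlgebra.ιMulti ℝ (k + 1) (ε ∘ I) *
        ρ ((-1) ^ (i : ℕ) • f ((b ∘ I) i) (i.removeNth (b ∘ I))) =
      (k ! : ℝ) • ∑ a, ExteriorAlgebra.ι ℝ (ε a) * realize b ε ρ k (f (b a)) := by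
    intro i
    rw [← (Fin.insertNthEquiv (fun _ => ι) i).sum_comp, Fintype.sum_prod_type, Finset.smul_sum]
    refine Finset.sum_congr rfl fun a _ => ?_
    rw [← mul_smul_comm, realize_apply, smul_smul, mul_inv_cancel₀ (by positivity), one_smul,
      Finset.mul_sum]
    refine Finset.sum_congr rfl fun I _ => ?_
    have e1 : ε ∘ (Fin.insertNthEquiv (fun _ => ι) i (a, I)) =
        i.insertNth (α := fun _ => G) (ε a) (ε ∘ I) := by
      funext j
      refine Fin.succAboveCases i ?_ (fun j => ?_) j <;> simp
    have e2 : i.removeNth (b ∘ (Fin.insertNthEquiv (fun _ => ι) i (a, I))) = b ∘ I := by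
      funext j; simp [Fin.removeNth]
    have e3 : (b ∘ (Fin.insertNthEquiv (fun _ => ι) i (a, I))) i = b a := by simp
    have e4 : ExteriorAlgebra.ιMulti ℝ (k + 1) (Matrix.vecCons (ε a) (ε ∘ I)) =
        ExteriorAlgebra.ι ℝ (ε a) * ExteriorAlgebra.ιMulti ℝ k (ε ∘ I) := by
      rw [ExteriorAlgebra.ιMulti_succ_apply]; rfl
    rw [e1, e2, e3, AlternatingMap.map_insertNth, e4]
    rcases neg_one_pow_eq_or ℤ (i : ℕ) with h | h <;> simp [h, mul_assoc]
  rw [realize_apply]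
  conv_lhs => simp only [AlternatingMap.alternatizeUncurryFin_apply, map_sum, Finset.mul_sum]
  rw [Finset.sum_comm, Finset.sum_congr rfl fun i _ => key i, Finset.sum_const, Finset.card_univ,
    Fintype.card_fin, ← Nat.cast_smul_eq_nsmul ℝ, smul_smul, smul_smul, Nat.factorial_succ]
  push_cast
  rw [mul_assoc, inv_mul_cancel₀ (by positivity), one_smul]

/-- The linear form on an exterior algebra that is the determinant form of `d₁, …, dₖ` on products
of `k` generators and zero in the other degrees. -/
noncomputable def detForm {k : ℕ} (d : Fin k → Module.Dual ℝ G) : ExteriorAlgebra ℝ G →ₗ[ℝ] ℝ :=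
  ExteriorAlgebra.liftAlternating (Pi.single (M := fun r : ℕ => G [⋀^Fin r]→ₗ[ℝ] ℝ) k
    ((Matrix.detRowAlternating (n := Fin k) (R := ℝ)).compLinearMap (LinearMap.pi d)))

theorem detForm_ιMulti {k : ℕ} (d : Fin k → Module.Dual ℝ G) (v : Fin k → G) :
    detForm d (ExteriorAlgebra.ιMulti ℝ k v) = ∑ σ : Equiv.Perm (Fin k),
      ((Equiv.Perm.sign σ : ℤ) : ℝ) * ∏ i, d i (v (σ i)) := by
  rw [detForm, ExteriorAlgebra.liftAlternating_apply_ιMulti, Pi.single_eq_same]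
  exact Matrix.det_apply' _

/-- The realization of real-valued forms. -/
noncomputable abbrev realizeR (b : ι → T) (ε : ι → G) (k : ℕ) :
    (T [⋀^Fin k]→ₗ[ℝ] ℝ) →ₗ[ℝ] ExteriorAlgebra ℝ G :=
  realize b ε (Algebra.linearMap ℝ (ExteriorAlgebra ℝ G)) k

open scoped Nat in
/-- The values of a form can be read off from its realization. -/
theorem detForm_realizeR (b : ι → T) (ε : ι → G) {k : ℕ} (d : Fin k → Module.Dual ℝ G)
    (a : T [⋀^Fin k]→ₗ[ℝ] ℝ) :
    detForm d (realizeR b ε k a) = a fun i => ∑ j, d i (ε j) • b j := by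
  have h1 : ∀ σ : Equiv.Perm (Fin k), ∑ I : Fin k → ι,
      ((Equiv.Perm.sign σ : ℤ) : ℝ) * ((∏ i, d i (ε (I (σ i)))) * a (b ∘ I))
      = a fun i => ∑ j, d i (ε j) • b j := by
    intro σ
    have h2 : a (fun i => ∑ j, d i (ε j) • b j) = ((Equiv.Perm.sign σ : ℤ) : ℝ) *
        a (fun i => ∑ j, d (σ.symm i) (ε j) • b j) := by
      have := AlternatingMap.map_perm a (fun i => ∑ j, d i (ε j) • b j) σ.symm
      rw [Equiv.Perm.sign_symm, Units.smul_def, zsmul_eq_mul] at this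
      change a (fun i => ∑ j, d (σ.symm i) (ε j) • b j) = _ at this
      rw [this, ← mul_assoc, ← Int.cast_mul, ← Units.val_mul, Int.units_mul_self]
      simp
    rw [h2, ← Finset.mul_sum]
    congr 1
    have h3 := a.toMultilinearMap.map_sum (fun i j => d (σ.symm i) (ε j) • b j)
    refine Eq.trans ?_ h3.symm
    refine Finset.sum_congr rfl fun I _ => ?_
    rw [MultilinearMap.map_smul_univ, smul_eq_mul]
    congr 1
    rw [← Equiv.prod_comp σ (fun i => d (σ.symm i) (ε (I i)))]
    simp
  have h5 : ∀ I : Fin k → ι, detForm d (ExteriorAlgebra.ιMulti ℝ k (ε ∘ I) *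
      algebraMap ℝ _ (a (b ∘ I))) = ∑ σ : Equiv.Perm (Fin k),
        ((Equiv.Perm.sign σ : ℤ) : ℝ) * ((∏ i, d i (ε (I (σ i)))) * a (b ∘ I)) := by
    intro I
    rw [← Algebra.commutes, ← Algebra.smul_def, map_smul, detForm_ιMulti, smul_eq_mul, Finset.mul_sum]
    refine Finset.sum_congr rfl fun σ _ => ?_
    simp only [Function.comp_apply]
    ring
  rw [realizeR, realize_apply, map_smul, map_sum]
  simp only [Algebra.linearMap_apply, h5]
  rw [Finset.sum_comm, Finset.sum_congr rfl fun σ _ => h1 σ, Finset.sum_const, Finset.card_univ,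
    Fintype.card_perm, Fintype.card_fin, nsmul_eq_mul, smul_eq_mul,
    inv_mul_cancel_left₀ (by positivity)]

/-- Forms of degree greater than the number of generators are realized by zero. -/
theorem realize_eq_zero (b : ι → T) (ε : ι → G) (ρ : A →ₗ[ℝ] ExteriorAlgebra ℝ G) {k : ℕ}
    (h : Fintype.card ι < k) (a : T [⋀^Fin k]→ₗ[ℝ] A) : realize b ε ρ k a = 0 := by
  rw [realize_apply, Finset.sum_eq_zero, smul_zero]
  intro I _
  rw [ExteriorAlgebra.ιMulti_eq_zero_of_not_inj, zero_mul]
  intro hI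
  have := Fintype.card_le_of_injective I hI.of_comp
  rw [Fintype.card_fin] at this
  omega

end Realize

/-! ### Realization of pairs of forms -/

section RealizePair

variable {T W G ι : Type*} [AddCommGroup T] [Module ℝ T] [NormedAddCommGroup W]
  [InnerProductSpace ℝ W] [AddCommGroup G] [Module ℝ G] [Fintype ι]

theorem signInv_pow_apply (l : ℕ) (x : ExteriorAlgebra ℝ W) :
    (signInv ^ l) x = (parity ^ l) x := by
  induction l with
  | zero => rfl
  | succ l ih => rw [pow_succ', pow_succ', Module.End.mul_apply, ih]; rfl

theorem parity_pow_map (r : W →ₗ[ℝ] G) (l : ℕ) (x : ExteriorAlgebra ℝ W) :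
    (parity ^ l) (ExteriorAlgebra.map r x) = ExteriorAlgebra.map r ((parity ^ l) x) := by
  induction l with
  | zero => rfl
  | succ l ih => rw [pow_succ', pow_succ', AlgHom.mul_apply, ih, parity_map]; rfl

theorem parity_pow_parity_pow (l : ℕ) (x : ExteriorAlgebra ℝ G) :
    (parity ^ l) ((parity ^ l) x) = x := by
  rw [← AlgHom.mul_apply, ← (Commute.refl _).mul_pow, 
    show (parity * parity : ExteriorAlgebra ℝ G →ₐ[ℝ] _) = 1 from
    AlgHom.ext parity_parity, one_pow]
  rfl

/-- The element of an exterior algebra that realizes an element of `⨁ₖ Λᵏ T* ⊗ Λ* W`. -/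
noncomputable def realizeForm (b : ι → T) (ε : ι → G) (r : W →ₗ[ℝ] G) :
    LForm T W →ₗ[ℝ] ExteriorAlgebra ℝ G :=
  ∑ k ∈ Finset.range (Fintype.card ι + 1),
    realize b ε (ExteriorAlgebra.map r).toLinearMap k ∘ₗ LinearMap.proj k

theorem realizeForm_apply (b : ι → T) (ε : ι → G) (r : W →ₗ[ℝ] G) (a : LForm T W) :
    realizeForm b ε r a = ∑ k ∈ Finset.range (Fintype.card ι + 1),
      realize b ε (ExteriorAlgebra.map r).toLinearMap k (a k) := by
  simp [realizeForm]

theorem realizeForm_single (b : ι → T) (ε : ι → G) (r : W →ₗ[ℝ] G) (k : ℕ)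
    (a : T [⋀^Fin k]→ₗ[ℝ] ExteriorAlgebra ℝ W) :
    realizeForm b ε r (Pi.single k a) =
      realize b ε (ExteriorAlgebra.map r).toLinearMap k a := by
  rw [realizeForm_apply]
  by_cases hk : k ∈ Finset.range (Fintype.card ι + 1)
  · rw [Finset.sum_eq_single_of_mem k hk, Pi.single_eq_same]
    intro j _ hj
    rw [Pi.single_eq_of_ne hj, map_zero]
  · rw [realize_eq_zero _ _ _ (by simpa [Nat.lt_succ_iff] using hk), Finset.sum_eq_zero]
    intro j hj
    rw [Pi.single_eq_of_ne (by rintro rfl; exact hk hj), map_zero]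

theorem realizeForm_ofZero (b : ι → T) (ε : ι → G) (r : W →ₗ[ℝ] G) (x : ExteriorAlgebra ℝ W) :
    realizeForm b ε r (ofZero x) = ExteriorAlgebra.map r x := by
  rw [ofZero, realizeForm_single, realize_zero_form]
  rfl

theorem realize_wedge_signedMul (b : ι → T) (ε : ι → G) (r : W →ₗ[ℝ] G) {k l : ℕ}
    (α : T [⋀^Fin k]→ₗ[ℝ] ExteriorAlgebra ℝ W) (β : T [⋀^Fin l]→ₗ[ℝ] ExteriorAlgebra ℝ W) :
    realize b ε (ExteriorAlgebra.map r).toLinearMap (k + l) (wedge (signedMul W l) α β) =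
      realize b ε (ExteriorAlgebra.map r).toLinearMap k α *
        realize b ε (ExteriorAlgebra.map r).toLinearMap l β := by
  refine realize_wedge b ε _ _ _ _ (fun x y v => ?_) α β
  have h := mul_ιMulti v ((parity ^ l) (ExteriorAlgebra.map r x))
  rw [parity_pow_parity_pow] at h
  change ExteriorAlgebra.map r x * (_ * ExteriorAlgebra.map r y) =
    _ * ExteriorAlgebra.map r ((signInv ^ l) x * y)
  rw [← mul_assoc, h, map_mul, signInv_pow_apply, parity_pow_map, mul_assoc]

theorem realizeForm_gmul (b : ι → T) (ε : ι → G) (r : W →ₗ[ℝ] G) (α β : LForm T W) :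
    realizeForm b ε r (gmul α β) = realizeForm b ε r α * realizeForm b ε r β := by
  rw [realizeForm_apply, realizeForm_apply, realizeForm_apply, Finset.sum_mul_sum]
  set R := fun k => realize b ε (ExteriorAlgebra.map r).toLinearMap k with hR
  have h1 : ∀ m, R m (gmul α β m) =
      ∑ k ∈ Finset.range (m + 1), R k (α k) * R (m - k) (β (m - k)) := by
    intro m
    rw [Finset.sum_range, gmul, map_sum]
    refine Finset.sum_congr rfl fun k _ => ?_
    rw [hR]
    dsimp only
    rw [realize_domDomCongr, realize_wedge_signedMul]
  rw [Finset.sum_congr rfl fun m _ => h1 m,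
    Finset.sum_range_diag_flip _ (fun i j => R i (α i) * R j (β j))]
  refine Finset.sum_congr rfl fun i _ => ?_
  refine Finset.sum_subset (Finset.range_mono (by omega)) fun j _ hj => ?_
  rw [hR]
  dsimp only
  rw [← realize_wedge_signedMul, realize_eq_zero]
  rw [Finset.mem_range] at hj
  omega

theorem parity_realizeForm (b : ι → T) (ε : ι → G) (r : W →ₗ[ℝ] G) (a : LForm T W) :
    parity (realizeForm b ε r a) = realizeForm b ε r (totalSign a) := by
  rw [realizeForm_apply, realizeForm_apply, map_sum]
  refine Finset.sum_congr rfl fun k _ => ?_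
  have h : totalSign a k = (-1 : ℝ) ^ k • signInv.compAlternatingMap (a k) := rfl
  rw [h, LinearMap.map_smul (realize b ε _ k), realize_comp, realize_apply, realize_apply, map_smul, map_sum,
    smul_comm ((-1 : ℝ) ^ k), Finset.smul_sum (s := Finset.univ) (r := (-1 : ℝ) ^ k)]
  refine congrArg _ (Finset.sum_congr rfl fun I _ => ?_)
  rw [map_mul, parity_ιMulti, smul_mul_assoc]
  exact congrArg (fun z => _ • (_ * z)) (parity_map r _)

/-- The element of an exterior algebra that realizes a pair `(α, β)`, namely `α + κβ` for an
additional generator `κ`. In this way the product of pairs becomes the product of an algebra. -/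
noncomputable def realizePair (b : ι → T) (ε : ι → G) (r : W →ₗ[ℝ] G) (κ : G) :
    LForm T W × LForm T W →ₗ[ℝ] ExteriorAlgebra ℝ G :=
  realizeForm b ε r ∘ₗ LinearMap.fst ℝ _ _ +
    LinearMap.mulLeft ℝ (ExteriorAlgebra.ι ℝ κ) ∘ₗ realizeForm b ε r ∘ₗ LinearMap.snd ℝ _ _

theorem realizePair_apply (b : ι → T) (ε : ι → G) (r : W →ₗ[ℝ] G) (κ : G)
    (a : LForm T W × LForm T W) : realizePair b ε r κ a =
      realizeForm b ε r a.1 + ExteriorAlgebra.ι ℝ κ * realizeForm b ε r a.2 := rfl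

/-- The signs in the product of pairs are those that arise from moving `κ` to the left. -/
theorem realizePair_pairMul (b : ι → T) (ε : ι → G) (r : W →ₗ[ℝ] G) (κ : G)
    (x y : LForm T W × LForm T W) :
    realizePair b ε r κ (pairMul x y) = realizePair b ε r κ x * realizePair b ε r κ y := by
  simp only [realizePair_apply, pairMul, realizeForm_gmul, map_add, ← parity_realizeForm]
  have h : ∀ z : ExteriorAlgebra ℝ G, z * ExteriorAlgebra.ι ℝ κ =
      ExteriorAlgebra.ι ℝ κ * parity z := by
    intro z; rw [ι_mul_eq, parity_parity]
  generalize realizeForm b ε r x.1 = α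
  generalize realizeForm b ε r x.2 = β
  generalize realizeForm b ε r y.1 = γ
  generalize realizeForm b ε r y.2 = δ
  have h0 : ExteriorAlgebra.ι ℝ κ * β * (ExteriorAlgebra.ι ℝ κ * δ) = 0 := by
    rw [mul_assoc, ← mul_assoc β, h, mul_assoc, ← mul_assoc, ExteriorAlgebra.ι_sq_zero, zero_mul]
  rw [add_mul, mul_add, mul_add, mul_add (_ * β), h0, ← mul_assoc α, h]
  simp only [mul_assoc]
  abel

theorem realizePair_pairPow (b : ι → T) (ε : ι → G) (r : W →ₗ[ℝ] G) (κ : G)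
    (x : LForm T W × LForm T W) (j : ℕ) :
    realizePair b ε r κ (pairPow x j) = realizePair b ε r κ x ^ j := by
  induction j with
  | zero =>
    rw [pairPow, realizePair_apply, realizeForm_ofZero]
    simp
  | succ j ih => rw [pairPow, realizePair_pairMul, ih, pow_succ']

end RealizePair

/-! ### The exponential of a pair and its degrees -/

section WedgeLinear

variable {T A B C : Type*} [AddCommGroup T] [Module ℝ T]
  [AddCommGroup A] [Module ℝ A] [AddCommGroup B] [Module ℝ B] [AddCommGroup C] [Module ℝ C]

theorem wedge_add_left (μ : A →ₗ[ℝ] B →ₗ[ℝ] C) {k l : ℕ} (a a' : T [⋀^Fin k]→ₗ[ℝ] A)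
    (b : T [⋀^Fin l]→ₗ[ℝ] B) : wedge μ (a + a') b = wedge μ a b + wedge μ a' b := by
  simp only [wedge, ← AlternatingMap.domCoprod'_apply, TensorProduct.add_tmul, map_add]
  ext v; simp

theorem wedge_add_right (μ : A →ₗ[ℝ] B →ₗ[ℝ] C) {k l : ℕ} (a : T [⋀^Fin k]→ₗ[ℝ] A)
    (b b' : T [⋀^Fin l]→ₗ[ℝ] B) : wedge μ a (b + b') = wedge μ a b + wedge μ a b' := by
  simp only [wedge, ← AlternatingMap.domCoprod'_apply, TensorProduct.tmul_add, map_add]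
  ext v; simp

theorem wedge_smul_left (μ : A →ₗ[ℝ] B →ₗ[ℝ] C) {k l : ℕ} (c : ℝ) (a : T [⋀^Fin k]→ₗ[ℝ] A)
    (b : T [⋀^Fin l]→ₗ[ℝ] B) : wedge μ (c • a) b = c • wedge μ a b := by
  simp only [wedge, ← AlternatingMap.domCoprod'_apply, ← TensorProduct.smul_tmul', map_smul]
  ext v; simp

theorem wedge_smul_right (μ : A →ₗ[ℝ] B →ₗ[ℝ] C) {k l : ℕ} (c : ℝ) (a : T [⋀^Fin k]→ₗ[ℝ] A)
    (b : T [⋀^Fin l]→ₗ[ℝ] B) : wedge μ a (c • b) = c • wedge μ a b := by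
  simp only [wedge, ← AlternatingMap.domCoprod'_apply, TensorProduct.tmul_smul, map_smul]
  ext v; simp

theorem wedge_zero_left (μ : A →ₗ[ℝ] B →ₗ[ℝ] C) {k l : ℕ} (b : T [⋀^Fin l]→ₗ[ℝ] B) :
    wedge μ (0 : T [⋀^Fin k]→ₗ[ℝ] A) b = 0 := by
  simpa using wedge_smul_left μ 0 (0 : T [⋀^Fin k]→ₗ[ℝ] A) b

theorem wedge_zero_right (μ : A →ₗ[ℝ] B →ₗ[ℝ] C) {k l : ℕ} (a : T [⋀^Fin k]→ₗ[ℝ] A) :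
    wedge μ a (0 : T [⋀^Fin l]→ₗ[ℝ] B) = 0 := by
  simpa using wedge_smul_right μ 0 a (0 : T [⋀^Fin l]→ₗ[ℝ] B)

open scoped Nat in
/-- The values of a wedge product lie in every subspace that contains the products of values. -/
theorem wedge_apply_mem (μ : A →ₗ[ℝ] B →ₗ[ℝ] C) {k l : ℕ} (a : T [⋀^Fin k]→ₗ[ℝ] A)
    (b : T [⋀^Fin l]→ₗ[ℝ] B) (S : Submodule ℝ C) (h : ∀ v w, μ (a v) (b w) ∈ S)
    (v : Fin (k + l) → T) : wedge μ a b v ∈ S := by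
  have hk : ((k ! : ℝ) * (l ! : ℝ)) ≠ 0 := by positivity
  rw [← S.smul_mem_iff hk, factorial_smul_wedge_apply]
  exact S.sum_mem fun σ _ => S.smul_mem _ (h _ _)

open scoped Nat in
theorem wedge_const (μ : A →ₗ[ℝ] B →ₗ[ℝ] C) {l : ℕ} (x : A) (b : T [⋀^Fin l]→ₗ[ℝ] B) :
    wedge μ (AlternatingMap.constOfIsEmpty ℝ T (Fin 0) x) b =
      ((μ x).compAlternatingMap b).domDomCongr (finCongr (Nat.zero_add l).symm) := by
  ext v
  have hk : ((0 ! : ℝ) * (l ! : ℝ)) ≠ 0 := by positivity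
  have hl : (l ! : ℝ) ≠ 0 := by positivity
  apply smul_right_injective _ hk
  dsimp only
  rw [factorial_smul_wedge_apply]
  have h : ∀ σ : Equiv.Perm (Fin 0 ⊕ Fin l), ((Equiv.Perm.sign σ : ℤ) : ℝ) •
      μ (AlternatingMap.constOfIsEmpty ℝ T (Fin 0) x fun i => v (finSumFinEquiv (σ (Sum.inl i))))
        (b fun i => v (finSumFinEquiv (σ (Sum.inr i)))) =
      ((μ x).compAlternatingMap b).domDomCongr (finCongr (Nat.zero_add l).symm) v := by
    intro σ
    let e := Equiv.emptySum (Fin 0) (Fin l)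
    have h1 := AlternatingMap.map_perm b (fun i => v (finSumFinEquiv (Sum.inr i)))
      ((e.symm.trans σ).trans e)
    rw [Equiv.Perm.sign_symm_trans_trans σ e, Units.smul_def, ← Int.cast_smul_eq_zsmul ℝ] at h1
    have h2 : (fun i => v (finSumFinEquiv (σ (Sum.inr i)))) =
        (fun i => v (finSumFinEquiv (Sum.inr i))) ∘ ((e.symm.trans σ).trans e) := by
      funext i
      have : σ (Sum.inr i) = Sum.inr (e (σ (Sum.inr i))) := by
        rw [← Equiv.emptySum_symm_apply (α := Fin 0)]
        exact (e.symm_apply_apply _).symm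
      rw [this]
      rfl
    have hs : (((Equiv.Perm.sign σ : ℤ) : ℝ)) * ((Equiv.Perm.sign σ : ℤ) : ℝ) = 1 := by
      rw [← Int.cast_mul, ← Units.val_mul, Int.units_mul_self]; simp
    rw [h2, h1, map_smul, smul_smul, hs, one_smul, AlternatingMap.constOfIsEmpty_apply,
      AlternatingMap.domDomCongr_apply, LinearMap.compAlternatingMap_apply]
    congr 2
    funext i
    congr 1
    ext
    simp
  rw [Finset.sum_congr rfl fun σ _ => h σ, Finset.sum_const, Finset.card_univ, Fintype.card_perm,
    ← Nat.cast_smul_eq_nsmul ℝ]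
  simp

end WedgeLinear

section PairExp

variable {T W : Type*} [AddCommGroup T] [Module ℝ T] [NormedAddCommGroup W]
  [InnerProductSpace ℝ W]

theorem gmul_add_left (a a' b : LForm T W) : gmul (a + a') b = gmul a b + gmul a' b := by
  funext m
  simp only [gmul, Pi.add_apply, wedge_add_left]
  rw [← Finset.sum_add_distrib]
  exact Finset.sum_congr rfl fun k _ => by ext; simp

theorem gmul_add_right (a b b' : LForm T W) : gmul a (b + b') = gmul a b + gmul a b' := by
  funext m
  simp only [gmul, Pi.add_apply, wedge_add_right]
  rw [← Finset.sum_add_distrib]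
  exact Finset.sum_congr rfl fun k _ => by ext; simp

theorem gmul_smul_left (c : ℝ) (a b : LForm T W) : gmul (c • a) b = c • gmul a b := by
  funext m
  simp only [gmul, Pi.smul_apply, wedge_smul_left]
  rw [Finset.smul_sum]
  exact Finset.sum_congr rfl fun k _ => by ext; simp

theorem gmul_smul_right (c : ℝ) (a b : LForm T W) : gmul a (c • b) = c • gmul a b := by
  funext m
  simp only [gmul, Pi.smul_apply, wedge_smul_right]
  rw [Finset.smul_sum]
  exact Finset.sum_congr rfl fun k _ => by ext; simp

theorem totalSign_add (a a' : LForm T W) : totalSign (a + a') = totalSign a + totalSign a' := by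
  funext m; ext v; simp [totalSign]

theorem totalSign_smul (c : ℝ) (a : LForm T W) : totalSign (c • a) = c • totalSign a := by
  funext m; ext v
  simp only [totalSign, Pi.smul_apply, AlternatingMap.smul_apply,
    LinearMap.compAlternatingMap_apply, map_smul]
  rw [smul_comm]

variable (T W) in
/-- The product of pairs, as a bilinear map. -/
noncomputable def pairMulₗ : LForm T W × LForm T W →ₗ[ℝ] Module.End ℝ (LForm T W × LForm T W) :=
  LinearMap.mk₂ ℝ pairMul
    (fun a a' b => by
      simp only [pairMul, Prod.fst_add, Prod.snd_add, gmul_add_left, totalSign_add]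
      ext1 <;> dsimp only [Prod.fst_add, Prod.snd_add]
      abel)
    (fun c a b => by
      simp only [pairMul, Prod.smul_fst, Prod.smul_snd, gmul_smul_left, totalSign_smul]
      ext1 <;> simp)
    (fun a b b' => by
      simp only [pairMul, Prod.fst_add, Prod.snd_add, gmul_add_right]
      ext1 <;> dsimp only [Prod.fst_add, Prod.snd_add]
      abel)
    (fun c a b => by
      simp only [pairMul, Prod.smul_fst, Prod.smul_snd, gmul_smul_right]
      ext1 <;> simp)

theorem pairMulₗ_apply (a b : LForm T W × LForm T W) : pairMulₗ T W a b = pairMul a b := rfl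

theorem pairPow_eq (a : LForm T W × LForm T W) (j : ℕ) :
    pairPow a j = (pairMulₗ T W a ^ j) (ofZero 1, 0) := by
  induction j with
  | zero => rfl
  | succ j ih => rw [pow_succ', Module.End.mul_apply, ← ih]; rfl

theorem gmul_ofZero (c : ℝ) (b : LForm T W) :
    gmul (ofZero (algebraMap ℝ _ c)) b = c • b := by
  funext m
  rw [gmul, Fin.sum_univ_succ, Finset.sum_eq_zero, add_zero]
  · have h : (ofZero (algebraMap ℝ _ c) : LForm T W) ((0 : Fin (m + 1)) : ℕ) =
        AlternatingMap.constOfIsEmpty ℝ T (Fin 0) (algebraMap ℝ _ c) := by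
      simp [ofZero]
    rw [h]
    ext v
    have h2 := wedge_const (signedMul W (m - ((0 : Fin (m + 1)) : ℕ)))
      (algebraMap ℝ (ExteriorAlgebra ℝ W) c) (b (m - ((0 : Fin (m + 1)) : ℕ)))
    refine (congrArg (fun f : T [⋀^Fin (0 + m)]→ₗ[ℝ] ExteriorAlgebra ℝ W =>
      f (v ∘ finCongr (Nat.zero_add m))) h2).trans ?_
    change (signInv ^ _) (algebraMap ℝ _ c) * b m _ = _
    rw [signInv_pow_apply, AlgHom.commutes, ← Algebra.smul_def]
    rfl
  · intro k _
    have h : (ofZero (algebraMap ℝ _ c) : LForm T W) ((k.succ : Fin (m + 1)) : ℕ) = 0 := by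
      simp [ofZero]
    rw [h, wedge_zero_left]
    rfl

variable (T W) in
/-- A real number, as a pair of forms of degree `0`. -/
noncomputable def scalarPair (c : ℝ) : LForm T W × LForm T W := (ofZero (algebraMap ℝ _ c), 0)

theorem pairMulₗ_scalar (c : ℝ) :
    pairMulₗ T W (scalarPair T W c) = c • (1 : Module.End ℝ _) := by
  refine LinearMap.ext fun b => ?_
  have h1 : totalSign (ofZero (algebraMap ℝ _ c) : LForm T W) = ofZero (algebraMap ℝ _ c) := by
    funext k
    rcases k with _ | k
    · ext v
      simp [totalSign, ofZero, signInv]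
    · ext v; simp [totalSign, ofZero]
  have h2 : gmul (0 : LForm T W) b.1 = 0 := by simpa using gmul_smul_left 0 (0 : LForm T W) b.1
  rw [pairMulₗ_apply, scalarPair, pairMul, h1, h2, gmul_ofZero, gmul_ofZero, zero_add]
  rfl

open scoped Nat in
/-- The binomial theorem applies although the product of pairs is not made into a ring: it is used
for the operators of left multiplication, among which scalars are central. -/
theorem pairPow_add_scalar (c : ℝ) (N : LForm T W × LForm T W) (j : ℕ) :
    (j ! : ℝ)⁻¹ • pairPow (scalarPair T W c + N) j =
      ∑ i ∈ Finset.range (j + 1), (((j - i)! : ℝ)⁻¹ * c ^ (j - i)) • (i ! : ℝ)⁻¹ • pairPow N i := by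
  rw [pairPow_eq, map_add, pairMulₗ_scalar, add_comm,
    ((Commute.one_right (pairMulₗ T W N)).smul_right c).add_pow]
  simp only [LinearMap.sum_apply, Finset.smul_sum]
  refine Finset.sum_congr rfl fun i hi => ?_
  rw [smul_pow, one_pow, mul_smul_comm, mul_one, ← Nat.cast_comm, ← nsmul_eq_mul,
    ← Nat.cast_smul_eq_nsmul ℝ, LinearMap.smul_apply, LinearMap.smul_apply, ← pairPow_eq,
    smul_smul, smul_smul, smul_smul]
  congr 1
  rw [Nat.cast_choose ℝ (Nat.lt_succ_iff.1 (Finset.mem_range.1 hi))]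
  field_simp

/-- A series whose terms lie in the span of finitely many vectors may be summed coefficientwise,
also in a space of infinite dimension. -/
theorem hasSum_vsum {X : Type*} [AddCommGroup X] [Module ℝ X] (K : ℕ) (c : ℕ → ℕ → ℝ)
    (s : ℕ → ℝ) (y : ℕ → X) (h : ∀ i < K, HasSum (c i) (s i)) :
    (vsum fun j => ∑ i ∈ Finset.range K, c i j • y i) = ∑ i ∈ Finset.range K, s i • y i := by
  let _ : TopologicalSpace X := moduleTopology ℝ X
  have : IsModuleTopology ℝ X := ⟨rfl⟩
  have : ContinuousSMul ℝ X := IsModuleTopology.toContinuousSMul ℝ X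
  have : ContinuousAdd X := IsModuleTopology.toContinuousAdd ℝ X
  -- linear forms are continuous for the module topology, and they separate points
  have : T2Space X := by
    refine T2Space.of_injective_continuous (f := fun x : X => fun φ : Module.Dual ℝ X => φ x) ?_ ?_
    · intro x y hxy
      rw [← sub_eq_zero, ← Module.forall_dual_apply_eq_zero_iff ℝ]
      intro φ
      rw [map_sub, sub_eq_zero]
      exact congrFun hxy φ
    · exact continuous_pi fun φ => IsModuleTopology.continuous_of_linearMap φ
  have : HasSum (fun j => ∑ i ∈ Finset.range K, c i j • y i) (∑ i ∈ Finset.range K, s i • y i) :=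
    hasSum_sum fun i hi => (h i (Finset.mem_range.1 hi)).smul_const (y i)
  exact this.tsum_eq

open scoped Nat in
/-- The exponential of the sum of a scalar and a nilpotent pair. -/
theorem pairExp_add_scalar (c : ℝ) (N : LForm T W × LForm T W) (K : ℕ)
    (hN : ∀ i, K ≤ i → pairPow N i = 0) :
    pairExp (scalarPair T W c + N) =
      Real.exp c • ∑ i ∈ Finset.range K, (i ! : ℝ)⁻¹ • pairPow N i := by
  -- `d i j` is the coefficient of `N ^ i / i!` in the `j`-th term of the series; for fixed `i` the
  -- sum over `j` is the exponential series of `c`, shifted by `i`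
  let d (i j : ℕ) : ℝ := if i ≤ j then ((j - i)! : ℝ)⁻¹ * c ^ (j - i) else 0
  have hd : ∀ i, HasSum (d i) (Real.exp c) := by
    intro i
    have h1 : HasSum (fun j => ((j)! : ℝ)⁻¹ * c ^ j) (Real.exp c) := by
      rw [Real.exp_eq_exp_ℝ]
      simpa using NormedSpace.exp_series_hasSum_exp' (𝕂 := ℝ) c
    have h2 : Function.Injective (fun j : ℕ => j + i) := add_left_injective i
    refine (h2.hasSum_iff ?_).1 ?_
    · intro j hj
      refine if_neg fun hij => hj ⟨j - i, Nat.sub_add_cancel hij⟩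
    · convert h1 using 2 with j
      simp [d]
  have key : ∀ j, (j ! : ℝ)⁻¹ • pairPow (scalarPair T W c + N) j =
      ∑ i ∈ Finset.range K, d i j • (i ! : ℝ)⁻¹ • pairPow N i := by
    intro j
    rw [pairPow_add_scalar]
    have e1 : ∑ i ∈ Finset.range (j + 1),
        (((j - i)! : ℝ)⁻¹ * c ^ (j - i)) • (i ! : ℝ)⁻¹ • pairPow N i =
        ∑ i ∈ Finset.range (j + 1 + K), d i j • (i ! : ℝ)⁻¹ • pairPow N i := by
      refine Eq.trans (Finset.sum_congr rfl fun i hi => ?_)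
        (Finset.sum_subset (Finset.range_mono (Nat.le_add_right _ _)) fun i _ hi => ?_)
      · simp only [d, if_pos (Nat.lt_succ_iff.1 (Finset.mem_range.1 hi))]
      · simp only [d]
        rw [if_neg (by simpa [Nat.lt_succ_iff] using hi), zero_smul]
    rw [e1]
    -- nilpotency cuts the sum off at `K`, for all `j` at once
    refine (Finset.sum_subset (Finset.range_mono (by omega)) fun i _ hi => ?_).symm
    rw [hN i (by simpa using hi), smul_zero, smul_zero]
  rw [Finset.smul_sum]
  ext1
  · funext k
    have h1 := hasSum_vsum K d (fun _ => Real.exp c)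
      (fun i => (i ! : ℝ)⁻¹ • (pairPow N i).1 k) fun i _ => hd i
    rw [Prod.fst_sum, Finset.sum_apply]
    refine Eq.trans ?_ h1
    refine congrArg vsum (funext fun j => ?_)
    have := congrArg (fun p : LForm T W × LForm T W => p.1 k) (key j)
    simpa only [Prod.fst_sum, Finset.sum_apply, Prod.smul_fst, Pi.smul_apply] using this
  · funext k
    have h1 := hasSum_vsum K d (fun _ => Real.exp c)
      (fun i => (i ! : ℝ)⁻¹ • (pairPow N i).2 k) fun i _ => hd i
    rw [Prod.snd_sum, Finset.sum_apply]
    refine Eq.trans ?_ h1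
    refine congrArg vsum (funext fun j => ?_)
    have := congrArg (fun p : LForm T W × LForm T W => p.2 k) (key j)
    simpa only [Prod.snd_sum, Finset.sum_apply, Prod.smul_snd, Pi.smul_apply] using this

/-- The components of total degree less than `i` of a pair `(α, β)` vanish, where the degree of
the components of `β` is raised by one. -/
def VanishesBelow (i : ℕ) (a : LForm T W × LForm T W) : Prop :=
  (∀ k, k < i → a.1 k = 0) ∧ ∀ k, k + 1 < i → a.2 k = 0

theorem gmul_eq_zero_of_vanishing {i j m : ℕ} {a b : LForm T W} (ha : ∀ k, k < i → a k = 0)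
    (hb : ∀ k, k < j → b k = 0) (hm : m < i + j) : gmul a b m = 0 := by
  rw [gmul]
  refine Finset.sum_eq_zero fun k _ => ?_
  rcases lt_or_ge (k : ℕ) i with h | h
  · rw [ha _ h, wedge_zero_left]; rfl
  · rw [hb (m - k) (by omega), wedge_zero_right]; rfl

theorem VanishesBelow.pairMul {i : ℕ} {a b : LForm T W × LForm T W} (ha : VanishesBelow 1 a)
    (hb : VanishesBelow i b) : VanishesBelow (i + 1) (pairMul a b) := by
  refine ⟨fun k hk => gmul_eq_zero_of_vanishing ha.1 hb.1 (by omega), fun k hk => ?_⟩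
  have h1 : gmul a.2 b.1 k = 0 :=
    gmul_eq_zero_of_vanishing (i := 0) (by simp) hb.1 (by omega)
  have h2 : gmul (totalSign a.1) b.2 k = 0 := by
    refine gmul_eq_zero_of_vanishing (i := 1) (j := i - 1) (fun l hl => ?_)
      (fun l hl => hb.2 l (by omega)) (by omega)
    ext v
    simp [totalSign, ha.1 l hl]
  change gmul a.2 b.1 k + gmul (totalSign a.1) b.2 k = 0
  rw [h1, h2, add_zero]

theorem pairPow_vanishesBelow {a : LForm T W × LForm T W} (ha : VanishesBelow 1 a) (i : ℕ) :
    VanishesBelow i (pairPow a i) := by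
  induction i with
  | zero => exact ⟨by simp, by simp⟩
  | succ i ih => exact ha.pairMul ih

theorem alternatingMap_eq_zero_of_finrank_lt {A : Type*} [AddCommGroup A] [Module ℝ A]
    [FiniteDimensional ℝ T] {k : ℕ} (h : Module.finrank ℝ T < k) (a : T [⋀^Fin k]→ₗ[ℝ] A) :
    a = 0 := by
  ext v
  refine a.map_linearDependent v fun hv => ?_
  have := hv.fintype_card_le_finrank
  rw [Fintype.card_fin] at this
  omega

/-- A pair without components of total degree zero is nilpotent. -/
theorem pairPow_eq_zero [FiniteDimensional ℝ T] {a : LForm T W × LForm T W}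
    (ha : VanishesBelow 1 a) {i : ℕ} (hi : Module.finrank ℝ T + 2 ≤ i) : pairPow a i = 0 := by
  have h := pairPow_vanishesBelow ha i
  ext1
  · funext k
    rcases lt_or_ge k i with hk | hk
    · exact h.1 k hk
    · exact alternatingMap_eq_zero_of_finrank_lt (by omega) _
  · funext k
    rcases lt_or_ge (k + 1) i with hk | hk
    · exact h.2 k hk
    · exact alternatingMap_eq_zero_of_finrank_lt (by omega) _

theorem parity_eq_of_mem {k : ℕ} {x : ExteriorAlgebra ℝ W} (hx : x ∈ ⋀[ℝ]^k W) :
    parity x = (-1 : ℝ) ^ k • x := by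
  rw [← ExteriorAlgebra.ιMulti_span_fixedDegree] at hx
  induction hx using Submodule.span_induction with
  | mem x hx => obtain ⟨v, rfl⟩ := hx; exact parity_ιMulti v
  | zero => simp
  | add x y _ _ hx hy => rw [map_add, hx, hy, smul_add]
  | smul c x _ hx => rw [map_smul, hx, smul_comm]

theorem parity_mem {k : ℕ} {x : ExteriorAlgebra ℝ W} (hx : x ∈ ⋀[ℝ]^k W) :
    parity x ∈ ⋀[ℝ]^k W := by
  rw [parity_eq_of_mem hx]
  exact Submodule.smul_mem _ _ hx

theorem parity_pow_mem {k : ℕ} (l : ℕ) {x : ExteriorAlgebra ℝ W} (hx : x ∈ ⋀[ℝ]^k W) :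
    (parity ^ l) x ∈ ⋀[ℝ]^k W := by
  induction l with
  | zero => exact hx
  | succ l ih => rw [pow_succ', AlgHom.mul_apply]; exact parity_mem ih

theorem mul_mem_exteriorPower {k l : ℕ} {x y : ExteriorAlgebra ℝ W} (hx : x ∈ ⋀[ℝ]^k W)
    (hy : y ∈ ⋀[ℝ]^l W) : x * y ∈ ⋀[ℝ]^(k + l) W := by
  rw [ExteriorAlgebra.exteriorPower, pow_add]
  exact Submodule.mul_mem_mul hx hy

/-- The components of form degree `k` of `α` and of form degree `k - 1` of `β` have values
in `Λᵏ W`. -/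
def IsBalanced (a : LForm T W × LForm T W) : Prop :=
  (∀ k v, a.1 k v ∈ ⋀[ℝ]^k W) ∧ ∀ k v, a.2 k v ∈ ⋀[ℝ]^(k + 1) W

theorem gmul_mem {i j m : ℕ} {a b : LForm T W} (ha : ∀ k v, a k v ∈ ⋀[ℝ]^(k + i) W)
    (hb : ∀ k v, b k v ∈ ⋀[ℝ]^(k + j) W) (v : Fin m → T) :
    gmul a b m v ∈ ⋀[ℝ]^(m + (i + j)) W := by
  refine Finset.sum_induction (M := T [⋀^Fin m]→ₗ[ℝ] ExteriorAlgebra ℝ W) _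
    (fun c => c v ∈ ⋀[ℝ]^(m + (i + j)) W) (fun c d hc hd => Submodule.add_mem _ hc hd)
    (Submodule.zero_mem _) fun k _ => ?_
  rw [AlternatingMap.domDomCongr_apply]
  refine wedge_apply_mem _ _ _ _ (fun x y => ?_) _
  have hk : (k : ℕ) + i + (m - k + j) = m + (i + j) := by have := k.2; omega
  rw [← hk]
  refine mul_mem_exteriorPower ?_ (hb _ _)
  rw [signInv_pow_apply]
  exact parity_pow_mem _ (ha _ _)

theorem IsBalanced.pairMul {a b : LForm T W × LForm T W} (ha : IsBalanced a) (hb : IsBalanced b) :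
    IsBalanced (pairMul a b) := by
  refine ⟨fun k v => gmul_mem (i := 0) (j := 0) ha.1 hb.1 v, fun k v => ?_⟩
  refine Submodule.add_mem _ (gmul_mem (i := 1) (j := 0) ha.2 hb.1 v)
    (gmul_mem (i := 0) (j := 1) (fun l w => ?_) hb.2 v)
  exact Submodule.smul_mem _ _ (parity_mem (ha.1 l w))

theorem IsBalanced.pairPow {a : LForm T W × LForm T W} (ha : IsBalanced a) (i : ℕ) :
    IsBalanced (pairPow a i) := by
  induction i with
  | zero =>
    refine ⟨fun k v => ?_, fun k v => Submodule.zero_mem _⟩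
    rcases k with _ | k
    · change (ofZero 1 : LForm T W) 0 v ∈ _
      simp [ofZero, ExteriorAlgebra.exteriorPower]
    · change (ofZero 1 : LForm T W) (k + 1) v ∈ _
      simp [ofZero]
  | succ i ih => exact ha.pairMul ih

theorem IsBalanced.smul {a : LForm T W × LForm T W} (ha : IsBalanced a) (c : ℝ) :
    IsBalanced (c • a) :=
  ⟨fun k v => Submodule.smul_mem _ c (ha.1 k v), fun k v => Submodule.smul_mem _ c (ha.2 k v)⟩

theorem IsBalanced.add {a b : LForm T W × LForm T W} (ha : IsBalanced a) (hb : IsBalanced b) :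
    IsBalanced (a + b) :=
  ⟨fun k v => Submodule.add_mem _ (ha.1 k v) (hb.1 k v),
    fun k v => Submodule.add_mem _ (ha.2 k v) (hb.2 k v)⟩

theorem IsBalanced.sum {ι : Type*} (s : Finset ι) {a : ι → LForm T W × LForm T W}
    (ha : ∀ i ∈ s, IsBalanced (a i)) : IsBalanced (∑ i ∈ s, a i) := by
  classical
  induction s using Finset.induction_on with
  | empty => exact ⟨fun k v => Submodule.zero_mem _, fun k v => Submodule.zero_mem _⟩
  | insert i s hi ih =>
    rw [Finset.sum_insert hi]
    exact (ha i (Finset.mem_insert_self i s)).add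
      (ih fun j hj => ha j (Finset.mem_insert_of_mem hj))

/-- The coefficient of the volume form vanishes outside the top degree. -/
theorem topCoeff_eq_zero {n : ℕ} [Fact (Module.finrank ℝ W = n)] (o : Orientation ℝ W (Fin n))
    {k : ℕ} (hk : k ≠ n) {x : ExteriorAlgebra ℝ W} (hx : x ∈ ⋀[ℝ]^k W) : topCoeff o x = 0 := by
  rw [← ExteriorAlgebra.ιMulti_span_fixedDegree] at hx
  induction hx using Submodule.span_induction with
  | mem x hx =>
    obtain ⟨v, rfl⟩ := hx
    rw [topCoeff, ExteriorAlgebra.liftAlternating_apply_ιMulti, Pi.single_eq_of_ne hk]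
    rfl
  | zero => simp
  | add x y _ _ hx hy => rw [map_add, hx, hy, add_zero]
  | smul c x _ hx => rw [map_smul, hx, smul_zero]

end PairExp

/-! ### Iterated contraction and the Berezin integral -/

section Contraction

variable {G G' : Type*} [AddCommGroup G] [Module ℝ G] [AddCommGroup G'] [Module ℝ G']

theorem parity_pow_ι_mul (m : ℕ) (v : G) (x : ExteriorAlgebra ℝ G) :
    (parity ^ m) (ExteriorAlgebra.ι ℝ v * x) =
      (-1 : ℝ) ^ m • (ExteriorAlgebra.ι ℝ v * (parity ^ m) x) := by
  induction m with
  | zero => simp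
  | succ m ih =>
    rw [pow_succ', AlgHom.mul_apply, ih, map_smul, map_mul, parity_ι, pow_succ', AlgHom.mul_apply]
    simp

theorem contr_parity_pow (m : ℕ) (d : Module.Dual ℝ G) (x : ExteriorAlgebra ℝ G) :
    contr d ((parity ^ m) x) = (-1 : ℝ) ^ m • (parity ^ m) (contr d x) := by
  induction m with
  | zero => simp
  | succ m ih =>
    rw [pow_succ', AlgHom.mul_apply, contr_parity, ih, map_smul, pow_succ', AlgHom.mul_apply]
    simp

/-- Successive contraction with `d₁`, then `d₂`, and so on. -/
noncomputable def contrFin : ∀ {m : ℕ}, (Fin m → Module.Dual ℝ G) →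
    ExteriorAlgebra ℝ G →ₗ[ℝ] ExteriorAlgebra ℝ G
  | 0, _ => LinearMap.id
  | _ + 1, d => contrFin (fun i => d i.succ) ∘ₗ contr (d 0)

theorem contrFin_succ {m : ℕ} (d : Fin (m + 1) → Module.Dual ℝ G) (x : ExteriorAlgebra ℝ G) :
    contrFin d x = contrFin (fun i => d i.succ) (contr (d 0) x) := rfl

theorem contrFin_ι_mul {m : ℕ} (d : Fin m → Module.Dual ℝ G) (v : G) (hv : ∀ i, d i v = 0)
    (x : ExteriorAlgebra ℝ G) : contrFin d (ExteriorAlgebra.ι ℝ v * x) =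
      (-1 : ℝ) ^ m • (ExteriorAlgebra.ι ℝ v * contrFin d x) := by
  induction m generalizing x with
  | zero => simp [contrFin]
  | succ m ih =>
    rw [contrFin_succ, contr_ι_mul, hv, zero_smul, zero_sub, map_neg, ih _ (fun i => hv _),
      contrFin_succ, pow_succ]
    simp

theorem contr_contrFin {m : ℕ} (d : Fin m → Module.Dual ℝ G) (d' : Module.Dual ℝ G)
    (x : ExteriorAlgebra ℝ G) : contr d' (contrFin d x) = (-1 : ℝ) ^ m • contrFin d (contr d' x) := by
  induction m generalizing x with
  | zero => simp [contrFin]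
  | succ m ih =>
    rw [contrFin_succ, ih, contrFin_succ, contr_contr d', map_neg, pow_succ]
    simp

theorem contrFin_contr {m : ℕ} (d : Fin m → Module.Dual ℝ G) (i : Fin m)
    (x : ExteriorAlgebra ℝ G) : contrFin d (contr (d i) x) = 0 := by
  induction m generalizing x with
  | zero => exact i.elim0
  | succ m ih =>
    rw [contrFin_succ]
    refine Fin.cases ?_ (fun i => ?_) i
    · rw [contr_contr_self, map_zero]
    · rw [contr_contr, map_neg, ih (fun i => d i.succ) i, neg_zero]

theorem contrFin_map {m : ℕ} (f : G →ₗ[ℝ] G') (d : Fin m → Module.Dual ℝ G')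
    (x : ExteriorAlgebra ℝ G) : contrFin d (ExteriorAlgebra.map f x) =
      ExteriorAlgebra.map f (contrFin (fun i => d i ∘ₗ f) x) := by
  induction m generalizing x with
  | zero => rfl
  | succ m ih => rw [contrFin_succ, contr_map, ih, contrFin_succ]

theorem ι_mul_mem {k : ℕ} (v : G) {x : ExteriorAlgebra ℝ G} (hx : x ∈ ⋀[ℝ]^k G) :
    ExteriorAlgebra.ι ℝ v * x ∈ ⋀[ℝ]^(k + 1) G := by
  rw [ExteriorAlgebra.exteriorPower, pow_succ']
  exact Submodule.mul_mem_mul (LinearMap.mem_range_self _ v) hx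

theorem ιMulti_mem {k : ℕ} (v : Fin k → G) : ExteriorAlgebra.ιMulti ℝ k v ∈ ⋀[ℝ]^k G :=
  ExteriorAlgebra.ιMulti_range ℝ k ⟨v, rfl⟩

theorem contr_mem {k : ℕ} (d : Module.Dual ℝ G) {x : ExteriorAlgebra ℝ G}
    (hx : x ∈ ⋀[ℝ]^(k + 1) G) : contr d x ∈ ⋀[ℝ]^k G := by
  rw [← ExteriorAlgebra.ιMulti_span_fixedDegree] at hx
  induction hx using Submodule.span_induction with
  | mem x hx =>
    obtain ⟨v, rfl⟩ := hx
    induction k with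
    | zero =>
      rw [ExteriorAlgebra.ιMulti_succ_apply, contr_ι_mul, ExteriorAlgebra.ιMulti_zero_apply,
        contr_one, mul_zero, sub_zero]
      refine Submodule.smul_mem _ _ ?_
      simp [ExteriorAlgebra.exteriorPower]
    | succ k ih =>
      rw [ExteriorAlgebra.ιMulti_succ_apply, contr_ι_mul]
      exact Submodule.sub_mem _ (Submodule.smul_mem _ _ (ιMulti_mem _)) (ι_mul_mem _ (ih _))
  | zero => simp
  | add x y _ _ hx hy => rw [map_add]; exact Submodule.add_mem _ hx hy
  | smul c x _ hx => rw [map_smul]; exact Submodule.smul_mem _ _ hx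

theorem contr_eq_zero_of_mem_zero (d : Module.Dual ℝ G) {x : ExteriorAlgebra ℝ G}
    (hx : x ∈ ⋀[ℝ]^0 G) : contr d x = 0 := by
  rw [← ExteriorAlgebra.ιMulti_span_fixedDegree] at hx
  induction hx using Submodule.span_induction with
  | mem x hx =>
    obtain ⟨v, rfl⟩ := hx
    rw [ExteriorAlgebra.ιMulti_zero_apply, contr_one]
  | zero => simp
  | add x y _ _ hx hy => rw [map_add, hx, hy, add_zero]
  | smul c x _ hx => rw [map_smul, hx, smul_zero]

theorem algebraMapInv_eq_zero {k : ℕ} (hk : k ≠ 0) {x : ExteriorAlgebra ℝ G}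
    (hx : x ∈ ⋀[ℝ]^k G) : ExteriorAlgebra.algebraMapInv x = 0 := by
  rw [← ExteriorAlgebra.ιMulti_span_fixedDegree] at hx
  induction hx using Submodule.span_induction with
  | mem x hx =>
    obtain ⟨v, rfl⟩ := hx
    obtain ⟨k, rfl⟩ := Nat.exists_eq_succ_of_ne_zero hk
    rw [ExteriorAlgebra.ιMulti_succ_apply, map_mul, ExteriorAlgebra.algebraMapInv,
      ExteriorAlgebra.lift_ι_apply]
    simp
  | zero => simp
  | add x y _ _ hx hy => rw [map_add, hx, hy, add_zero]
  | smul c x _ hx => rw [map_smul, hx, smul_zero]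

theorem algebraMapInv_contrFin_eq_zero {m k : ℕ} (h : k ≠ m) (d : Fin m → Module.Dual ℝ G)
    {x : ExteriorAlgebra ℝ G} (hx : x ∈ ⋀[ℝ]^k G) :
    ExteriorAlgebra.algebraMapInv (contrFin d x) = 0 := by
  induction m generalizing k x with
  | zero => exact algebraMapInv_eq_zero h hx
  | succ m ih =>
    rw [contrFin_succ]
    rcases k with _ | k
    · rw [contr_eq_zero_of_mem_zero _ hx, map_zero, map_zero]
    · exact ih (by omega) _ (contr_mem _ hx)

theorem contr_ιMulti_eq_zero {k : ℕ} (d : Module.Dual ℝ G) (v : Fin k → G) (h : ∀ i, d (v i) = 0) :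
    contr d (ExteriorAlgebra.ιMulti ℝ k v) = 0 := by
  induction k with
  | zero => rw [ExteriorAlgebra.ιMulti_zero_apply, contr_one]
  | succ k ih =>
    rw [ExteriorAlgebra.ιMulti_succ_apply, contr_ι_mul, h, zero_smul,
      ih (Matrix.vecTail v) (fun i => h i.succ), mul_zero, sub_zero]

theorem contrFin_ιMulti {m : ℕ} (d : Fin m → Module.Dual ℝ G) (v : Fin m → G)
    (h : ∀ i j, d i (v j) = if i = j then 1 else 0) :
    contrFin d (ExteriorAlgebra.ιMulti ℝ m v) = 1 := by
  induction m with
  | zero => rw [ExteriorAlgebra.ιMulti_zero_apply]; rfl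
  | succ m ih =>
    rw [contrFin_succ, ExteriorAlgebra.ιMulti_succ_apply, contr_ι_mul, contr_ιMulti_eq_zero,
      mul_zero, sub_zero, h, if_pos rfl, one_smul]
    · refine ih _ _ fun i j => (h i.succ j.succ).trans ?_
      simp only [Fin.succ_inj]
    · exact fun i => (h 0 i.succ).trans (if_neg (Fin.succ_ne_zero i).symm)

theorem map_zero_apply (x : ExteriorAlgebra ℝ G) :
    ExteriorAlgebra.map (0 : G →ₗ[ℝ] G') x = algebraMap ℝ _ (ExteriorAlgebra.algebraMapInv x) := by
  induction x using left_induction with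
  | h0 r => simp [ExteriorAlgebra.algebraMapInv]
  | hadd x y hx hy => simp only [map_add, hx, hy]
  | hmul x v hx =>
    rw [map_mul, ExteriorAlgebra.map_apply_ι, map_mul, ExteriorAlgebra.algebraMapInv,
      ExteriorAlgebra.lift_ι_apply]
    simp

end Contraction

section Berezin

variable {ι : Type*} {n : ℕ}

variable (ι n) in
/-- The space of generators: one for each coordinate of the total space, one for each vector of an
orthonormal frame, and the additional generator `κ` for the second component of a pair. -/
abbrev Gen : Type _ := ι ⊕ (Fin n ⊕ Unit) → ℝ

variable (ι n) in
/-- The exterior algebra in which the calculations take place. -/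
abbrev Alg : Type _ := ExteriorAlgebra ℝ (Gen ι n)

section Generators

variable [DecidableEq ι]

variable (n) in
/-- The generator of a coordinate. -/
def formGen (a : ι) : Gen ι n := Pi.single (Sum.inl a) 1

variable (ι) in
/-- The generator of a vector of the frame. -/
def frameGen (i : Fin n) : Gen ι n := Pi.single (Sum.inr (Sum.inl i)) 1

variable (ι n) in
/-- The additional generator. -/
def kapGen : Gen ι n := Pi.single (Sum.inr (Sum.inr ())) 1

variable (n) in
/-- The coordinate differential, as an element of the algebra. -/
noncomputable abbrev dx (a : ι) : Alg ι n := ExteriorAlgebra.ι ℝ (formGen n a)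

variable (ι) in
/-- A vector of the frame, as an element of the algebra. -/
noncomputable abbrev fr (i : Fin n) : Alg ι n := ExteriorAlgebra.ι ℝ (frameGen ι i)

variable (ι n) in
/-- The element `κ` of the algebra. -/
noncomputable abbrev kap : Alg ι n := ExteriorAlgebra.ι ℝ (kapGen ι n)

end Generators

variable (ι) in
/-- The linear form dual to a vector of the frame. -/
abbrev frameDual (i : Fin n) : Module.Dual ℝ (Gen ι n) := LinearMap.proj (Sum.inr (Sum.inl i))

variable (ι n) in
/-- The linear form dual to `κ`. -/
abbrev kapDual : Module.Dual ℝ (Gen ι n) := LinearMap.proj (Sum.inr (Sum.inr ()))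

variable (ι n) in
/-- The projection of the generators that kills the frame. -/
def killFrame : Gen ι n →ₗ[ℝ] Gen ι n :=
  LinearMap.pi fun j => match j with
    | Sum.inl a => LinearMap.proj (Sum.inl a)
    | Sum.inr (Sum.inl _) => 0
    | Sum.inr (Sum.inr u) => LinearMap.proj (Sum.inr (Sum.inr u))

theorem killFrame_eq_self {v : Gen ι n} (hv : ∀ i, frameDual ι i v = 0) : killFrame ι n v = v := by
  funext j
  rcases j with a | i | u
  · rfl
  · exact (hv i).symm
  · rfl

variable (ι n) in
/-- The Berezin integral on the algebra: the coefficient of the product of the frame, where the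
coefficients are written on the left. -/
noncomputable def berez : Alg ι n →ₗ[ℝ] Alg ι n :=
  (-1 : ℝ) ^ n • ((ExteriorAlgebra.map (killFrame ι n)).toLinearMap ∘ₗ contrFin (frameDual ι) ∘ₗ
    (parity ^ n : Alg ι n →ₐ[ℝ] Alg ι n).toLinearMap)

theorem berez_apply (x : Alg ι n) : berez ι n x =
    (-1 : ℝ) ^ n • ExteriorAlgebra.map (killFrame ι n) (contrFin (frameDual ι) ((parity ^ n) x)) :=
  rfl

theorem neg_one_pow_mul_self_real (m : ℕ) : (-1 : ℝ) ^ m * (-1) ^ m = 1 := by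
  rw [← mul_pow]; simp

theorem berez_ι_mul {v : Gen ι n} (hv : ∀ i, frameDual ι i v = 0) (x : Alg ι n) :
    berez ι n (ExteriorAlgebra.ι ℝ v * x) = ExteriorAlgebra.ι ℝ v * berez ι n x := by
  rw [berez_apply, parity_pow_ι_mul, map_smul, contrFin_ι_mul _ _ hv, smul_smul,
    neg_one_pow_mul_self_real, one_smul, map_mul, ExteriorAlgebra.map_apply_ι,
    killFrame_eq_self hv, berez_apply, mul_smul_comm]

theorem berez_contr {d : Module.Dual ℝ (Gen ι n)} (hd : d ∘ₗ killFrame ι n = d) (x : Alg ι n) :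
    berez ι n (contr d x) = contr d (berez ι n x) := by
  rw [berez_apply, berez_apply, map_smul, contr_map, hd, contr_contrFin, contr_parity_pow, map_smul,
    map_smul, map_smul, smul_smul ((-1 : ℝ) ^ n) ((-1) ^ n), neg_one_pow_mul_self_real, one_smul]

/-- A contraction with a vector of the frame has no component of top degree in the frame. This is
the Berezin analogue of the vanishing of the integral of a derivative. -/
theorem berez_contr_frame (i : Fin n) (x : Alg ι n) : berez ι n (contr (frameDual ι i) x) = 0 := by
  have h : (parity ^ n) (contr (frameDual ι i) x) =
      (-1 : ℝ) ^ n • contr (frameDual ι i) ((parity ^ n) x) := by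
    rw [contr_parity_pow, smul_smul, neg_one_pow_mul_self_real, one_smul]
  rw [berez_apply, h, map_smul, contrFin_contr, smul_zero, map_zero, smul_zero]

/-- Integration by parts for the Berezin integral. -/
theorem berez_frame_mul_contr [DecidableEq ι] (i j : Fin n) (x : Alg ι n) :
    berez ι n (fr ι j * contr (frameDual ι i) x) = if i = j then berez ι n x else 0 := by
  have h : fr ι j * contr (frameDual ι i) x =
      frameDual ι i (frameGen ι j) • x - contr (frameDual ι i) (fr ι j * x) := by
    rw [contr_ι_mul]; abel
  rw [h, map_sub, berez_contr_frame, sub_zero, map_smul]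
  by_cases hij : i = j
  · simp [hij, frameGen]
  · simp [hij, frameGen]

variable {W : Type*} [NormedAddCommGroup W] [InnerProductSpace ℝ W]

variable (ι) in
/-- The coordinates with respect to an orthonormal basis, as a map to the frame generators. -/
noncomputable def frameMap [DecidableEq ι] (e : Fin n → W) : W →ₗ[ℝ] Gen ι n :=
  ∑ i, (innerₗ W (e i)).smulRight (frameGen ι i)

theorem frameMap_apply [DecidableEq ι] (e : Fin n → W) (w : W) :
    frameMap ι e w = ∑ i, inner ℝ (e i) w • frameGen ι i := by
  simp [frameMap]

theorem frameDual_frameMap [DecidableEq ι] (e : Fin n → W) (i : Fin n) (w : W) :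
    frameDual ι i (frameMap ι e w) = inner ℝ (e i) w := by
  rw [frameMap_apply, map_sum, Finset.sum_eq_single i]
  · simp [frameGen]
  · intro j _ hj
    simp [frameGen, hj.symm]
  · simp

theorem killFrame_comp_frameMap [DecidableEq ι] (e : Fin n → W) :
    killFrame ι n ∘ₗ frameMap ι e = 0 := by
  refine LinearMap.ext fun w => ?_
  rw [LinearMap.zero_apply, LinearMap.comp_apply, frameMap_apply, map_sum, Finset.sum_eq_zero]
  intro i _
  rw [map_smul]
  have : killFrame ι n (frameGen ι i) = 0 := by
    funext j
    rcases j with a | i | u <;> simp [killFrame, frameGen]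
  rw [this, smul_zero]

/-- The Berezin integral of the algebra agrees, up to the orientation of the frame, with the one
on the exterior algebra of the fibre. -/
theorem berez_map_frameMap [DecidableEq ι] [Fact (Module.finrank ℝ W = n)]
    (o : Orientation ℝ W (Fin n)) (e : OrthonormalBasis (Fin n) ℝ W) (x : ExteriorAlgebra ℝ W) :
    algebraMap ℝ _ (topCoeff o x) =
      o.volumeForm e • berez ι n (ExteriorAlgebra.map (frameMap ι e) x) := by
  have h1 : berez ι n (ExteriorAlgebra.map (frameMap ι e) x) =
      algebraMap ℝ _ ((-1 : ℝ) ^ n * ExteriorAlgebra.algebraMapInv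
        (contrFin (fun i => innerₗ W (e i)) ((parity ^ n) x))) := by
    rw [berez_apply, parity_pow_map, contrFin_map, ← AlgHom.comp_apply,
      ExteriorAlgebra.map_comp_map, killFrame_comp_frameMap, map_zero_apply, map_mul,
      Algebra.smul_def]
    congr 5
    funext i
    exact LinearMap.ext fun w => frameDual_frameMap _ _ _
  rw [h1, Algebra.smul_def, ← map_mul]
  congr 1
  have key : topCoeff o = o.volumeForm e • ((-1 : ℝ) ^ n •
      (ExteriorAlgebra.algebraMapInv.toLinearMap ∘ₗ contrFin (fun i => innerₗ W (e i)) ∘ₗ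
        (parity ^ n : ExteriorAlgebra ℝ W →ₐ[ℝ] _).toLinearMap)) := by
    refine ExteriorAlgebra.lhom_ext fun k => ?_
    by_cases hk : k = n
    · subst hk
      have hb : ∀ f g : W [⋀^Fin k]→ₗ[ℝ] ℝ, f e = g e → f = g := by
        intro f g hfg
        rw [AlternatingMap.eq_smul_basis_det e.toBasis f,
          AlternatingMap.eq_smul_basis_det e.toBasis g]
        simp only [OrthonormalBasis.coe_toBasis, hfg]
      refine hb _ _ ?_
      have hmem := ιMulti_mem (G := W) e
      have hp : ∀ m : ℕ, (parity ^ m) (ExteriorAlgebra.ιMulti ℝ k e) =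
          ((-1 : ℝ) ^ k) ^ m • ExteriorAlgebra.ιMulti ℝ k e := by
        intro m
        induction m with
        | zero => simp
        | succ m ih => rw [pow_succ', AlgHom.mul_apply, ih, map_smul, parity_ιMulti, smul_smul,
            pow_succ]
      have hc : contrFin (fun i => innerₗ W (e i)) (ExteriorAlgebra.ιMulti ℝ k e) = 1 :=
        contrFin_ιMulti _ _ fun i j => by
          simpa using orthonormal_iff_ite.1 e.orthonormal i j
      change topCoeff o (ExteriorAlgebra.ιMulti ℝ k e) = o.volumeForm e • ((-1 : ℝ) ^ k •
        ExteriorAlgebra.algebraMapInv (contrFin (fun i => innerₗ W (e i))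
          ((parity ^ k) (ExteriorAlgebra.ιMulti ℝ k e))))
      rw [hp, map_smul, hc, map_smul, map_one, topCoeff,
        ExteriorAlgebra.liftAlternating_apply_ιMulti, Pi.single_eq_same]
      have : (-1 : ℝ) ^ k * ((-1) ^ k) ^ k = 1 := by
        rcases Nat.even_or_odd k with h | h <;> simp [h.neg_one_pow]
      simp [this]
    · ext v
      have hmem := ιMulti_mem (G := W) v
      change topCoeff o (ExteriorAlgebra.ιMulti ℝ k v) = o.volumeForm e • ((-1 : ℝ) ^ n •
        ExteriorAlgebra.algebraMapInv (contrFin (fun i => innerₗ W (e i))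
          ((parity ^ n) (ExteriorAlgebra.ιMulti ℝ k v))))
      rw [topCoeff_eq_zero o hk hmem, algebraMapInv_contrFin_eq_zero hk _ (parity_pow_mem n hmem)]
      simp
  exact congrArg (fun f => f x) key

end Berezin

/-! ### Differential forms in charts -/

section Charts

variable {E H N : Type*} [NormedAddCommGroup E] [NormedSpace ℝ E] [TopologicalSpace H]
  {I : ModelWithCorners ℝ E H} [TopologicalSpace N] [ChartedSpace H N]

theorem inChart_apply_of_mem_source {k : ℕ} (α : DForm I N k) {x₀ x : N}
    (hx : x ∈ (extChartAt I x₀).source) (v : Fin k → E) :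
    inChart I α x₀ (extChartAt I x₀ x) v =
      α x (fun i => (mfderiv 𝓘(ℝ, E) I (extChartAt I x₀).symm (extChartAt I x₀ x) : E →L[ℝ] E)
        (v i)) := by
  have key : ∀ q₁ q₂ : N, q₁ = q₂ → (α q₁ : E [⋀^Fin k]→L[ℝ] ℝ) = α q₂ := by rintro _ _ rfl; rfl
  exact congrArg (fun a : E [⋀^Fin k]→L[ℝ] ℝ => a fun i =>
    (mfderiv 𝓘(ℝ, E) I (extChartAt I x₀).symm (extChartAt I x₀ x) : E →L[ℝ] E) (v i))
    (key _ _ ((extChartAt I x₀).left_inv hx))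

variable [I.Boundaryless]

theorem extChartAt_target_mem_nhds_of_mem {x₀ : N} {u : E} (hu : u ∈ (extChartAt I x₀).target) :
    (extChartAt I x₀).target ∈ 𝓝 u :=
  (isOpen_extChartAt_target x₀).mem_nhds hu

theorem mfderiv_symm_comp_mfderiv [IsManifold I 1 N] {x₀ x : N} (hx : x ∈ (extChartAt I x₀).source) :
    (mfderiv 𝓘(ℝ, E) I (extChartAt I x₀).symm (extChartAt I x₀ x) : E →L[ℝ] E) ∘L
      (mfderiv I 𝓘(ℝ, E) (extChartAt I x₀) x : E →L[ℝ] E) = ContinuousLinearMap.id ℝ E := by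
  have h := mfderivWithin_extChartAt_symm_comp_mfderiv_extChartAt' (I := I) hx
  rw [I.range_eq_univ, mfderivWithin_univ] at h
  exact h

theorem mfderiv_comp_mfderiv_symm [IsManifold I 1 N] {x₀ x : N} (hx : x ∈ (extChartAt I x₀).source) :
    (mfderiv I 𝓘(ℝ, E) (extChartAt I x₀) x : E →L[ℝ] E) ∘L
      (mfderiv 𝓘(ℝ, E) I (extChartAt I x₀).symm (extChartAt I x₀ x) : E →L[ℝ] E) =
      ContinuousLinearMap.id ℝ E := by
  have h := mfderiv_extChartAt_comp_mfderivWithin_extChartAt_symm' (I := I) hx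
  rw [I.range_eq_univ, mfderivWithin_univ] at h
  exact h

theorem mdifferentiableAt_extChartAt_symm [IsManifold I 1 N] {x₀ : N} {u : E}
    (hu : u ∈ (extChartAt I x₀).target) :
    MDifferentiableAt 𝓘(ℝ, E) I (extChartAt I x₀).symm u := by
  have h := mdifferentiableWithinAt_extChartAt_symm (I := I) hu
  rwa [I.range_eq_univ, mdifferentiableWithinAt_univ] at h

theorem contMDiffAt_extChartAt_symm [IsManifold I ∞ N] {x₀ : N} {u : E}
    (hu : u ∈ (extChartAt I x₀).target) :
    ContMDiffAt 𝓘(ℝ, E) I ∞ (extChartAt I x₀).symm u :=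
  (contMDiffOn_extChartAt_symm x₀).contMDiffAt (extChartAt_target_mem_nhds_of_mem hu)

theorem eq_inChart_of_mem_source [IsManifold I 1 N] {k : ℕ} (α : DForm I N k) {x₀ x : N}
    (hx : x ∈ (extChartAt I x₀).source) :
    α x = (inChart I α x₀ (extChartAt I x₀ x)).compContinuousLinearMap
      (mfderiv I 𝓘(ℝ, E) (extChartAt I x₀) x) := by
  ext v
  refine Eq.trans ?_ (inChart_apply_of_mem_source α hx _).symm
  congr 1
  funext i
  exact (DFunLike.congr_fun (mfderiv_symm_comp_mfderiv hx) (v i)).symm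

/-- The change of coordinates between two charts. -/
theorem contDiffAt_transition [IsManifold I ∞ N] {x₀ x₁ : N} {u : E}
    (hu : u ∈ (extChartAt I x₁).target)
    (hu' : (extChartAt I x₁).symm u ∈ (extChartAt I x₀).source) :
    ContDiffAt ℝ ∞ (extChartAt I x₀ ∘ (extChartAt I x₁).symm) u := by
  rw [← contMDiffAt_iff_contDiffAt]
  refine ContMDiffAt.comp u ?_ (contMDiffAt_extChartAt_symm hu)
  exact contMDiffAt_extChartAt' (by rwa [extChartAt_source] at hu')

/-- The local expressions of a form in two charts are related by the pullback under the change of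
coordinates. -/
theorem inChart_transition [IsManifold I ∞ N] {k : ℕ} (α : DForm I N k) {x₀ x₁ : N} {u : E}
    (hu : u ∈ (extChartAt I x₁).target)
    (hu' : (extChartAt I x₁).symm u ∈ (extChartAt I x₀).source) :
    inChart I α x₁ u =
      (inChart I α x₀ ((extChartAt I x₀ ∘ (extChartAt I x₁).symm) u)).compContinuousLinearMap
        (fderiv ℝ (extChartAt I x₀ ∘ (extChartAt I x₁).symm) u) := by
  have : IsManifold I 1 N := IsManifold.of_le (n := ∞) (by norm_cast)
  ext v
  refine Eq.trans ?_ (inChart_apply_of_mem_source α hu' _).symm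
  change α _ _ = α _ _
  congr 1
  funext i
  have h1 : (fderiv ℝ (extChartAt I x₀ ∘ (extChartAt I x₁).symm) u : E →L[ℝ] E) =
      (mfderiv I 𝓘(ℝ, E) (extChartAt I x₀) ((extChartAt I x₁).symm u) : E →L[ℝ] E) ∘L
        (mfderiv 𝓘(ℝ, E) I (extChartAt I x₁).symm u : E →L[ℝ] E) := by
    rw [← mfderiv_eq_fderiv]
    exact mfderiv_comp u (mdifferentiableAt_extChartAt (by rwa [extChartAt_source] at hu'))
      (mdifferentiableAt_extChartAt_symm hu)
  have h2 := DFunLike.congr_fun (mfderiv_symm_comp_mfderiv hu')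
    ((mfderiv 𝓘(ℝ, E) I (extChartAt I x₁).symm u : E →L[ℝ] E) (v i))
  have h3 := DFunLike.congr_fun h1 (v i)
  refine h2.symm.trans ?_
  exact congrArg (mfderiv 𝓘(ℝ, E) I (extChartAt I x₀).symm
    (extChartAt I x₀ ((extChartAt I x₁).symm u)) : E →L[ℝ] E) h3.symm

/-- The exterior derivative may be computed in any chart. -/
theorem inChart_extD [IsManifold I ∞ N] {k : ℕ} (α : DForm I N k) {x₀ : N} {u : E}
    (hu : u ∈ (extChartAt I x₀).target) (hα : DifferentiableAt ℝ (inChart I α x₀) u) :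
    inChart I (extD I α) x₀ u = extDeriv (inChart I α x₀) u := by
  have : IsManifold I 1 N := IsManifold.of_le (n := ∞) (by norm_cast)
  set x := (extChartAt I x₀).symm u with hx
  have hxs : x ∈ (extChartAt I x₀).source := (extChartAt I x₀).map_target hu
  have hxu : extChartAt I x₀ x = u := (extChartAt I x₀).right_inv hu
  have hxt : extChartAt I x x ∈ (extChartAt I x).target := mem_extChartAt_target x
  have hxx : (extChartAt I x).symm (extChartAt I x x) = x := extChartAt_to_inv x
  -- the exterior derivative at `x` is defined by the chart at `x`; `g` is the change of
  -- coordinates, and the exterior derivative commutes with the pullback by `g`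
  set g := extChartAt I x₀ ∘ (extChartAt I x).symm with hg
  have hgx : g (extChartAt I x x) = u := by rw [hg, Function.comp_apply, hxx, hxu]
  have hev : inChart I α x =ᶠ[𝓝 (extChartAt I x x)]
      fun y => (inChart I α x₀ (g y)).compContinuousLinearMap (fderiv ℝ g y) := by
    have h1 : ∀ᶠ y in 𝓝 (extChartAt I x x), (extChartAt I x).symm y ∈ (extChartAt I x₀).source := by
      have hc := continuousAt_extChartAt_symm (I := I) x
      refine hc.eventually_mem ?_
      rw [hxx]
      exact (isOpen_extChartAt_source x₀).mem_nhds hxs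
    filter_upwards [h1, extChartAt_target_mem_nhds_of_mem hxt] with y hy hy'
    exact inChart_transition α hy' hy
  have hgs : ContDiffAt ℝ ∞ g (extChartAt I x x) := contDiffAt_transition hxt (by rwa [hxx])
  have hd : extDeriv (inChart I α x) (extChartAt I x x) =
      (extDeriv (inChart I α x₀) u).compContinuousLinearMap (fderiv ℝ g (extChartAt I x x)) := by
    rw [hev.extDeriv_eq, extDeriv_pullback (by rwa [hgx]) hgs
      (by rw [minSmoothness_of_isRCLikeNormedField]; exact ENat.LEInfty.out), hgx]
  have hg' : (fderiv ℝ g (extChartAt I x x) : E →L[ℝ] E) ∘L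
      (mfderiv I 𝓘(ℝ, E) (extChartAt I x) x : E →L[ℝ] E) =
      (mfderiv I 𝓘(ℝ, E) (extChartAt I x₀) x : E →L[ℝ] E) := by
    have h0 : (fderiv ℝ g (extChartAt I x x) : E →L[ℝ] E) ∘L
        (mfderiv I 𝓘(ℝ, E) (extChartAt I x) x : E →L[ℝ] E) =
        mfderiv I 𝓘(ℝ, E) (g ∘ extChartAt I x) x := by
      rw [← mfderiv_eq_fderiv]
      refine (mfderiv_comp x ?_ (mdifferentiableAt_extChartAt (mem_chart_source H x))).symm
      exact (hgs.differentiableAt (by simp)).mdifferentiableAt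
    rw [h0]
    refine Filter.EventuallyEq.mfderiv_eq ?_
    filter_upwards [extChartAt_source_mem_nhds (I := I) x] with y hy
    rw [hg, Function.comp_apply, Function.comp_apply, (extChartAt I x).left_inv hy]
  ext v
  change (extDeriv (inChart I α x) (extChartAt I x x)) (fun i =>
    (mfderiv I 𝓘(ℝ, E) (extChartAt I x) x : E →L[ℝ] E)
      ((mfderiv 𝓘(ℝ, E) I (extChartAt I x₀).symm u : E →L[ℝ] E) (v i))) = _
  rw [hd]
  change extDeriv (inChart I α x₀) u _ = _
  congr 1
  funext i
  refine (DFunLike.congr_fun hg' _).trans ?_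
  have := DFunLike.congr_fun (mfderiv_comp_mfderiv_symm hxs) (v i)
  rw [hxu] at this
  exact this

/-- A form vanishes if its local expressions vanish. -/
theorem eq_zero_of_inChart [IsManifold I 1 N] {k : ℕ} (α : DForm I N k) (x : N)
    (h : inChart I α x (extChartAt I x x) = 0) : α x = 0 := by
  rw [eq_inChart_of_mem_source α (mem_extChartAt_source x), h]
  rfl

end Charts

/-! ### Orthonormal frames and orientation -/

section GramSchmidtDet

/-- The diagonal entries of the change of basis in the Gram-Schmidt process are positive. -/
theorem inner_gramSchmidtNormed_pos {W : Type*} [NormedAddCommGroup W] [InnerProductSpace ℝ W]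
    {n : ℕ} {f : Fin n → W} (hf : LinearIndependent ℝ f) (i : Fin n) :
    0 < inner ℝ (InnerProductSpace.gramSchmidtNormed ℝ f i) (f i) := by
  have h0 : InnerProductSpace.gramSchmidt ℝ f i ≠ 0 :=
    InnerProductSpace.gramSchmidt_ne_zero i hf
  have h1 : inner ℝ (InnerProductSpace.gramSchmidt ℝ f i) (f i) =
      ‖InnerProductSpace.gramSchmidt ℝ f i‖ ^ 2 := by
    conv_lhs => rw [InnerProductSpace.gramSchmidt_def'' ℝ f i]
    rw [inner_add_right, inner_sum, Finset.sum_eq_zero, add_zero, real_inner_self_eq_norm_sq]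
    intro j hj
    rw [inner_smul_right, InnerProductSpace.gramSchmidt_orthogonal ℝ f
      (Finset.mem_Iio.1 hj).ne', mul_zero]
  rw [InnerProductSpace.gramSchmidtNormed, inner_smul_left, h1]
  have := norm_pos_iff.2 h0
  simp only [RCLike.ofReal_real_eq_id, id_eq, map_inv₀, conj_trivial]
  positivity

/-- The Gram-Schmidt process preserves the orientation, because its change of basis is triangular
with positive diagonal. -/
theorem orientation_orthonormalBasis_of_gramSchmidt {W : Type*} [NormedAddCommGroup W]
    [InnerProductSpace ℝ W] {n : ℕ} (b : Module.Basis (Fin n) ℝ W)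
    (e : OrthonormalBasis (Fin n) ℝ W)
    (he : ∀ i, e i = InnerProductSpace.gramSchmidtNormed ℝ b i) :
    e.toBasis.orientation = b.orientation := by
  rw [Module.Basis.orientation_eq_iff_det_pos, Module.Basis.det_apply,
    Matrix.det_of_isUpperTriangular]
  · refine Finset.prod_pos fun i _ => ?_
    rw [Module.Basis.toMatrix_apply, OrthonormalBasis.coe_toBasis_repr_apply,
      OrthonormalBasis.repr_apply_apply, he]
    exact inner_gramSchmidtNormed_pos b.linearIndependent i
  · intro i j hij
    rw [Module.Basis.toMatrix_apply, OrthonormalBasis.coe_toBasis_repr_apply,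
      OrthonormalBasis.repr_apply_apply, he, InnerProductSpace.gramSchmidtNormed, inner_smul_left,
      InnerProductSpace.gramSchmidt_inv_triangular ℝ b (show j < i from hij), mul_zero]

end GramSchmidtDet

section Frames

variable {EM H M : Type*} [NormedAddCommGroup EM] [NormedSpace ℝ EM]
  [TopologicalSpace H] {I : ModelWithCorners ℝ EM H} [TopologicalSpace M] [ChartedSpace H M]
  {n : ℕ} {V : M → Type*} [TopologicalSpace (TotalSpace (EuclideanSpace ℝ (Fin n)) V)]
  [∀ x, NormedAddCommGroup (V x)] [∀ x, InnerProductSpace ℝ (V x)]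
  [FiberBundle (EuclideanSpace ℝ (Fin n)) V] [VectorBundle ℝ (EuclideanSpace ℝ (Fin n)) V]

variable (n V) in
/-- The domain of the frame `orthoFrame x₀`. -/
abbrev frameSet (x₀ : M) : Set M :=
  (trivializationAt (EuclideanSpace ℝ (Fin n)) V x₀).baseSet

theorem localFrame_eq_basisAt {x₀ x : M} (hx : x ∈ frameSet n V x₀) :
    (fun j => (trivializationAt (EuclideanSpace ℝ (Fin n)) V x₀).localFrame
      (EuclideanSpace.basisFun (Fin n) ℝ).toBasis j x) =
    (trivializationAt (EuclideanSpace ℝ (Fin n)) V x₀).basisAt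
      (EuclideanSpace.basisFun (Fin n) ℝ).toBasis hx := by
  funext j
  exact Bundle.Trivialization.localFrame_apply_of_mem_baseSet _ _ hx

/-- The frame `orthoFrame x₀` at a point of its domain, as an orthonormal basis. -/
noncomputable def orthoBasis {x₀ x : M} (_hx : x ∈ frameSet n V x₀) :
    OrthonormalBasis (Fin n) ℝ (V x) :=
  haveI : FiniteDimensional ℝ (V x) := fiber_finiteDimensional n x
  InnerProductSpace.gramSchmidtOrthonormalBasis (by rw [fiber_finrank (n := n) x, Fintype.card_fin])
    (fun j => (trivializationAt (EuclideanSpace ℝ (Fin n)) V x₀).localFrame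
      (EuclideanSpace.basisFun (Fin n) ℝ).toBasis j x)

theorem linearIndependent_localFrame {x₀ x : M} (hx : x ∈ frameSet n V x₀) :
    LinearIndependent ℝ (fun j => (trivializationAt (EuclideanSpace ℝ (Fin n)) V x₀).localFrame
      (EuclideanSpace.basisFun (Fin n) ℝ).toBasis j x) := by
  rw [localFrame_eq_basisAt hx]
  exact Module.Basis.linearIndependent _

theorem orthoBasis_apply {x₀ x : M} (hx : x ∈ frameSet n V x₀) (i : Fin n) :
    orthoBasis hx i = orthoFrame x₀ i x := by
  have : FiniteDimensional ℝ (V x) := fiber_finiteDimensional n x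
  refine InnerProductSpace.gramSchmidtOrthonormalBasis_apply _ ?_
  have h := InnerProductSpace.gramSchmidtNormed_unit_length i (linearIndependent_localFrame hx)
  intro h0
  rw [h0, norm_zero] at h
  exact zero_ne_one h

/-- The frame `orthoFrame x₀` has the orientation of the standard basis in the trivialization at
`x₀`. -/
theorem orthoBasis_orientation {x₀ x : M} (hx : x ∈ frameSet n V x₀) :
    Orientation.map (Fin n) ((trivializationAt (EuclideanSpace ℝ (Fin n)) V x₀).linearEquivAt ℝ x hx)
      (orthoBasis hx).toBasis.orientation =
      (EuclideanSpace.basisFun (Fin n) ℝ).toBasis.orientation := by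
  rw [orientation_orthonormalBasis_of_gramSchmidt
    ((trivializationAt (EuclideanSpace ℝ (Fin n)) V x₀).basisAt
      (EuclideanSpace.basisFun (Fin n) ℝ).toBasis hx), ← Module.Basis.orientation_map]
  · congr 1
    refine Module.Basis.eq_of_apply_eq fun i => ?_
    exact LinearEquiv.apply_symm_apply ((trivializationAt (EuclideanSpace ℝ (Fin n)) V
      x₀).linearEquivAt ℝ x hx) _
  · intro i
    rw [orthoBasis_apply, orthoFrame, localFrame_eq_basisAt hx]

/-- The sign that compares the frame `orthoFrame x₀` with an orientation. -/
noncomputable def frameSign (o : ∀ x, Orientation ℝ (V x) (Fin n)) (x₀ x : M) : ℝ :=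
  haveI : Fact (Module.finrank ℝ (V x) = n) := ⟨fiber_finrank x⟩
  (o x).volumeForm fun i => orthoFrame x₀ i x

theorem frameSign_mul_self (o : ∀ x, Orientation ℝ (V x) (Fin n)) {x₀ x : M}
    (hx : x ∈ frameSet n V x₀) : frameSign o x₀ x * frameSign o x₀ x = 1 := by
  have : Fact (Module.finrank ℝ (V x) = n) := ⟨fiber_finrank x⟩
  have h := (o x).abs_volumeForm_apply_of_orthonormal (orthoBasis hx)
  rw [funext (orthoBasis_apply hx)] at h
  rw [← abs_mul_abs_self]
  change |(o x).volumeForm fun i => orthoFrame x₀ i x| * |(o x).volumeForm _| = 1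
  rw [h, one_mul]

/-- The frame and the orientation of the bundle are both locally constant in the trivialization. -/
theorem frameSign_eventually_eq {o : ∀ x, Orientation ℝ (V x) (Fin n)}
    (ho : IsBundleOrientation o) (x₀ : M) :
    ∀ᶠ x in 𝓝 x₀, frameSign o x₀ x = frameSign o x₀ x₀ := by
  classical
  have key : ∀ (x : M) (hx : x ∈ frameSet n V x₀), frameSign o x₀ x =
      if (EuclideanSpace.basisFun (Fin n) ℝ).toBasis.orientation =
        Orientation.map (Fin n)
          ((trivializationAt (EuclideanSpace ℝ (Fin n)) V x₀).linearEquivAt ℝ x hx) (o x)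
        then 1 else -1 := by
    intro x hx
    have : Fact (Module.finrank ℝ (V x) = n) := ⟨fiber_finrank x⟩
    rw [← orthoBasis_orientation hx, (Orientation.map (Fin n) _).injective.eq_iff, frameSign,
      ← funext (orthoBasis_apply hx)]
    split_ifs with h
    · rw [(o x).volumeForm_robust _ h]
      simpa using (orthoBasis hx).toBasis.det_self
    · rw [(o x).volumeForm_robust_neg _ h]
      simpa using (orthoBasis hx).toBasis.det_self
  have hb : ∀ᶠ x in 𝓝 x₀, x ∈ frameSet n V x₀ :=
    (trivializationAt (EuclideanSpace ℝ (Fin n)) V x₀).open_baseSet.mem_nhds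
      (mem_baseSet_trivializationAt _ _ _)
  filter_upwards [ho x₀, hb] with x h1 hx
  rw [key x hx, key x₀ (mem_baseSet_trivializationAt _ _ _), h1 hx]
  rfl

/-- A smooth connection differentiates smooth local sections to smooth local sections. -/
theorem contMDiffAt_cov [FiniteDimensional ℝ EM] [T2Space M] [IsManifold I ∞ M]
    {cov : CovariantDerivative I (EuclideanSpace ℝ (Fin n)) V}
    (hcov : CovariantDerivative.ContMDiffCovariantDerivative cov ∞) {σ : ∀ x, V x} {s : Set M}
    (hs : IsOpen s) (hσ : ContMDiffOn I (I.prod 𝓘(ℝ, EuclideanSpace ℝ (Fin n))) ∞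
      (fun y => TotalSpace.mk' (EuclideanSpace ℝ (Fin n)) y (σ y)) s) {x : M} (hx : x ∈ s) :
    ContMDiffAt I (I.prod 𝓘(ℝ, EM →L[ℝ] EuclideanSpace ℝ (Fin n))) ∞
      (fun y => TotalSpace.mk' (EM →L[ℝ] EuclideanSpace ℝ (Fin n))
        (E := fun y => TangentSpace I y →L[ℝ] V y) y (cov σ y)) x := by
  -- smoothness of a connection is a condition on global sections: the local section is multiplied
  -- with a bump function, which does not change the derivative near `x`, as `cov` is local
  obtain ⟨f, -, hf⟩ := (SmoothBumpFunction.nhds_basis_tsupport (I := I) x).mem_iff.1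
    (hs.mem_nhds hx)
  have h1 : ContMDiff I (I.prod 𝓘(ℝ, EuclideanSpace ℝ (Fin n))) ∞
      (fun y => TotalSpace.mk' (EuclideanSpace ℝ (Fin n)) y (((f : M → ℝ) • σ) y)) :=
    ContMDiffOn.smul_section_of_tsupport f.contMDiff.contMDiffOn hs hf hσ
  have h2 := hcov.contMDiff.contMDiff (σ := (f : M → ℝ) • σ) (h1.contMDiffOn)
  refine ((h2 x (Set.mem_univ x)).contMDiffAt Filter.univ_mem).congr_of_eventuallyEq ?_
  have h3 : ∀ᶠ y in 𝓝 x, ∀ᶠ y' in 𝓝 y, f y' = 1 := f.eventuallyEq_one.eventually_nhds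
  filter_upwards [h3, hs.mem_nhds hx] with y hy hys
  have h4 : cov σ y = cov ((f : M → ℝ) • σ) y := by
    refine cov.isCovariantDerivativeOn.congr_of_eventuallyEq (s := Set.univ) ?_ ?_ Filter.univ_mem ?_
    · exact ((hσ y hys).contMDiffAt (hs.mem_nhds hys)).mdifferentiableAt (by simp)
    · exact (h1 y).mdifferentiableAt (by simp)
    · filter_upwards [hy] with y' hy'
      simp [hy']
  rw [h4]

variable [ContMDiffVectorBundle ∞ (EuclideanSpace ℝ (Fin n)) V I]
  [IsContMDiffRiemannianBundle I ∞ (EuclideanSpace ℝ (Fin n)) V]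

theorem contMDiffAt_orthoFrame {x₀ x : M} (hx : x ∈ frameSet n V x₀) (i : Fin n) :
    ContMDiffAt I (I.prod 𝓘(ℝ, EuclideanSpace ℝ (Fin n))) ∞
      (fun y => TotalSpace.mk' (EuclideanSpace ℝ (Fin n)) y (orthoFrame (V := V) x₀ i y)) x := by
  -- the formulas of the Gram-Schmidt process are smooth where the vectors of the local frame are
  -- linearly independent
  set f : Fin n → ∀ y, V y := fun j y =>
    (trivializationAt (EuclideanSpace ℝ (Fin n)) V x₀).localFrame
      (EuclideanSpace.basisFun (Fin n) ℝ).toBasis j y with hf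
  have hfs : ∀ j, ContMDiffAt I (I.prod 𝓘(ℝ, EuclideanSpace ℝ (Fin n))) ∞
      (fun y => TotalSpace.mk' (EuclideanSpace ℝ (Fin n)) y (f j y)) x := fun j =>
    contMDiffAt_localFrame_of_mem ∞ _ _ j hx
  have hne : ∀ j, InnerProductSpace.gramSchmidt ℝ (fun k => f k x) j ≠ 0 := fun j =>
    InnerProductSpace.gramSchmidt_ne_zero j (linearIndependent_localFrame hx)
  have hg : ∀ j : Fin n, ContMDiffAt I (I.prod 𝓘(ℝ, EuclideanSpace ℝ (Fin n))) ∞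
      (fun y => TotalSpace.mk' (EuclideanSpace ℝ (Fin n)) y
        (InnerProductSpace.gramSchmidt ℝ (fun k => f k y) j)) x := by
    intro j
    refine WellFoundedLT.induction (motive := fun j => ContMDiffAt I
      (I.prod 𝓘(ℝ, EuclideanSpace ℝ (Fin n))) ∞ (fun y => TotalSpace.mk' (EuclideanSpace ℝ (Fin n)) y
        (InnerProductSpace.gramSchmidt ℝ (fun k => f k y) j)) x) j fun j ih => ?_
    have he : ∀ y, InnerProductSpace.gramSchmidt ℝ (fun k => f k y) j =
        f j y - ∑ i ∈ Finset.Iio j, (inner ℝ (InnerProductSpace.gramSchmidt ℝ (fun k => f k y) i)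
          (f j y) / inner ℝ (InnerProductSpace.gramSchmidt ℝ (fun k => f k y) i)
            (InnerProductSpace.gramSchmidt ℝ (fun k => f k y) i)) •
            InnerProductSpace.gramSchmidt ℝ (fun k => f k y) i := by
      intro y
      rw [eq_sub_iff_add_eq]
      simp only [real_inner_self_eq_norm_sq]
      exact (InnerProductSpace.gramSchmidt_def'' ℝ (fun k => f k y) j).symm
    simp only [he]
    refine ContMDiffAt.sub_section (hfs j) (ContMDiffAt.sum_section fun i hi => ?_)
    refine ContMDiffAt.smul_section (ContMDiffAt.div₀ ?_ ?_ ?_) (ih i (Finset.mem_Iio.1 hi))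
    · exact ContMDiffAt.inner_bundle (ih i (Finset.mem_Iio.1 hi)) (hfs j)
    · exact ContMDiffAt.inner_bundle (ih i (Finset.mem_Iio.1 hi)) (ih i (Finset.mem_Iio.1 hi))
    · exact inner_self_ne_zero.2 (hne i)
  have he : ∀ y, orthoFrame (V := V) x₀ i y =
      (Real.sqrt (inner ℝ (InnerProductSpace.gramSchmidt ℝ (fun k => f k y) i)
        (InnerProductSpace.gramSchmidt ℝ (fun k => f k y) i)))⁻¹ •
        InnerProductSpace.gramSchmidt ℝ (fun k => f k y) i := by
    intro y
    rw [real_inner_self_eq_norm_sq, Real.sqrt_sq (norm_nonneg _)]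
    rfl
  simp only [he]
  have hpos : 0 < inner ℝ (InnerProductSpace.gramSchmidt ℝ (fun k => f k x) i)
      (InnerProductSpace.gramSchmidt ℝ (fun k => f k x) i) := real_inner_self_pos.2 (hne i)
  refine ContMDiffAt.smul_section ?_ (hg i)
  have h1 : ContDiffAt ℝ ∞ (fun t : ℝ => (Real.sqrt t)⁻¹)
      (inner ℝ (InnerProductSpace.gramSchmidt ℝ (fun k => f k x) i)
        (InnerProductSpace.gramSchmidt ℝ (fun k => f k x) i)) :=
    (Real.contDiffAt_sqrt hpos.ne').inv (Real.sqrt_pos.2 hpos).ne'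
  exact ContMDiffAt.comp (g := fun t : ℝ => (Real.sqrt t)⁻¹) x h1.contMDiffAt
    (ContMDiffAt.inner_bundle (hg i) (hg i))

end Frames

/-! ### Exterior derivative of algebra-valued functions -/

theorem eq_zero_of_eq_neg {G : Type*} [AddCommGroup G] [Module ℝ G] {x : ExteriorAlgebra ℝ G}
    (h : x = -x) : x = 0 := by
  have h2 : (2 : ℝ) • x = 0 := by
    rw [two_smul]; nth_rewrite 1 [h]; exact neg_add_cancel x
  exact (smul_eq_zero.1 h2).resolve_left two_ne_zero

section Calculus

variable {F G ι : Type*} [NormedAddCommGroup F] [NormedSpace ℝ F] [AddCommGroup G] [Module ℝ G]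
  [FiniteDimensional ℝ G] [Fintype ι]

/-- An exterior algebra of finite dimension is a normed algebra: it acts faithfully on itself by
left multiplication, and carries the operator norm of this action. The choice of norm is immaterial;
it gives a meaning to derivatives of functions with values in the algebra. -/
noncomputable instance : NormedRing (ExteriorAlgebra ℝ G) :=
  letI := Matrix.linftyOpNormedRing (n := Fin (Module.finrank ℝ (ExteriorAlgebra ℝ G))) (α := ℝ)
  NormedRing.induced (ExteriorAlgebra ℝ G) _
    (Algebra.leftMulMatrix (Module.finBasis ℝ (ExteriorAlgebra ℝ G)))
    (Algebra.leftMulMatrix_injective _)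

noncomputable instance : NormedAlgebra ℝ (ExteriorAlgebra ℝ G) :=
  letI := Matrix.linftyOpNormedRing (n := Fin (Module.finrank ℝ (ExteriorAlgebra ℝ G))) (α := ℝ)
  letI := Matrix.linftyOpNormedAlgebra (R := ℝ)
    (n := Fin (Module.finrank ℝ (ExteriorAlgebra ℝ G))) (α := ℝ)
  NormedAlgebra.induced ℝ (ExteriorAlgebra ℝ G) _
    (Algebra.leftMulMatrix (Module.finBasis ℝ (ExteriorAlgebra ℝ G)))

/-- A linear map between finite dimensional exterior algebras, as a continuous linear map. -/
noncomputable abbrev clm {G' : Type*} [AddCommGroup G'] [Module ℝ G'] [FiniteDimensional ℝ G']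
    (L : ExteriorAlgebra ℝ G →ₗ[ℝ] ExteriorAlgebra ℝ G') :
    ExteriorAlgebra ℝ G →L[ℝ] ExteriorAlgebra ℝ G' :=
  LinearMap.toContinuousLinearMap L

/-- The exterior derivative `∑ₐ dxᵃ ∂ₐ f` of a function with values in the algebra, where `b` is a
basis and the generator `ε a` stands for the differential of the coordinate `a`. -/
noncomputable def extDA (b : ι → F) (ε : ι → G) (f : F → ExteriorAlgebra ℝ G) (u : F) :
    ExteriorAlgebra ℝ G :=
  ∑ a, ExteriorAlgebra.ι ℝ (ε a) * fderiv ℝ f u (b a)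

variable {b : ι → F} {ε : ι → G} {f g : F → ExteriorAlgebra ℝ G} {u : F}

theorem extDA_congr (h : f =ᶠ[𝓝 u] g) : extDA b ε f u = extDA b ε g u := by
  rw [extDA, extDA, h.fderiv_eq]

theorem extDA_add (hf : DifferentiableAt ℝ f u) (hg : DifferentiableAt ℝ g u) :
    extDA b ε (fun v => f v + g v) u = extDA b ε f u + extDA b ε g u := by
  simp only [extDA, fderiv_fun_add hf hg, add_apply, mul_add, Finset.sum_add_distrib]

theorem extDA_neg : extDA b ε (fun v => -f v) u = -extDA b ε f u := by
  simp only [extDA, fderiv_fun_neg, neg_apply, mul_neg, Finset.sum_neg_distrib]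

theorem extDA_sum {J : Type*} {s : Finset J} {f : J → F → ExteriorAlgebra ℝ G}
    (hf : ∀ j ∈ s, DifferentiableAt ℝ (f j) u) :
    extDA b ε (fun v => ∑ j ∈ s, f j v) u = ∑ j ∈ s, extDA b ε (f j) u := by
  simp only [extDA, fderiv_fun_sum hf, sum_apply, Finset.mul_sum]
  exact Finset.sum_comm

theorem extDA_const (x : ExteriorAlgebra ℝ G) : extDA b ε (fun _ => x) u = 0 := by
  simp [extDA]

theorem extDA_mul (hf : DifferentiableAt ℝ f u) (hg : DifferentiableAt ℝ g u) :
    extDA b ε (fun v => f v * g v) u = extDA b ε f u * g u + parity (f u) * extDA b ε g u := by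
  simp only [extDA, fderiv_fun_mul' hf hg, add_apply, smul_apply, smul_eq_mul, mul_add,
    Finset.sum_add_distrib, Finset.sum_mul, Finset.mul_sum]
  rw [add_comm]
  congr 1
  · refine Finset.sum_congr rfl fun a _ => ?_
    exact (mul_assoc _ _ _).symm
  · refine Finset.sum_congr rfl fun a _ => ?_
    rw [← mul_assoc, ι_mul_eq, mul_assoc]

/-- A linear map that commutes with the generators `ε a`, up to a sign, commutes with the exterior
derivative up to this sign. -/
theorem map_extDA {G' : Type*} [AddCommGroup G'] [Module ℝ G'] [FiniteDimensional ℝ G']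
    {ε' : ι → G'} {L : ExteriorAlgebra ℝ G →ₗ[ℝ] ExteriorAlgebra ℝ G'} {s : ℝ}
    (hL : ∀ a x, L (ExteriorAlgebra.ι ℝ (ε a) * x) = s • (ExteriorAlgebra.ι ℝ (ε' a) * L x))
    (hf : DifferentiableAt ℝ f u) :
    L (extDA b ε f u) = s • extDA b ε' (fun v => L (f v)) u := by
  have h : fderiv ℝ (fun v => L (f v)) u = (clm L).comp (fderiv ℝ f u) :=
    ((clm L).hasFDerivAt.comp u hf.hasFDerivAt).fderiv
  simp only [extDA, h, map_sum, hL, Finset.smul_sum]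
  rfl

theorem parity_extDA (hf : DifferentiableAt ℝ f u) :
    parity (extDA b ε f u) = -extDA b ε (fun v => parity (f v)) u := by
  have h := map_extDA (b := b) (L := (parity : ExteriorAlgebra ℝ G →ₐ[ℝ] _).toLinearMap) (s := -1)
    (ε := ε) (ε' := ε) (fun a x => by simp) hf
  simpa using h

theorem contr_extDA {d : Module.Dual ℝ G} (hd : ∀ a, d (ε a) = 0) (hf : DifferentiableAt ℝ f u) :
    contr d (extDA b ε f u) = -extDA b ε (fun v => contr d (f v)) u := by
  have h := map_extDA (b := b) (L := contr d) (s := -1)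
    (ε := ε) (ε' := ε) (fun a x => by rw [contr_ι_mul, hd]; simp) hf
  simpa using h

theorem contDiffAt_clm {G' : Type*} [AddCommGroup G'] [Module ℝ G'] [FiniteDimensional ℝ G']
    (L : ExteriorAlgebra ℝ G →ₗ[ℝ] ExteriorAlgebra ℝ G') (hf : ContDiffAt ℝ ∞ f u) :
    ContDiffAt ℝ ∞ (fun v => L (f v)) u :=
  (clm L).contDiff.contDiffAt.comp u hf

theorem contDiffAt_extDA (hf : ContDiffAt ℝ ∞ f u) : ContDiffAt ℝ ∞ (extDA b ε f) u := by
  unfold extDA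
  refine ContDiffAt.sum fun a _ => contDiffAt_const.mul ?_
  exact (hf.fderiv_right (m := ∞) (by simp)).clm_apply contDiffAt_const

theorem contDiffAt_algebraMap {h : F → ℝ} (hh : ContDiffAt ℝ ∞ h u) :
    ContDiffAt ℝ ∞ (fun v => algebraMap ℝ (ExteriorAlgebra ℝ G) (h v)) u :=
  (algebraMapCLM ℝ (ExteriorAlgebra ℝ G)).contDiff.contDiffAt.comp u hh

theorem eventually_contDiffAt (hf : ContDiffAt ℝ ∞ f u) :
    ∀ᶠ v in 𝓝 u, DifferentiableAt ℝ f v := by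
  have h1 : ContDiffAt ℝ 1 f u := hf.of_le (by norm_cast)
  filter_upwards [h1.eventually (by simp)] with v hv
  exact hv.differentiableAt (by simp)

/-- The exterior derivative squares to zero, because second derivatives are symmetric while the
generators anticommute. -/
theorem extDA_extDA (hf : ContDiffAt ℝ ∞ f u) : extDA b ε (extDA b ε f) u = 0 := by
  have hd : DifferentiableAt ℝ (fderiv ℝ f) u :=
    (hf.fderiv_right (m := ∞) (by simp)).differentiableAt (by simp)
  have hs : ∀ x y, fderiv ℝ (fderiv ℝ f) u x y = fderiv ℝ (fderiv ℝ f) u y x :=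
    fun x y => hf.isSymmSndFDerivAt
      (by rw [minSmoothness_of_isRCLikeNormedField]; exact ENat.LEInfty.out) x y
  have h1 : ∀ a, fderiv ℝ (extDA b ε f) u (b a) =
      ∑ c, ExteriorAlgebra.ι ℝ (ε c) * fderiv ℝ (fderiv ℝ f) u (b a) (b c) := by
    intro a
    have h2 : ∀ c, HasFDerivAt (fun v => ExteriorAlgebra.ι ℝ (ε c) * fderiv ℝ f v (b c))
        ((ContinuousLinearMap.mul ℝ (ExteriorAlgebra ℝ G) (ExteriorAlgebra.ι ℝ (ε c))).comp
          ((ContinuousLinearMap.apply ℝ _ (b c)).comp (fderiv ℝ (fderiv ℝ f) u))) u := by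
      intro c
      have h3 := (ContinuousLinearMap.apply ℝ (ExteriorAlgebra ℝ G) (b c)).hasFDerivAt.comp u
        hd.hasFDerivAt
      exact (ContinuousLinearMap.mul ℝ (ExteriorAlgebra ℝ G)
        (ExteriorAlgebra.ι ℝ (ε c))).hasFDerivAt.comp u h3
    have h4 := (HasFDerivAt.fun_sum (u := Finset.univ) fun c _ => h2 c).fderiv
    have h5 : fderiv ℝ (extDA b ε f) u = _ := h4
    rw [h5, sum_apply]
    rfl
  have h6 : extDA b ε (extDA b ε f) u = ∑ a, ∑ c, ExteriorAlgebra.ι ℝ (ε a) *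
      ExteriorAlgebra.ι ℝ (ε c) * fderiv ℝ (fderiv ℝ f) u (b a) (b c) := by
    rw [extDA]
    simp only [h1, Finset.mul_sum, mul_assoc]
  have h7 : extDA b ε (extDA b ε f) u = -extDA b ε (extDA b ε f) u := by
    conv_lhs => rw [h6, Finset.sum_comm]
    rw [h6, ← Finset.sum_neg_distrib]
    refine Finset.sum_congr rfl fun a _ => ?_
    rw [← Finset.sum_neg_distrib]
    refine Finset.sum_congr rfl fun c _ => ?_
    rw [hs, odd_anticomm (parity_ι _) (parity_ι _), neg_mul]
  exact eq_zero_of_eq_neg h7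

/-- The operator `∑ₐ dxᵃ ∂ₐ + ∑ⱼ cⱼ ι_{dⱼ}`; it is an odd derivation if the `cⱼ` are even. -/
noncomputable def delta (b : ι → F) (ε : ι → G) {J : Type*} [Fintype J]
    (c : J → F → ExteriorAlgebra ℝ G) (d : J → Module.Dual ℝ G) (f : F → ExteriorAlgebra ℝ G)
    (u : F) : ExteriorAlgebra ℝ G :=
  extDA b ε f u + ∑ j, c j u * contr (d j) (f u)

variable {J : Type*} [Fintype J] {c : J → F → ExteriorAlgebra ℝ G} {d : J → Module.Dual ℝ G}

theorem delta_add (hf : DifferentiableAt ℝ f u) (hg : DifferentiableAt ℝ g u) :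
    delta b ε c d (fun v => f v + g v) u = delta b ε c d f u + delta b ε c d g u := by
  simp only [delta, extDA_add hf hg, map_add, mul_add, Finset.sum_add_distrib]
  abel

theorem delta_neg : delta b ε c d (fun v => -f v) u = -delta b ε c d f u := by
  simp only [delta, extDA_neg, map_neg, mul_neg, Finset.sum_neg_distrib]
  abel

theorem delta_sum {K : Type*} {s : Finset K} {f : K → F → ExteriorAlgebra ℝ G}
    (hf : ∀ j ∈ s, DifferentiableAt ℝ (f j) u) :
    delta b ε c d (fun v => ∑ j ∈ s, f j v) u = ∑ j ∈ s, delta b ε c d (f j) u := by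
  simp only [delta, extDA_sum hf, map_sum, Finset.mul_sum, Finset.sum_add_distrib]
  rw [Finset.sum_comm]

theorem delta_const_smul (r : ℝ) (hf : DifferentiableAt ℝ f u) :
    delta b ε c d (fun v => r • f v) u = r • delta b ε c d f u := by
  simp only [delta, extDA, fderiv_fun_const_smul hf, smul_apply, map_smul, mul_smul_comm,
    smul_add, Finset.smul_sum]

theorem delta_mul (hc : ∀ j, parity (c j u) = c j u) (hf : DifferentiableAt ℝ f u)
    (hg : DifferentiableAt ℝ g u) :
    delta b ε c d (fun v => f v * g v) u =
      delta b ε c d f u * g u + parity (f u) * delta b ε c d g u := by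
  have h : ∀ j, c j u * contr (d j) (f u * g u) =
      c j u * contr (d j) (f u) * g u + parity (f u) * (c j u * contr (d j) (g u)) := by
    intro j
    rw [contr_mul, mul_add, ← mul_assoc, ← mul_assoc, even_comm (hc j) (parity (f u)),
      mul_assoc (parity (f u))]
  simp only [delta, extDA_mul hf hg, h, Finset.sum_add_distrib, add_mul, mul_add, Finset.sum_mul,
    Finset.mul_sum]
  abel

theorem delta_one : delta b ε c d (fun _ => 1) u = 0 := by
  simp [delta, extDA_const]

/-- The derivative of a power of an even function. -/
theorem delta_pow (hc : ∀ j, parity (c j u) = c j u) (hf : DifferentiableAt ℝ f u)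
    (he : parity (f u) = f u) (i : ℕ) :
    delta b ε c d (fun v => f v ^ (i + 1)) u =
      ((i : ℝ) + 1) • (delta b ε c d f u * f u ^ i) := by
  induction i with
  | zero => simp
  | succ i ih =>
    simp only [pow_succ' (f _) (i + 1)]
    rw [delta_mul (g := fun v => f v ^ (i + 1)) hc hf (hf.pow (i + 1)), ih, he, mul_smul_comm,
      ← mul_assoc, even_comm he, mul_assoc, ← pow_succ', Nat.cast_succ]
    module

/-- The exponential of the sum of a function `s` and an even function `N`, written as a truncated
series in `N`, is annihilated by the derivation if `s + N` is. The term of order `K` is kept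
although it vanishes at `u`: nilpotency is only assumed at this point, and the derivative of this
term need not vanish. -/
theorem delta_exp (hc : ∀ j, parity (c j u) = c j u) {s : F → ℝ} {N : F → ExteriorAlgebra ℝ G}
    (hs : DifferentiableAt ℝ s u) (hN : DifferentiableAt ℝ N u) (he : parity (N u) = N u) {K : ℕ}
    (hK : N u ^ K = 0)
    (h : delta b ε c d (fun v => algebraMap ℝ _ (s v) + N v) u = 0) :
    delta b ε c d (fun v => Real.exp (s v) •
      ∑ i ∈ Finset.range (K + 1), (i.factorial : ℝ)⁻¹ • N v ^ i) u = 0 := by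
  have hsA : ∀ {r : F → ℝ}, DifferentiableAt ℝ r u →
      DifferentiableAt ℝ (fun v => algebraMap ℝ (ExteriorAlgebra ℝ G) (r v)) u := fun hr =>
    (algebraMapCLM ℝ (ExteriorAlgebra ℝ G)).differentiableAt.comp u hr
  have hds : ∀ {r : F → ℝ}, DifferentiableAt ℝ r u →
      delta b ε c d (fun v => algebraMap ℝ (ExteriorAlgebra ℝ G) (r v)) u =
        ∑ a, ExteriorAlgebra.ι ℝ (ε a) * algebraMap ℝ _ (fderiv ℝ r u (b a)) := by
    intro r hr
    have h1 : fderiv ℝ (fun v => algebraMap ℝ (ExteriorAlgebra ℝ G) (r v)) u =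
      (algebraMapCLM ℝ (ExteriorAlgebra ℝ G)).comp (fderiv ℝ r u) :=
      ((algebraMapCLM ℝ (ExteriorAlgebra ℝ G)).hasFDerivAt.comp u hr.hasFDerivAt).fderiv
    simp only [delta, contr_algebraMap, mul_zero, Finset.sum_const_zero, add_zero, extDA, h1]
    rfl
  have hexp : delta b ε c d (fun v => algebraMap ℝ (ExteriorAlgebra ℝ G) (Real.exp (s v))) u =
      Real.exp (s u) • delta b ε c d (fun v => algebraMap ℝ (ExteriorAlgebra ℝ G) (s v)) u := by
    rw [hds hs.exp, hds hs, Finset.smul_sum]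
    refine Finset.sum_congr rfl fun a _ => ?_
    rw [fderiv_exp hs, smul_apply, smul_eq_mul, map_mul, ← Algebra.smul_def, mul_smul_comm]
  rw [delta_add (hsA hs) hN] at h
  have hpow : ∀ i, DifferentiableAt ℝ (fun v => (i.factorial : ℝ)⁻¹ • N v ^ i) u := fun i =>
    (hN.fun_pow i).fun_const_smul _
  have hsum : delta b ε c d (fun v => ∑ i ∈ Finset.range (K + 1), (i.factorial : ℝ)⁻¹ • N v ^ i) u =
      delta b ε c d N u * ∑ i ∈ Finset.range (K + 1), (i.factorial : ℝ)⁻¹ • N u ^ i := by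
    rw [delta_sum fun i _ => hpow i, Finset.sum_range_succ', Finset.sum_range_succ]
    have h0 : delta b ε c d (fun v => ((0 : ℕ).factorial : ℝ)⁻¹ • N v ^ 0) u = 0 := by
      simpa using delta_one (b := b) (ε := ε) (c := c) (d := d) (u := u)
    rw [h0, add_zero, hK, smul_zero, add_zero, Finset.mul_sum]
    refine Finset.sum_congr rfl fun i _ => ?_
    rw [delta_const_smul _ (hN.fun_pow _), delta_pow hc hN he, smul_smul, mul_smul_comm]
    congr 1
    rw [Nat.factorial_succ]
    push_cast
    field_simp
  simp only [Algebra.smul_def (Real.exp _)]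
  rw [delta_mul hc (hsA hs.exp) (DifferentiableAt.fun_sum fun i _ => hpow i), hsum, hexp,
    AlgHom.commutes, ← Algebra.smul_def, smul_mul_assoc, ← smul_add, ← add_mul, h, zero_mul,
    smul_zero]

end Calculus

/-! ### Subalgebras of the algebra of generators -/

section Subalgebras

variable {ι : Type*} {n : ℕ}

theorem contr_zero {G : Type*} [AddCommGroup G] [Module ℝ G] (x : ExteriorAlgebra ℝ G) :
    contr (0 : Module.Dual ℝ G) x = 0 := by
  have h := LinearMap.congr_fun (map_zero (CliffordAlgebra.contractLeft
    (Q := (0 : QuadraticForm ℝ G)))) x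
  exact h

variable (ι n) in
/-- The projection of the generators to those of the coordinates. -/
def killRest : Gen ι n →ₗ[ℝ] Gen ι n :=
  LinearMap.pi fun j => match j with
    | Sum.inl a => LinearMap.proj (Sum.inl a)
    | Sum.inr _ => 0

variable (ι n) in
/-- The subalgebra generated by the coordinate differentials and `κ`. -/
noncomputable def baseAlg : Subalgebra ℝ (Alg ι n) :=
  AlgHom.equalizer (ExteriorAlgebra.map (killFrame ι n)) (AlgHom.id ℝ _)

variable (ι n) in
/-- The subalgebra generated by the coordinate differentials. -/
noncomputable def formAlg : Subalgebra ℝ (Alg ι n) :=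
  AlgHom.equalizer (ExteriorAlgebra.map (killRest ι n)) (AlgHom.id ℝ _)

theorem mem_baseAlg {x : Alg ι n} :
    x ∈ baseAlg ι n ↔ ExteriorAlgebra.map (killFrame ι n) x = x := Iff.rfl

theorem mem_formAlg {x : Alg ι n} :
    x ∈ formAlg ι n ↔ ExteriorAlgebra.map (killRest ι n) x = x := Iff.rfl

theorem formAlg_le_baseAlg {x : Alg ι n} (hx : x ∈ formAlg ι n) : x ∈ baseAlg ι n := by
  rw [mem_formAlg] at hx
  rw [mem_baseAlg, ← hx, ← AlgHom.comp_apply, ExteriorAlgebra.map_comp_map]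
  congr 2
  refine LinearMap.ext fun v => funext fun j => ?_
  rcases j with a | i | w <;> rfl

theorem ι_mem_baseAlg {v : Gen ι n} (hv : ∀ i, frameDual ι i v = 0) :
    ExteriorAlgebra.ι ℝ v ∈ baseAlg ι n := by
  rw [mem_baseAlg, ExteriorAlgebra.map_apply_ι, killFrame_eq_self hv]

theorem dx_mem_formAlg [DecidableEq ι] (a : ι) : dx n a ∈ formAlg ι n := by
  rw [mem_formAlg, ExteriorAlgebra.map_apply_ι]
  congr 1
  funext j
  rcases j with a | i | w <;> simp [killRest, formGen]

theorem kap_mem_baseAlg [DecidableEq ι] : kap ι n ∈ baseAlg ι n :=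
  ι_mem_baseAlg fun i => by simp [kapGen]

theorem contr_frameDual_of_mem {x : Alg ι n} (hx : x ∈ baseAlg ι n) (i : Fin n) :
    contr (frameDual ι i) x = 0 := by
  rw [mem_baseAlg] at hx
  have h : (frameDual ι i) ∘ₗ killFrame ι n = 0 := LinearMap.ext fun v => rfl
  rw [← hx, contr_map, h, contr_zero, map_zero]

theorem contr_kapDual_of_mem {x : Alg ι n} (hx : x ∈ formAlg ι n) :
    contr (kapDual ι n) x = 0 := by
  rw [mem_formAlg] at hx
  have h : (kapDual ι n) ∘ₗ killRest ι n = 0 := LinearMap.ext fun v => rfl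
  rw [← hx, contr_map, h, contr_zero, map_zero]

theorem contrFin_mul_of_forall_contr_eq_zero {G : Type*} [AddCommGroup G] [Module ℝ G] {m : ℕ}
    (d : Fin m → Module.Dual ℝ G) {w : ExteriorAlgebra ℝ G} (hw : ∀ i, contr (d i) w = 0)
    (x : ExteriorAlgebra ℝ G) : contrFin d (w * x) = (parity ^ m) w * contrFin d x := by
  induction m generalizing w x with
  | zero => rfl
  | succ m ih =>
    rw [contrFin_succ, contr_mul, hw, zero_mul, zero_add, ih, contrFin_succ, pow_succ,
      AlgHom.mul_apply]
    intro i
    rw [contr_parity, hw, map_zero, neg_zero]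

theorem berez_mul_of_mem {w : Alg ι n} (hw : w ∈ baseAlg ι n) (x : Alg ι n) :
    berez ι n (w * x) = w * berez ι n x := by
  have hw' : ∀ m, contr (frameDual ι m) ((parity ^ n) w) = 0 := fun m => by
    rw [contr_parity_pow, contr_frameDual_of_mem hw, map_zero, smul_zero]
  rw [berez_apply, berez_apply, map_mul, contrFin_mul_of_forall_contr_eq_zero _ hw',
    parity_pow_parity_pow, map_mul, mem_baseAlg.1 hw, mul_smul_comm]

theorem contr_kapDual_mem_baseAlg {x : Alg ι n} (hx : x ∈ baseAlg ι n) :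
    contr (kapDual ι n) x ∈ baseAlg ι n := by
  have h : (kapDual ι n) ∘ₗ killFrame ι n = kapDual ι n := LinearMap.ext fun v => rfl
  rw [mem_baseAlg] at hx ⊢
  conv_rhs => rw [← hx, contr_map, h]

variable {F : Type*} [NormedAddCommGroup F] [NormedSpace ℝ F] [Fintype ι] [DecidableEq ι]
  {b : ι → F} {f : F → Alg ι n} {u : F}

theorem extDA_mem_baseAlg (hf : DifferentiableAt ℝ f u) (h : ∀ᶠ v in 𝓝 u, f v ∈ baseAlg ι n) :
    extDA b (formGen n) f u ∈ baseAlg ι n := by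
  have h1 := map_extDA (b := b) (ε := formGen n) (ε' := formGen n) (s := 1)
    (L := (ExteriorAlgebra.map (killFrame ι n)).toLinearMap) (fun a x => by
      have := formAlg_le_baseAlg (dx_mem_formAlg (n := n) a)
      rw [mem_baseAlg] at this
      rw [one_smul, AlgHom.toLinearMap_apply, map_mul, this]; rfl) hf
  rw [one_smul] at h1
  rw [mem_baseAlg]
  exact h1.trans (extDA_congr (by filter_upwards [h] with v hv using hv))

theorem extDA_mem_formAlg (hf : DifferentiableAt ℝ f u) (h : ∀ᶠ v in 𝓝 u, f v ∈ formAlg ι n) :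
    extDA b (formGen n) f u ∈ formAlg ι n := by
  have h1 := map_extDA (b := b) (ε := formGen n) (ε' := formGen n) (s := 1)
    (L := (ExteriorAlgebra.map (killRest ι n)).toLinearMap) (fun a x => by
      have := dx_mem_formAlg (n := n) a
      rw [mem_formAlg] at this
      rw [one_smul, AlgHom.toLinearMap_apply, map_mul, this]; rfl) hf
  rw [one_smul] at h1
  rw [mem_formAlg]
  exact h1.trans (extDA_congr (by filter_upwards [h] with v hv using hv))

theorem berez_extDA (hf : DifferentiableAt ℝ f u) :
    berez ι n (extDA b (formGen n) f u) = extDA b (formGen n) (fun v => berez ι n (f v)) u := by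
  have h1 := map_extDA (b := b) (ε := formGen n) (ε' := formGen n) (s := 1)
    (L := berez ι n) (fun a x => by
      rw [one_smul]; exact berez_mul_of_mem (formAlg_le_baseAlg (dx_mem_formAlg a)) x) hf
  rwa [one_smul] at h1

end Subalgebras

section Bianchi

variable {G : Type*} [AddCommGroup G] [Module ℝ G] {n : ℕ}
  {T R : Fin n → Fin n → ExteriorAlgebra ℝ G} {X e : Fin n → ExteriorAlgebra ℝ G} {z : Fin n → ℝ}

/-- The algebraic identities behind the Bianchi identity and the closedness of the Thom form: `T` is
a skew-symmetric matrix of odd elements with "differential" `R`, and `X`, the "differential" of `z`,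
and `e` consist of odd elements. -/
theorem bianchi_sum (hT : ∀ i j, parity (T i j) = -T i j) (hR : ∀ i j, parity (R i j) = R i j)
    (he : ∀ i, parity (e i) = -e i) (hTs : ∀ i j, T j i = -T i j) (hRs : ∀ i j, R j i = -R i j) :
    (∑ i, z i • X i)
      + ∑ i, ((∑ j, (X j * T j i + z j • R j i)) * e i
        - (X i + ∑ j, z j • T j i) * ((∑ j, T i j * e j) + algebraMap ℝ _ (z i)))
      - (1 / 2 : ℝ) • ∑ i, ∑ k, (-(∑ j, (R i j * T j k - T i j * R j k)) * (e i * e k)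
        + (R i k - ∑ j, T i j * T j k) * (((∑ j, T i j * e j) + algebraMap ℝ _ (z i)) * e k
          - e i * ((∑ j, T k j * e j) + algebraMap ℝ _ (z k)))) = 0 := by
  -- the two halves of the Bianchi term agree
  have hB : ∑ i, ∑ k, (∑ j, T i j * R j k) * (e i * e k) =
      -∑ i, ∑ k, (∑ j, R i j * T j k) * (e i * e k) := by
    rw [Finset.sum_comm, ← Finset.sum_neg_distrib]
    refine Finset.sum_congr rfl fun i _ => ?_
    rw [← Finset.sum_neg_distrib]
    refine Finset.sum_congr rfl fun k _ => ?_
    rw [odd_anticomm (he k) (he i), mul_neg]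
    congr 2
    refine Finset.sum_congr rfl fun j _ => ?_
    rw [hTs j k, hRs i j, neg_mul_neg, even_comm (hR i j)]
  have hP : ∀ i k, parity (R i k - ∑ j, T i j * T j k) = R i k - ∑ j, T i j * T j k := by
    intro i k
    simp only [map_sub, map_sum, map_mul, hR, hT, neg_mul_neg]
  have hPs : ∀ i k, R k i - ∑ j, T k j * T j i = -(R i k - ∑ j, T i j * T j k) := by
    intro i k
    rw [hRs i k, neg_sub, sub_eq_add_neg, add_comm, ← Finset.sum_neg_distrib, sub_eq_add_neg]
    congr 1
    refine Finset.sum_congr rfl fun j _ => ?_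
    rw [hTs j k, hTs i j, neg_mul_neg, odd_anticomm (hT j k) (hT i j), neg_neg]
  -- `P` is the curvature and `D` the differential of the frame
  set P : Fin n → Fin n → ExteriorAlgebra ℝ G := fun i k => R i k - ∑ j, T i j * T j k with hPdef
  set D : Fin n → ExteriorAlgebra ℝ G := fun i => (∑ j, T i j * e j) + algebraMap ℝ _ (z i) with hD
  have hDe : ∀ i, parity (D i) = D i := by
    intro i
    simp only [hD, map_add, map_sum, map_mul, hT, he, neg_mul_neg, AlgHom.commutes]
  have hC : ∑ i, ∑ k, P i k * (D i * e k - e i * D k) = (2 : ℝ) • ∑ i, ∑ k, P i k * (D i * e k) := by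
    have h1 : ∑ i, ∑ k, P i k * (e i * D k) = -∑ i, ∑ k, P i k * (D i * e k) := by
      rw [Finset.sum_comm, ← Finset.sum_neg_distrib]
      refine Finset.sum_congr rfl fun i _ => ?_
      rw [← Finset.sum_neg_distrib]
      refine Finset.sum_congr rfl fun k _ => ?_
      rw [show P k i = -P i k from hPs i k, even_comm (hDe i), neg_mul]
    simp only [mul_sub, Finset.sum_sub_distrib, h1, two_smul, sub_neg_eq_add]
  have hmat : ∀ a : Fin n → Fin n → ExteriorAlgebra ℝ G,
      ∑ i, ∑ k, a i k * ((∑ j, T i j * e j) * e k) =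
        ∑ j, ∑ k, (∑ i, a i k * T i j) * (e j * e k) := by
    intro a
    rw [Finset.sum_comm]
    conv_rhs => rw [Finset.sum_comm]
    refine Finset.sum_congr rfl fun k _ => ?_
    simp only [Finset.mul_sum, Finset.sum_mul]
    rw [Finset.sum_comm]
    simp only [mul_assoc]
  -- the coefficients of the cubic term in `T` are symmetric, so they pair to zero with `e j * e k`
  have hS : ∑ i, ∑ k, (∑ j, T i j * T j k) * ((∑ j, T i j * e j) * e k) = 0 := by
    rw [hmat]
    have h2 : ∀ i k, parity (∑ j, T i j * T j k) = ∑ j, T i j * T j k := by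
      intro i k
      simp only [map_sum, map_mul, hT, neg_mul_neg]
    have h3 : ∀ i k, ∑ j, T k j * T j i = -∑ j, T i j * T j k := by
      intro i k
      rw [← Finset.sum_neg_distrib]
      refine Finset.sum_congr rfl fun j _ => ?_
      rw [hTs j k, hTs i j, neg_mul_neg, odd_anticomm (hT j k) (hT i j)]
    have h4 : ∀ l k, ∑ i, (∑ j, T i j * T j k) * T i l = ∑ i, (∑ j, T i j * T j l) * T i k := by
      intro l k
      have h5 : ∑ i, (∑ j, T i j * T j k) * T i l = -∑ i, T l i * ∑ j, T i j * T j k := by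
        rw [← Finset.sum_neg_distrib]
        refine Finset.sum_congr rfl fun i _ => ?_
        rw [even_comm (h2 i k), hTs l i, neg_mul]
      have h6 : ∑ i, (∑ j, T i j * T j l) * T i k = -∑ i, (∑ j, T l j * T j i) * T i k := by
        rw [← Finset.sum_neg_distrib]
        refine Finset.sum_congr rfl fun i _ => ?_
        rw [h3 l i, neg_mul]
      rw [h5, h6]
      simp only [Finset.mul_sum, Finset.sum_mul, mul_assoc]
      rw [Finset.sum_comm]
    refine eq_zero_of_eq_neg ?_
    conv_lhs => rw [Finset.sum_comm]
    rw [← Finset.sum_neg_distrib]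
    refine Finset.sum_congr rfl fun l _ => ?_
    rw [← Finset.sum_neg_distrib]
    refine Finset.sum_congr rfl fun k _ => ?_
    rw [h4, odd_anticomm (he k) (he l), mul_neg]
  have hRT : ∑ i, ∑ k, R i k * ((∑ j, T i j * e j) * e k) =
      ∑ i, ∑ k, (∑ j, R i j * T j k) * (e i * e k) := by
    rw [hmat, Finset.sum_comm]
    refine Finset.sum_congr rfl fun i _ => Finset.sum_congr rfl fun k _ => ?_
    rw [odd_anticomm (he k) (he i), mul_neg, ← neg_mul, ← Finset.sum_neg_distrib]
    congr 1
    refine Finset.sum_congr rfl fun j _ => ?_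
    rw [hRs i j, neg_mul, neg_neg]
  have hPD : ∑ i, ∑ k, P i k * (D i * e k) =
      ∑ i, ∑ k, (∑ j, R i j * T j k) * (e i * e k) + ∑ i, ∑ k, z i • (P i k * e k) := by
    have h1 : ∀ i k, P i k * (D i * e k) = R i k * ((∑ j, T i j * e j) * e k) -
        (∑ j, T i j * T j k) * ((∑ j, T i j * e j) * e k) + z i • (P i k * e k) := by
      intro i k
      rw [← sub_mul, hD]
      simp only [add_mul, mul_add, ← Algebra.smul_def, mul_smul_comm]
      rfl
    simp only [h1, Finset.sum_add_distrib, Finset.sum_sub_distrib, hS, hRT, sub_zero]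
  have hQ : ∑ i, ((∑ j, (X j * T j i + z j • R j i)) * e i
        - (X i + ∑ j, z j • T j i) * D i) =
      -(∑ i, z i • X i) + ∑ i, ∑ k, z i • (P i k * e k) := by
    have h1 : ∑ i, (∑ j, X j * T j i) * e i = ∑ i, X i * ∑ j, T i j * e j := by
      simp only [Finset.mul_sum, Finset.sum_mul, mul_assoc]
      exact Finset.sum_comm
    have h2 : ∑ i, (∑ j, z j • R j i) * e i = ∑ i, ∑ k, z i • (R i k * e k) := by
      simp only [Finset.sum_mul, smul_mul_assoc]
      exact Finset.sum_comm
    have h3 : ∑ i, (∑ j, z j • T j i) * ∑ k, T i k * e k =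
        ∑ i, ∑ k, z i • ((∑ j, T i j * T j k) * e k) := by
      simp only [Finset.mul_sum, Finset.sum_mul, smul_mul_assoc, Finset.smul_sum, mul_assoc]
      rw [Finset.sum_congr rfl fun i _ => Finset.sum_comm, Finset.sum_comm]
      exact Finset.sum_congr rfl fun i _ => Finset.sum_comm
    have h4 : ∑ i, z i • ∑ j, z j • T j i = 0 := by
      refine eq_zero_of_eq_neg ?_
      simp only [Finset.smul_sum]
      conv_lhs => rw [Finset.sum_comm]
      rw [← Finset.sum_neg_distrib]
      refine Finset.sum_congr rfl fun i _ => ?_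
      rw [← Finset.sum_neg_distrib]
      refine Finset.sum_congr rfl fun j _ => ?_
      rw [hTs j i, smul_neg, smul_neg, smul_comm]
    have h5 : ∀ i, (∑ j, (X j * T j i + z j • R j i)) * e i - (X i + ∑ j, z j • T j i) * D i =
        (∑ j, X j * T j i) * e i + (∑ j, z j • R j i) * e i - X i * (∑ j, T i j * e j)
          - (∑ j, z j • T j i) * (∑ k, T i k * e k) - z i • X i - z i • ∑ j, z j • T j i := by
      intro i
      simp only [hD, Finset.sum_add_distrib, add_mul, mul_add,
        ← Algebra.commutes (z i), ← Algebra.smul_def]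
      abel
    have h6 : ∑ i, ∑ k, z i • (P i k * e k) = ∑ i, ∑ k, z i • (R i k * e k) -
        ∑ i, ∑ k, z i • ((∑ j, T i j * T j k) * e k) := by
      simp only [hPdef, sub_mul, smul_sub, Finset.sum_sub_distrib]
    rw [Finset.sum_congr rfl fun i _ => h5 i]
    simp only [Finset.sum_add_distrib, Finset.sum_sub_distrib, h1, h2, h3, h4, h6]
    abel
  have hBB : ∑ i, ∑ k, -(∑ j, (R i j * T j k - T i j * R j k)) * (e i * e k) =
      -(2 : ℝ) • ∑ i, ∑ k, (∑ j, R i j * T j k) * (e i * e k) := by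
    simp only [Finset.sum_sub_distrib, neg_mul, sub_mul, Finset.sum_neg_distrib, hB]
    module
  simp only [Finset.sum_add_distrib] at hQ hBB hC ⊢
  rw [hQ, hBB, hC, hPD]
  module

end Bianchi

/-! ### The local model of the Thom form -/

section LocalData

variable {F : Type*} [NormedAddCommGroup F] [NormedSpace ℝ F] {ι : Type*} [Fintype ι]
  [DecidableEq ι] {n : ℕ}

variable (F ι n) in
/-- The data from which the Thom form is built in local coordinates and a local orthonormal frame:
the coordinates `z` of the tautological section, the matrix `T = θ + κ φ` made of the connection
form and of the endomorphism, and the closed `2`-form `om`. -/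
structure LocalData where
  /-- the coordinates of the tautological section -/
  z : Fin n → F → ℝ
  /-- the matrix of the superconnection; `T i j` is the component of the derivative of the `i`-th
  vector of the frame along the `j`-th -/
  T : Fin n → Fin n → F → Alg ι n
  /-- the closed `2`-form, seen in the algebra -/
  om : F → Alg ι n

namespace LocalData

variable (D : LocalData F ι n) (b : ι → F)

/-- The differential `d + om ∂/∂κ`, that is the differential of the mapping cone if `κ` is a formal
primitive of `om`. -/
noncomputable def coneDiff (f : F → Alg ι n) (u : F) : Alg ι n :=
  extDA b (formGen n) f u + D.om u * contr (kapDual ι n) (f u)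

/-- The curvature matrix. The sign of the second term is due to the convention that `T` acts on
components by its transpose, and to its entries being odd. -/
noncomputable def curv (i k : Fin n) (u : F) : Alg ι n :=
  D.coneDiff b (D.T i k) u - ∑ j, D.T i j u * D.T j k u

/-- The covariant differential of the tautological section. -/
noncomputable def dTaut (i : Fin n) (u : F) : Alg ι n :=
  extDA b (formGen n) (fun v => algebraMap ℝ _ (D.z i v)) u + ∑ j, D.z j u • D.T j i u

/-- The part of `𝒜` that is nilpotent. -/
noncomputable def nilPart (u : F) : Alg ι n :=
  ∑ i, D.dTaut b i u * fr ι i - (1 / 2 : ℝ) • ∑ i, ∑ k, D.curv b i k u * (fr ι i * fr ι k)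

/-- Half of the squared norm of the tautological section. -/
noncomputable def halfSq (u : F) : ℝ := 1 / 2 * ∑ i, D.z i u ^ 2

/-- The conditions under which the local data define a closed form near a point. -/
structure IsRegularAt (u : F) : Prop where
  z_smooth : ∀ i, ContDiffAt ℝ ∞ (D.z i) u
  T_smooth : ∀ i j, ContDiffAt ℝ ∞ (D.T i j) u
  om_smooth : ContDiffAt ℝ ∞ D.om u
  T_odd : ∀ᶠ v in 𝓝 u, ∀ i j, parity (D.T i j v) = -D.T i j v
  T_skew : ∀ᶠ v in 𝓝 u, ∀ i j, D.T j i v = -D.T i j v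
  T_base : ∀ᶠ v in 𝓝 u, ∀ i j, D.T i j v ∈ baseAlg ι n
  om_even : ∀ᶠ v in 𝓝 u, parity (D.om v) = D.om v
  om_form : ∀ᶠ v in 𝓝 u, D.om v ∈ formAlg ι n
  om_closed : extDA b (formGen n) D.om u = 0

/-- The coefficients of the derivation that extends `coneDiff` to the frame: contraction with `κ` is
multiplied with `om`, contraction with a vector of the frame with its covariant derivative plus the
corresponding coordinate of the tautological section. -/
noncomputable def derCoeff : Unit ⊕ Fin n → F → Alg ι n
  | Sum.inl _ => D.om
  | Sum.inr i => fun u => (∑ j, D.T i j u * fr ι j) + algebraMap ℝ _ (D.z i u)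

variable (ι n) in
/-- The linear forms to contract with. -/
def derDual : Unit ⊕ Fin n → Module.Dual ℝ (Gen ι n)
  | Sum.inl _ => kapDual ι n
  | Sum.inr i => frameDual ι i

/-- The derivation under which `𝒜` is closed. -/
noncomputable abbrev der (f : F → Alg ι n) (u : F) : Alg ι n :=
  delta b (formGen n) D.derCoeff (derDual ι n) f u

theorem der_eq (f : F → Alg ι n) (u : F) : D.der b f u = D.coneDiff b f u +
    ∑ i, ((∑ j, D.T i j u * fr ι j) + algebraMap ℝ _ (D.z i u)) * contr (frameDual ι i) (f u) := by
  rw [der, delta, Fintype.sum_sum_type, coneDiff]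
  simp only [derCoeff, derDual, Finset.univ_unique, Finset.sum_singleton]
  abel

variable {D b} {f : F → Alg ι n} {u : F}

theorem coneDiff_congr {g : F → Alg ι n} (h : f =ᶠ[𝓝 u] g) :
    D.coneDiff b f u = D.coneDiff b g u := by
  rw [coneDiff, coneDiff, extDA_congr h, h.eq_of_nhds]

theorem der_of_mem (hf : f u ∈ baseAlg ι n) : D.der b f u = D.coneDiff b f u := by
  rw [der_eq, Finset.sum_eq_zero, add_zero]
  intro i _
  rw [contr_frameDual_of_mem hf, mul_zero]

/-- The value of the derivation on a vector of the frame. -/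
theorem der_fr (i : Fin n) : D.der b (fun _ => fr ι i) u =
    (∑ j, D.T i j u * fr ι j) + algebraMap ℝ _ (D.z i u) := by
  rw [der_eq, coneDiff, extDA_const, contr_ι]
  have h : kapDual ι n (frameGen ι i) = 0 := by simp [frameGen]
  rw [h, map_zero, mul_zero, add_zero, zero_add, Finset.sum_eq_single i]
  · rw [contr_ι]
    simp [frameGen]
  · intro j _ hj
    rw [contr_ι]
    have : frameDual ι j (frameGen ι i) = 0 := by simp [frameGen, hj]
    rw [this, map_zero, mul_zero]
  · simp

namespace IsRegularAt

theorem derCoeff_even (h : D.IsRegularAt b u) (j : Unit ⊕ Fin n) :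
    parity (D.derCoeff j u) = D.derCoeff j u := by
  rcases j with j | i
  · exact h.om_even.self_of_nhds
  · simp only [derCoeff, map_add, map_sum, map_mul, h.T_odd.self_of_nhds, parity_ι, neg_mul_neg,
      AlgHom.commutes]

theorem differentiableAt_T (h : D.IsRegularAt b u) (i j : Fin n) :
    DifferentiableAt ℝ (D.T i j) u := (h.T_smooth i j).differentiableAt (by simp)

theorem differentiableAt_z (h : D.IsRegularAt b u) (i : Fin n) :
    DifferentiableAt ℝ (D.z i) u := (h.z_smooth i).differentiableAt (by simp)

theorem contDiffAt_coneDiff (h : D.IsRegularAt b u) (hf : ContDiffAt ℝ ∞ f u) :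
    ContDiffAt ℝ ∞ (D.coneDiff b f) u :=
  (contDiffAt_extDA hf).add (h.om_smooth.mul (contDiffAt_clm _ hf))

theorem contDiffAt_curv (h : D.IsRegularAt b u) (i k : Fin n) :
    ContDiffAt ℝ ∞ (D.curv b i k) u :=
  (h.contDiffAt_coneDiff (h.T_smooth i k)).sub
    (ContDiffAt.sum fun j _ => (h.T_smooth i j).mul (h.T_smooth j k))

theorem contDiffAt_dTaut (h : D.IsRegularAt b u) (i : Fin n) :
    ContDiffAt ℝ ∞ (D.dTaut b i) u :=
  (contDiffAt_extDA (contDiffAt_algebraMap (h.z_smooth i))).add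
    (ContDiffAt.sum fun j _ => (h.z_smooth j).smul (h.T_smooth j i))

theorem contDiffAt_nilPart (h : D.IsRegularAt b u) : ContDiffAt ℝ ∞ (D.nilPart b) u := by
  refine (ContDiffAt.sum fun i _ => (h.contDiffAt_dTaut i).mul contDiffAt_const).sub
    (ContDiffAt.const_smul _ (ContDiffAt.sum fun i _ => ContDiffAt.sum fun k _ =>
      (h.contDiffAt_curv i k).mul contDiffAt_const))

theorem contDiffAt_halfSq (h : D.IsRegularAt b u) : ContDiffAt ℝ ∞ D.halfSq u :=
  contDiffAt_const.mul (ContDiffAt.sum fun i _ => (h.z_smooth i).pow 2)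

/-- The square of the cone differential vanishes. -/
theorem coneDiff_coneDiff (h : D.IsRegularAt b u) (hf : ContDiffAt ℝ ∞ f u) :
    D.coneDiff b (D.coneDiff b f) u = 0 := by
  have hfd : DifferentiableAt ℝ f u := hf.differentiableAt (by simp)
  have hc : ContDiffAt ℝ ∞ (fun v => contr (kapDual ι n) (f v)) u := contDiffAt_clm _ hf
  have hcd := hc.differentiableAt (by simp)
  have hom := h.om_smooth.differentiableAt (by simp)
  have h1 : extDA b (formGen n) (D.coneDiff b f) u =
      D.om u * extDA b (formGen n) (fun v => contr (kapDual ι n) (f v)) u := by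
    have := extDA_add (b := b) (ε := formGen n)
      ((contDiffAt_extDA (b := b) (ε := formGen n) hf).differentiableAt (by simp))
      (hom.mul hcd)
    refine this.trans ?_
    refine (congrArg₂ (· + ·) (extDA_extDA hf) (extDA_mul hom hcd)).trans ?_
    rw [h.om_closed, zero_mul, zero_add, zero_add, h.om_even.self_of_nhds]
  have h2 : contr (kapDual ι n) (D.coneDiff b f u) =
      -extDA b (formGen n) (fun v => contr (kapDual ι n) (f v)) u := by
    rw [coneDiff, map_add, contr_extDA (fun a => by simp [formGen]) hfd, contr_mul,
      contr_kapDual_of_mem h.om_form.self_of_nhds, zero_mul, contr_contr_self, mul_zero, add_zero,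
      add_zero]
  rw [coneDiff, h1, h2, mul_neg, add_neg_cancel]

theorem eventually_differentiableAt_T (h : D.IsRegularAt b u) :
    ∀ᶠ v in 𝓝 u, ∀ i j, DifferentiableAt ℝ (D.T i j) v := by
  simp only [Filter.eventually_all]
  exact fun i j => eventually_contDiffAt (h.T_smooth i j)

theorem eventually_coneDiff_T_mem (h : D.IsRegularAt b u) (i j : Fin n) :
    ∀ᶠ v in 𝓝 u, D.coneDiff b (D.T i j) v ∈ baseAlg ι n := by
  filter_upwards [h.eventually_differentiableAt_T, h.T_base.eventually_nhds, h.om_form]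
    with v h1 h2 h3
  exact add_mem (extDA_mem_baseAlg (h1 i j) (h2.mono fun w hw => hw i j))
    (mul_mem (formAlg_le_baseAlg h3) (contr_kapDual_mem_baseAlg (h2.self_of_nhds i j)))

theorem parity_coneDiff_T (h : D.IsRegularAt b u) (i j : Fin n) :
    parity (D.coneDiff b (D.T i j) u) = D.coneDiff b (D.T i j) u := by
  have h1 : extDA b (formGen n) (fun v => parity (D.T i j v)) u =
      -extDA b (formGen n) (D.T i j) u := by
    rw [← extDA_neg]
    exact extDA_congr (h.T_odd.mono fun v hv => hv i j)
  rw [coneDiff, map_add, parity_extDA (h.differentiableAt_T i j), h1, neg_neg, map_mul,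
    h.om_even.self_of_nhds, ← neg_neg (parity (contr _ _)), ← contr_parity,
    h.T_odd.self_of_nhds, map_neg, neg_neg]

theorem coneDiff_T_skew (h : D.IsRegularAt b u) (i j : Fin n) :
    D.coneDiff b (D.T j i) u = -D.coneDiff b (D.T i j) u := by
  have h1 : D.coneDiff b (D.T j i) u = D.coneDiff b (fun v => -D.T i j v) u :=
    coneDiff_congr (h.T_skew.mono fun v hv => hv i j)
  rw [h1, coneDiff, coneDiff, extDA_neg, map_neg, mul_neg, neg_add]

theorem parity_curv (h : D.IsRegularAt b u) (i k : Fin n) :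
    parity (D.curv b i k u) = D.curv b i k u := by
  simp only [curv, map_sub, map_sum, map_mul, h.parity_coneDiff_T, h.T_odd.self_of_nhds,
    neg_mul_neg]

theorem parity_dTaut (h : D.IsRegularAt b u) (i : Fin n) :
    parity (D.dTaut b i u) = -D.dTaut b i u := by
  have h1 : extDA b (formGen n) (fun v => parity (algebraMap ℝ (Alg ι n) (D.z i v))) u =
      extDA b (formGen n) (fun v => algebraMap ℝ (Alg ι n) (D.z i v)) u := by
    simp only [AlgHom.commutes]
  have h2 := (contDiffAt_algebraMap (G := Gen ι n) (h.z_smooth i)).differentiableAt (by simp)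
  simp only [dTaut, map_add, map_sum, map_smul, parity_extDA h2, h1, h.T_odd.self_of_nhds,
    neg_add, smul_neg, Finset.sum_neg_distrib]

theorem parity_nilPart (h : D.IsRegularAt b u) : parity (D.nilPart b u) = D.nilPart b u := by
  simp only [nilPart, map_sub, map_sum, map_smul, map_mul, h.parity_curv, h.parity_dTaut, parity_ι,
    neg_mul_neg]

/-- The derivation annihilates `½ |v|² + ∇v - (Q + κ S)`. -/
theorem der_halfSq_add_nilPart (h : D.IsRegularAt b u) :
    D.der b (fun v => algebraMap ℝ _ (D.halfSq v) + D.nilPart b v) u = 0 := by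
  have hc := h.derCoeff_even
  have hz : ∀ i, ContDiffAt ℝ ∞ (fun v => algebraMap ℝ (Alg ι n) (D.z i v)) u :=
    fun i => contDiffAt_algebraMap (h.z_smooth i)
  have hzd := fun i => (hz i).differentiableAt (by simp)
  have hTd := h.differentiableAt_T
  set X : Fin n → F → Alg ι n := fun i => extDA b (formGen n) fun v => algebraMap ℝ _ (D.z i v)
    with hX
  have hXd : ∀ i, DifferentiableAt ℝ (X i) u := fun i =>
    (contDiffAt_extDA (hz i)).differentiableAt (by simp)
  have hRd : ∀ i j, DifferentiableAt ℝ (D.coneDiff b (D.T i j)) u := fun i j =>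
    (h.contDiffAt_coneDiff (h.T_smooth i j)).differentiableAt (by simp)
  -- the derivatives of the building blocks
  have dz : ∀ i, D.der b (fun v => algebraMap ℝ _ (D.z i v)) u = X i u := by
    intro i
    rw [der_of_mem (f := fun v => algebraMap ℝ (Alg ι n) (D.z i v)) (algebraMap_mem _ _), coneDiff,
      contr_algebraMap, mul_zero, add_zero]
  have dX : ∀ i, D.der b (X i) u = 0 := by
    intro i
    have hm : X i u ∈ formAlg ι n :=
      extDA_mem_formAlg (hzd i) (Filter.Eventually.of_forall fun v => algebraMap_mem _ _)
    rw [der_of_mem (formAlg_le_baseAlg hm), coneDiff, contr_kapDual_of_mem hm, mul_zero, add_zero]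
    exact extDA_extDA (hz i)
  have dT : ∀ i j, D.der b (D.T i j) u = D.coneDiff b (D.T i j) u := fun i j =>
    der_of_mem (h.T_base.self_of_nhds i j)
  have dR : ∀ i j, D.der b (D.coneDiff b (D.T i j)) u = 0 := fun i j => by
    rw [der_of_mem (h.eventually_coneDiff_T_mem i j).self_of_nhds]
    exact h.coneDiff_coneDiff (h.T_smooth i j)
  have pz : ∀ i, parity (algebraMap ℝ (Alg ι n) (D.z i u)) = algebraMap ℝ _ (D.z i u) :=
    fun i => AlgHom.commutes _ _
  have pT := h.T_odd.self_of_nhds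
  have dzT : ∀ j i, D.der b (fun v => D.z j v • D.T j i v) u =
      X j u * D.T j i u + D.z j u • D.coneDiff b (D.T j i) u := by
    intro j i
    simp only [Algebra.smul_def]
    rw [der, delta_mul hc (hzd j) (hTd j i)]
    rw [show delta b (formGen n) D.derCoeff (derDual ι n)
      (fun v => algebraMap ℝ (Alg ι n) (D.z j v)) u = X j u from dz j,
      show delta b (formGen n) D.derCoeff (derDual ι n) (D.T j i) u = _ from dT j i, pz]
  have hzT : ∀ j i, DifferentiableAt ℝ (fun v => D.z j v • D.T j i v) u := fun j i =>
    (h.differentiableAt_z j).fun_smul (hTd j i)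
  have dY : ∀ i, D.der b (D.dTaut b i) u =
      ∑ j, (X j u * D.T j i u + D.z j u • D.coneDiff b (D.T j i) u) := by
    intro i
    have h1 : D.der b (D.dTaut b i) u = D.der b (fun v => X i v + ∑ j, D.z j v • D.T j i v) u := rfl
    rw [h1, der, delta_add (hXd i) (DifferentiableAt.fun_sum fun j _ => hzT j i),
      delta_sum fun j _ => hzT j i]
    rw [show delta b (formGen n) D.derCoeff (derDual ι n) (X i) u = 0 from dX i, zero_add]
    exact Finset.sum_congr rfl fun j _ => dzT j i
  have dTT : ∀ i j k, D.der b (fun v => D.T i j v * D.T j k v) u =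
      D.coneDiff b (D.T i j) u * D.T j k u - D.T i j u * D.coneDiff b (D.T j k) u := by
    intro i j k
    rw [der, delta_mul hc (hTd i j) (hTd j k), pT, neg_mul, ← sub_eq_add_neg]
    congr 2
    · exact dT i j
    · exact dT j k
  have dP : ∀ i k, D.der b (D.curv b i k) u =
      -∑ j, (D.coneDiff b (D.T i j) u * D.T j k u - D.T i j u * D.coneDiff b (D.T j k) u) := by
    intro i k
    have h1 : D.der b (D.curv b i k) u = D.der b (fun v => D.coneDiff b (D.T i k) v +
        -∑ j, D.T i j v * D.T j k v) u := by
      congr 1; funext v; exact sub_eq_add_neg _ _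
    rw [h1, der, delta_add (hRd i k)
      (DifferentiableAt.fun_neg (DifferentiableAt.fun_sum fun j _ => (hTd i j).fun_mul (hTd j k))),
      delta_neg, delta_sum fun j _ => (hTd i j).fun_mul (hTd j k)]
    rw [show delta b (formGen n) D.derCoeff (derDual ι n) (D.coneDiff b (D.T i k)) u = 0 from dR i k,
      zero_add]
    congr 1
    exact Finset.sum_congr rfl fun j _ => dTT i j k
  have hYd := fun i => (h.contDiffAt_dTaut i).differentiableAt (n := ∞) (by simp)
  have hPd := fun i k => (h.contDiffAt_curv i k).differentiableAt (n := ∞) (by simp)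
  have hed : ∀ i, DifferentiableAt ℝ (fun _ : F => fr ι (n := n) i) u := fun i =>
    differentiableAt_const _
  have dYe : ∀ i, D.der b (fun v => D.dTaut b i v * fr ι i) u =
      (∑ j, (X j u * D.T j i u + D.z j u • D.coneDiff b (D.T j i) u)) * fr ι i -
        (X i u + ∑ j, D.z j u • D.T j i u) *
          ((∑ j, D.T i j u * fr ι j) + algebraMap ℝ _ (D.z i u)) := by
    intro i
    rw [der, delta_mul hc (hYd i) (hed i), h.parity_dTaut, neg_mul, ← sub_eq_add_neg]
    congr 2
    · exact dY i
    · exact der_fr i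
  have dee : ∀ i k, D.der b (fun _ => fr ι i * fr ι k) u =
      ((∑ j, D.T i j u * fr ι j) + algebraMap ℝ _ (D.z i u)) * fr ι k -
        fr ι i * ((∑ j, D.T k j u * fr ι j) + algebraMap ℝ _ (D.z k u)) := by
    intro i k
    rw [der, delta_mul hc (hed i) (hed k), parity_ι, neg_mul, ← sub_eq_add_neg]
    congr 2
    · exact der_fr i
    · exact der_fr k
  have dPee : ∀ i k, D.der b (fun v => D.curv b i k v * (fr ι i * fr ι k)) u =
      -(∑ j, (D.coneDiff b (D.T i j) u * D.T j k u - D.T i j u * D.coneDiff b (D.T j k) u)) *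
        (fr ι i * fr ι k) + (D.coneDiff b (D.T i k) u - ∑ j, D.T i j u * D.T j k u) *
        (((∑ j, D.T i j u * fr ι j) + algebraMap ℝ _ (D.z i u)) * fr ι k -
        fr ι i * ((∑ j, D.T k j u * fr ι j) + algebraMap ℝ _ (D.z k u))) := by
    intro i k
    rw [der, delta_mul hc (hPd i k) (differentiableAt_const _), h.parity_curv]
    congr 2
    · exact dP i k
    · exact dee i k
  have ds : D.der b (fun v => algebraMap ℝ _ (D.halfSq v)) u = ∑ i, D.z i u • X i u := by
    have h1 : (fun v => algebraMap ℝ (Alg ι n) (D.halfSq v)) = fun v => (1 / 2 : ℝ) •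
        ∑ i, algebraMap ℝ (Alg ι n) (D.z i v) * algebraMap ℝ _ (D.z i v) := by
      funext v
      rw [halfSq, map_mul, ← Algebra.smul_def, map_sum]
      simp only [pow_two, map_mul]
    rw [h1, der, delta_const_smul _ (DifferentiableAt.fun_sum fun i _ => (hzd i).fun_mul (hzd i)),
      delta_sum fun i _ => (hzd i).fun_mul (hzd i), Finset.smul_sum]
    refine Finset.sum_congr rfl fun i _ => ?_
    rw [delta_mul hc (hzd i) (hzd i), pz,
      show delta b (formGen n) D.derCoeff (derDual ι n)
        (fun v => algebraMap ℝ (Alg ι n) (D.z i v)) u = X i u from dz i, ← Algebra.commutes,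
      ← Algebra.smul_def]
    module
  have hYe := fun i => (hYd i).fun_mul (hed i)
  have hPe := fun i k => (hPd i k).fun_mul (differentiableAt_const (fr ι i * fr ι k))
  have h1 : D.der b (fun v => algebraMap ℝ _ (D.halfSq v) + D.nilPart b v) u =
      D.der b (fun v => algebraMap ℝ _ (D.halfSq v) + ((∑ i, D.dTaut b i v * fr ι i) +
        (-(1 / 2 : ℝ)) • ∑ i, ∑ k, D.curv b i k v * (fr ι i * fr ι k))) u := by
    congr 1; funext v; rw [nilPart, neg_smul, ← sub_eq_add_neg]
  have hd1 := DifferentiableAt.fun_sum (u := Finset.univ) fun i _ => hYe i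
  have hd2 := DifferentiableAt.fun_sum (u := Finset.univ) fun i _ =>
    DifferentiableAt.fun_sum (u := Finset.univ) fun k _ => hPe i k
  rw [h1, der, delta_add ((contDiffAt_algebraMap (G := Gen ι n)
    h.contDiffAt_halfSq).differentiableAt (by simp))
    (hd1.fun_add (hd2.fun_const_smul _)), delta_add hd1 (hd2.fun_const_smul _),
    delta_const_smul _ hd2, delta_sum fun i _ => hYe i,
    delta_sum fun i _ => DifferentiableAt.fun_sum (u := Finset.univ) fun k _ => hPe i k]
  have h3 : ∀ i, delta b (formGen n) D.derCoeff (derDual ι n)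
      (fun v => ∑ k, D.curv b i k v * (fr ι i * fr ι k)) u = _ := fun i =>
    delta_sum fun k _ => hPe i k
  rw [Finset.sum_congr rfl fun i _ => dYe i, Finset.sum_congr rfl fun i _ =>
    (h3 i).trans (Finset.sum_congr rfl fun k _ => dPee i k)]
  rw [show delta b (formGen n) D.derCoeff (derDual ι n)
    (fun v => algebraMap ℝ (Alg ι n) (D.halfSq v)) u = _ from ds]
  have key := bianchi_sum (T := fun i j => D.T i j u) (R := fun i j => D.coneDiff b (D.T i j) u)
    (X := fun i => X i u) (e := fun i => fr ι i) (z := fun i => D.z i u) pT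
    h.parity_coneDiff_T (fun i => parity_ι _) h.T_skew.self_of_nhds h.coneDiff_T_skew
  rw [← key]
  module

/-- The Berezin integral intertwines the derivation and the cone differential. The contribution of
the connection is the trace of `T`, which vanishes since `T` is skew-symmetric. -/
theorem berez_der (h : D.IsRegularAt b u) (hf : DifferentiableAt ℝ f u) :
    berez ι n (D.der b f u) = D.coneDiff b (fun v => berez ι n (f v)) u := by
  have hT := h.T_base.self_of_nhds
  have hdiag : ∀ i, D.T i i u = 0 := fun i => eq_zero_of_eq_neg (h.T_skew.self_of_nhds i i)
  have hsum : ∑ i, berez ι n (((∑ j, D.T i j u * fr ι j) + algebraMap ℝ _ (D.z i u)) *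
      contr (frameDual ι i) (f u)) = 0 := by
    refine Finset.sum_eq_zero fun i _ => ?_
    rw [add_mul, map_add, ← Algebra.smul_def, map_smul, berez_contr_frame, smul_zero, add_zero,
      Finset.sum_mul, map_sum]
    refine Finset.sum_eq_zero fun j _ => ?_
    rw [mul_assoc, berez_mul_of_mem (hT i j), berez_frame_mul_contr]
    split_ifs with hij
    · rw [← hij, hdiag, zero_mul]
    · rw [mul_zero]
  have hk : (kapDual ι n) ∘ₗ killFrame ι n = kapDual ι n := LinearMap.ext fun v => rfl
  rw [der_eq, map_add, map_sum, hsum, add_zero, coneDiff, coneDiff, map_add, berez_extDA hf,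
    berez_mul_of_mem (formAlg_le_baseAlg h.om_form.self_of_nhds), berez_contr hk]

/-- The Berezin integral of the exponential is closed. -/
theorem coneDiff_berez_exp (h : D.IsRegularAt b u) {K : ℕ} (hK : D.nilPart b u ^ K = 0) :
    D.coneDiff b (fun v => berez ι n (Real.exp (-D.halfSq v) •
      ∑ i ∈ Finset.range (K + 1), (i.factorial : ℝ)⁻¹ • (-D.nilPart b v) ^ i)) u = 0 := by
  have hs := h.contDiffAt_halfSq.differentiableAt (n := ∞) (by simp)
  have hN := h.contDiffAt_nilPart.differentiableAt (n := ∞) (by simp)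
  rw [← h.berez_der, der, delta_exp h.derCoeff_even (s := fun v => -D.halfSq v)
    (N := fun v => -D.nilPart b v) hs.fun_neg hN.fun_neg (by rw [map_neg, h.parity_nilPart])
    (by rw [neg_pow, hK, mul_zero]), map_zero]
  · have := h.der_halfSq_add_nilPart
    simp only [map_neg]
    have h2 := delta_neg (b := b) (ε := formGen n) (c := D.derCoeff) (d := derDual ι n) (u := u)
      (f := fun v => algebraMap ℝ _ (D.halfSq v) + D.nilPart b v)
    simp only [neg_add] at h2
    rw [h2]
    exact neg_eq_zero.2 this
  · exact hs.fun_neg.exp.fun_smul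
      (DifferentiableAt.fun_sum fun i _ => (hN.fun_neg.fun_pow i).fun_const_smul _)

end IsRegularAt

end LocalData

end LocalData

/-! ### Local expressions of forms on the total space -/

section RealizeInjective

variable {F ι : Type*} [NormedAddCommGroup F] [NormedSpace ℝ F] [Fintype ι] [DecidableEq ι] {n : ℕ}
  (b : Module.Basis ι ℝ F)

/-- The realization of continuous alternating maps on a space with a basis. -/
noncomputable def realizeC (n k : ℕ) : (F [⋀^Fin k]→L[ℝ] ℝ) →ₗ[ℝ] Alg ι n where
  toFun a := realizeR b (formGen n) k a.toAlternatingMap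
  map_add' a a' := map_add (realizeR b (formGen n) k) a.toAlternatingMap a'.toAlternatingMap
  map_smul' r a := map_smul (realizeR b (formGen n) k) r a.toAlternatingMap

theorem realizeC_apply {k : ℕ} (a : F [⋀^Fin k]→L[ℝ] ℝ) :
    realizeC b n k a = realizeR b (formGen n) k a.toAlternatingMap := rfl

/-- The values of a form on a basis are determined by its realization. -/
theorem realizeC_injective (k : ℕ) : Function.Injective (realizeC b n k) := by
  rw [← LinearMap.ker_eq_bot, LinearMap.ker_eq_bot']
  intro a ha
  ext v
  have h := detForm_realizeR b (formGen n)
    (fun i => ∑ c, b.coord c (v i) • (LinearMap.proj (Sum.inl c) : Module.Dual ℝ (Gen ι n)))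
    a.toAlternatingMap
  rw [← realizeC_apply, ha, map_zero] at h
  have h2 : (fun i => ∑ j, (∑ c, b.coord c (v i) • (LinearMap.proj (Sum.inl c) :
      Module.Dual ℝ (Gen ι n))) (formGen n j) • b j) = v := by
    funext i
    conv_rhs => rw [← b.sum_repr (v i)]
    refine Finset.sum_congr rfl fun j _ => ?_
    congr 1
    rw [LinearMap.sum_apply, Finset.sum_eq_single j]
    · simp [formGen]
    · intro c _ hc
      simp [formGen, hc]
    · simp
  rw [h2] at h
  exact h.symm

theorem finiteDimensional_alternating {F ι : Type*} [NormedAddCommGroup F] [NormedSpace ℝ F]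
    [Fintype ι] [DecidableEq ι] (b : Module.Basis ι ℝ F) (k : ℕ) :
    FiniteDimensional ℝ (F [⋀^Fin k]→L[ℝ] ℝ) :=
  Module.Finite.of_injective (realizeC b 0 k) (realizeC_injective b k)

/-- A continuous left inverse of the realization, by which differentiability and smoothness of a
form may be tested on its realization. -/
theorem exists_clm_realizeC (k : ℕ) : ∃ L : Alg ι n →L[ℝ] (F [⋀^Fin k]→L[ℝ] ℝ),
    ∀ a, L (realizeC b n k a) = a := by
  obtain ⟨L, hL⟩ := LinearMap.exists_leftInverse_of_injective (realizeC b n k)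
    (LinearMap.ker_eq_bot.2 (realizeC_injective b k))
  exact ⟨LinearMap.toContinuousLinearMap L, fun a => LinearMap.congr_fun hL a⟩

/-- Realization turns the exterior derivative of forms into that of functions with values in the
algebra. -/
theorem realizeC_extDeriv {k : ℕ} {f : F → F [⋀^Fin k]→L[ℝ] ℝ} {u : F}
    (hf : DifferentiableAt ℝ (fun v => realizeC b n k (f v)) u) :
    DifferentiableAt ℝ f u ∧
      realizeC b n (k + 1) (extDeriv f u) =
        extDA b (formGen n) (fun v => realizeC b n k (f v)) u := by
  have : FiniteDimensional ℝ F := b.finiteDimensional_of_finite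
  have := finiteDimensional_alternating b k
  obtain ⟨L, hL⟩ := exists_clm_realizeC (n := n) b k
  have h1 : DifferentiableAt ℝ f u := by
    have := L.differentiableAt.comp u hf
    simpa only [Function.comp_def, hL] using this
  refine ⟨h1, ?_⟩
  have h2 : fderiv ℝ (fun v => realizeC b n k (f v)) u =
      (LinearMap.toContinuousLinearMap (realizeC b n k)).comp (fderiv ℝ f u) :=
    ((LinearMap.toContinuousLinearMap (realizeC b n k)).hasFDerivAt.comp u h1.hasFDerivAt).fderiv
  rw [extDA, h2]
  have h3 := realize_alternatizeUncurryFin b (formGen n) (Algebra.linearMap ℝ (Alg ι n))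
    ((ContinuousAlternatingMap.toAlternatingMapLinear (R := ℝ) (A := ℝ)).comp
      (fderiv ℝ f u).toLinearMap)
  rw [realizeC_apply, extDeriv]
  rw [ContinuousAlternatingMap.toAlternatingMap_alternatizeUncurryFin]
  exact h3

end RealizeInjective

section RealForms

variable {T ι : Type*} [AddCommGroup T] [Module ℝ T] [Fintype ι] [DecidableEq ι] {n : ℕ}

theorem realizeR_mem_formAlg (b : ι → T) {k : ℕ} (a : T [⋀^Fin k]→ₗ[ℝ] ℝ) :
    realizeR b (formGen n) k a ∈ formAlg ι n := by
  rw [realizeR, realize_apply]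
  refine Subalgebra.smul_mem _ (Subalgebra.sum_mem _ fun (J : Fin k → ι) _ =>
    mul_mem ?_ (Subalgebra.algebraMap_mem _ _)) _
  rw [ExteriorAlgebra.ιMulti_apply]
  exact list_prod_mem fun x hx => by
    obtain ⟨i, rfl⟩ := List.mem_ofFn.1 hx
    exact dx_mem_formAlg _

theorem parity_realizeR {G : Type*} [AddCommGroup G] [Module ℝ G] (b : ι → T) (ε : ι → G) {k : ℕ}
    (a : T [⋀^Fin k]→ₗ[ℝ] ℝ) :
    parity (realizeR b ε k a) = (-1 : ℝ) ^ k • realizeR b ε k a := by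
  rw [realizeR, realize_apply, map_smul, map_sum (parity (G := G)), smul_comm]
  congr 1
  rw [Finset.smul_sum]
  refine Finset.sum_congr rfl fun (J : Fin k → ι) _ => ?_
  rw [map_mul, parity_ιMulti, smul_mul_assoc]
  refine congrArg _ (congrArg _ ?_)
  exact AlgHom.commutes _ _

end RealForms

section TotalSpace

variable {EM H M : Type*} [NormedAddCommGroup EM] [NormedSpace ℝ EM] [FiniteDimensional ℝ EM]
  [TopologicalSpace H] (I : ModelWithCorners ℝ EM H) [TopologicalSpace M] [ChartedSpace H M]
  {n : ℕ} {V : M → Type*} [TopologicalSpace (TotalSpace (EuclideanSpace ℝ (Fin n)) V)]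
  [∀ x, NormedAddCommGroup (V x)] [∀ x, InnerProductSpace ℝ (V x)]
  [FiberBundle (EuclideanSpace ℝ (Fin n)) V] [VectorBundle ℝ (EuclideanSpace ℝ (Fin n)) V]

variable (EM n) in
/-- The index type of the coordinates of the total space. -/
abbrev Idx : Type := Fin (Module.finrank ℝ EM) ⊕ Fin n

variable (EM n) in
/-- The basis of the model space of the total space. -/
noncomputable def coordBasis : Module.Basis (Idx EM n) ℝ (EM × EuclideanSpace ℝ (Fin n)) :=
  (Module.finBasis ℝ EM).prod (EuclideanSpace.basisFun (Fin n) ℝ).toBasis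

/-- The point of the total space with coordinates `u` in the chart at `p₀`. -/
noncomputable abbrev pt (p₀ : Tot n V) (u : EM × EuclideanSpace ℝ (Fin n)) : Tot n V :=
  (extChartAt (totI I n) p₀).symm u

/-- The coordinate frame of the chart at `p₀`. -/
noncomputable def coordFrame (p₀ : Tot n V) (u : EM × EuclideanSpace ℝ (Fin n)) (a : Idx EM n) :
    TangentSpace (totI I n) (pt I p₀ u) :=
  mfderiv 𝓘(ℝ, EM × EuclideanSpace ℝ (Fin n)) (totI I n) (extChartAt (totI I n) p₀).symm u
    (coordBasis EM n a)

/-- A real-valued form on the total space, in the chart at `p₀` and seen in the algebra. -/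
noncomputable def loc (p₀ : Tot n V) {k : ℕ} (α : DForm (totI I n) (Tot n V) k)
    (u : EM × EuclideanSpace ℝ (Fin n)) : Alg (Idx EM n) n :=
  realizeR (coordFrame I p₀ u) (formGen n) k (α (pt I p₀ u)).toAlternatingMap

theorem loc_eq (p₀ : Tot n V) {k : ℕ} (α : DForm (totI I n) (Tot n V) k)
    (u : EM × EuclideanSpace ℝ (Fin n)) :
    loc I p₀ α u = realizeC (coordBasis EM n) n k (inChart (totI I n) α p₀ u) := rfl

variable {I}

theorem mem_target_iff {p₀ : Tot n V} {u : EM × EuclideanSpace ℝ (Fin n)} :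
    u ∈ (extChartAt (totI I n) p₀).target ↔ u.1 ∈ (extChartAt I p₀.proj).target ∧
      (extChartAt I p₀.proj).symm u.1 ∈ frameSet n V p₀.proj := by
  rw [FiberBundle.extChartAt_target]
  simp

theorem proj_pt {p₀ : Tot n V} {u : EM × EuclideanSpace ℝ (Fin n)}
    (hu : u ∈ (extChartAt (totI I n) p₀).target) :
    (pt I p₀ u).proj = (extChartAt I p₀.proj).symm u.1 := by
  rw [pt, FiberBundle.extChartAt]
  refine Trivialization.proj_symm_apply _ ?_
  rw [Trivialization.mem_target]
  exact (mem_target_iff.1 hu).2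

variable [I.Boundaryless] [IsManifold I ∞ M]
  [ContMDiffVectorBundle ∞ (EuclideanSpace ℝ (Fin n)) V I]

theorem loc_extD {p₀ : Tot n V} {k : ℕ} (α : DForm (totI I n) (Tot n V) k)
    {u : EM × EuclideanSpace ℝ (Fin n)} (hu : u ∈ (extChartAt (totI I n) p₀).target)
    (hα : DifferentiableAt ℝ (loc I p₀ α) u) :
    loc I p₀ (extD (totI I n) α) u = extDA (coordBasis EM n) (formGen n) (loc I p₀ α) u := by
  obtain ⟨h1, h2⟩ := realizeC_extDeriv (n := n) (coordBasis EM n)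
    (f := inChart (totI I n) α p₀) hα
  rw [loc_eq, inChart_extD α hu h1, h2]
  rfl

theorem eq_zero_of_loc {k : ℕ} (α : DForm (totI I n) (Tot n V) k) (p : Tot n V)
    (h : loc I p α (extChartAt (totI I n) p p) = 0) : α p = 0 := by
  have : IsManifold (totI I n) 1 (Tot n V) := IsManifold.of_le (n := ∞) (by norm_cast)
  refine eq_zero_of_inChart α p (realizeC_injective (n := n) (coordBasis EM n) k ?_)
  rw [map_zero]
  exact h

theorem isSmoothForm_of_loc {k : ℕ} (α : DForm (totI I n) (Tot n V) k)
    (h : ∀ (p₀ : Tot n V), ∀ u ∈ (extChartAt (totI I n) p₀).target,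
      ContDiffAt ℝ ∞ (loc I p₀ α) u) : IsSmoothForm (totI I n) α := by
  intro p₀ u hu
  obtain ⟨L, hL⟩ := exists_clm_realizeC (n := n) (coordBasis EM n) k
  have h1 := L.contDiff.contDiffAt.comp u (h p₀ u hu)
  have h2 : inChart (totI I n) α p₀ = L ∘ loc I p₀ α := by
    funext v
    exact (hL _).symm
  rw [h2]
  exact h1.contDiffWithinAt

theorem contMDiffAt_pt {p₀ : Tot n V} {u : EM × EuclideanSpace ℝ (Fin n)}
    (hu : u ∈ (extChartAt (totI I n) p₀).target) :
    ContMDiffAt 𝓘(ℝ, EM × EuclideanSpace ℝ (Fin n)) (totI I n) ∞ (pt I p₀) u :=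
  contMDiffAt_extChartAt_symm hu

theorem contMDiffAt_proj_pt {p₀ : Tot n V} {u : EM × EuclideanSpace ℝ (Fin n)}
    (hu : u ∈ (extChartAt (totI I n) p₀).target) :
    ContMDiffAt 𝓘(ℝ, EM × EuclideanSpace ℝ (Fin n)) I ∞ (fun v => (pt I p₀ v).proj) u :=
  ContMDiffAt.comp u (Bundle.contMDiff_proj V).contMDiffAt (contMDiffAt_pt hu)

theorem eventually_mem_target {p₀ : Tot n V} {u : EM × EuclideanSpace ℝ (Fin n)}
    (hu : u ∈ (extChartAt (totI I n) p₀).target) :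
    ∀ᶠ v in 𝓝 u, v ∈ (extChartAt (totI I n) p₀).target :=
  extChartAt_target_mem_nhds_of_mem hu

/-- The differential of the projection, in coordinates. -/
theorem dProj_mfderiv {p₀ : Tot n V} {u : EM × EuclideanSpace ℝ (Fin n)}
    (hu : u ∈ (extChartAt (totI I n) p₀).target) (w : EM × EuclideanSpace ℝ (Fin n)) :
    dProj I (pt I p₀ u) (mfderiv 𝓘(ℝ, EM × EuclideanSpace ℝ (Fin n)) (totI I n)
      (extChartAt (totI I n) p₀).symm u w) =
    mfderiv 𝓘(ℝ, EM × EuclideanSpace ℝ (Fin n)) I (fun v => (pt I p₀ v).proj) u w := by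
  have h1 := mfderiv_comp u ((Bundle.contMDiff_proj (n := ∞) (IB := I)
    (F := EuclideanSpace ℝ (Fin n)) V).contMDiffAt.mdifferentiableAt (by simp))
    ((contMDiffAt_pt (V := V) hu).mdifferentiableAt (by simp))
  exact (DFunLike.congr_fun h1 w).symm

theorem mfderiv_proj_pt {p₀ : Tot n V} {u : EM × EuclideanSpace ℝ (Fin n)}
    (hu : u ∈ (extChartAt (totI I n) p₀).target) (w : EM × EuclideanSpace ℝ (Fin n)) :
    (mfderiv 𝓘(ℝ, EM × EuclideanSpace ℝ (Fin n)) I (fun v => (pt I p₀ v).proj) u w : EM) =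
      (mfderiv 𝓘(ℝ, EM) I (extChartAt I p₀.proj).symm u.1 w.1 : EM) := by
  have : IsManifold I 1 M := IsManifold.of_le (n := ∞) (by norm_cast)
  have h1 : (fun v => (pt I p₀ v).proj) =ᶠ[𝓝 u] (extChartAt I p₀.proj).symm ∘ Prod.fst := by
    filter_upwards [eventually_mem_target hu] with v hv
    exact proj_pt hv
  have h2 := h1.mfderiv_eq (I := 𝓘(ℝ, EM × EuclideanSpace ℝ (Fin n))) (I' := I)
  have h3 := mfderiv_comp (I := 𝓘(ℝ, EM × EuclideanSpace ℝ (Fin n))) (I' := 𝓘(ℝ, EM)) (I'' := I) u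
    (mdifferentiableAt_extChartAt_symm (mem_target_iff.1 hu).1)
    (f := (Prod.fst : EM × EuclideanSpace ℝ (Fin n) → EM))
    differentiableAt_fst.mdifferentiableAt
  have h4 : (mfderiv 𝓘(ℝ, EM × EuclideanSpace ℝ (Fin n)) 𝓘(ℝ, EM)
    (Prod.fst : EM × EuclideanSpace ℝ (Fin n) → EM) u) w = w.1 := by
    rw [mfderiv_eq_fderiv]
    exact DFunLike.congr_fun (fderiv_fst) w
  have h5 := DFunLike.congr_fun h2 w
  have h6 := DFunLike.congr_fun h3 w
  refine h5.trans (h6.trans ?_)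
  exact congrArg (mfderiv 𝓘(ℝ, EM) I (extChartAt I p₀.proj).symm u.1 : EM →L[ℝ] EM) h4

/-- The local expression of the pullback of a form on the base. -/
theorem inChart_pullForm {p₀ : Tot n V} {k : ℕ} (α : DForm I M k)
    {u : EM × EuclideanSpace ℝ (Fin n)} (hu : u ∈ (extChartAt (totI I n) p₀).target) :
    inChart (totI I n) (pullForm I α) p₀ u = (inChart I α p₀.proj u.1).compContinuousLinearMap
      (ContinuousLinearMap.fst ℝ EM (EuclideanSpace ℝ (Fin n))) := by
  ext v
  have h1 : ∀ (x y : M) (_ : x = y) (w : Fin k → EM), α x w = α y w := by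
    rintro x _ rfl w
    rfl
  refine Eq.trans ?_ (h1 _ _ (proj_pt hu) _)
  refine congrArg (α (pt I p₀ u).proj) (funext fun i => ?_)
  exact (dProj_mfderiv hu (v i)).trans (mfderiv_proj_pt hu (v i))

theorem contDiffAt_inChart {k : ℕ} {α : DForm I M k} (hα : IsSmoothForm I α) {x₀ : M} {u : EM}
    (hu : u ∈ (extChartAt I x₀).target) : ContDiffAt ℝ ∞ (inChart I α x₀) u :=
  (hα x₀ u hu).contDiffAt (extChartAt_target_mem_nhds_of_mem hu)

theorem contDiffAt_loc_pullForm {p₀ : Tot n V} {k : ℕ} {α : DForm I M k}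
    (hα : IsSmoothForm I α) {u : EM × EuclideanSpace ℝ (Fin n)}
    (hu : u ∈ (extChartAt (totI I n) p₀).target) :
    ContDiffAt ℝ ∞ (loc I p₀ (pullForm I α)) u := by
  have := finiteDimensional_alternating (Module.finBasis ℝ EM) k
  have h2 : loc I p₀ (pullForm I α) =ᶠ[𝓝 u] fun v =>
      LinearMap.toContinuousLinearMap (((realizeC (coordBasis EM n) n k)).comp
        (ContinuousAlternatingMap.compContinuousLinearMapₗ
          (ContinuousLinearMap.fst ℝ EM (EuclideanSpace ℝ (Fin n)))))
        (inChart I α p₀.proj v.1) := by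
    filter_upwards [eventually_mem_target hu] with v hv
    rw [loc_eq, inChart_pullForm α hv]
    rfl
  refine ContDiffAt.congr_of_eventuallyEq ?_ h2
  exact ContDiffAt.comp u (ContinuousLinearMap.contDiff _).contDiffAt
    ((contDiffAt_inChart hα (mem_target_iff.1 hu).1).comp u contDiffAt_fst)

/-- The pullback of a closed form is closed. -/
theorem extDA_loc_pullForm {p₀ : Tot n V} {k : ℕ} {α : DForm I M k}
    (hα : IsSmoothForm I α) (hd : extD I α = 0) {u : EM × EuclideanSpace ℝ (Fin n)}
    (hu : u ∈ (extChartAt (totI I n) p₀).target) :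
    extDA (coordBasis EM n) (formGen n) (loc I p₀ (pullForm I α)) u = 0 := by
  have h0 := (mem_target_iff.1 hu).1
  have h1 := (contDiffAt_loc_pullForm (n := n) (V := V) hα hu).differentiableAt (by simp)
  obtain ⟨h2, h3⟩ := realizeC_extDeriv (n := n) (coordBasis EM n)
    (f := inChart (totI I n) (pullForm I α) p₀) h1
  refine Eq.trans h3.symm ?_
  have h4 : inChart (totI I n) (pullForm I α) p₀ =ᶠ[𝓝 u] fun v =>
      (inChart I α p₀.proj v.1).compContinuousLinearMap
        (ContinuousLinearMap.fst ℝ EM (EuclideanSpace ℝ (Fin n))) := by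
    filter_upwards [eventually_mem_target hu] with v hv using inChart_pullForm α hv
  have h5 := (contDiffAt_inChart hα h0).differentiableAt (by simp)
  have h6 : extDeriv (inChart I α p₀.proj) u.1 = 0 := by
    rw [← inChart_extD α h0 h5, hd]
    rfl
  have h7 := extDeriv_pullback (x := u) (f := (Prod.fst : EM × EuclideanSpace ℝ (Fin n) → EM)) h5
    (contDiffAt_fst (n := ∞)) (by rw [minSmoothness_of_isRCLikeNormedField]; norm_cast)
  simp only [fderiv_fst] at h7
  rw [h4.extDeriv_eq, h7, h6]
  exact map_zero (realizeC (coordBasis EM n) n (k + 1))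

end TotalSpace

/-! ### Local expressions of sections and connections -/

theorem extDA_algebraMap {F G ι : Type*} [NormedAddCommGroup F] [NormedSpace ℝ F] [AddCommGroup G]
    [Module ℝ G] [FiniteDimensional ℝ G] [Fintype ι] {b : ι → F} {ε : ι → G} {h : F → ℝ} {u : F}
    (hh : DifferentiableAt ℝ h u) :
    extDA b ε (fun v => algebraMap ℝ (ExteriorAlgebra ℝ G) (h v)) u =
      ∑ a, ExteriorAlgebra.ι ℝ (ε a) * algebraMap ℝ _ (fderiv ℝ h u (b a)) := by
  have h1 : fderiv ℝ (fun v => algebraMap ℝ (ExteriorAlgebra ℝ G) (h v)) u =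
      (algebraMapCLM ℝ (ExteriorAlgebra ℝ G)).comp (fderiv ℝ h u) :=
    ((algebraMapCLM ℝ (ExteriorAlgebra ℝ G)).hasFDerivAt.comp u hh.hasFDerivAt).fderiv
  rw [extDA, h1]
  rfl

theorem contMDiff_constField {E : Type*} [NormedAddCommGroup E] [NormedSpace ℝ E] (w : E) :
    ContMDiff 𝓘(ℝ, E) 𝓘(ℝ, E).tangent ∞ (fun v => (⟨v, w⟩ : TangentBundle 𝓘(ℝ, E) E)) :=
  fun _ => contMDiffAt_vectorSpace_iff_contDiffAt.2 contDiffAt_const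

section Sections

variable {EM H M : Type*} [NormedAddCommGroup EM] [NormedSpace ℝ EM] [FiniteDimensional ℝ EM]
  [TopologicalSpace H] {I : ModelWithCorners ℝ EM H} [TopologicalSpace M] [ChartedSpace H M]
  {n : ℕ} {V : M → Type*} [TopologicalSpace (TotalSpace (EuclideanSpace ℝ (Fin n)) V)]
  [∀ x, NormedAddCommGroup (V x)] [∀ x, InnerProductSpace ℝ (V x)]
  [FiberBundle (EuclideanSpace ℝ (Fin n)) V] [VectorBundle ℝ (EuclideanSpace ℝ (Fin n)) V]

variable (I n) in
/-- Smoothness of a section of the bundle at a point. -/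
abbrev SmoothSectionAt (σ : ∀ x, V x) (x : M) : Prop :=
  ContMDiffAt I (I.prod 𝓘(ℝ, EuclideanSpace ℝ (Fin n))) ∞
    (fun y => TotalSpace.mk' (EuclideanSpace ℝ (Fin n)) y (σ y)) x

variable (I) in
/-- The real-valued `1`-form `g(τ, ∇σ)` on the total space, for sections `σ`, `τ` of the bundle. -/
noncomputable def covForm (cov : CovariantDerivative I (EuclideanSpace ℝ (Fin n)) V)
    (σ τ : ∀ x, V x) : DForm (totI I n) (Tot n V) 1 := fun q =>
  toCont ((innerSL ℝ (τ q.proj)).toLinearMap.compAlternatingMap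
    (AlternatingMap.ofSubsingleton ℝ _ _ (0 : Fin 1)
      ((cov σ q.proj).comp (dProj I q)).toLinearMap))

theorem loc_covForm (cov : CovariantDerivative I (EuclideanSpace ℝ (Fin n)) V) (σ τ : ∀ x, V x)
    (p₀ : Tot n V) (u : EM × EuclideanSpace ℝ (Fin n)) :
    loc I p₀ (covForm I cov σ τ) u = ∑ a, dx n a * algebraMap ℝ _
      (inner ℝ (τ (pt I p₀ u).proj)
        (cov σ (pt I p₀ u).proj (dProj I (pt I p₀ u) (coordFrame I p₀ u a)))) := by
  rw [loc, realizeR, realize_one_form]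
  rfl

variable [I.Boundaryless] [IsManifold I ∞ M]
  [ContMDiffVectorBundle ∞ (EuclideanSpace ℝ (Fin n)) V I] {p₀ : Tot n V}
  {u : EM × EuclideanSpace ℝ (Fin n)}

theorem contMDiffAt_section_pt {σ : ∀ x, V x} (hu : u ∈ (extChartAt (totI I n) p₀).target)
    (hσ : SmoothSectionAt I n σ (pt I p₀ u).proj) :
    ContMDiffAt 𝓘(ℝ, EM × EuclideanSpace ℝ (Fin n)) (I.prod 𝓘(ℝ, EuclideanSpace ℝ (Fin n))) ∞
      (fun v => TotalSpace.mk' (EuclideanSpace ℝ (Fin n)) (pt I p₀ v).proj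
        (σ (pt I p₀ v).proj)) u :=
  ContMDiffAt.comp u hσ (contMDiffAt_proj_pt hu)

/-- The coordinate vector fields, projected to the base, are smooth. -/
theorem contMDiffAt_dProj_coordFrame (hu : u ∈ (extChartAt (totI I n) p₀).target)
    (a : Idx EM n) :
    ContMDiffAt 𝓘(ℝ, EM × EuclideanSpace ℝ (Fin n)) (I.prod 𝓘(ℝ, EM)) ∞
      (fun v => TotalSpace.mk' EM (E := TangentSpace I) (pt I p₀ v).proj
        (dProj I (pt I p₀ v) (coordFrame I p₀ v a))) u := by
  have ho : IsOpen (extChartAt (totI I n) p₀).target := isOpen_extChartAt_target p₀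
  have h1 : ContMDiffOn 𝓘(ℝ, EM × EuclideanSpace ℝ (Fin n)) I ∞ (fun v => (pt I p₀ v).proj)
      (extChartAt (totI I n) p₀).target := fun v hv => (contMDiffAt_proj_pt hv).contMDiffWithinAt
  have h2 := h1.contMDiffOn_tangentMapWithin (m := ∞) (by norm_cast) ho.uniqueMDiffOn
  have h3 := contMDiff_constField (coordBasis EM n a)
  have h4 := (h2 ⟨u, coordBasis EM n a⟩ hu).contMDiffAt
    ((ho.preimage (FiberBundle.continuous_proj _ _)).mem_nhds hu)
  have h5 := ContMDiffAt.comp u h4 (h3 u)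
  refine h5.congr_of_eventuallyEq ?_
  filter_upwards [eventually_mem_target hu] with v hv
  simp only [Function.comp_apply, tangentMapWithin]
  congr 1
  rw [mfderivWithin_of_isOpen ho hv]
  exact dProj_mfderiv hv _

variable [IsContMDiffRiemannianBundle I ∞ (EuclideanSpace ℝ (Fin n)) V]

theorem contDiffAt_inner_pt {σ τ : ∀ x, V x} (hu : u ∈ (extChartAt (totI I n) p₀).target)
    (hσ : SmoothSectionAt I n σ (pt I p₀ u).proj) (hτ : SmoothSectionAt I n τ (pt I p₀ u).proj) :
    ContDiffAt ℝ ∞ (fun v => inner ℝ (σ (pt I p₀ v).proj) (τ (pt I p₀ v).proj)) u :=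
  (ContMDiffAt.inner_bundle (contMDiffAt_section_pt hu hσ)
    (contMDiffAt_section_pt hu hτ)).contDiffAt

theorem contDiffAt_inner_snd {σ : ∀ x, V x} (hu : u ∈ (extChartAt (totI I n) p₀).target)
    (hσ : SmoothSectionAt I n σ (pt I p₀ u).proj) :
    ContDiffAt ℝ ∞ (fun v => inner ℝ (σ (pt I p₀ v).proj) (pt I p₀ v).2) u :=
  (ContMDiffAt.inner_bundle (contMDiffAt_section_pt hu hσ) (contMDiffAt_pt hu)).contDiffAt

/-- The connection form in a smooth local frame is smooth. -/
theorem contDiffAt_loc_covForm [T2Space M]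
    {cov : CovariantDerivative I (EuclideanSpace ℝ (Fin n)) V}
    (hcov : CovariantDerivative.ContMDiffCovariantDerivative cov ∞) {σ τ : ∀ x, V x}
    (hu : u ∈ (extChartAt (totI I n) p₀).target) {s : Set M} (hs : IsOpen s)
    (hus : (pt I p₀ u).proj ∈ s) (hσ : ∀ x ∈ s, SmoothSectionAt I n σ x)
    (hτ : SmoothSectionAt I n τ (pt I p₀ u).proj) :
    ContDiffAt ℝ ∞ (loc I p₀ (covForm I cov σ τ)) u := by
  have h0 : loc I p₀ (covForm I cov σ τ) = _ := funext fun v => loc_covForm cov σ τ p₀ v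
  rw [h0]
  refine ContDiffAt.sum fun a _ => contDiffAt_const.mul (contDiffAt_algebraMap ?_)
  have h1 := contMDiffAt_cov hcov hs (fun x hx => (hσ x hx).contMDiffWithinAt) hus
  have h2 := ContMDiffAt.comp u h1 (contMDiffAt_proj_pt hu)
  exact (ContMDiffAt.inner_bundle (contMDiffAt_section_pt hu hτ)
    (ContMDiffAt.clm_bundle_apply h2 (contMDiffAt_dProj_coordFrame hu a))).contDiffAt

/-- The compatibility of the connection with the metric, in coordinates. -/
theorem extDA_inner {cov : CovariantDerivative I (EuclideanSpace ℝ (Fin n)) V}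
    (hmetric : cov.IsMetricCompatible) {σ τ : ∀ x, V x}
    (hu : u ∈ (extChartAt (totI I n) p₀).target)
    (hσ : SmoothSectionAt I n σ (pt I p₀ u).proj) (hτ : SmoothSectionAt I n τ (pt I p₀ u).proj) :
    extDA (coordBasis EM n) (formGen n) (fun v => algebraMap ℝ (Alg (Idx EM n) n)
      (inner ℝ (σ (pt I p₀ v).proj) (τ (pt I p₀ v).proj))) u =
      loc I p₀ (covForm I cov σ τ) u + loc I p₀ (covForm I cov τ σ) u := by
  have hd := (contDiffAt_inner_pt hu hσ hτ).differentiableAt (by simp)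
  rw [extDA_algebraMap hd, loc_covForm, loc_covForm, ← Finset.sum_add_distrib]
  refine Finset.sum_congr rfl fun a _ => ?_
  rw [← mul_add, ← map_add]
  congr 2
  have hσ' := hσ.mdifferentiableAt (by simp)
  have hτ' := hτ.mdifferentiableAt (by simp)
  have h1 := hmetric.mvfderiv_inner_eq
    (fun _ => (dProj I (pt I p₀ u) (coordFrame I p₀ u a) : EM)) hσ' hτ'
  rw [real_inner_comm]
  refine Eq.trans ?_ h1
  have h2 : MDifferentiableAt I 𝓘(ℝ, ℝ) (fun x => inner ℝ (σ x) (τ x)) (pt I p₀ u).proj :=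
    (ContMDiffAt.inner_bundle hσ hτ).mdifferentiableAt (by simp)
  have h3 := mfderiv_comp u h2 ((contMDiffAt_proj_pt hu).mdifferentiableAt (by simp))
  rw [mfderiv_eq_fderiv] at h3
  have h4 := DFunLike.congr_fun h3 (coordBasis EM n a)
  refine h4.trans ?_
  have h5 := dProj_mfderiv hu (coordBasis EM n a)
  exact congrArg (mfderiv I 𝓘(ℝ, ℝ) (fun x => inner ℝ (σ x) (τ x)) (pt I p₀ u).proj) h5.symm

end Sections

/-! ### The local data of the connection -/

/-- The algebra behind a change of orthonormal frame: `h` is the matrix of the change of frame, `ψ`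
and `θ` are the connection forms in the two frames. -/
theorem sum_change_of_frame {X : Type*} [Ring X] [Algebra ℝ X] {n k : ℕ} {h : Fin n → Fin n → ℝ}
    {P R ψ θ : Fin n → Fin n → X} {A dA : Fin n → X}
    (hδ : ∀ i m, ∑ j, h j i * h j m = if i = m then 1 else 0)
    (hP : ∀ j m, P j m = ∑ l, h l m • ψ j l) (hψ : ∀ j l, ψ l j = -ψ j l)
    (hR : ∀ m j, R m j = ∑ l, h j l • θ m l)
    (hc : ∀ m j i, (-1 : ℝ) ^ k • (A m * P j i) = P j i * A m) (i : Fin n) :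
    ∑ j, (h j i • (∑ m, ((P j m + R m j) * A m + h j m • dA m))
      + (-1 : ℝ) ^ k • ((∑ m, h j m • A m) * P j i)) = dA i + ∑ m, θ m i * A m := by
  have h1 : ∀ m, (∑ j, h j i • P j m) + ∑ j, h j m • P j i = 0 := by
    intro m
    simp only [hP, Finset.smul_sum]
    rw [Finset.sum_comm (f := fun j l => h j m • h l i • ψ j l), ← Finset.sum_add_distrib]
    refine Finset.sum_eq_zero fun j _ => ?_
    rw [← Finset.sum_add_distrib]
    refine Finset.sum_eq_zero fun l _ => ?_
    rw [hψ j l, smul_neg, smul_neg, smul_comm (h j i), add_neg_cancel]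
  have h2 : ∀ m, ∑ j, h j i • R m j = θ m i := by
    intro m
    simp only [hR, Finset.smul_sum, smul_smul]
    rw [Finset.sum_comm]
    simp only [← Finset.sum_smul, hδ]
    simp
  have h3 : ∀ j, (h j i • (∑ m, ((P j m + R m j) * A m + h j m • dA m))
      + (-1 : ℝ) ^ k • ((∑ m, h j m • A m) * P j i)) =
      ∑ m, ((h j i • P j m + h j m • P j i + h j i • R m j) * A m + (h j i * h j m) • dA m) := by
    intro j
    rw [Finset.smul_sum, Finset.sum_mul, Finset.smul_sum, ← Finset.sum_add_distrib]
    refine Finset.sum_congr rfl fun m _ => ?_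
    rw [smul_mul_assoc, smul_comm ((-1 : ℝ) ^ k), hc]
    simp only [smul_add, add_mul, smul_mul_assoc, smul_smul]
    abel
  simp only [h3]
  rw [Finset.sum_comm]
  simp only [Finset.sum_add_distrib, ← Finset.sum_mul, ← Finset.sum_smul, hδ, h2, h1]
  simp [add_comm]

/-- The dependence of the realization on the map that realizes the values. -/
theorem realize_eq_sum {T A G ι J : Type*} [AddCommGroup T] [Module ℝ T] [AddCommGroup A]
    [Module ℝ A] [AddCommGroup G] [Module ℝ G] [Fintype ι] [Fintype J] (b : ι → T) (ε : ι → G)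
    (ρ : A →ₗ[ℝ] ExteriorAlgebra ℝ G) (ρ' : J → A →ₗ[ℝ] ExteriorAlgebra ℝ G) (c : J → ℝ)
    (h : ∀ w, ρ w = ∑ m, c m • ρ' m w) {k : ℕ} (a : T [⋀^Fin k]→ₗ[ℝ] A) :
    realize b ε ρ k a = ∑ m, c m • realize b ε (ρ' m) k a := by
  simp only [realize_apply, smul_comm _ ((k.factorial : ℝ)⁻¹), ← Finset.smul_sum]
  congr 1
  simp only [Finset.smul_sum]
  rw [Finset.sum_comm]
  refine Finset.sum_congr rfl fun (L : Fin k → ι) _ => ?_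
  simp only [← mul_smul_comm, ← Finset.mul_sum]
  rw [h]

theorem realize_toSpanSingleton {T W G ι : Type*} [AddCommGroup T] [Module ℝ T]
    [NormedAddCommGroup W] [InnerProductSpace ℝ W] [AddCommGroup G] [Module ℝ G] [Fintype ι]
    (b : ι → T) (ε : ι → G) (s w : W) {k : ℕ} (a : T [⋀^Fin k]→ₗ[ℝ] ℝ) :
    realize b ε (Algebra.linearMap ℝ (ExteriorAlgebra ℝ G) ∘ₗ (innerSL ℝ s).toLinearMap) k
      ((LinearMap.toSpanSingleton ℝ W w).compAlternatingMap a) =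
      inner ℝ s w • realizeR b ε k a := by
  rw [realizeR, realize_apply, realize_apply, smul_comm]
  congr 1
  rw [Finset.smul_sum]
  refine Finset.sum_congr rfl fun (J : Fin k → ι) _ => ?_
  rw [← mul_smul_comm]
  congr 1
  change algebraMap ℝ _ (inner ℝ s (a (b ∘ J) • w)) = inner ℝ s w • algebraMap ℝ _ (a (b ∘ J))
  rw [inner_smul_right, mul_comm, map_mul, Algebra.smul_def]

theorem realize_wedge_lsmul {T W G ι : Type*} [AddCommGroup T] [Module ℝ T]
    [NormedAddCommGroup W] [InnerProductSpace ℝ W] [AddCommGroup G] [Module ℝ G] [Fintype ι]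
    (b : ι → T) (ε : ι → G) (s : W) {k l : ℕ} (a : T [⋀^Fin k]→ₗ[ℝ] ℝ) (c : T [⋀^Fin l]→ₗ[ℝ] W) :
    realize b ε (Algebra.linearMap ℝ (ExteriorAlgebra ℝ G) ∘ₗ (innerSL ℝ s).toLinearMap) (k + l)
      (wedge (LinearMap.lsmul ℝ W) a c) =
      realizeR b ε k a * realizeR b ε l ((innerSL ℝ s).toLinearMap.compAlternatingMap c) := by
  rw [realize_comp]
  refine realize_wedge (A := ℝ) (B := W) (C := W) b ε (LinearMap.lsmul ℝ W)
    (Algebra.linearMap ℝ (ExteriorAlgebra ℝ G)) _ _ ?_ a c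
  intro x y v
  change algebraMap ℝ _ x * (_ * algebraMap ℝ _ (inner ℝ s y)) =
    _ * algebraMap ℝ _ (inner ℝ s (x • y))
  rw [inner_smul_right, map_mul, ← mul_assoc, Algebra.commutes, mul_assoc]

section FrameData

variable {EM H M : Type*} [NormedAddCommGroup EM] [NormedSpace ℝ EM] [FiniteDimensional ℝ EM]
  [TopologicalSpace H] {I : ModelWithCorners ℝ EM H} [TopologicalSpace M] [ChartedSpace H M]
  {n : ℕ} {V : M → Type*} [TopologicalSpace (TotalSpace (EuclideanSpace ℝ (Fin n)) V)]
  [∀ x, NormedAddCommGroup (V x)] [∀ x, InnerProductSpace ℝ (V x)]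
  [FiberBundle (EuclideanSpace ℝ (Fin n)) V] [VectorBundle ℝ (EuclideanSpace ℝ (Fin n)) V]

variable (I) in
/-- The real-valued form `g(σ, α)`, for a section `σ` and a bundle-valued form `α`. -/
noncomputable def innerForm (σ : ∀ x, V x) {k : ℕ} (α : TForm I n V k) :
    DForm (totI I n) (Tot n V) k := fun q =>
  toCont ((innerSL ℝ (σ q.proj)).toLinearMap.compAlternatingMap (α q))

variable (I) in
/-- The coordinates in the chart at `p₀` of the points over the domain of the frame at `x₁`. -/
def chartFrameSet (p₀ : Tot n V) (x₁ : M) : Set (EM × EuclideanSpace ℝ (Fin n)) :=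
  {u | u ∈ (extChartAt (totI I n) p₀).target ∧ (pt I p₀ u).proj ∈ frameSet n V x₁}

variable (I) in
/-- The local data of the Thom form in the chart at `p₀` and the orthonormal frame at `x₁`. -/
noncomputable def frameData (om : DForm I M 2)
    (cov : CovariantDerivative I (EuclideanSpace ℝ (Fin n)) V) (Φ : ∀ x, V x →L[ℝ] V x)
    (p₀ : Tot n V) (x₁ : M) : LocalData (EM × EuclideanSpace ℝ (Fin n)) (Idx EM n) n where
  z i u := inner ℝ (orthoFrame x₁ i (pt I p₀ u).proj) (pt I p₀ u).2
  T i j u := loc I p₀ (covForm I cov (orthoFrame x₁ i) (orthoFrame x₁ j)) u +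
    algebraMap ℝ _ (inner ℝ (orthoFrame x₁ j (pt I p₀ u).proj)
      (Φ (pt I p₀ u).proj (orthoFrame x₁ i (pt I p₀ u).proj))) * kap (Idx EM n) n
  om := loc I p₀ (pullForm I om)

variable {p₀ : Tot n V} {x₁ : M} {u : EM × EuclideanSpace ℝ (Fin n)}

theorem inner_orthoFrame {x : M} (hx : x ∈ frameSet n V x₁)
    (i j : Fin n) : inner ℝ (orthoFrame (V := V) x₁ i x) (orthoFrame x₁ j x) =
      if i = j then (1 : ℝ) else 0 := by
  rw [← orthoBasis_apply hx, ← orthoBasis_apply hx]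
  exact orthonormal_iff_ite.1 (orthoBasis hx).orthonormal i j

/-- The matrix of a change of orthonormal frame is orthogonal. -/
theorem sum_inner_mul_inner_orthoFrame {x : M} (hx : x ∈ frameSet n V x₁) (v w : V x) :
    ∑ j : Fin n, inner ℝ (orthoFrame x₁ j x) v * inner ℝ (orthoFrame x₁ j x) w = inner ℝ v w := by
  rw [← (orthoBasis hx).sum_inner_mul_inner v w]
  refine Finset.sum_congr rfl fun j _ => ?_
  rw [orthoBasis_apply, real_inner_comm v]

theorem loc_innerForm_eq_sum (hu : u ∈ chartFrameSet I p₀ x₁) (σ : ∀ x, V x) {k : ℕ}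
    (α : TForm I n V k) : loc I p₀ (innerForm I σ α) u =
      ∑ m : Fin n, inner ℝ (σ (pt I p₀ u).proj) (orthoFrame x₁ m (pt I p₀ u).proj) •
        loc I p₀ (innerForm I (orthoFrame x₁ m) α) u := by
  have h1 : ∀ w : V (pt I p₀ u).proj, (Algebra.linearMap ℝ (Alg (Idx EM n) n))
      (inner ℝ (σ (pt I p₀ u).proj) w) = ∑ m : Fin n,
        inner ℝ (σ (pt I p₀ u).proj) (orthoFrame x₁ m (pt I p₀ u).proj) •
          (Algebra.linearMap ℝ (Alg (Idx EM n) n))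
            (inner ℝ (orthoFrame x₁ m (pt I p₀ u).proj) w) := by
    intro w
    rw [← sum_inner_mul_inner_orthoFrame hu.2 (σ (pt I p₀ u).proj) w, map_sum]
    refine Finset.sum_congr rfl fun m _ => ?_
    rw [real_inner_comm, ← smul_eq_mul, map_smul]
  exact realize_eq_sum (coordFrame I p₀ u) (formGen n) (Algebra.linearMap ℝ (Alg (Idx EM n) n) ∘ₗ
    (innerSL ℝ (σ (pt I p₀ u).proj)).toLinearMap) (fun m => Algebra.linearMap ℝ (Alg (Idx EM n) n) ∘ₗ
    (innerSL ℝ (orthoFrame x₁ m (pt I p₀ u).proj)).toLinearMap) _ h1 (α (pt I p₀ u))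

theorem loc_covForm_eq_sum (hu : u ∈ chartFrameSet I p₀ x₁)
    (cov : CovariantDerivative I (EuclideanSpace ℝ (Fin n)) V) (σ τ : ∀ x, V x) :
    loc I p₀ (covForm I cov σ τ) u =
      ∑ m : Fin n, inner ℝ (τ (pt I p₀ u).proj) (orthoFrame x₁ m (pt I p₀ u).proj) •
        loc I p₀ (covForm I cov σ (orthoFrame x₁ m)) u := by
  simp only [loc_covForm, Finset.smul_sum]
  rw [Finset.sum_comm]
  refine Finset.sum_congr rfl fun a _ => ?_
  rw [← sum_inner_mul_inner_orthoFrame hu.2 (τ (pt I p₀ u).proj), map_sum, Finset.mul_sum]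
  refine Finset.sum_congr rfl fun m _ => ?_
  rw [map_mul, ← Algebra.smul_def, mul_smul_comm, real_inner_comm]

theorem parity_loc {k : ℕ} (α : DForm (totI I n) (Tot n V) k) :
    parity (loc I p₀ α u) = (-1 : ℝ) ^ k • loc I p₀ α u :=
  parity_realizeR _ _ _

theorem loc_mem_formAlg {k : ℕ} (α : DForm (totI I n) (Tot n V) k) :
    loc I p₀ α u ∈ formAlg (Idx EM n) n :=
  realizeR_mem_formAlg _ _

variable [I.Boundaryless] [IsManifold I ∞ M]
  [ContMDiffVectorBundle ∞ (EuclideanSpace ℝ (Fin n)) V I]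

theorem eventually_mem_chartFrameSet (hu : u ∈ chartFrameSet I p₀ x₁) :
    ∀ᶠ v in 𝓝 u, v ∈ chartFrameSet I p₀ x₁ :=
  (eventually_mem_target hu.1).and ((contMDiffAt_proj_pt hu.1).continuousAt.eventually
    ((trivializationAt (EuclideanSpace ℝ (Fin n)) V x₁).open_baseSet.mem_nhds hu.2))

variable [IsContMDiffRiemannianBundle I ∞ (EuclideanSpace ℝ (Fin n)) V]

/-- The connection form in an orthonormal frame is skew. -/
theorem loc_covForm_skew {cov : CovariantDerivative I (EuclideanSpace ℝ (Fin n)) V}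
    (hmetric : cov.IsMetricCompatible) (hu : u ∈ chartFrameSet I p₀ x₁) (i j : Fin n) :
    loc I p₀ (covForm I cov (orthoFrame x₁ j) (orthoFrame x₁ i)) u =
      -loc I p₀ (covForm I cov (orthoFrame x₁ i) (orthoFrame x₁ j)) u := by
  rw [eq_neg_iff_add_eq_zero, ← extDA_inner hmetric hu.1 (contMDiffAt_orthoFrame hu.2 j)
    (contMDiffAt_orthoFrame hu.2 i)]
  rw [extDA_congr (g := fun _ => algebraMap ℝ _ (if j = i then (1 : ℝ) else 0)), extDA_const]
  filter_upwards [eventually_mem_chartFrameSet hu] with v hv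
  rw [inner_orthoFrame hv.2]

/-- This is where the hypotheses on `ω`, on the connection and on the endomorphism enter. -/
theorem isRegularAt_frameData [T2Space M] {om : DForm I M 2} (hom : IsSmoothForm I om)
    (hdom : extD I om = 0) {cov : CovariantDerivative I (EuclideanSpace ℝ (Fin n)) V}
    (hcov : CovariantDerivative.ContMDiffCovariantDerivative cov ∞)
    (hmetric : cov.IsMetricCompatible) {Φ : ∀ x, V x →L[ℝ] V x}
    (hΦ : ContMDiff I (I.prod 𝓘(ℝ, EuclideanSpace ℝ (Fin n) →L[ℝ] EuclideanSpace ℝ (Fin n))) ∞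
      fun x => TotalSpace.mk' (EuclideanSpace ℝ (Fin n) →L[ℝ] EuclideanSpace ℝ (Fin n))
        (E := fun x => V x →L[ℝ] V x) x (Φ x))
    (hskew : ∀ (x : M) (v w : V x), inner ℝ (Φ x v) w = -inner ℝ v (Φ x w))
    (hu : u ∈ chartFrameSet I p₀ x₁) :
    (frameData I om cov Φ p₀ x₁).IsRegularAt (coordBasis EM n) u where
  z_smooth i := contDiffAt_inner_snd hu.1 (contMDiffAt_orthoFrame hu.2 i)
  T_smooth i j := by
    refine ContDiffAt.add (contDiffAt_loc_covForm hcov hu.1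
      (trivializationAt (EuclideanSpace ℝ (Fin n)) V x₁).open_baseSet hu.2
      (fun x hx => contMDiffAt_orthoFrame hx i) (contMDiffAt_orthoFrame hu.2 j))
      ((contDiffAt_algebraMap ?_).mul contDiffAt_const)
    exact contDiffAt_inner_pt (σ := orthoFrame x₁ j) (τ := fun x => Φ x (orthoFrame x₁ i x)) hu.1
      (contMDiffAt_orthoFrame hu.2 j)
      (ContMDiffAt.clm_bundle_apply (hΦ _) (contMDiffAt_orthoFrame hu.2 i))
  om_smooth := contDiffAt_loc_pullForm hom hu.1
  T_odd := Filter.Eventually.of_forall fun v i j => by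
    simp only [frameData, map_add, map_mul, parity_loc, parity_ι, AlgHom.commutes]
    simp
    exact add_comm _ _
  T_skew := by
    filter_upwards [eventually_mem_chartFrameSet hu] with v hv i j
    simp only [frameData]
    rw [loc_covForm_skew hmetric hv, real_inner_comm, hskew, map_neg]
    simp
    exact add_comm _ _
  T_base := Filter.Eventually.of_forall fun v i j =>
    add_mem (formAlg_le_baseAlg (loc_mem_formAlg _))
      (mul_mem (Subalgebra.algebraMap_mem _ _) kap_mem_baseAlg)
  om_even := Filter.Eventually.of_forall fun v => (parity_loc _).trans (by simp [frameData])
  om_form := Filter.Eventually.of_forall fun v => loc_mem_formAlg _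
  om_closed := extDA_loc_pullForm hom hdom hu.1

/-- The definition of the pullback connection, in the chart. The frame in which it is computed at a
point is the one that belongs to this point. -/
theorem loc_innerForm_pullNabla (cov : CovariantDerivative I (EuclideanSpace ℝ (Fin n)) V)
    (σ : ∀ x, V x) {k : ℕ} (α : TForm I n V k) :
    loc I p₀ (innerForm I σ (pullNabla I cov α)) u =
      ∑ j : Fin n, (inner ℝ (σ (pt I p₀ u).proj) (orthoFrame (pt I p₀ u).proj j (pt I p₀ u).proj) •
          loc I p₀ (extD (totI I n) (innerForm I (orthoFrame (pt I p₀ u).proj j) α)) u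
        + (-1 : ℝ) ^ k • (loc I p₀ (innerForm I (orthoFrame (pt I p₀ u).proj j) α) u *
          loc I p₀ (covForm I cov (orthoFrame (pt I p₀ u).proj j) σ) u)) := by
  have h0 : loc I p₀ (innerForm I σ (pullNabla I cov α)) u =
      realize (coordFrame I p₀ u) (formGen n)
        (Algebra.linearMap ℝ (Alg (Idx EM n) n) ∘ₗ (innerSL ℝ (σ (pt I p₀ u).proj)).toLinearMap)
        (k + 1) (pullNabla I cov α (pt I p₀ u)) := rfl
  rw [h0, pullNabla, map_sum]
  refine Finset.sum_congr rfl fun j _ => ?_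
  rw [map_add, map_smul]
  congr 1
  · exact realize_toSpanSingleton _ _ _ _ _
  · congr 1
    exact realize_wedge_lsmul _ _ _ _ _

end FrameData

/-! ### The covariant derivative of the cone in the local model -/

namespace LocalData

variable {F : Type*} [NormedAddCommGroup F] [NormedSpace ℝ F] {ι : Type*} [Fintype ι]
  [DecidableEq ι] {n : ℕ} (D : LocalData F ι n) (b : ι → F)

/-- The mapping cone covariant derivative `𝔸` on a pair of bundle-valued forms with components
`A i = αᵢ + κ βᵢ`, in coordinates. -/
noncomputable def coneCov (A : Fin n → F → Alg ι n) (i : Fin n) (u : F) : Alg ι n :=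
  D.coneDiff b (A i) u + ∑ j, D.T j i u * A j u

variable {D b} {u : F}

theorem coneDiff_mul {f g : F → Alg ι n} (hom : parity (D.om u) = D.om u)
    (hf : DifferentiableAt ℝ f u) (hg : DifferentiableAt ℝ g u) :
    D.coneDiff b (fun v => f v * g v) u =
      D.coneDiff b f u * g u + parity (f u) * D.coneDiff b g u := by
  simp only [coneDiff]
  rw [extDA_mul hf hg, contr_mul, mul_add, add_mul, mul_add, mul_assoc (D.om u),
    ← mul_assoc (parity (f u)), ← even_comm hom (parity (f u)), mul_assoc]
  abel

theorem coneDiff_add {f g : F → Alg ι n} (hf : DifferentiableAt ℝ f u)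
    (hg : DifferentiableAt ℝ g u) :
    D.coneDiff b (fun v => f v + g v) u = D.coneDiff b f u + D.coneDiff b g u := by
  simp only [coneDiff]
  rw [extDA_add hf hg, map_add, mul_add]
  abel

theorem coneDiff_sum {J : Type*} {s : Finset J} {f : J → F → Alg ι n}
    (hf : ∀ j ∈ s, DifferentiableAt ℝ (f j) u) :
    D.coneDiff b (fun v => ∑ j ∈ s, f j v) u = ∑ j ∈ s, D.coneDiff b (f j) u := by
  simp only [coneDiff]
  rw [extDA_sum hf, map_sum, Finset.mul_sum, Finset.sum_add_distrib]

theorem coneDiff_of_mem_formAlg {f : F → Alg ι n} (hf : f u ∈ formAlg ι n) :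
    D.coneDiff b f u = extDA b (formGen n) f u := by
  rw [coneDiff, contr_kapDual_of_mem hf, mul_zero, add_zero]

theorem coneDiff_kap_mul {f : F → Alg ι n} (hf : f u ∈ formAlg ι n)
    (hd : DifferentiableAt ℝ f u) :
    D.coneDiff b (fun v => kap ι n * f v) u =
      D.om u * f u - kap ι n * extDA b (formGen n) f u := by
  have h1 : kapDual ι n (kapGen ι n) = 1 := by simp [kapGen]
  rw [coneDiff, extDA_mul (f := fun _ => kap ι n) (differentiableAt_const _) hd, extDA_const, zero_mul,
    zero_add,
    parity_ι, contr_ι_mul, contr_kapDual_of_mem hf, h1,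
    one_smul, mul_zero, sub_zero, neg_mul]
  abel

theorem coneCov_add {A B : Fin n → F → Alg ι n} (hA : ∀ i, DifferentiableAt ℝ (A i) u)
    (hB : ∀ i, DifferentiableAt ℝ (B i) u) (i : Fin n) :
    D.coneCov b (fun j v => A j v + B j v) i u = D.coneCov b A i u + D.coneCov b B i u := by
  simp only [coneCov, mul_add, Finset.sum_add_distrib]
  rw [coneDiff_add (hA i) (hB i)]
  abel

theorem coneCov_congr {A B : Fin n → F → Alg ι n} (h : ∀ᶠ v in 𝓝 u, ∀ i, A i v = B i v)
    (i : Fin n) : D.coneCov b A i u = D.coneCov b B i u := by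
  rw [coneCov, coneCov, coneDiff_congr (g := B i) (h.mono fun v hv => hv i)]
  congr 1
  exact Finset.sum_congr rfl fun j _ => by rw [h.self_of_nhds j]

namespace IsRegularAt

theorem contDiffAt_coneCov (h : D.IsRegularAt b u) {A : Fin n → F → Alg ι n}
    (hA : ∀ i, ContDiffAt ℝ ∞ (A i) u) (i : Fin n) : ContDiffAt ℝ ∞ (D.coneCov b A i) u :=
  (h.contDiffAt_coneDiff (hA i)).add (ContDiffAt.sum fun j _ => (h.T_smooth j i).mul (hA j))

/-- The square of the mapping cone covariant derivative is given by the curvature. -/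
theorem coneCov_coneCov (h : D.IsRegularAt b u) {A : Fin n → F → Alg ι n}
    (hA : ∀ i, ContDiffAt ℝ ∞ (A i) u) (i : Fin n) :
    D.coneCov b (D.coneCov b A) i u = ∑ j, D.curv b j i u * A j u := by
  have hA' : ∀ j, DifferentiableAt ℝ (A j) u := fun j => (hA j).differentiableAt (by simp)
  have h1 : D.coneDiff b (D.coneCov b A i) u =
      ∑ j, (D.coneDiff b (D.T j i) u * A j u - D.T j i u * D.coneDiff b (A j) u) := by
    have h2 : D.coneCov b A i = fun v => D.coneDiff b (A i) v + ∑ j, D.T j i v * A j v := rfl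
    have h3 : ∀ j ∈ Finset.univ, DifferentiableAt ℝ (fun v => D.T j i v * A j v) u :=
      fun j _ => (h.differentiableAt_T j i).mul (hA' j)
    rw [h2, coneDiff_add ((h.contDiffAt_coneDiff (hA i)).differentiableAt (by simp))
      (DifferentiableAt.fun_sum h3), h.coneDiff_coneDiff (hA i), zero_add, coneDiff_sum h3]
    refine Finset.sum_congr rfl fun j _ => ?_
    rw [coneDiff_mul h.om_even.self_of_nhds (h.differentiableAt_T j i) (hA' j),
      h.T_odd.self_of_nhds j i, neg_mul, sub_eq_add_neg]
  rw [coneCov, h1, ← Finset.sum_add_distrib]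
  have h4 : ∀ j, D.coneDiff b (D.T j i) u * A j u - D.T j i u * D.coneDiff b (A j) u +
      D.T j i u * D.coneCov b A j u = D.coneDiff b (D.T j i) u * A j u +
        ∑ l, D.T j i u * (D.T l j u * A l u) := by
    intro j
    rw [coneCov, mul_add, ← Finset.mul_sum]
    abel
  simp only [h4]
  simp only [Finset.sum_add_distrib, curv, sub_eq_add_neg,
    Finset.sum_mul, neg_mul, add_mul, ← Finset.sum_neg_distrib]
  congr 1
  rw [Finset.sum_comm]
  refine Finset.sum_congr rfl fun j _ => Finset.sum_congr rfl fun l _ => ?_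
  rw [← mul_assoc, odd_anticomm (h.T_odd.self_of_nhds l i) (h.T_odd.self_of_nhds j l), neg_mul]

theorem curv_skew (h : D.IsRegularAt b u) (i k : Fin n) : D.curv b k i u = -D.curv b i k u := by
  rw [curv, curv, h.coneDiff_T_skew i k, neg_sub, ← Finset.sum_congr rfl (fun j _ => by
    rw [h.T_skew.self_of_nhds j i, h.T_skew.self_of_nhds k j, neg_mul_neg,
      odd_anticomm (h.T_odd.self_of_nhds j i) (h.T_odd.self_of_nhds k j)] : ∀ j ∈ Finset.univ,
        -(D.T k j u * D.T j i u) = D.T i j u * D.T j k u)]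
  rw [Finset.sum_neg_distrib]
  abel

end IsRegularAt

end LocalData

/-! ### Local expression of the pulled back covariant derivative -/

section CovariantDerivative

variable {EM H M : Type*} [NormedAddCommGroup EM] [NormedSpace ℝ EM] [FiniteDimensional ℝ EM]
  [TopologicalSpace H] {I : ModelWithCorners ℝ EM H} [TopologicalSpace M] [ChartedSpace H M]
  {n : ℕ} {V : M → Type*} [TopologicalSpace (TotalSpace (EuclideanSpace ℝ (Fin n)) V)]
  [∀ x, NormedAddCommGroup (V x)] [∀ x, InnerProductSpace ℝ (V x)]
  [FiberBundle (EuclideanSpace ℝ (Fin n)) V] [VectorBundle ℝ (EuclideanSpace ℝ (Fin n)) V]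
  {p₀ : Tot n V} {x₁ : M} {u : EM × EuclideanSpace ℝ (Fin n)}
  {om : DForm I M 2} {cov : CovariantDerivative I (EuclideanSpace ℝ (Fin n)) V}
  {Φ : ∀ x, V x →L[ℝ] V x}

variable (I) in
/-- The components of a bundle-valued form with respect to the orthonormal frame at `x₁`, in the
chart at `p₀`. -/
noncomputable abbrev comps (p₀ : Tot n V) (x₁ : M) {k : ℕ} (α : TForm I n V k) (i : Fin n) :
    EM × EuclideanSpace ℝ (Fin n) → Alg (Idx EM n) n :=
  loc I p₀ (innerForm I (orthoFrame x₁ i) α)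

theorem comps_wedgeTwo {k : ℕ} (β : TForm I n V k) (i : Fin n) :
    comps I p₀ x₁ (fun p => wedgeTwo (pullForm I om p).toAlternatingMap (β p)) i u =
      loc I p₀ (pullForm I om) u * comps I p₀ x₁ β i u := by
  refine Eq.trans ?_ (realize_wedge_lsmul (coordFrame I p₀ u) (formGen n)
    (orthoFrame x₁ i (pt I p₀ u).proj) (pullForm I om (pt I p₀ u)).toAlternatingMap
    (β (pt I p₀ u)))
  exact realize_domDomCongr (coordFrame I p₀ u) (formGen n) (Algebra.linearMap ℝ _ ∘ₗ
    (innerSL ℝ (orthoFrame x₁ i (pt I p₀ u).proj)).toLinearMap) (Nat.add_comm 2 k)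
    (wedge (LinearMap.lsmul ℝ (V (pt I p₀ u).proj)) (pullForm I om (pt I p₀ u)).toAlternatingMap
    (β (pt I p₀ u)))

theorem comps_add {k : ℕ} (α β : TForm I n V k) (i : Fin n) :
    comps I p₀ x₁ (α + β) i u = comps I p₀ x₁ α i u + comps I p₀ x₁ β i u :=
  map_add (realize (coordFrame I p₀ u) (formGen n) (Algebra.linearMap ℝ (Alg (Idx EM n) n) ∘ₗ
    (innerSL ℝ (orthoFrame x₁ i (pt I p₀ u).proj)).toLinearMap) k) (α (pt I p₀ u)) (β (pt I p₀ u))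

theorem comps_sub {k : ℕ} (α β : TForm I n V k) (i : Fin n) :
    comps I p₀ x₁ (α - β) i u = comps I p₀ x₁ α i u - comps I p₀ x₁ β i u :=
  map_sub (realize (coordFrame I p₀ u) (formGen n) (Algebra.linearMap ℝ (Alg (Idx EM n) n) ∘ₗ
    (innerSL ℝ (orthoFrame x₁ i (pt I p₀ u).proj)).toLinearMap) k) (α (pt I p₀ u)) (β (pt I p₀ u))

theorem comps_ofSection (w : ∀ p : Tot n V, V p.proj) (i : Fin n) :
    comps I p₀ x₁ (ofSection I w) i u = algebraMap ℝ _
      (inner ℝ (orthoFrame x₁ i (pt I p₀ u).proj) (w (pt I p₀ u))) := by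
  rw [comps, loc, realizeR, realize_zero_form]
  rfl

theorem comps_actForm (hu : u ∈ chartFrameSet I p₀ x₁) {k : ℕ} (α : TForm I n V k) (i : Fin n) :
    comps I p₀ x₁ (actForm I Φ α) i u = ∑ j : Fin n, inner ℝ (orthoFrame x₁ i (pt I p₀ u).proj)
      (Φ (pt I p₀ u).proj (orthoFrame x₁ j (pt I p₀ u).proj)) • comps I p₀ x₁ α j u := by
  refine realize_eq_sum (coordFrame I p₀ u) (formGen n) (Algebra.linearMap ℝ (Alg (Idx EM n) n) ∘ₗ
    (innerSL ℝ (orthoFrame x₁ i (pt I p₀ u).proj)).toLinearMap ∘ₗ (Φ (pt I p₀ u).proj).toLinearMap)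
    (fun m => Algebra.linearMap ℝ (Alg (Idx EM n) n) ∘ₗ
    (innerSL ℝ (orthoFrame x₁ m (pt I p₀ u).proj)).toLinearMap) _ (fun w => ?_) (α (pt I p₀ u))
  have h1 : inner ℝ (orthoFrame x₁ i (pt I p₀ u).proj) (Φ (pt I p₀ u).proj w) =
      ∑ m : Fin n, inner ℝ (orthoFrame x₁ i (pt I p₀ u).proj)
        (Φ (pt I p₀ u).proj (orthoFrame x₁ m (pt I p₀ u).proj)) *
          inner ℝ (orthoFrame x₁ m (pt I p₀ u).proj) w := by
    conv_lhs => rw [← (orthoBasis hu.2).sum_repr' w, map_sum, inner_sum]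
    refine Finset.sum_congr rfl fun m _ => ?_
    rw [map_smul, inner_smul_right, mul_comm, orthoBasis_apply]
  refine (congrArg (Algebra.linearMap ℝ (Alg (Idx EM n) n)) h1).trans ?_
  rw [map_sum]
  exact Finset.sum_congr rfl fun m _ => by rw [← smul_eq_mul, map_smul]; rfl

theorem comps_mem_formAlg {k : ℕ} (α : TForm I n V k) (i : Fin n) :
    comps I p₀ x₁ α i u ∈ formAlg (Idx EM n) n := loc_mem_formAlg _

variable [I.Boundaryless] [IsManifold I ∞ M]
  [ContMDiffVectorBundle ∞ (EuclideanSpace ℝ (Fin n)) V I]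
  [IsContMDiffRiemannianBundle I ∞ (EuclideanSpace ℝ (Fin n)) V]

/-- The pullback connection in an arbitrary orthonormal frame. -/
theorem comps_pullNabla (hmetric : cov.IsMetricCompatible) (hu : u ∈ chartFrameSet I p₀ x₁) {k : ℕ}
    {α : TForm I n V k} (hα : ∀ i, DifferentiableAt ℝ (comps I p₀ x₁ α i) u) (i : Fin n) :
    comps I p₀ x₁ (pullNabla I cov α) i u =
      extDA (coordBasis EM n) (formGen n) (comps I p₀ x₁ α i) u +
        ∑ j, loc I p₀ (covForm I cov (orthoFrame x₁ j) (orthoFrame x₁ i)) u *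
          comps I p₀ x₁ α j u := by
  set x₂ := (pt I p₀ u).proj with hx₂
  have hu₂ : u ∈ chartFrameSet I p₀ x₂ := ⟨hu.1, mem_baseSet_trivializationAt _ _ _⟩
  have hsm : ∀ j m : Fin n, DifferentiableAt ℝ
      (fun v => inner ℝ (orthoFrame (V := V) x₂ j (pt I p₀ v).proj)
      (orthoFrame x₁ m (pt I p₀ v).proj)) u := fun j m =>
    (contDiffAt_inner_pt hu.1 (contMDiffAt_orthoFrame hu₂.2 j)
      (contMDiffAt_orthoFrame hu.2 m)).differentiableAt (by simp)
  have hA : ∀ j m : Fin n, DifferentiableAt ℝ (fun v => algebraMap ℝ (Alg (Idx EM n) n)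
      (inner ℝ (orthoFrame (V := V) x₂ j (pt I p₀ v).proj) (orthoFrame x₁ m (pt I p₀ v).proj))) u :=
    fun j m => (algebraMapCLM ℝ (Alg (Idx EM n) n)).differentiableAt.comp u (hsm j m)
  have h1 : ∀ j : Fin n, loc I p₀ (innerForm I (orthoFrame x₂ j) α) =ᶠ[𝓝 u]
      fun v => ∑ m : Fin n, algebraMap ℝ (Alg (Idx EM n) n)
        (inner ℝ (orthoFrame (V := V) x₂ j (pt I p₀ v).proj) (orthoFrame x₁ m (pt I p₀ v).proj)) *
          comps I p₀ x₁ α m v := by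
    intro j
    filter_upwards [eventually_mem_chartFrameSet hu] with v hv
    rw [loc_innerForm_eq_sum hv]
    exact Finset.sum_congr rfl fun m _ => Algebra.smul_def _ _
  have h2 : ∀ j : Fin n, loc I p₀ (extD (totI I n) (innerForm I (orthoFrame (V := V) x₂ j) α)) u =
      ∑ m : Fin n, ((loc I p₀ (covForm I cov (orthoFrame (V := V) x₂ j) (orthoFrame x₁ m)) u +
        loc I p₀ (covForm I cov (orthoFrame (V := V) x₁ m) (orthoFrame x₂ j)) u) *
          comps I p₀ x₁ α m u +
        inner ℝ (orthoFrame (V := V) x₂ j (pt I p₀ u).proj) (orthoFrame x₁ m (pt I p₀ u).proj) •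
          extDA (coordBasis EM n) (formGen n) (comps I p₀ x₁ α m) u) := by
    intro j
    rw [loc_extD _ hu.1, extDA_congr (h1 j), extDA_sum fun m _ => (hA j m).fun_mul (hα m)]
    · refine Finset.sum_congr rfl fun m _ => ?_
      rw [extDA_mul (hA j m) (hα m), extDA_inner hmetric hu.1 (contMDiffAt_orthoFrame hu₂.2 j)
        (contMDiffAt_orthoFrame hu.2 m), AlgHom.commutes, Algebra.smul_def]
    · exact (DifferentiableAt.fun_sum fun m _ => (hA j m).fun_mul (hα m)).congr_of_eventuallyEq
        (h1 j)
  rw [comps, loc_innerForm_pullNabla]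
  rw [← sum_change_of_frame (k := k)
    (h := fun j m : Fin n =>
      inner ℝ (orthoFrame (V := V) x₂ j (pt I p₀ u).proj) (orthoFrame x₁ m (pt I p₀ u).proj))
    (P := fun j m : Fin n =>
      loc I p₀ (covForm I cov (orthoFrame (V := V) x₂ j) (orthoFrame x₁ m)) u)
    (R := fun m j : Fin n =>
      loc I p₀ (covForm I cov (orthoFrame (V := V) x₁ m) (orthoFrame x₂ j)) u)
    (ψ := fun j l : Fin n =>
      loc I p₀ (covForm I cov (orthoFrame (V := V) x₂ j) (orthoFrame x₂ l)) u)
    (θ := fun j l : Fin n =>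
      loc I p₀ (covForm I cov (orthoFrame (V := V) x₁ j) (orthoFrame x₁ l)) u)
    (A := fun m => comps I p₀ x₁ α m u)
    (dA := fun m => extDA (coordBasis EM n) (formGen n) (comps I p₀ x₁ α m) u) ?_ ?_ ?_ ?_ ?_]
  · refine Finset.sum_congr rfl fun j _ => ?_
    congr 1
    · rw [h2, real_inner_comm]
    · rw [loc_innerForm_eq_sum hu]
  · intro i m
    rw [sum_inner_mul_inner_orthoFrame hu₂.2, inner_orthoFrame hu.2]
  · intro j m
    rw [loc_covForm_eq_sum hu₂]
    exact Finset.sum_congr rfl fun l _ => by rw [real_inner_comm]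
  · exact fun j l => loc_covForm_skew hmetric hu₂ j l
  · exact fun m j => loc_covForm_eq_sum hu cov _ _
  · intro m j i
    have ho : parity (loc I p₀ (covForm I cov (orthoFrame x₂ j) (orthoFrame x₁ i)) u) =
        -loc I p₀ (covForm I cov (orthoFrame x₂ j) (orthoFrame x₁ i)) u :=
      (parity_loc _).trans (by rw [pow_one, neg_one_smul])
    rw [odd_mul_eq ho, parity_loc (innerForm I (orthoFrame x₁ m) α), smul_mul_assoc]

/-- The mapping cone covariant derivative in coordinates, on pairs with vanishing second
component. -/
theorem coneCov_comps (hmetric : cov.IsMetricCompatible) (hu : u ∈ chartFrameSet I p₀ x₁) {k : ℕ}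
    {α : TForm I n V k} (hα : ∀ i, DifferentiableAt ℝ (comps I p₀ x₁ α i) u) (i : Fin n) :
    (frameData I om cov Φ p₀ x₁).coneCov (coordBasis EM n) (comps I p₀ x₁ α) i u =
      comps I p₀ x₁ (pullNabla I cov α) i u +
        kap (Idx EM n) n * comps I p₀ x₁ (actForm I Φ α) i u := by
  rw [LocalData.coneCov, LocalData.coneDiff_of_mem_formAlg (comps_mem_formAlg α i),
    comps_pullNabla hmetric hu hα, add_assoc, comps_actForm hu, Finset.mul_sum,
    ← Finset.sum_add_distrib]
  congr 1
  refine Finset.sum_congr rfl fun j _ => ?_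
  simp only [frameData]
  rw [add_mul, ← Algebra.smul_def, smul_mul_assoc, mul_smul_comm]

/-- The mapping cone covariant derivative in coordinates, on pairs with vanishing first
component. -/
theorem coneCov_kap_mul_comps (hmetric : cov.IsMetricCompatible) (hu : u ∈ chartFrameSet I p₀ x₁)
    {k : ℕ} {β : TForm I n V k} (hβ : ∀ i, DifferentiableAt ℝ (comps I p₀ x₁ β i) u) (i : Fin n) :
    (frameData I om cov Φ p₀ x₁).coneCov (coordBasis EM n)
        (fun j v => kap (Idx EM n) n * comps I p₀ x₁ β j v) i u =
      comps I p₀ x₁ (fun p => wedgeTwo (pullForm I om p).toAlternatingMap (β p)) i u -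
        kap (Idx EM n) n * comps I p₀ x₁ (pullNabla I cov β) i u := by
  have hκ : parity (kap (Idx EM n) n) = -kap (Idx EM n) n := parity_ι _
  rw [LocalData.coneCov, LocalData.coneDiff_kap_mul (comps_mem_formAlg β i) (hβ i), comps_wedgeTwo,
    comps_pullNabla hmetric hu hβ, mul_add, sub_add_eq_sub_sub, sub_eq_add_neg _ (_ * ∑ _, _),
    Finset.mul_sum, ← Finset.sum_neg_distrib]
  congr 1
  refine Finset.sum_congr rfl fun j _ => ?_
  have ho : parity (loc I p₀ (covForm I cov (orthoFrame x₁ j) (orthoFrame x₁ i)) u) =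
      -loc I p₀ (covForm I cov (orthoFrame x₁ j) (orthoFrame x₁ i)) u :=
    (parity_loc _).trans (by rw [pow_one, neg_one_smul])
  simp only [frameData]
  rw [add_mul, mul_assoc (algebraMap ℝ _ _), ← mul_assoc (kap _ _), odd_sq hκ, zero_mul, mul_zero,
    add_zero, ← mul_assoc, odd_anticomm ho hκ, neg_mul, mul_assoc]

end CovariantDerivative

/-! ### Local expression of the curvature -/

section Curvature

variable {EM H M : Type*} [NormedAddCommGroup EM] [NormedSpace ℝ EM] [FiniteDimensional ℝ EM]
  [TopologicalSpace H] {I : ModelWithCorners ℝ EM H} [TopologicalSpace M] [ChartedSpace H M]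
  {n : ℕ} {V : M → Type*} [TopologicalSpace (TotalSpace (EuclideanSpace ℝ (Fin n)) V)]
  [∀ x, NormedAddCommGroup (V x)] [∀ x, InnerProductSpace ℝ (V x)]
  [FiberBundle (EuclideanSpace ℝ (Fin n)) V] [VectorBundle ℝ (EuclideanSpace ℝ (Fin n)) V]
  {p₀ : Tot n V} {x₁ : M} {u : EM × EuclideanSpace ℝ (Fin n)}
  {om : DForm I M 2} {cov : CovariantDerivative I (EuclideanSpace ℝ (Fin n)) V}
  {Φ : ∀ x, V x →L[ℝ] V x}
  [I.Boundaryless] [IsManifold I ∞ M]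
  [ContMDiffVectorBundle ∞ (EuclideanSpace ℝ (Fin n)) V I]
  [IsContMDiffRiemannianBundle I ∞ (EuclideanSpace ℝ (Fin n)) V]

/-- The curvature matrix of the local data computes the operator
`(∇² + ω ∧ Φ) + κ (Φ ∇ - ∇ Φ)`. -/
theorem sum_curv_mul_comps (hmetric : cov.IsMetricCompatible) (hu : u ∈ chartFrameSet I p₀ x₁)
    (hD : (frameData I om cov Φ p₀ x₁).IsRegularAt (coordBasis EM n) u) {k : ℕ}
    {α : TForm I n V k} (hα : ∀ i, ContDiffAt ℝ ∞ (comps I p₀ x₁ α i) u) (i : Fin n) :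
    ∑ j, (frameData I om cov Φ p₀ x₁).curv (coordBasis EM n) j i u * comps I p₀ x₁ α j u =
      comps I p₀ x₁ (fun p => pullNabla I cov (pullNabla I cov α) p
          + wedgeTwo (pullForm I om p).toAlternatingMap (actForm I Φ α p)) i u +
        kap (Idx EM n) n * comps I p₀ x₁ (fun p => actForm I Φ (pullNabla I cov α) p
          - pullNabla I cov (actForm I Φ α) p) i u := by
  set D := frameData I om cov Φ p₀ x₁ with hDdef
  have h1 : ∀ᶠ v in 𝓝 u, ∀ i, D.coneCov (coordBasis EM n) (comps I p₀ x₁ α) i v =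
      comps I p₀ x₁ (pullNabla I cov α) i v +
        kap (Idx EM n) n * comps I p₀ x₁ (actForm I Φ α) i v := by
    filter_upwards [eventually_mem_chartFrameSet hu,
      Filter.eventually_all.2 fun i => eventually_contDiffAt (hα i)] with v hv hv' i
    exact coneCov_comps hmetric hv hv' i
  -- contraction with `κ` separates the two components, whence both are smooth
  have hs := fun i => hD.contDiffAt_coneCov hα i
  have hκ : kapDual (Idx EM n) n (kapGen (Idx EM n) n) = 1 := by simp [kapGen]
  have h2 : ∀ i, ContDiffAt ℝ ∞ (comps I p₀ x₁ (actForm I Φ α) i) u := by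
    intro i
    refine (contDiffAt_clm (contr (kapDual (Idx EM n) n)) (hs i)).congr_of_eventuallyEq ?_
    filter_upwards [h1] with v hv
    rw [hv i, map_add, contr_ι_mul, contr_kapDual_of_mem (comps_mem_formAlg _ _),
      contr_kapDual_of_mem (comps_mem_formAlg _ _), hκ]
    simp
  have h3 : ∀ i, ContDiffAt ℝ ∞ (comps I p₀ x₁ (pullNabla I cov α) i) u := by
    intro i
    refine ((hs i).sub ((contDiffAt_const (c := kap (Idx EM n) n)).mul (h2 i))).congr_of_eventuallyEq
      ?_
    filter_upwards [h1] with v hv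
    rw [hv i, add_sub_cancel_right]
  have h2' := fun i => (h2 i).differentiableAt (by simp)
  have h3' := fun i => (h3 i).differentiableAt (by simp)
  rw [← hD.coneCov_coneCov hα, LocalData.coneCov_congr h1, LocalData.coneCov_add h3'
    (fun i => (differentiableAt_const (kap (Idx EM n) n)).fun_mul (h2' i)),
    coneCov_comps hmetric hu h3', coneCov_kap_mul_comps hmetric hu h2']
  have h4 := comps_add (p₀ := p₀) (x₁ := x₁) (u := u) (pullNabla I cov (pullNabla I cov α))
    (fun p => wedgeTwo (pullForm I om p).toAlternatingMap (actForm I Φ α p)) i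
  have h5 := comps_sub (p₀ := p₀) (x₁ := x₁) (u := u) (actForm I Φ (pullNabla I cov α))
    (pullNabla I cov (actForm I Φ α)) i
  rw [show (fun p => pullNabla I cov (pullNabla I cov α) p
          + wedgeTwo (pullForm I om p).toAlternatingMap (actForm I Φ α p)) =
      pullNabla I cov (pullNabla I cov α) +
        fun p => wedgeTwo (pullForm I om p).toAlternatingMap (actForm I Φ α p) from rfl,
    show (fun p => actForm I Φ (pullNabla I cov α) p - pullNabla I cov (actForm I Φ α) p) =
      actForm I Φ (pullNabla I cov α) - pullNabla I cov (actForm I Φ α) from rfl, h4, h5, mul_sub]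
  abel

end Curvature

section SkewSum

/-- A sum over `i < j` of symmetric terms is half of the sum over all pairs of indices. -/
theorem sum_Ioi_eq_half {X : Type*} [AddCommGroup X] [Module ℝ X] {n : ℕ} (g : Fin n → Fin n → X)
    (hs : ∀ i j, g j i = g i j) (h0 : ∀ i, g i i = 0) :
    ∑ i, ∑ j ∈ Finset.Ioi i, g i j = (1 / 2 : ℝ) • ∑ i, ∑ j, g i j := by
  have h1 := Finset.sum_sum_Ioi_add_eq_sum_sum_off_diag g
  have h2 : ∑ i, ∑ j ∈ Finset.Ioi i, (g j i + g i j) =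
      (2 : ℝ) • ∑ i, ∑ j ∈ Finset.Ioi i, g i j := by
    simp only [Finset.smul_sum]
    exact Finset.sum_congr rfl fun i _ => Finset.sum_congr rfl fun j _ => by rw [hs, two_smul]
  have h3 : ∑ i, ∑ j ∈ {i}ᶜ, g j i = ∑ i, ∑ j, g i j := by
    refine Finset.sum_congr rfl fun i _ => ?_
    rw [← Finset.sum_add_sum_compl {i} (fun j => g i j), Finset.sum_singleton, h0, zero_add]
    exact Finset.sum_congr rfl fun j _ => hs i j
  rw [← h3, ← h1, h2, smul_smul]
  norm_num

/-- The algebra behind the independence of the curvature term of the orthonormal frame. -/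
theorem sum_Ioi_change_of_frame {G : Type*} [AddCommGroup G] [Module ℝ G] {n : ℕ}
    {h : Fin n → Fin n → ℝ} {C : Fin n → Fin n → ExteriorAlgebra ℝ G} {f e : Fin n → G}
    (hδ : ∀ i m, ∑ j, h j i * h j m = if i = m then 1 else 0) (hC : ∀ i k, C k i = -C i k)
    (hf : ∀ m, f m = ∑ k, h m k • e k) :
    ∑ m, ∑ j ∈ Finset.Ioi m, (∑ i, h j i • ∑ l, C l i * algebraMap ℝ _ (h m l)) *
        (ExteriorAlgebra.ι ℝ (f m) * ExteriorAlgebra.ι ℝ (f j)) =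
      (1 / 2 : ℝ) • ∑ i, ∑ k, C i k * (ExteriorAlgebra.ι ℝ (e i) * ExteriorAlgebra.ι ℝ (e k)) := by
  have h1 : ∀ j m, ∑ i, h j i • ∑ l, C l i * algebraMap ℝ _ (h m l) =
      ∑ i, ∑ l, (h j i * h m l) • C l i := by
    intro j m
    refine Finset.sum_congr rfl fun i _ => ?_
    rw [Finset.smul_sum]
    refine Finset.sum_congr rfl fun l _ => ?_
    rw [mul_smul, ← Algebra.commutes, ← Algebra.smul_def]
  have h2 : ∀ j m, ∑ i, ∑ l, (h m i * h j l) • C l i = -∑ i, ∑ l, (h j i * h m l) • C l i := by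
    intro j m
    rw [Finset.sum_comm, ← Finset.sum_neg_distrib]
    refine Finset.sum_congr rfl fun i _ => ?_
    rw [← Finset.sum_neg_distrib]
    refine Finset.sum_congr rfl fun l _ => ?_
    rw [hC l i, smul_neg, mul_comm]
  have ha : ∀ v w : G, ExteriorAlgebra.ι ℝ v * ExteriorAlgebra.ι ℝ w =
      -(ExteriorAlgebra.ι ℝ w * ExteriorAlgebra.ι ℝ v) := fun v w =>
    odd_anticomm (parity_ι v) (parity_ι w)
  have h3 : ∀ l, ∑ m, h m l • f m = e l := by
    intro l
    simp only [hf, Finset.smul_sum, smul_smul]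
    rw [Finset.sum_comm]
    simp only [← Finset.sum_smul, hδ]
    simp
  rw [sum_Ioi_eq_half]
  · congr 1
    simp only [h1, Finset.sum_mul]
    have h4 : ∀ i l, C l i * (ExteriorAlgebra.ι ℝ (e l) * ExteriorAlgebra.ι ℝ (e i)) =
        ∑ m, ∑ j, (h j i * h m l) • C l i *
          (ExteriorAlgebra.ι ℝ (f m) * ExteriorAlgebra.ι ℝ (f j)) := by
      intro i l
      rw [← h3 l, ← h3 i, map_sum, map_sum, Finset.sum_mul_sum, Finset.mul_sum]
      refine Finset.sum_congr rfl fun m _ => ?_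
      rw [Finset.mul_sum]
      refine Finset.sum_congr rfl fun j _ => ?_
      rw [map_smul, map_smul, smul_mul_smul_comm, mul_smul_comm, smul_mul_assoc, mul_comm]
    rw [Finset.sum_comm (f := fun i k => C i k * _)]
    simp only [h4]
    have h5 : ∀ m, ∑ j, ∑ i, ∑ l, (h j i * h m l) • C l i *
        (ExteriorAlgebra.ι ℝ (f m) * ExteriorAlgebra.ι ℝ (f j)) =
        ∑ i, ∑ l, ∑ j, (h j i * h m l) • C l i *
        (ExteriorAlgebra.ι ℝ (f m) * ExteriorAlgebra.ι ℝ (f j)) := by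
      intro m
      rw [Finset.sum_comm]
      exact Finset.sum_congr rfl fun i _ => Finset.sum_comm
    simp only [h5]
    rw [Finset.sum_comm]
    exact Finset.sum_congr rfl fun i _ => Finset.sum_comm
  · intro m j
    rw [h1, h1, h2, ha (f j) (f m), neg_mul_neg]
  · intro m
    rw [odd_sq (parity_ι _), mul_zero]

theorem realize_smulRight {T A G ι : Type*} [AddCommGroup T] [Module ℝ T] [AddCommGroup A]
    [Module ℝ A] [AddCommGroup G] [Module ℝ G] [Fintype ι] (b : ι → T) (ε : ι → G)
    (ρ : A →ₗ[ℝ] ExteriorAlgebra ℝ G) (ℓ : A →ₗ[ℝ] ExteriorAlgebra ℝ G) (y : ExteriorAlgebra ℝ G)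
    (h : ∀ w, ρ w = ℓ w * y) {k : ℕ} (a : T [⋀^Fin k]→ₗ[ℝ] A) :
    realize b ε ρ k a = realize b ε ℓ k a * y := by
  simp only [realize_apply, smul_mul_assoc, Finset.sum_mul, mul_assoc, h]

variable {T W ι : Type*} [AddCommGroup T] [Module ℝ T] [NormedAddCommGroup W]
  [InnerProductSpace ℝ W] [Fintype ι] [DecidableEq ι] {n : ℕ}

theorem realize_skewSum (b : ι → T) (e f : Fin n → W) {k : ℕ} (τ : Fin n → T [⋀^Fin k]→ₗ[ℝ] W) :
    realize b (formGen n) (ExteriorAlgebra.map (frameMap ι e)).toLinearMap k (skewSum τ f) =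
      ∑ m, ∑ j ∈ Finset.Ioi m,
        realizeR b (formGen n) k ((innerSL ℝ (f j)).toLinearMap.compAlternatingMap (τ m)) *
          (ExteriorAlgebra.ι ℝ (frameMap ι e (f m)) * ExteriorAlgebra.ι ℝ (frameMap ι e (f j))) := by
  rw [skewSum, map_sum]
  refine Finset.sum_congr rfl fun m _ => ?_
  rw [map_sum]
  refine Finset.sum_congr rfl fun j _ => ?_
  rw [realize_comp]
  refine realize_smulRight b _ _ _ _ (fun w => ?_) _
  rw [LinearMap.comp_apply, LinearMap.toSpanSingleton_apply, AlgHom.toLinearMap_apply, map_smul,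
    map_mul, ExteriorAlgebra.map_apply_ι, ExteriorAlgebra.map_apply_ι,
    Algebra.smul_def, Algebra.linearMap_apply]

theorem realize_ι (b : ι → T) (e : Fin n → W) {k : ℕ} (τ : T [⋀^Fin k]→ₗ[ℝ] W) :
    realize b (formGen n) (ExteriorAlgebra.map (frameMap ι e)).toLinearMap k
        ((ExteriorAlgebra.ι ℝ).compAlternatingMap τ) =
      ∑ i, realizeR b (formGen n) k ((innerSL ℝ (e i)).toLinearMap.compAlternatingMap τ) *
        fr ι i := by
  simp only [realize_apply, smul_mul_assoc, Finset.sum_mul, ← Finset.smul_sum]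
  congr 1
  rw [Finset.sum_comm]
  refine Finset.sum_congr rfl fun (L : Fin k → ι) _ => ?_
  simp only [mul_assoc, ← Finset.mul_sum]
  congr 1
  change ExteriorAlgebra.map (frameMap ι e) (ExteriorAlgebra.ι ℝ _) =
    ∑ i, algebraMap ℝ _ (inner ℝ (e i) _) * fr ι i
  rw [ExteriorAlgebra.map_apply_ι, frameMap_apply, map_sum]
  exact Finset.sum_congr rfl fun i _ => by rw [map_smul, Algebra.smul_def]

end SkewSum

/-! ### Local expression of `𝒜` -/

/-- The covariant differential of the tautological section is that of a `0`-form with components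
`z`. -/
theorem LocalData.dTaut_eq_coneCov {F : Type*} [NormedAddCommGroup F] [NormedSpace ℝ F]
    {ι : Type*} [Fintype ι] [DecidableEq ι] {n : ℕ} (D : LocalData F ι n) (b : ι → F) (i : Fin n)
    (u : F) : D.dTaut b i u = D.coneCov b (fun j v => algebraMap ℝ _ (D.z j v)) i u := by
  rw [dTaut, coneCov, coneDiff_of_mem_formAlg (f := fun v => algebraMap ℝ (Alg ι n) (D.z i v))
    (Subalgebra.algebraMap_mem _ _)]
  congr 1
  exact Finset.sum_congr rfl fun j _ => by rw [Algebra.smul_def, Algebra.commutes]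

theorem extD_zero {E H N : Type*} [NormedAddCommGroup E] [NormedSpace ℝ E] [TopologicalSpace H]
    (I : ModelWithCorners ℝ E H) [TopologicalSpace N] [ChartedSpace H N] (k : ℕ) :
    extD I (0 : DForm I N k) = 0 := by
  funext x
  have h1 : inChart I (0 : DForm I N k) x = fun _ => 0 := rfl
  have h2 : extDeriv (fun _ : E => (0 : E [⋀^Fin k]→L[ℝ] ℝ)) (extChartAt I x x) = 0 := by
    rw [extDeriv, fderiv_fun_const]
    exact (ContinuousAlternatingMap.alternatizeUncurryFinCLM ℝ E ℝ).map_zero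
  rw [extD, h1, h2]
  rfl

section Pair

variable {EM H M : Type*} [NormedAddCommGroup EM] [NormedSpace ℝ EM] [FiniteDimensional ℝ EM]
  [TopologicalSpace H] {I : ModelWithCorners ℝ EM H} [TopologicalSpace M] [ChartedSpace H M]
  {n : ℕ} {V : M → Type*} [TopologicalSpace (TotalSpace (EuclideanSpace ℝ (Fin n)) V)]
  [∀ x, NormedAddCommGroup (V x)] [∀ x, InnerProductSpace ℝ (V x)]
  [FiberBundle (EuclideanSpace ℝ (Fin n)) V] [VectorBundle ℝ (EuclideanSpace ℝ (Fin n)) V]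
  {p₀ : Tot n V} {x₁ : M} {u : EM × EuclideanSpace ℝ (Fin n)}

theorem pullNabla_zero (cov : CovariantDerivative I (EuclideanSpace ℝ (Fin n)) V) (k : ℕ) :
    pullNabla I cov (0 : TForm I n V k) = 0 := by
  funext p
  have h1 : ∀ i : Fin n, (fun q : Tot n V => toCont ((innerSL ℝ (orthoFrame (V := V) p.proj i
      q.proj)).toLinearMap.compAlternatingMap ((0 : TForm I n V k) q))) =
      (0 : DForm (totI I n) (Tot n V) k) := by
    intro i
    funext q
    ext v
    exact map_zero (innerSL ℝ (orthoFrame (V := V) p.proj i q.proj))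
  have h2 : ∀ (η : DForm (totI I n) (Tot n V) k) (w : V p.proj)
      (c : TangentSpace (totI I n) p [⋀^Fin 1]→ₗ[ℝ] V p.proj), η = 0 →
      (LinearMap.toSpanSingleton ℝ (V p.proj) w).compAlternatingMap
        (extD (totI I n) η p).toAlternatingMap +
        (-1 : ℝ) ^ k • wedge (LinearMap.lsmul ℝ (V p.proj)) (η p).toAlternatingMap c = 0 := by
    rintro η w c rfl
    have h3 : ((0 : DForm (totI I n) (Tot n V) k) p).toAlternatingMap = 0 := rfl
    rw [extD_zero, h3, wedge_zero_left, smul_zero, add_zero]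
    ext v
    exact zero_smul ℝ w
  exact Finset.sum_eq_zero fun i _ => h2 _ _ _ (h1 i)

/-- An element of `⨁ₖ Λᵏ T* ⊗ Λ* W` of form degree `k`. -/
noncomputable abbrev formSingle {T W : Type*} [AddCommGroup T] [Module ℝ T] [NormedAddCommGroup W]
    [InnerProductSpace ℝ W] (k : ℕ) (a : T [⋀^Fin k]→ₗ[ℝ] ExteriorAlgebra ℝ W) : LForm T W :=
  Pi.single k a

theorem formSingle_same {T W : Type*} [AddCommGroup T] [Module ℝ T] [NormedAddCommGroup W]
    [InnerProductSpace ℝ W] (k : ℕ) (a : T [⋀^Fin k]→ₗ[ℝ] ExteriorAlgebra ℝ W) :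
    formSingle k a k = a := Pi.single_eq_same _ _

theorem formSingle_of_ne {T W : Type*} [AddCommGroup T] [Module ℝ T] [NormedAddCommGroup W]
    [InnerProductSpace ℝ W] {j k : ℕ} (h : j ≠ k) (a : T [⋀^Fin k]→ₗ[ℝ] ExteriorAlgebra ℝ W) :
    formSingle k a j = 0 := Pi.single_eq_of_ne h _

variable (I) in
/-- The part of `𝒜` without its component of degree zero. -/
noncomputable def nilPair (om : DForm I M 2)
    (cov : CovariantDerivative I (EuclideanSpace ℝ (Fin n)) V) (Φ : ∀ x, V x →L[ℝ] V x)
    (p : Tot n V) :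
    LForm (TangentSpace (totI I n) p) (V p.proj) ×
      LForm (TangentSpace (totI I n) p) (V p.proj) :=
  (formSingle 1 ((ExteriorAlgebra.ι ℝ).compAlternatingMap
      (pullNabla I cov (ofSection I fun q => q.2) p)) - formSingle 2 (formQ I om cov Φ p),
    formSingle 0 ((ExteriorAlgebra.ι ℝ).compAlternatingMap
      (actForm I Φ (ofSection I fun q => q.2) p)) - formSingle 1 (formS I cov Φ p))

/-- The splitting of `𝒜` into its scalar part and its components of positive degree. -/
theorem pairA_eq (om : DForm I M 2) (cov : CovariantDerivative I (EuclideanSpace ℝ (Fin n)) V)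
    (Φ : ∀ x, V x →L[ℝ] V x) (p : Tot n V) :
    pairA I om cov Φ p = scalarPair _ _ (1 / 2 * ‖p.2‖ ^ 2) + nilPair I om cov Φ p := by
  have h0 : ∀ k, (tautological I : ∀ k, TForm I n V k) (k + 1) = 0 := fun _ => rfl
  have h00 : (tautological I : ∀ k, TForm I n V k) 0 = ofSection I fun q => q.2 := rfl
  have h1 : toLForm I (coneNabla I om cov Φ (tautological I, 0)).1 p =
      formSingle 1 ((ExteriorAlgebra.ι ℝ).compAlternatingMap
        (pullNabla I cov (ofSection I fun q => q.2) p)) := by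
    funext k
    match k with
    | 0 =>
      rw [formSingle_of_ne (by decide)]
      ext v
      exact map_zero (ExteriorAlgebra.ι ℝ)
    | 1 => rw [formSingle_same]; rfl
    | k + 2 =>
      rw [formSingle_of_ne (by omega)]
      have h2 : (coneNabla I om cov Φ (tautological I, 0)).1 (k + 2) p = 0 := by
        change pullNabla I cov ((tautological I : ∀ k, TForm I n V k) (k + 1)) p +
          wedgeTwo (pullForm I om p).toAlternatingMap (0 : _ [⋀^Fin k]→ₗ[ℝ] V p.proj) = 0
        rw [h0, pullNabla_zero, wedgeTwo, wedge_zero_right]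
        ext v
        exact add_zero (0 : V p.proj)
      ext v
      change ExteriorAlgebra.ι ℝ ((coneNabla I om cov Φ (tautological I, 0)).1 (k + 2) p v) = 0
      rw [h2]
      exact map_zero (ExteriorAlgebra.ι ℝ)
  have h3 : toLForm I (coneNabla I om cov Φ (tautological I, 0)).2 p =
      formSingle 0 ((ExteriorAlgebra.ι ℝ).compAlternatingMap
        (actForm I Φ (ofSection I fun q => q.2) p)) := by
    funext k
    match k with
    | 0 => rw [formSingle_same]; rfl
    | k + 1 =>
      rw [formSingle_of_ne (by omega)]
      have h2 : (coneNabla I om cov Φ (tautological I, 0)).2 (k + 1) p = 0 := by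
        change actForm I Φ ((tautological I : ∀ k, TForm I n V k) (k + 1)) p -
          pullNabla I cov (0 : TForm I n V k) p = 0
        rw [h0, pullNabla_zero]
        ext v
        exact (sub_zero _).trans (map_zero (Φ p.proj))
      ext v
      change ExteriorAlgebra.ι ℝ ((coneNabla I om cov Φ (tautological I, 0)).2 (k + 1) p v) = 0
      rw [h2]
      exact map_zero (ExteriorAlgebra.ι ℝ)
  rw [pairA, h1, h3, nilPair, scalarPair, add_sub_assoc]
  rfl

theorem vanishesBelow_nilPair (om : DForm I M 2)
    (cov : CovariantDerivative I (EuclideanSpace ℝ (Fin n)) V)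
    (Φ : ∀ x, V x →L[ℝ] V x) (p : Tot n V) : VanishesBelow 1 (nilPair I om cov Φ p) := by
  refine ⟨fun k hk => ?_, fun k hk => absurd hk (by omega)⟩
  obtain rfl : k = 0 := by omega
  change formSingle 1 _ 0 - formSingle 2 _ 0 = 0
  rw [formSingle_of_ne (by decide), formSingle_of_ne (by decide), sub_zero]

theorem ι_mem_exteriorPower {W : Type*} [AddCommGroup W] [Module ℝ W] (w : W) :
    ExteriorAlgebra.ι ℝ w ∈ ⋀[ℝ]^1 W := by
  rw [ExteriorAlgebra.exteriorPower, pow_one]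
  exact LinearMap.mem_range_self _ _

theorem skewSum_mem {T W : Type*} [AddCommGroup T] [Module ℝ T] [NormedAddCommGroup W]
    [InnerProductSpace ℝ W] {k : ℕ} (τ : Fin n → T [⋀^Fin k]→ₗ[ℝ] W) (e : Fin n → W)
    (v : Fin k → T) : skewSum τ e v ∈ ⋀[ℝ]^2 W := by
  let ev : (T [⋀^Fin k]→ₗ[ℝ] ExteriorAlgebra ℝ W) →+ ExteriorAlgebra ℝ W :=
    ⟨⟨fun a => a v, rfl⟩, fun _ _ => rfl⟩
  change ev (skewSum τ e) ∈ _
  rw [skewSum, map_sum]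
  refine Submodule.sum_mem _ fun i _ => ?_
  rw [map_sum]
  refine Submodule.sum_mem _ fun j _ => ?_
  change inner ℝ (e j) (τ i v) • (ExteriorAlgebra.ι ℝ (e i) * ExteriorAlgebra.ι ℝ (e j)) ∈ _
  refine Submodule.smul_mem _ _ ?_
  exact mul_mem_exteriorPower (ι_mem_exteriorPower _) (ι_mem_exteriorPower _)

theorem isBalanced_nilPair (om : DForm I M 2)
    (cov : CovariantDerivative I (EuclideanSpace ℝ (Fin n)) V)
    (Φ : ∀ x, V x →L[ℝ] V x) (p : Tot n V) : IsBalanced (nilPair I om cov Φ p) := by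
  have hs : ∀ (j m : ℕ) (a : TangentSpace (totI I n) p [⋀^Fin j]→ₗ[ℝ] ExteriorAlgebra ℝ (V p.proj)),
      (∀ v, a v ∈ ⋀[ℝ]^(j + m) (V p.proj)) → ∀ k v,
      (Pi.single j a : LForm (TangentSpace (totI I n) p) (V p.proj)) k v ∈
        ⋀[ℝ]^(k + m) (V p.proj) := by
    intro j m a ha k v
    by_cases h : k = j
    · subst h
      rw [Pi.single_eq_same]
      exact ha v
    · rw [Pi.single_eq_of_ne h]
      exact Submodule.zero_mem _
  constructor
  · intro k v
    exact Submodule.sub_mem _ (hs 1 0 _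
      (fun v => ι_mem_exteriorPower (pullNabla I cov (ofSection I fun q => q.2) p v)) k v)
      (hs 2 0 _ (fun v => skewSum_mem _ _ _) k v)
  · intro k v
    exact Submodule.sub_mem _ (hs 0 1 _
      (fun v => ι_mem_exteriorPower (actForm I Φ (ofSection I fun q => q.2) p v)) k v)
      (hs 1 1 _ (fun v => skewSum_mem _ _ _) k v)

variable {om : DForm I M 2} {cov : CovariantDerivative I (EuclideanSpace ℝ (Fin n)) V}
  {Φ : ∀ x, V x →L[ℝ] V x}

/-- The norm of the tautological section is computed by its coordinates in any orthonormal frame. -/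
theorem halfSq_frameData (hu : u ∈ chartFrameSet I p₀ x₁) :
    (frameData I om cov Φ p₀ x₁).halfSq u = 1 / 2 * ‖(pt I p₀ u).2‖ ^ 2 := by
  rw [LocalData.halfSq, ← real_inner_self_eq_norm_sq, ← sum_inner_mul_inner_orthoFrame hu.2]
  simp only [frameData, sq]

variable [I.Boundaryless] [IsManifold I ∞ M]
  [ContMDiffVectorBundle ∞ (EuclideanSpace ℝ (Fin n)) V I]
  [IsContMDiffRiemannianBundle I ∞ (EuclideanSpace ℝ (Fin n)) V]

/-- The local expression of `𝒜`: its part of positive degree is given by the nilpotent part of the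
local data, in every orthonormal frame. -/
theorem realizePair_nilPair (hmetric : cov.IsMetricCompatible) (hu : u ∈ chartFrameSet I p₀ x₁)
    (hD : (frameData I om cov Φ p₀ x₁).IsRegularAt (coordBasis EM n) u) :
    realizePair (coordFrame I p₀ u) (formGen n)
      (frameMap (Idx EM n) fun i => orthoFrame x₁ i (pt I p₀ u).proj) (kapGen (Idx EM n) n)
      (nilPair I om cov Φ (pt I p₀ u)) =
    (frameData I om cov Φ p₀ x₁).nilPart (coordBasis EM n) u := by
  set D := frameData I om cov Φ p₀ x₁ with hDdef
  -- `Q` and `S` are defined by the frame that belongs to the base point `x₂` of the point under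
  -- consideration; they are compared with the expressions in the frame that belongs to `x₁`
  set x₂ := (pt I p₀ u).proj with hx₂
  have hu₂ : u ∈ chartFrameSet I p₀ x₂ := ⟨hu.1, mem_baseSet_trivializationAt _ _ _⟩
  have hz : (fun (j : Fin n) v => algebraMap ℝ (Alg (Idx EM n) n) (D.z j v)) =
      comps I p₀ x₁ (ofSection I fun q => q.2) := by
    funext j v
    rw [comps_ofSection]
    rfl
  have h1 : ∀ i, D.dTaut (coordBasis EM n) i u =
      comps I p₀ x₁ (pullNabla I cov (ofSection I fun q => q.2)) i u + kap (Idx EM n) n *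
        comps I p₀ x₁ (actForm I Φ (ofSection I fun q => q.2)) i u := by
    intro i
    rw [LocalData.dTaut_eq_coneCov, hz]
    refine coneCov_comps hmetric hu (fun j => ?_) i
    rw [← hz]
    exact (contDiffAt_algebraMap (hD.z_smooth j)).differentiableAt (by simp)
  have h2 : ∀ m j : Fin n, loc I p₀ (innerForm I (orthoFrame x₂ j) fun p =>
        pullNabla I cov (pullNabla I cov (liftFrame I x₂ m)) p
          + wedgeTwo (pullForm I om p).toAlternatingMap (actForm I Φ (liftFrame I x₂ m) p)) u +
      kap (Idx EM n) n * loc I p₀ (innerForm I (orthoFrame x₂ j) fun p =>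
        actForm I Φ (pullNabla I cov (liftFrame I x₂ m)) p
          - pullNabla I cov (actForm I Φ (liftFrame I x₂ m)) p) u =
      ∑ i : Fin n, inner ℝ (orthoFrame (V := V) x₂ j x₂) (orthoFrame x₁ i x₂) •
        ∑ l, D.curv (coordBasis EM n) l i u * algebraMap ℝ _
          (inner ℝ (orthoFrame (V := V) x₂ m x₂) (orthoFrame x₁ l x₂)) := by
    intro m j
    rw [loc_innerForm_eq_sum hu, loc_innerForm_eq_sum hu, Finset.mul_sum, ← Finset.sum_add_distrib]
    refine Finset.sum_congr rfl fun i _ => ?_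
    rw [mul_smul_comm, ← smul_add]
    congr 1
    refine (sum_curv_mul_comps hmetric hu hD (α := liftFrame I x₂ m) (fun l => ?_) i).symm.trans ?_
    · have h3 : comps I p₀ x₁ (liftFrame I x₂ m) l = fun v => algebraMap ℝ _
          (inner ℝ (orthoFrame x₁ l (pt I p₀ v).proj) (orthoFrame x₂ m (pt I p₀ v).proj)) :=
        funext fun v => comps_ofSection _ _
      rw [h3]
      exact contDiffAt_algebraMap (contDiffAt_inner_pt hu.1 (contMDiffAt_orthoFrame hu.2 l)
        (contMDiffAt_orthoFrame hu₂.2 m))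
    · refine Finset.sum_congr rfl fun l _ => ?_
      rw [liftFrame, comps_ofSection, real_inner_comm]
  have h3 := sum_Ioi_change_of_frame
    (h := fun j i => inner ℝ (orthoFrame (V := V) x₂ j x₂) (orthoFrame x₁ i x₂))
    (C := fun i k => D.curv (coordBasis EM n) i k u)
    (f := fun m => frameMap (Idx EM n) (fun i => orthoFrame x₁ i x₂) (orthoFrame (V := V) x₂ m x₂))
    (e := frameGen (Idx EM n))
    (fun i m => by rw [sum_inner_mul_inner_orthoFrame hu₂.2, inner_orthoFrame hu.2])
    (fun i k => hD.curv_skew i k)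
    (fun m => by
      rw [frameMap_apply]
      exact Finset.sum_congr rfl fun i _ => by rw [real_inner_comm])
  rw [LocalData.nilPart, ← h3, nilPair, realizePair_apply, map_sub, map_sub, realizeForm_single,
    realizeForm_single, realizeForm_single, realizeForm_single, realize_ι, realize_ι, formQ, formS,
    realize_skewSum, realize_skewSum, mul_sub, sub_add_sub_comm]
  congr 1
  · rw [Finset.mul_sum, ← Finset.sum_add_distrib]
    refine Finset.sum_congr rfl fun i _ => ?_
    rw [h1, add_mul, mul_assoc]
    rfl
  · rw [Finset.mul_sum, ← Finset.sum_add_distrib]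
    refine Finset.sum_congr rfl fun m _ => ?_
    rw [Finset.mul_sum, ← Finset.sum_add_distrib]
    refine Finset.sum_congr rfl fun j _ => ?_
    rw [← h2, add_mul, mul_assoc]
    rfl

end Pair

/-! ### Local expression of the Thom form -/

section TopCoeff

variable {T W ι : Type*} [AddCommGroup T] [Module ℝ T] [NormedAddCommGroup W]
  [InnerProductSpace ℝ W] [Fintype ι] [DecidableEq ι] {n : ℕ}

theorem realizeR_topCoeff [Fact (Module.finrank ℝ W = n)] (o : Orientation ℝ W (Fin n))
    (e : OrthonormalBasis (Fin n) ℝ W) (b : ι → T) {k : ℕ}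
    (a : T [⋀^Fin k]→ₗ[ℝ] ExteriorAlgebra ℝ W) :
    realizeR b (formGen n) k ((topCoeff o).compAlternatingMap a) = o.volumeForm e •
      berez ι n (realize b (formGen n) (ExteriorAlgebra.map (frameMap ι e)).toLinearMap k a) := by
  rw [realizeR, realize_apply, realize_apply, map_smul, smul_comm, map_sum]
  congr 1
  rw [Finset.smul_sum]
  refine Finset.sum_congr rfl fun (J : Fin k → ι) _ => ?_
  rw [berez_mul_of_mem, ← mul_smul_comm]
  · congr 1
    exact berez_map_frameMap o e _
  · refine formAlg_le_baseAlg ?_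
    rw [ExteriorAlgebra.ιMulti_apply]
    refine Subalgebra.list_prod_mem _ fun x hx => ?_
    obtain ⟨i, rfl⟩ := List.mem_ofFn.1 hx
    exact dx_mem_formAlg _

/-- The Berezin integral of a pair, seen in the algebra. -/
theorem sum_realizeR_topCoeff [Fact (Module.finrank ℝ W = n)] (o : Orientation ℝ W (Fin n))
    (e : OrthonormalBasis (Fin n) ℝ W) (b : ι → T) (a : LForm T W × LForm T W) :
    ∑ k ∈ Finset.range (Fintype.card ι + 1),
        realizeR b (formGen n) k ((topCoeff o).compAlternatingMap (a.1 k)) +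
      kap ι n * ∑ k ∈ Finset.range (Fintype.card ι + 1),
        realizeR b (formGen n) k ((topCoeff o).compAlternatingMap (a.2 k)) =
    o.volumeForm e • berez ι n (realizePair b (formGen n) (frameMap ι e) (kapGen ι n) a) := by
  rw [realizePair_apply, map_add, smul_add, realizeForm_apply, realizeForm_apply,
    berez_ι_mul (fun i => by simp [kapGen]), ← mul_smul_comm, map_sum, map_sum, Finset.smul_sum,
    Finset.smul_sum]
  simp only [realizeR_topCoeff o e]

end TopCoeff

theorem neg_scalarPair {T W : Type*} [AddCommGroup T] [Module ℝ T] [NormedAddCommGroup W]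
    [InnerProductSpace ℝ W] (c : ℝ) : -scalarPair T W c = scalarPair T W (-c) := by
  have h : ∀ x : ExteriorAlgebra ℝ W, -(ofZero x : LForm T W) = ofZero (-x) := by
    intro x
    rw [ofZero, ofZero, ← Pi.single_neg]
    rfl
  rw [scalarPair, scalarPair, map_neg, ← h]
  ext1
  · rfl
  · exact neg_zero

theorem VanishesBelow.neg {T W : Type*} [AddCommGroup T] [Module ℝ T] [NormedAddCommGroup W]
    [InnerProductSpace ℝ W] {i : ℕ} {a : LForm T W × LForm T W} (h : VanishesBelow i a) :
    VanishesBelow i (-a) :=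
  ⟨fun k hk => neg_eq_zero.2 (h.1 k hk), fun k hk => neg_eq_zero.2 (h.2 k hk)⟩

section Thom

variable {EM H M : Type*} [NormedAddCommGroup EM] [NormedSpace ℝ EM] [FiniteDimensional ℝ EM]
  [TopologicalSpace H] {I : ModelWithCorners ℝ EM H} [TopologicalSpace M] [ChartedSpace H M]
  {n : ℕ} {V : M → Type*} [TopologicalSpace (TotalSpace (EuclideanSpace ℝ (Fin n)) V)]
  [∀ x, NormedAddCommGroup (V x)] [∀ x, InnerProductSpace ℝ (V x)]
  [FiberBundle (EuclideanSpace ℝ (Fin n)) V] [VectorBundle ℝ (EuclideanSpace ℝ (Fin n)) V]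
  {p₀ : Tot n V} {x₁ : M} {u : EM × EuclideanSpace ℝ (Fin n)}

variable (EM n) in
/-- A number `K` such that products of `K` factors without component of degree zero vanish. -/
noncomputable abbrev nilBound : ℕ := Module.finrank ℝ (EM × EuclideanSpace ℝ (Fin n)) + 2

theorem pairPow_neg_nilPair_eq_zero (om : DForm I M 2)
    (cov : CovariantDerivative I (EuclideanSpace ℝ (Fin n)) V)
    (Φ : ∀ x, V x →L[ℝ] V x) (p : Tot n V) {i : ℕ} (hi : nilBound EM n ≤ i) :
    pairPow (-nilPair I om cov Φ p) i = 0 :=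
  pairPow_eq_zero (vanishesBelow_nilPair om cov Φ p).neg hi

theorem pairExp_neg_pairA (om : DForm I M 2)
    (cov : CovariantDerivative I (EuclideanSpace ℝ (Fin n)) V)
    (Φ : ∀ x, V x →L[ℝ] V x) (p : Tot n V) :
    pairExp (-pairA I om cov Φ p) = Real.exp (-(1 / 2 * ‖p.2‖ ^ 2)) •
      ∑ i ∈ Finset.range (nilBound EM n + 1), (i.factorial : ℝ)⁻¹ •
        pairPow (-nilPair I om cov Φ p) i := by
  rw [pairA_eq, neg_add, neg_scalarPair, pairExp_add_scalar]
  exact fun i hi => pairPow_neg_nilPair_eq_zero om cov Φ p (by omega)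

theorem isBalanced_pairExp (om : DForm I M 2)
    (cov : CovariantDerivative I (EuclideanSpace ℝ (Fin n)) V)
    (Φ : ∀ x, V x →L[ℝ] V x) (p : Tot n V) : IsBalanced (pairExp (-pairA I om cov Φ p)) := by
  rw [pairExp_neg_pairA]
  refine (IsBalanced.sum _ fun i _ => (IsBalanced.pairPow ?_ i).smul _).smul _
  rw [← neg_one_smul ℝ]
  exact (isBalanced_nilPair om cov Φ p).smul _

variable (o : ∀ x, Orientation ℝ (V x) (Fin n)) (om : DForm I M 2)
  (cov : CovariantDerivative I (EuclideanSpace ℝ (Fin n)) V) (Φ : ∀ x, V x →L[ℝ] V x)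

theorem thomPair_fst_eq_zero {k : ℕ} (hk : k ≠ n) : (thomPair I o om cov Φ).1 k = 0 := by
  funext p
  have : Fact (Module.finrank ℝ (V p.proj) = n) := ⟨fiber_finrank p.proj⟩
  ext v
  change _ * topCoeff (o p.proj) ((pairExp (-pairA I om cov Φ p)).1 k v) = 0
  rw [topCoeff_eq_zero _ hk ((isBalanced_pairExp om cov Φ p).1 k v), mul_zero]

theorem thomPair_snd_eq_zero {k : ℕ} (hk : k + 1 ≠ n) : (thomPair I o om cov Φ).2 k = 0 := by
  funext p
  have : Fact (Module.finrank ℝ (V p.proj) = n) := ⟨fiber_finrank p.proj⟩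
  ext v
  change _ * topCoeff (o p.proj) ((pairExp (-pairA I om cov Φ p)).2 k v) = 0
  rw [topCoeff_eq_zero _ hk ((isBalanced_pairExp om cov Φ p).2 k v), mul_zero]

variable (n) in
/-- The constant factor of the Thom form. -/
noncomputable def thomConst : ℝ :=
  (-1 : ℝ) ^ (n * (n + 1) / 2) * (1 / (2 * Real.pi)) ^ ((n : ℝ) / 2)

variable [I.Boundaryless] [IsManifold I ∞ M]
  [ContMDiffVectorBundle ∞ (EuclideanSpace ℝ (Fin n)) V I]
  [IsContMDiffRiemannianBundle I ∞ (EuclideanSpace ℝ (Fin n)) V]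

variable {o om cov Φ}

theorem realizePair_pairExp (hmetric : cov.IsMetricCompatible) (hu : u ∈ chartFrameSet I p₀ x₁)
    (hD : (frameData I om cov Φ p₀ x₁).IsRegularAt (coordBasis EM n) u) :
    realizePair (coordFrame I p₀ u) (formGen n)
      (frameMap (Idx EM n) fun i => orthoFrame x₁ i (pt I p₀ u).proj) (kapGen (Idx EM n) n)
      (pairExp (-pairA I om cov Φ (pt I p₀ u))) =
    Real.exp (-(frameData I om cov Φ p₀ x₁).halfSq u) •
      ∑ i ∈ Finset.range (nilBound EM n + 1), (i.factorial : ℝ)⁻¹ •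
        (-(frameData I om cov Φ p₀ x₁).nilPart (coordBasis EM n) u) ^ i := by
  rw [pairExp_neg_pairA, halfSq_frameData hu, map_smul, map_sum]
  congr 1
  refine Finset.sum_congr rfl fun i _ => ?_
  rw [map_smul, realizePair_pairPow, map_neg, realizePair_nilPair hmetric hu hD]

theorem nilPart_pow_eq_zero (hmetric : cov.IsMetricCompatible) (hu : u ∈ chartFrameSet I p₀ x₁)
    (hD : (frameData I om cov Φ p₀ x₁).IsRegularAt (coordBasis EM n) u) :
    (frameData I om cov Φ p₀ x₁).nilPart (coordBasis EM n) u ^ nilBound EM n = 0 := by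
  have h : pairPow (nilPair I om cov Φ (pt I p₀ u)) (nilBound EM n) = 0 :=
    pairPow_eq_zero (vanishesBelow_nilPair om cov Φ (pt I p₀ u)) le_rfl
  rw [← realizePair_nilPair hmetric hu hD, ← realizePair_pairPow, h, map_zero]

/-- The local expression of the Thom form. -/
theorem sum_loc_thomPair (hmetric : cov.IsMetricCompatible) (hu : u ∈ chartFrameSet I p₀ x₁)
    (hD : (frameData I om cov Φ p₀ x₁).IsRegularAt (coordBasis EM n) u) :
    ∑ k ∈ Finset.range (Fintype.card (Idx EM n) + 1), loc I p₀ ((thomPair I o om cov Φ).1 k) u +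
      kap (Idx EM n) n * ∑ k ∈ Finset.range (Fintype.card (Idx EM n) + 1),
        loc I p₀ ((thomPair I o om cov Φ).2 k) u =
    (thomConst n * frameSign o x₁ (pt I p₀ u).proj) • berez (Idx EM n) n
      (Real.exp (-(frameData I om cov Φ p₀ x₁).halfSq u) •
        ∑ i ∈ Finset.range (nilBound EM n + 1), (i.factorial : ℝ)⁻¹ •
          (-(frameData I om cov Φ p₀ x₁).nilPart (coordBasis EM n) u) ^ i) := by
  have : Fact (Module.finrank ℝ (V (pt I p₀ u).proj) = n) := ⟨fiber_finrank _⟩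
  have h := sum_realizeR_topCoeff (o (pt I p₀ u).proj) (orthoBasis hu.2) (coordFrame I p₀ u)
    (pairExp (-pairA I om cov Φ (pt I p₀ u)))
  rw [funext (orthoBasis_apply hu.2), realizePair_pairExp hmetric hu hD] at h
  have h1 : ∀ k, loc I p₀ ((thomPair I o om cov Φ).1 k) u = thomConst n •
      realizeR (coordFrame I p₀ u) (formGen n) k ((topCoeff (o (pt I p₀ u).proj)).compAlternatingMap
        ((pairExp (-pairA I om cov Φ (pt I p₀ u))).1 k)) := fun k =>
    map_smul (realizeR (coordFrame I p₀ u) (formGen n) k) _ _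
  have h2 : ∀ k, loc I p₀ ((thomPair I o om cov Φ).2 k) u = thomConst n •
      realizeR (coordFrame I p₀ u) (formGen n) k ((topCoeff (o (pt I p₀ u).proj)).compAlternatingMap
        ((pairExp (-pairA I om cov Φ (pt I p₀ u))).2 k)) := fun k =>
    map_smul (realizeR (coordFrame I p₀ u) (formGen n) k) _ _
  simp only [h1, h2]
  rw [← Finset.smul_sum, ← Finset.smul_sum, mul_smul_comm, ← smul_add, h, smul_smul]
  rfl

end Thom

/-! ### Smoothness and closedness -/

theorem realizeR_wedgeTwo {T G ι : Type*} [AddCommGroup T] [Module ℝ T] [AddCommGroup G]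
    [Module ℝ G] [Fintype ι] (b : ι → T) (ε : ι → G) {k : ℕ} (θ : T [⋀^Fin 2]→ₗ[ℝ] ℝ)
    (β : T [⋀^Fin k]→ₗ[ℝ] ℝ) :
    realizeR b ε (k + 2) (wedgeTwo θ β) = realizeR b ε 2 θ * realizeR b ε k β := by
  rw [wedgeTwo, realizeR, realize_domDomCongr b ε _ (Nat.add_comm 2 k)]
  refine realize_wedge (A := ℝ) (B := ℝ) (C := ℝ) b ε (LinearMap.lsmul ℝ ℝ)
    (Algebra.linearMap ℝ (ExteriorAlgebra ℝ G)) _ _ ?_ θ β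
  intro x y v
  change algebraMap ℝ _ x * (_ * algebraMap ℝ _ y) = _ * algebraMap ℝ _ (x * y)
  rw [map_mul, ← mul_assoc, Algebra.commutes, mul_assoc]

theorem LocalData.coneDiff_const_smul {F : Type*} [NormedAddCommGroup F] [NormedSpace ℝ F]
    {ι : Type*} [Fintype ι] [DecidableEq ι] {n : ℕ} (D : LocalData F ι n) (b : ι → F)
    (f : F → Alg ι n) (u : F) (r : ℝ) :
    D.coneDiff b (fun v => r • f v) u = r • D.coneDiff b f u := by
  have h : fderiv ℝ (fun v => r • f v) u = r • fderiv ℝ f u :=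
    congrFun (fderiv_const_smul_field (f := f) r) u
  simp only [coneDiff, extDA, h, smul_apply, mul_smul_comm, map_smul,
    ← Finset.smul_sum, smul_add]

section Closed

variable {EM H M : Type*} [NormedAddCommGroup EM] [NormedSpace ℝ EM] [FiniteDimensional ℝ EM]
  [TopologicalSpace H] {I : ModelWithCorners ℝ EM H} [TopologicalSpace M] [ChartedSpace H M]
  {n : ℕ} {V : M → Type*} [TopologicalSpace (TotalSpace (EuclideanSpace ℝ (Fin n)) V)]
  [∀ x, NormedAddCommGroup (V x)] [∀ x, InnerProductSpace ℝ (V x)]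
  [FiberBundle (EuclideanSpace ℝ (Fin n)) V] [VectorBundle ℝ (EuclideanSpace ℝ (Fin n)) V]
  {p₀ : Tot n V} {u : EM × EuclideanSpace ℝ (Fin n)}

variable (I) in
/-- The sum of the components of an inhomogeneous form, in the chart at `p₀`. -/
noncomputable def locSum (p₀ : Tot n V) (α : ∀ k, DForm (totI I n) (Tot n V) k)
    (u : EM × EuclideanSpace ℝ (Fin n)) : Alg (Idx EM n) n :=
  ∑ k ∈ Finset.range (Fintype.card (Idx EM n) + 1), loc I p₀ (α k) u

theorem locSum_mem_formAlg (α : ∀ k, DForm (totI I n) (Tot n V) k) :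
    locSum I p₀ α u ∈ formAlg (Idx EM n) n :=
  Subalgebra.sum_mem _ fun k _ => loc_mem_formAlg (α k)

theorem loc_of_eq_zero {k : ℕ} {α : DForm (totI I n) (Tot n V) k} (h : α = 0) :
    loc I p₀ α u = 0 := by
  rw [h]
  exact map_zero (realizeR (coordFrame I p₀ u) (formGen n) k)

theorem loc_add_wedgeTwo {k : ℕ} (α : DForm (totI I n) (Tot n V) (k + 2))
    (θ : DForm (totI I n) (Tot n V) 2) (β : DForm (totI I n) (Tot n V) k) :
    loc I p₀ (fun q => α q + toCont (wedgeTwo (θ q).toAlternatingMap (β q).toAlternatingMap)) u =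
      loc I p₀ α u + loc I p₀ θ u * loc I p₀ β u := by
  have e : loc I p₀ θ u * loc I p₀ β u = realizeR (coordFrame I p₀ u) (formGen n) (k + 2)
      (wedgeTwo (θ (pt I p₀ u)).toAlternatingMap (β (pt I p₀ u)).toAlternatingMap) :=
    (realizeR_wedgeTwo (coordFrame I p₀ u) (formGen n) (θ (pt I p₀ u)).toAlternatingMap
      (β (pt I p₀ u)).toAlternatingMap).symm
  rw [e]
  exact map_add (realizeR (coordFrame I p₀ u) (formGen n) (k + 2)) (α (pt I p₀ u)).toAlternatingMap
    (wedgeTwo (θ (pt I p₀ u)).toAlternatingMap (β (pt I p₀ u)).toAlternatingMap)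

theorem loc_eq_locSum {α : ∀ k, DForm (totI I n) (Tot n V) k} {k : ℕ}
    (hk : k ≤ n) (h : ∀ j, j ≠ k → α j = 0) : loc I p₀ (α k) = locSum I p₀ α := by
  funext u
  rw [locSum, Finset.sum_eq_single_of_mem k]
  · rw [Finset.mem_range, Fintype.card_sum, Fintype.card_fin, Fintype.card_fin]
    omega
  · exact fun j _ hj => loc_of_eq_zero (h j hj)

/-- Contraction with `κ` gives the second component of a pair. -/
theorem contr_kapDual_add {ι : Type*} [DecidableEq ι] {n : ℕ} {x y : Alg ι n}
    (hx : x ∈ formAlg ι n) (hy : y ∈ formAlg ι n) :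
    contr (kapDual ι n) (x + kap ι n * y) = y := by
  rw [map_add, contr_kapDual_of_mem hx, contr_ι_mul, contr_kapDual_of_mem hy]
  simp [kapGen]

variable [I.Boundaryless] [IsManifold I ∞ M] [T2Space M]
  [ContMDiffVectorBundle ∞ (EuclideanSpace ℝ (Fin n)) V I]
  [IsContMDiffRiemannianBundle I ∞ (EuclideanSpace ℝ (Fin n)) V]
  {o : ∀ x, Orientation ℝ (V x) (Fin n)} {om : DForm I M 2}
  {cov : CovariantDerivative I (EuclideanSpace ℝ (Fin n)) V} {Φ : ∀ x, V x →L[ℝ] V x}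

/-- Smoothness and closedness of the Thom form, in a chart: `κ` serves as a formal primitive of
`om`, so that the two components form a single closed element of the algebra. -/
theorem contDiffAt_locSum_thomPair (ho : IsBundleOrientation o) (hom : IsSmoothForm I om)
    (hdom : extD I om = 0) (hcov : CovariantDerivative.ContMDiffCovariantDerivative cov ∞)
    (hmetric : cov.IsMetricCompatible)
    (hΦ : ContMDiff I (I.prod 𝓘(ℝ, EuclideanSpace ℝ (Fin n) →L[ℝ] EuclideanSpace ℝ (Fin n))) ∞
      fun x => TotalSpace.mk' (EuclideanSpace ℝ (Fin n) →L[ℝ] EuclideanSpace ℝ (Fin n))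
        (E := fun x => V x →L[ℝ] V x) x (Φ x))
    (hskew : ∀ (x : M) (v w : V x), inner ℝ (Φ x v) w = -inner ℝ v (Φ x w))
    (hu : u ∈ (extChartAt (totI I n) p₀).target) :
    ContDiffAt ℝ ∞ (locSum I p₀ (thomPair I o om cov Φ).1) u ∧
    ContDiffAt ℝ ∞ (locSum I p₀ (thomPair I o om cov Φ).2) u ∧
    extDA (coordBasis EM n) (formGen n) (locSum I p₀ (thomPair I o om cov Φ).1) u +
      loc I p₀ (pullForm I om) u * locSum I p₀ (thomPair I o om cov Φ).2 u = 0 ∧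
    extDA (coordBasis EM n) (formGen n) (locSum I p₀ (thomPair I o om cov Φ).2) u = 0 := by
  set x₁ := (pt I p₀ u).proj with hx₁
  have hux : u ∈ chartFrameSet I p₀ x₁ := ⟨hu, mem_baseSet_trivializationAt _ _ _⟩
  set D := frameData I om cov Φ p₀ x₁ with hDdef
  set A := locSum I p₀ (thomPair I o om cov Φ).1
  set B := locSum I p₀ (thomPair I o om cov Φ).2
  set Z : EM × EuclideanSpace ℝ (Fin n) → Alg (Idx EM n) n := fun v =>
    berez (Idx EM n) n (Real.exp (-D.halfSq v) •
      ∑ i ∈ Finset.range (nilBound EM n + 1), (i.factorial : ℝ)⁻¹ •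
        (-D.nilPart (coordBasis EM n) v) ^ i) with hZ
  have hreg : ∀ {v}, v ∈ chartFrameSet I p₀ x₁ → D.IsRegularAt (coordBasis EM n) v :=
    fun hv => isRegularAt_frameData hom hdom hcov hmetric hΦ hskew hv
  have hD := hreg hux
  have hA : ∀ v, A v ∈ formAlg (Idx EM n) n := fun v => locSum_mem_formAlg _
  have hB : ∀ v, B v ∈ formAlg (Idx EM n) n := fun v => locSum_mem_formAlg _
  have hW : (fun v => A v + kap (Idx EM n) n * B v) =ᶠ[𝓝 u]
      fun v => (thomConst n * frameSign o x₁ x₁) • Z v := by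
    filter_upwards [eventually_mem_chartFrameSet hux,
      (contMDiffAt_proj_pt hu).continuousAt.eventually (frameSign_eventually_eq ho x₁)] with v hv hs
    have h := sum_loc_thomPair (o := o) hmetric hv (hreg hv)
    rw [hs] at h
    exact h
  have hZs : ContDiffAt ℝ ∞ Z u := by
    refine contDiffAt_clm (berez (Idx EM n) n)
      (ContDiffAt.fun_smul ?_ (ContDiffAt.sum fun i _ => ?_))
    · exact hD.contDiffAt_halfSq.neg.exp
    · exact (hD.contDiffAt_nilPart.neg.pow i).const_smul ((i.factorial : ℝ)⁻¹)
  have hWs : ContDiffAt ℝ ∞ (fun v => A v + kap (Idx EM n) n * B v) u :=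
    (hZs.const_smul (thomConst n * frameSign o x₁ x₁)).congr_of_eventuallyEq hW
  -- the two components are separated by contraction with `κ`
  have hBs : ContDiffAt ℝ ∞ B u := by
    have h := contDiffAt_clm (contr (kapDual (Idx EM n) n)) hWs
    simp only [contr_kapDual_add (hA _) (hB _)] at h
    exact h
  have hAs : ContDiffAt ℝ ∞ A u := by
    have h := hWs.sub (contDiffAt_const (c := kap (Idx EM n) n) |>.mul hBs)
    simpa using h
  have hcl : D.coneDiff (coordBasis EM n) (fun v => A v + kap (Idx EM n) n * B v) u = 0 := by
    rw [LocalData.coneDiff_congr hW, LocalData.coneDiff_const_smul, hZ,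
      hD.coneDiff_berez_exp (nilPart_pow_eq_zero hmetric hux hD), smul_zero]
  have hAd := hAs.differentiableAt (n := ∞) (by simp)
  have hBd := hBs.differentiableAt (n := ∞) (by simp)
  have hom1 : D.om u ∈ formAlg (Idx EM n) n := loc_mem_formAlg _
  have hdA := extDA_mem_formAlg (b := coordBasis EM n) hAd (Filter.Eventually.of_forall hA)
  have hdB := extDA_mem_formAlg (b := coordBasis EM n) hBd (Filter.Eventually.of_forall hB)
  rw [LocalData.coneDiff_add hAd ((differentiableAt_const _).fun_mul hBd),
    LocalData.coneDiff_of_mem_formAlg (hA u), LocalData.coneDiff_kap_mul (hB u) hBd,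
    ← add_sub_assoc, sub_eq_add_neg, ← mul_neg] at hcl
  have h2 := contr_kapDual_add (Subalgebra.add_mem _ hdA (Subalgebra.mul_mem _ hom1 (hB u)))
    (Subalgebra.neg_mem _ hdB)
  rw [hcl, map_zero] at h2
  have h3 := neg_eq_zero.1 h2.symm
  rw [h3, neg_zero, mul_zero, add_zero] at hcl
  exact ⟨hAs, hBs, hcl, h3⟩

end Closed

section Closed

variable {EM H M : Type*} [NormedAddCommGroup EM] [NormedSpace ℝ EM] [FiniteDimensional ℝ EM]
  [TopologicalSpace H] {I : ModelWithCorners ℝ EM H} [TopologicalSpace M] [ChartedSpace H M]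
  {n : ℕ} {V : M → Type*} [TopologicalSpace (TotalSpace (EuclideanSpace ℝ (Fin n)) V)]
  [∀ x, NormedAddCommGroup (V x)] [∀ x, InnerProductSpace ℝ (V x)]
  [FiberBundle (EuclideanSpace ℝ (Fin n)) V] [VectorBundle ℝ (EuclideanSpace ℝ (Fin n)) V]
  [I.Boundaryless] [IsManifold I ∞ M]
  [ContMDiffVectorBundle ∞ (EuclideanSpace ℝ (Fin n)) V I]

/-- A pair of forms of degrees `n` and `n - 1` is smooth if its local expressions are. -/
theorem isPairOfDegree_of_locSum {U : (∀ k, DForm (totI I n) (Tot n V) k) ×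
      (∀ k, DForm (totI I n) (Tot n V) k)}
    (h1 : ∀ k, k ≠ n → U.1 k = 0) (h2 : ∀ k, k + 1 ≠ n → U.2 k = 0)
    (hs : ∀ (p₀ : Tot n V), ∀ u ∈ (extChartAt (totI I n) p₀).target,
      ContDiffAt ℝ ∞ (locSum I p₀ U.1) u ∧ ContDiffAt ℝ ∞ (locSum I p₀ U.2) u) :
    IsPairOfDegree (totI I n) n U := by
  have h0 : ∀ {k : ℕ} {α : DForm (totI I n) (Tot n V) k}, α = 0 →
      IsSmoothForm (totI I n) α := fun {k α} h =>
    isSmoothForm_of_loc α fun p₀ u _ => by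
      rw [show loc I p₀ α = fun _ => 0 from funext fun v => loc_of_eq_zero h]
      exact contDiffAt_const
  refine ⟨fun k => ?_, fun k => ?_, h1, h2⟩
  · by_cases hk : k = n
    · refine isSmoothForm_of_loc _ fun p₀ u hu => ?_
      rw [loc_eq_locSum hk.le fun j hj => h1 j (by omega)]
      exact (hs p₀ u hu).1
    · exact h0 (h1 k hk)
  · by_cases hk : k + 1 = n
    · refine isSmoothForm_of_loc _ fun p₀ u hu => ?_
      rw [loc_eq_locSum (by omega) fun j hj => h2 j (by omega)]
      exact (hs p₀ u hu).2
    · exact h0 (h2 k hk)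

/-- A pair of forms of degrees `n` and `n - 1` is closed if the sums of the local expressions of its
components are. -/
theorem coneD_eq_zero_of_locSum {om : DForm I M 2} {U : (∀ k, DForm (totI I n) (Tot n V) k) ×
      (∀ k, DForm (totI I n) (Tot n V) k)}
    (h1 : ∀ k, k ≠ n → U.1 k = 0) (h2 : ∀ k, k + 1 ≠ n → U.2 k = 0)
    (hs : ∀ (p₀ : Tot n V), ∀ u ∈ (extChartAt (totI I n) p₀).target,
      ContDiffAt ℝ ∞ (locSum I p₀ U.1) u ∧ ContDiffAt ℝ ∞ (locSum I p₀ U.2) u ∧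
      extDA (coordBasis EM n) (formGen n) (locSum I p₀ U.1) u +
        loc I p₀ (pullForm I om) u * locSum I p₀ U.2 u = 0 ∧
      extDA (coordBasis EM n) (formGen n) (locSum I p₀ U.2) u = 0) :
    coneD (totI I n) (pullForm I om) U = (0, 0) := by
  have hu : ∀ p : Tot n V, extChartAt (totI I n) p p ∈ (extChartAt (totI I n) p).target :=
    fun p => mem_extChartAt_target p
  have hloc : ∀ (p : Tot n V) (k : ℕ), loc I p (fun q => extD (totI I n) (U.1 (k + 1)) q +
        toCont (wedgeTwo (pullForm I om q).toAlternatingMap (U.2 k q).toAlternatingMap))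
        (extChartAt (totI I n) p p) =
      loc I p (extD (totI I n) (U.1 (k + 1))) (extChartAt (totI I n) p p) +
        loc I p (pullForm I om) (extChartAt (totI I n) p p) *
          loc I p (U.2 k) (extChartAt (totI I n) p p) := by
    exact fun p k => loc_add_wedgeTwo _ _ _
  have hd1 : ∀ p : Tot n V, loc I p (extD (totI I n) (U.1 n)) (extChartAt (totI I n) p p) =
      extDA (coordBasis EM n) (formGen n) (locSum I p U.1) (extChartAt (totI I n) p p) := by
    intro p
    have e1 := loc_eq_locSum (p₀ := p) le_rfl h1
    rw [loc_extD _ (hu p), e1]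
    rw [e1]
    exact (hs p _ (hu p)).1.differentiableAt (by simp)
  ext1
  · funext k
    match k with
    | 0 => rfl
    | 1 =>
      change extD (totI I n) (U.1 0) = 0
      by_cases hn : n = 0
      · funext p
        refine eq_zero_of_loc _ p ?_
        have h3 := (hs p _ (hu p)).2.2.1
        have h4 : locSum I p U.2 (extChartAt (totI I n) p p) = 0 :=
          Finset.sum_eq_zero fun k _ => loc_of_eq_zero (h2 k (by omega))
        rw [h4, mul_zero, add_zero, ← hd1] at h3
        subst hn
        exact h3
      · rw [h1 0 (Ne.symm hn), extD_zero]
    | k + 2 =>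
      funext p
      refine eq_zero_of_loc _ p ((hloc p k).trans ?_)
      by_cases hk : k + 1 = n
      · have h3 := (hs p _ (hu p)).2.2.1
        rw [← hd1, ← loc_eq_locSum (k := k) (by omega) fun j hj => h2 j (by omega)] at h3
        subst hk
        exact h3
      · rw [loc_of_eq_zero (h2 k hk), mul_zero, add_zero]
        refine loc_of_eq_zero ?_
        rw [h1 _ hk, extD_zero]
  · funext k
    match k with
    | 0 => rfl
    | k + 1 =>
      change -extD (totI I n) (U.2 k) = 0
      rw [neg_eq_zero]
      by_cases hk : k + 1 = n
      · funext p
        refine eq_zero_of_loc _ p ?_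
        have e1 := loc_eq_locSum (p₀ := p) (α := U.2) (k := k) (by omega) fun j hj => h2 j (by omega)
        rw [loc_extD _ (hu p), e1]
        · exact (hs p _ (hu p)).2.2.2
        · rw [e1]
          exact (hs p _ (hu p)).2.1.differentiableAt (by simp)
      · rw [h2 k hk, extD_zero]

end Closed

/-! ### Restriction of forms to the fibres -/

section Exponential

variable {G : Type*} [AddCommGroup G] [Module ℝ G]

theorem contr_pow_of_even (d : Module.Dual ℝ G) {Y : ExteriorAlgebra ℝ G} (hY : parity Y = Y)
    (i : ℕ) : contr d (Y ^ (i + 1)) = ((i : ℝ) + 1) • (contr d Y * Y ^ i) := by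
  induction i with
  | zero => simp
  | succ i ih =>
    rw [pow_succ' Y (i + 1), contr_mul, ih, hY, mul_smul_comm, ← mul_assoc, even_comm hY,
      mul_assoc, ← pow_succ', Nat.cast_succ]
    module

/-- Contraction of the truncated exponential series of an even nilpotent element. -/
theorem contr_exp (d : Module.Dual ℝ G) {Y : ExteriorAlgebra ℝ G} (hY : parity Y = Y) {K : ℕ}
    (hK : Y ^ K = 0) :
    contr d (∑ i ∈ Finset.range (K + 1), (i.factorial : ℝ)⁻¹ • Y ^ i) =
      contr d Y * ∑ i ∈ Finset.range (K + 1), (i.factorial : ℝ)⁻¹ • Y ^ i := by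
  have h1 : ∀ i : ℕ, contr d (((i + 1).factorial : ℝ)⁻¹ • Y ^ (i + 1)) =
      contr d Y * ((i.factorial : ℝ)⁻¹ • Y ^ i) := by
    intro i
    rw [map_smul, contr_pow_of_even d hY, smul_smul, mul_smul_comm, Nat.factorial_succ]
    congr 1
    have h1 : ((i : ℝ) + 1) ≠ 0 := by positivity
    have h2 : (i.factorial : ℝ) ≠ 0 := by positivity
    push_cast
    field_simp
  have h2 : contr d (∑ i ∈ Finset.range (K + 1), (i.factorial : ℝ)⁻¹ • Y ^ i) =
      ∑ i ∈ Finset.range K, contr d Y * ((i.factorial : ℝ)⁻¹ • Y ^ i) := by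
    rw [Finset.sum_range_succ', map_add, map_sum, pow_zero, map_smul, contr_one, smul_zero,
      add_zero]
    exact Finset.sum_congr rfl fun i _ => h1 i
  rw [h2, Finset.sum_range_succ, hK, smul_zero, add_zero, Finset.mul_sum]

/-- An element on which each contraction acts as multiplication with a generator, such as an
exponential, is multiplied by all these generators under successive contraction. -/
theorem contrFin_of_contr_eq_ι_mul {m : ℕ} (d : Fin m → Module.Dual ℝ G) (t : Fin m → G)
    (ht : ∀ i j, d i (t j) = 0) {f : ExteriorAlgebra ℝ G}
    (hf : ∀ i, contr (d i) f = ExteriorAlgebra.ι ℝ (t i) * f) :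
    contrFin d f = (-1 : ℝ) ^ (m * (m - 1) / 2) • (ExteriorAlgebra.ιMulti ℝ m t * f) := by
  induction m with
  | zero => simp [contrFin]
  | succ m ih =>
    rw [contrFin_succ, hf, contrFin_ι_mul _ _ (fun i => ht _ _),
      ih (fun i => d i.succ) (fun i => t i.succ) (fun i j => ht _ _) (fun i => hf _),
      Nat.triangle_succ, ExteriorAlgebra.ιMulti_succ_apply, mul_smul_comm, smul_smul, mul_assoc,
      pow_add, mul_comm]
    rfl

theorem detForm_ιMulti_self {m : ℕ} (d : Fin m → Module.Dual ℝ G) (v : Fin m → G)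
    (h : ∀ i j, d i (v j) = if i = j then 1 else 0) :
    detForm d (ExteriorAlgebra.ιMulti ℝ m v) = 1 := by
  rw [detForm, ExteriorAlgebra.liftAlternating_apply_ιMulti, Pi.single_eq_same]
  have h1 : (fun i => LinearMap.pi d (v i)) = (1 : Matrix (Fin m) (Fin m) ℝ) := by
    ext i j
    rw [Matrix.one_apply]
    exact (h j i).trans (if_congr eq_comm rfl rfl)
  change Matrix.det (fun i => LinearMap.pi d (v i) : Matrix (Fin m) (Fin m) ℝ) = 1
  rw [h1, Matrix.det_one]

variable {ι : Type*} [DecidableEq ι] {n : ℕ}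

/-- The Berezin integral of `exp (-∑ⱼ dxⱼ eⱼ)`. The sign arises from sorting `dxⱼ` and `eⱼ`. -/
theorem berez_exp_neg_sum {a : Fin n → ι} {K : ℕ}
    (hK : (∑ j, dx n (a j) * fr ι j) ^ K = 0) :
    berez ι n (∑ i ∈ Finset.range (K + 1), (i.factorial : ℝ)⁻¹ •
      (-∑ j, dx n (a j) * fr ι j) ^ i) =
    (-1 : ℝ) ^ (n * (n + 1) / 2) • ExteriorAlgebra.ιMulti ℝ n (fun j => formGen n (a j)) := by
  set Y : Alg ι n := -∑ j, dx n (a j) * fr ι j with hYdef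
  set f : Alg ι n := ∑ i ∈ Finset.range (K + 1), (i.factorial : ℝ)⁻¹ • Y ^ i with hf
  have hY : parity Y = Y := by
    rw [hYdef, map_neg, map_sum (parity (G := Gen ι n))]
    simp only [map_mul, parity_ι, neg_mul_neg]
  have hYK : Y ^ K = 0 := by rw [hYdef, neg_pow, hK, mul_zero]
  have hd : ∀ (i : Fin n) (b : ι), frameDual ι i (formGen n b) = 0 := fun i b => by
    simp [formGen]
  have hdf : ∀ i j : Fin n, frameDual ι i (frameGen ι j) = if i = j then 1 else 0 := fun i j => by
    by_cases h : i = j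
    · simp [h, frameGen]
    · simp [h, frameGen]
  have hc : ∀ i, contr (frameDual ι i) Y = dx n (a i) := by
    intro i
    rw [hYdef, map_neg, map_sum, Finset.sum_eq_single i]
    · rw [contr_ι_mul, hd, contr_ι, hdf, if_pos rfl, map_one, mul_one, zero_smul, zero_sub, neg_neg]
    · intro j _ hj
      rw [contr_ι_mul, hd, contr_ι, hdf, if_neg (Ne.symm hj), map_zero, mul_zero, zero_smul,
        sub_zero]
    · simp
  have hpar : ∀ m : ℕ, (parity ^ m : Alg ι n →ₐ[ℝ] Alg ι n) f = f := by
    have h1 : parity f = f := by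
      rw [hf, map_sum (parity (G := Gen ι n))]
      simp only [map_smul, map_pow, hY]
    intro m
    induction m with
    | zero => simp
    | succ m ih => rw [pow_succ', AlgHom.mul_apply, ih, h1]
  have hk : ∀ b : ι, killFrame ι n (formGen n b) = formGen n b := fun b =>
    killFrame_eq_self fun i => hd i b
  have hkY : ExteriorAlgebra.map (killFrame ι n) Y = 0 := by
    rw [hYdef, map_neg, map_sum, Finset.sum_eq_zero, neg_zero]
    intro j _
    have : killFrame ι n (frameGen ι j) = 0 := by
      funext l
      rcases l with b | i | w <;> simp [killFrame, frameGen]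
    rw [map_mul, ExteriorAlgebra.map_apply_ι, ExteriorAlgebra.map_apply_ι, this, map_zero, mul_zero]
  have hkf : ExteriorAlgebra.map (killFrame ι n) f = 1 := by
    rw [hf, map_sum, Finset.sum_range_succ', Finset.sum_eq_zero]
    · simp
    · intro i _
      rw [map_smul, map_pow, hkY, zero_pow (Nat.succ_ne_zero i), smul_zero]
  have hkM : ExteriorAlgebra.map (killFrame ι n)
      (ExteriorAlgebra.ιMulti ℝ n fun j => formGen n (a j)) =
      ExteriorAlgebra.ιMulti ℝ n fun j => formGen n (a j) := by
    rw [ExteriorAlgebra.map_apply_ιMulti]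
    congr 1
    funext j
    exact hk _
  rw [berez_apply, hpar, contrFin_of_contr_eq_ι_mul (frameDual ι) (fun j => formGen n (a j))
    (fun i j => hd i _) (fun i => by rw [hf, contr_exp _ hY hYK, hc]), map_smul, map_mul, hkf, hkM,
    mul_one, smul_smul, ← pow_add]
  congr 2
  have := Nat.triangle_succ n
  rw [Nat.add_sub_cancel, mul_comm] at this
  omega

end Exponential

section Restriction

variable {ι : Type*} [Fintype ι] [DecidableEq ι] {n m : ℕ}

/-- The substitution of the coordinate differentials `dxᵃ ↦ ∑ⱼ c j a dxʲ` in the algebra that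
corresponds to restricting a form to the vectors with coordinates `c j`. The generator `κ` is
mapped to zero. -/
def restrictGen {ι : Type*} [Fintype ι] {n m : ℕ} (c : Fin m → ι → ℝ) :
    Gen ι n →ₗ[ℝ] Gen (Fin m) n :=
  LinearMap.pi fun j => match j with
    | Sum.inl j => ∑ a, c j a • LinearMap.proj (Sum.inl a)
    | Sum.inr (Sum.inl i) => LinearMap.proj (Sum.inr (Sum.inl i))
    | Sum.inr (Sum.inr _) => 0

theorem restrictGen_formGen (c : Fin m → ι → ℝ) (a : ι) :
    restrictGen c (formGen n a) = ∑ j, c j a • formGen n j := by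
  funext l
  rw [Finset.sum_apply]
  rcases l with j | i | w
  · simp [restrictGen, formGen, Pi.single_apply]
  · simp [restrictGen, formGen]
  · simp [restrictGen, formGen]

theorem restrictGen_frameGen (c : Fin m → ι → ℝ) (i : Fin n) :
    restrictGen c (frameGen ι i) = frameGen (Fin m) i := by
  funext l
  rcases l with j | i | w <;> simp [restrictGen, frameGen, Pi.single_apply]

theorem restrictGen_kapGen (c : Fin m → ι → ℝ) :
    restrictGen c (kapGen ι n) = 0 := by
  funext l
  rcases l with j | i | w <;> simp [restrictGen, kapGen]

theorem berez_map_restrictGen (c : Fin m → ι → ℝ) (x : Alg ι n) :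
    berez (Fin m) n (ExteriorAlgebra.map (restrictGen c) x) =
      ExteriorAlgebra.map (restrictGen c) (berez ι n x) := by
  have h1 : ∀ k : ℕ, (parity ^ k) (ExteriorAlgebra.map (restrictGen (n := n) c) x) =
      ExteriorAlgebra.map (restrictGen c) ((parity ^ k) x) := by
    intro k
    induction k with
    | zero => rfl
    | succ k ih => rw [pow_succ', AlgHom.mul_apply, ih, parity_map, pow_succ', AlgHom.mul_apply]
  have h2 : killFrame (Fin m) n ∘ₗ restrictGen c = restrictGen c ∘ₗ killFrame ι n := by
    refine LinearMap.ext fun v => funext fun l => ?_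
    rcases l with j | i | w
    · simp [killFrame, restrictGen]
    · rfl
    · rfl
  have h3 : (fun i => frameDual (Fin m) i ∘ₗ restrictGen (ι := ι) (n := n) c) = frameDual ι := rfl
  rw [berez_apply, berez_apply, h1, contrFin_map, h3, map_smul, ← AlgHom.comp_apply,
    ← AlgHom.comp_apply, ExteriorAlgebra.map_comp_map, ExteriorAlgebra.map_comp_map, h2]

theorem map_realizeR {T G G' : Type*} [AddCommGroup T] [Module ℝ T] [AddCommGroup G] [Module ℝ G]
    [AddCommGroup G'] [Module ℝ G'] (f : G →ₗ[ℝ] G') (b : ι → T) (ε : ι → G) {k : ℕ}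
    (a : T [⋀^Fin k]→ₗ[ℝ] ℝ) :
    ExteriorAlgebra.map f (realizeR b ε k a) = realizeR b (f ∘ ε) k a := by
  rw [realizeR, realizeR, realize_apply, realize_apply, map_smul, map_sum]
  congr 1
  refine Finset.sum_congr rfl fun (J : Fin k → ι) _ => ?_
  rw [map_mul, ExteriorAlgebra.map_apply_ιMulti, Algebra.linearMap_apply, Algebra.linearMap_apply,
    AlgHom.commutes]
  rfl

theorem realizeR_substitution {T G J : Type*} [AddCommGroup T] [Module ℝ T] [AddCommGroup G]
    [Module ℝ G] [Fintype J] [DecidableEq J] (c : J → ι → ℝ) (b : ι → T) (ε : J → G) {k : ℕ}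
    (α : T [⋀^Fin k]→ₗ[ℝ] ℝ) :
    realizeR b (fun a => ∑ j, c j a • ε j) k α = realizeR (fun j => ∑ a, c j a • b a) ε k α := by
  have h1 : ∀ A : Fin k → ι,
      ExteriorAlgebra.ιMulti ℝ k ((fun a => ∑ j, c j a • ε j) ∘ A) =
      ∑ B : Fin k → J, (∏ i, c (B i) (A i)) • ExteriorAlgebra.ιMulti ℝ k (ε ∘ B) := by
    intro A
    refine ((ExteriorAlgebra.ιMulti ℝ k).toMultilinearMap.map_sum
      (fun i j => c j (A i) • ε j)).trans (Finset.sum_congr rfl fun (B : Fin k → J) _ => ?_)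
    exact MultilinearMap.map_smul_univ _ _ _
  have h2 : ∀ B : Fin k → J, α ((fun j => ∑ a, c j a • b a) ∘ B) =
      ∑ A : Fin k → ι, (∏ i, c (B i) (A i)) • α (b ∘ A) := by
    intro B
    refine (α.toMultilinearMap.map_sum
      (fun i a => c (B i) a • b a)).trans (Finset.sum_congr rfl fun (A : Fin k → ι) _ => ?_)
    exact MultilinearMap.map_smul_univ _ _ _
  rw [realizeR, realizeR, realize_apply, realize_apply]
  congr 1
  simp only [h1, h2, map_sum, Finset.sum_mul, Finset.mul_sum]
  rw [Finset.sum_comm]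
  refine Finset.sum_congr rfl fun (B : Fin k → J) _ => Finset.sum_congr rfl fun
    (A : Fin k → ι) _ => ?_
  rw [map_smul, smul_mul_assoc, mul_smul_comm]

theorem map_restrictGen_realizeR {T : Type*} [AddCommGroup T] [Module ℝ T] (c : Fin m → ι → ℝ)
    (b : ι → T) {k : ℕ} (α : T [⋀^Fin k]→ₗ[ℝ] ℝ) :
    ExteriorAlgebra.map (restrictGen c) (realizeR b (formGen n) k α) =
      realizeR (fun j => ∑ a, c j a • b a) (formGen n) k α := by
  have h : restrictGen c ∘ formGen n = fun a => ∑ j, c j a • formGen (ι := Fin m) n j :=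
    funext fun a => restrictGen_formGen c a
  rw [map_realizeR, h, realizeR_substitution]

end Restriction

/-! ### The Thom form on vertical vectors -/

section Fiber

variable {EM H M : Type*} [NormedAddCommGroup EM] [NormedSpace ℝ EM] [FiniteDimensional ℝ EM]
  [TopologicalSpace H] {I : ModelWithCorners ℝ EM H} [TopologicalSpace M] [ChartedSpace H M]
  {n : ℕ} {V : M → Type*} [TopologicalSpace (TotalSpace (EuclideanSpace ℝ (Fin n)) V)]
  [∀ x, NormedAddCommGroup (V x)] [∀ x, InnerProductSpace ℝ (V x)]
  [FiberBundle (EuclideanSpace ℝ (Fin n)) V] [VectorBundle ℝ (EuclideanSpace ℝ (Fin n)) V]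

variable (I) in
/-- The coordinates of a point of a fibre in the chart at another point of this fibre. -/
noncomputable def fiberChart (x : M) (w : V x) : EM × EuclideanSpace ℝ (Fin n) :=
  (extChartAt I x x, fiberEquiv n x w)

theorem extChartAt_fiber (x : M) (v w : V x) :
    extChartAt (totI I n) (⟨x, v⟩ : Tot n V) ⟨x, w⟩ = fiberChart I x w := by
  rw [FiberBundle.extChartAt]
  have h : (trivializationAt (EuclideanSpace ℝ (Fin n)) V x ⟨x, w⟩).1 = x :=
    Trivialization.coe_fst' _ (mem_baseSet_trivializationAt _ _ x)
  refine Prod.ext ?_ ?_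
  · exact congrArg (extChartAt I x) h
  · rfl

theorem mem_extChartAt_source_fiber (x : M) (v w : V x) :
    (⟨x, w⟩ : Tot n V) ∈ (extChartAt (totI I n) (⟨x, v⟩ : Tot n V)).source := by
  rw [FiberBundle.extChartAt]
  simp [Trivialization.mem_source, mem_baseSet_trivializationAt]

theorem pt_fiberChart (x : M) (v w : V x) :
    pt I (⟨x, v⟩ : Tot n V) (fiberChart I x w) = ⟨x, w⟩ := by
  rw [← extChartAt_fiber x v w]
  exact (extChartAt (totI I n) (⟨x, v⟩ : Tot n V)).left_inv (mem_extChartAt_source_fiber x v w)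

theorem fiberChart_mem_target (x : M) (v w : V x) :
    fiberChart I x w ∈ (extChartAt (totI I n) (⟨x, v⟩ : Tot n V)).target := by
  rw [← extChartAt_fiber x v w]
  exact (extChartAt (totI I n) (⟨x, v⟩ : Tot n V)).map_source (mem_extChartAt_source_fiber x v w)

theorem hasFDerivAt_fiberChart (x : M) (v : V x) :
    haveI : FiniteDimensional ℝ (V x) := fiber_finiteDimensional n x
    HasFDerivAt (fiberChart I x) ((ContinuousLinearMap.inr ℝ EM (EuclideanSpace ℝ (Fin n))).comp
      (LinearMap.toContinuousLinearMap (fiberEquiv (V := V) n x).toLinearMap)) v := by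
  have : FiniteDimensional ℝ (V x) := fiber_finiteDimensional n x
  exact (hasFDerivAt_const (extChartAt I x x) v).prodMk
    (LinearMap.toContinuousLinearMap (fiberEquiv (V := V) n x).toLinearMap).hasFDerivAt

variable [I.Boundaryless] [IsManifold I ∞ M]
  [ContMDiffVectorBundle ∞ (EuclideanSpace ℝ (Fin n)) V I]

/-- Vertical vectors in the chart: their component along the base vanishes. -/
theorem vertLift_eq (x : M) (v w : V x) :
    (vertLift I x v w : EM × EuclideanSpace ℝ (Fin n)) =
      (mfderiv 𝓘(ℝ, EM × EuclideanSpace ℝ (Fin n)) (totI I n)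
        (extChartAt (totI I n) (⟨x, v⟩ : Tot n V)).symm (fiberChart I x v)
        ((0, fiberEquiv n x w) : EM × EuclideanSpace ℝ (Fin n)) :
          EM × EuclideanSpace ℝ (Fin n)) := by
  have h1 : (fun w : V x => (⟨x, w⟩ : Tot n V)) =
      pt I (⟨x, v⟩ : Tot n V) ∘ fiberChart I (n := n) x := funext fun w => (pt_fiberChart x v w).symm
  have h2 := mfderiv_comp (I := 𝓘(ℝ, V x)) v
    ((contMDiffAt_pt (V := V) (fiberChart_mem_target x v v)).mdifferentiableAt (by simp))
    (hasFDerivAt_fiberChart (I := I) (n := n) x v).differentiableAt.mdifferentiableAt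
  have h3 := congrArg (fun f : V x → Tot n V =>
    (mfderiv 𝓘(ℝ, V x) (totI I n) f v w : EM × EuclideanSpace ℝ (Fin n))) h1
  refine h3.trans ((DFunLike.congr_fun h2 w).trans ?_)
  have h4 : mfderiv 𝓘(ℝ, V x) 𝓘(ℝ, EM × EuclideanSpace ℝ (Fin n)) (fiberChart I (n := n) x) v w =
      ((0, fiberEquiv n x w) : EM × EuclideanSpace ℝ (Fin n)) := by
    rw [mfderiv_eq_fderiv, (hasFDerivAt_fiberChart (I := I) (n := n) x v).fderiv]
    rfl
  exact congrArg (mfderiv 𝓘(ℝ, EM × EuclideanSpace ℝ (Fin n)) (totI I n)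
    (extChartAt (totI I n) (⟨x, v⟩ : Tot n V)).symm (fiberChart I x v)) h4

variable (EM) in
/-- The coordinates of the vertical vectors given by a family of vectors of the fibre. -/
noncomputable def vertCoord (x : M) (e : Fin n → V x) (j : Fin n) (a : Idx EM n) : ℝ :=
  (coordBasis EM n).repr ((0, fiberEquiv n x (e j)) : EM × EuclideanSpace ℝ (Fin n)) a

theorem sum_vertCoord_smul_coordFrame (x : M) (e : Fin n → V x) (j : Fin n) (p₀ : Tot n V)
    (u : EM × EuclideanSpace ℝ (Fin n)) :
    ∑ a, vertCoord EM x e j a • coordFrame I p₀ u a =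
      mfderiv 𝓘(ℝ, EM × EuclideanSpace ℝ (Fin n)) (totI I n) (extChartAt (totI I n) p₀).symm u
        ((0, fiberEquiv n x (e j)) : EM × EuclideanSpace ℝ (Fin n)) := by
  have h := (coordBasis EM n).sum_repr ((0, fiberEquiv n x (e j)) : EM × EuclideanSpace ℝ (Fin n))
  conv_rhs => rw [← h]
  refine Eq.trans ?_ (map_sum (mfderiv 𝓘(ℝ, EM × EuclideanSpace ℝ (Fin n)) (totI I n)
    (extChartAt (totI I n) p₀).symm u) _ _).symm
  refine Finset.sum_congr rfl fun a _ => ?_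
  exact ((mfderiv 𝓘(ℝ, EM × EuclideanSpace ℝ (Fin n)) (totI I n)
    (extChartAt (totI I n) p₀).symm u).map_smul _ _).symm

/-- The values of a form on vertical vectors, in the algebra. -/
theorem apply_vertLift (x : M) (v : V x) (e : Fin n → V x)
    (α : DForm (totI I n) (Tot n V) n) :
    α ⟨x, v⟩ (fun i => vertLift I x v (e i)) =
      detForm (fun i : Fin n => LinearMap.proj (Sum.inl i))
        (ExteriorAlgebra.map (restrictGen (vertCoord EM x e))
          (loc I ⟨x, v⟩ α (fiberChart I x v))) := by
  have h1 : ∀ (q : Tot n V), q = ⟨x, v⟩ → ∀ w : Fin n → EM × EuclideanSpace ℝ (Fin n),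
      α ⟨x, v⟩ w = α q w := by
    rintro _ rfl _
    rfl
  rw [loc, map_restrictGen_realizeR, detForm_realizeR]
  refine (h1 _ (pt_fiberChart (I := I) (n := n) x v v) _).trans ?_
  change (α _).toAlternatingMap _ = (α _).toAlternatingMap _
  congr 1
  funext i
  rw [Finset.sum_eq_single i]
  · rw [sum_vertCoord_smul_coordFrame]
    refine (vertLift_eq x v (e i)).trans ?_
    simp only [formGen, LinearMap.proj_apply, Pi.single_eq_same]
    exact (one_smul ℝ _).symm
  · intro j _ hj
    simp only [formGen, LinearMap.proj_apply]
    rw [Pi.single_eq_of_ne (by simpa using hj.symm), zero_smul]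
  · simp

theorem dProj_sum_vertCoord {p₀ : Tot n V} {u : EM × EuclideanSpace ℝ (Fin n)}
    (hu : u ∈ (extChartAt (totI I n) p₀).target) (x : M) (e : Fin n → V x) (j : Fin n) :
    dProj I (pt I p₀ u) (∑ a, vertCoord EM x e j a • coordFrame I p₀ u a) = 0 := by
  rw [sum_vertCoord_smul_coordFrame, dProj_mfderiv hu]
  refine (mfderiv_proj_pt hu _).trans ?_
  exact map_zero (mfderiv 𝓘(ℝ, EM) I (extChartAt I p₀.proj).symm u.1 : EM →L[ℝ] EM)

/-- Pullbacks of forms on the base vanish on vertical vectors. -/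
theorem map_restrictGen_loc_pullForm {p₀ : Tot n V} {u : EM × EuclideanSpace ℝ (Fin n)}
    (hu : u ∈ (extChartAt (totI I n) p₀).target) (x : M) (e : Fin n → V x) (om : DForm I M 2) :
    ExteriorAlgebra.map (restrictGen (vertCoord EM x e)) (loc I p₀ (pullForm I om) u) = 0 := by
  rw [loc, map_restrictGen_realizeR, realizeR, realize_apply, Finset.sum_eq_zero, smul_zero]
  intro J _
  have h : (pullForm I om (pt I p₀ u)).toAlternatingMap
      ((fun j => ∑ a, vertCoord EM x e j a • coordFrame I p₀ u a) ∘ J) = 0 :=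
    (om (pt I p₀ u).proj).toAlternatingMap.map_coord_zero 0 (dProj_sum_vertCoord hu x e (J 0))
  rw [h, map_zero, mul_zero]

variable {om : DForm I M 2} {cov : CovariantDerivative I (EuclideanSpace ℝ (Fin n)) V}
  {Φ : ∀ x, V x →L[ℝ] V x}

/-- The connection form is a pullback from the base and `κ` is mapped to zero. -/
theorem map_restrictGen_T {p₀ : Tot n V} {u : EM × EuclideanSpace ℝ (Fin n)}
    (hu : u ∈ (extChartAt (totI I n) p₀).target) (x₁ x : M) (e : Fin n → V x) (i j : Fin n) :
    ExteriorAlgebra.map (restrictGen (vertCoord EM x e))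
      ((frameData I om cov Φ p₀ x₁).T i j u) = 0 := by
  have h1 : ExteriorAlgebra.map (restrictGen (vertCoord EM x e))
      (loc I p₀ (covForm I cov (orthoFrame x₁ i) (orthoFrame x₁ j)) u) = 0 := by
    rw [loc, map_restrictGen_realizeR, realizeR, realize_one_form, Finset.sum_eq_zero]
    intro l _
    have h : (covForm I cov (orthoFrame x₁ i) (orthoFrame x₁ j) (pt I p₀ u)).toAlternatingMap
        (fun _ => ∑ a, vertCoord EM x e l a • coordFrame I p₀ u a) = 0 := by
      change inner ℝ (orthoFrame x₁ j (pt I p₀ u).proj) (cov (orthoFrame x₁ i) (pt I p₀ u).proj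
        (dProj I (pt I p₀ u) (∑ a, vertCoord EM x e l a • coordFrame I p₀ u a))) = 0
      rw [dProj_sum_vertCoord hu, map_zero, inner_zero_right]
    rw [h, map_zero, mul_zero]
  rw [frameData, map_add, h1, zero_add, map_mul, ExteriorAlgebra.map_apply_ι, restrictGen_kapGen,
    map_zero, mul_zero]

variable [IsContMDiffRiemannianBundle I ∞ (EuclideanSpace ℝ (Fin n)) V]

/-- The curvature vanishes on vertical vectors, because the connection form does at all points of
the chart. -/
theorem map_restrictGen_curv (x : M) (v : V x) (e : Fin n → V x) (i k : Fin n)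
    (hD : (frameData I om cov Φ ⟨x, v⟩ x).IsRegularAt (coordBasis EM n) (fiberChart I x v)) :
    ExteriorAlgebra.map (restrictGen (vertCoord EM x e))
      ((frameData I om cov Φ ⟨x, v⟩ x).curv (coordBasis EM n) i k (fiberChart I x v)) = 0 := by
  set D := frameData I om cov Φ ⟨x, v⟩ x with hDdef
  have hu := fiberChart_mem_target (I := I) (n := n) x v v
  have h1 : ExteriorAlgebra.map (restrictGen (vertCoord EM x e))
      (extDA (coordBasis EM n) (formGen n) (D.T i k) (fiberChart I x v)) = 0 := by
    have h := map_extDA (b := coordBasis EM n) (ε := formGen n)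
      (ε' := fun a => restrictGen (vertCoord EM x e) (formGen n a)) (s := 1)
      (L := (ExteriorAlgebra.map (restrictGen (n := n) (vertCoord EM x e))).toLinearMap)
      (fun a y => by
        rw [one_smul, AlgHom.toLinearMap_apply, map_mul, ExteriorAlgebra.map_apply_ι]
        rfl) (hD.differentiableAt_T i k)
    refine h.trans ?_
    rw [one_smul, extDA_congr (g := fun _ => 0), extDA_const]
    filter_upwards [eventually_mem_target hu] with u' hu'
    exact map_restrictGen_T hu' x x e i k
  rw [LocalData.curv, LocalData.coneDiff, map_sub, map_add, h1, map_mul, map_sum]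
  have h2 : ExteriorAlgebra.map (restrictGen (vertCoord EM x e)) (D.om (fiberChart I x v)) = 0 :=
    map_restrictGen_loc_pullForm hu x e om
  rw [h2, zero_mul, zero_add, Finset.sum_eq_zero, sub_zero]
  intro j _
  rw [map_mul, map_restrictGen_T hu, zero_mul]

/-- The coordinates of the tautological section are linear on the fibre. -/
theorem fderiv_z (x : M) (v : V x) (i j : Fin n)
    (hD : (frameData I om cov Φ ⟨x, v⟩ x).IsRegularAt (coordBasis EM n) (fiberChart I x v)) :
    fderiv ℝ ((frameData I om cov Φ ⟨x, v⟩ x).z i) (fiberChart I x v)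
      ((0, fiberEquiv n x (orthoFrame (n := n) (V := V) x j x)) : EM × EuclideanSpace ℝ (Fin n)) =
    if i = j then 1 else 0 := by
  have h1 := (hD.differentiableAt_z i).hasFDerivAt.comp v
    (hasFDerivAt_fiberChart (I := I) (n := n) x v)
  have h2 : (frameData I om cov Φ ⟨x, v⟩ x).z i ∘ fiberChart I (n := n) x =
      fun w => innerSL ℝ (orthoFrame (n := n) (V := V) x i x) w := by
    funext w
    exact congrArg (fun q : Tot n V => inner ℝ (orthoFrame x i q.proj) q.2) (pt_fiberChart x v w)
  rw [h2] at h1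
  have h3 := h1.unique (innerSL ℝ (orthoFrame (n := n) (V := V) x i x)).hasFDerivAt
  rw [← inner_orthoFrame (n := n) (V := V) (mem_baseSet_trivializationAt _ _ x) i j]
  exact DFunLike.congr_fun h3 (orthoFrame (n := n) (V := V) x j x)

/-- The restriction of the nilpotent part of `𝒜` to the fibre. -/
theorem map_restrictGen_nilPart (x : M) (v : V x)
    (hD : (frameData I om cov Φ ⟨x, v⟩ x).IsRegularAt (coordBasis EM n) (fiberChart I x v)) :
    ExteriorAlgebra.map (restrictGen (vertCoord EM x fun i => orthoFrame (n := n) (V := V) x i x))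
      ((frameData I om cov Φ ⟨x, v⟩ x).nilPart (coordBasis EM n) (fiberChart I x v)) =
    ∑ i, dx n i * fr (Fin n) i := by
  have hu := fiberChart_mem_target (I := I) (n := n) x v v
  have h1 : ∀ i, ExteriorAlgebra.map
        (restrictGen (vertCoord EM x fun i => orthoFrame (n := n) (V := V) x i x))
      ((frameData I om cov Φ ⟨x, v⟩ x).dTaut (coordBasis EM n) i (fiberChart I x v)) =
      dx n i := by
    intro i
    have h2 : ∀ j : Fin n, ∑ a, vertCoord EM x (fun i => orthoFrame (n := n) (V := V) x i x) j a *
        fderiv ℝ ((frameData I om cov Φ ⟨x, v⟩ x).z i) (fiberChart I x v) (coordBasis EM n a) =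
        if i = j then 1 else 0 := by
      intro j
      rw [← fderiv_z x v i j hD]
      conv_rhs => rw [← (coordBasis EM n).sum_repr
        ((0, fiberEquiv n x (orthoFrame (n := n) (V := V) x j x)) :
        EM × EuclideanSpace ℝ (Fin n)), map_sum]
      exact Finset.sum_congr rfl fun a _ => ((fderiv ℝ ((frameData I om cov Φ ⟨x, v⟩ x).z i)
        (fiberChart I x v)).map_smul _ _).symm
    rw [LocalData.dTaut, extDA_algebraMap (hD.differentiableAt_z i), map_add, map_sum, map_sum,
      Finset.sum_eq_zero (s := Finset.univ) (f := fun j => ExteriorAlgebra.map _ (_ • _)), add_zero]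
    · simp only [map_mul, ExteriorAlgebra.map_apply_ι, restrictGen_formGen, AlgHom.commutes,
        map_sum, map_smul, Finset.sum_mul]
      rw [Finset.sum_comm, Finset.sum_eq_single i]
      · have h3 : ∀ a, vertCoord EM x (fun i => orthoFrame (n := n) (V := V) x i x) i a • dx n i *
            algebraMap ℝ (Alg (Fin n) n) (fderiv ℝ ((frameData I om cov Φ ⟨x, v⟩ x).z i)
              (fiberChart I x v) (coordBasis EM n a)) =
            (vertCoord EM x (fun i => orthoFrame (n := n) (V := V) x i x) i a *
              fderiv ℝ ((frameData I om cov Φ ⟨x, v⟩ x).z i) (fiberChart I x v)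
                (coordBasis EM n a)) • dx n i := by
          intro a
          rw [← Algebra.commutes, ← Algebra.smul_def, smul_smul, mul_comm]
        rw [Finset.sum_congr rfl fun a _ => h3 a, ← Finset.sum_smul, h2, if_pos rfl, one_smul]
      · intro j _ hj
        have h3 : ∀ a, vertCoord EM x (fun i => orthoFrame (n := n) (V := V) x i x) j a • dx n j *
            algebraMap ℝ (Alg (Fin n) n) (fderiv ℝ ((frameData I om cov Φ ⟨x, v⟩ x).z i)
              (fiberChart I x v) (coordBasis EM n a)) =
            (vertCoord EM x (fun i => orthoFrame (n := n) (V := V) x i x) j a *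
              fderiv ℝ ((frameData I om cov Φ ⟨x, v⟩ x).z i) (fiberChart I x v)
                (coordBasis EM n a)) • dx n j := by
          intro a
          rw [← Algebra.commutes, ← Algebra.smul_def, smul_smul, mul_comm]
        rw [Finset.sum_congr rfl fun a _ => h3 a, ← Finset.sum_smul, h2, if_neg hj.symm, zero_smul]
      · simp
    · intro j _
      rw [map_smul, map_restrictGen_T hu, smul_zero]
  rw [LocalData.nilPart, map_sub, map_sum, map_smul, map_sum,
    Finset.sum_eq_zero (s := Finset.univ) (f := fun i => ExteriorAlgebra.map _ (∑ k, _)),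
    smul_zero, sub_zero]
  · refine Finset.sum_congr rfl fun i _ => ?_
    rw [map_mul, h1, ExteriorAlgebra.map_apply_ι, restrictGen_frameGen]
  · intro i _
    rw [map_sum, Finset.sum_eq_zero]
    intro k _
    rw [map_mul, map_restrictGen_curv x v _ i k hD, zero_mul]

end Fiber

/-! ### Integration over the fibres -/

section FiberIntegral

theorem integral_gaussian_eq_one {W : Type*} [NormedAddCommGroup W] [InnerProductSpace ℝ W]
    [FiniteDimensional ℝ W] [MeasurableSpace W] [BorelSpace W] {n : ℕ}
    (hn : Module.finrank ℝ W = n) :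
    ∫ v : W, (1 / (2 * Real.pi)) ^ ((n : ℝ) / 2) * Real.exp (-(1 / 2) * ‖v‖ ^ 2) = 1 := by
  rw [MeasureTheory.integral_const_mul,
    GaussianFourier.integral_rexp_neg_mul_sq_norm (by norm_num), hn,
    ← Real.mul_rpow (by positivity) (by positivity)]
  have h : 1 / (2 * Real.pi) * (Real.pi / (1 / 2)) = 1 := by
    have := Real.pi_pos.ne'
    field_simp
  rw [h, Real.one_rpow]

/-- The integral of a function that is not integrable is zero by convention, so a nonzero integral
implies integrability. -/
theorem integrable_gaussian {W : Type*} [NormedAddCommGroup W] [InnerProductSpace ℝ W]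
    [FiniteDimensional ℝ W] [MeasurableSpace W] [BorelSpace W] {n : ℕ}
    (hn : Module.finrank ℝ W = n) :
    MeasureTheory.Integrable
      (fun v : W => (1 / (2 * Real.pi)) ^ ((n : ℝ) / 2) * Real.exp (-(1 / 2) * ‖v‖ ^ 2)) := by
  by_contra h
  have := integral_gaussian_eq_one hn
  rw [MeasureTheory.integral_undef h] at this
  exact zero_ne_one this

/-- The product of the values of the volume form and of another alternating form of top degree on an
orthonormal basis does not depend on the basis. -/
theorem volumeForm_mul_apply {W : Type*} [NormedAddCommGroup W] [InnerProductSpace ℝ W] {n : ℕ}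
    [Fact (Module.finrank ℝ W = n)] (o : Orientation ℝ W (Fin n)) (g : W [⋀^Fin n]→ₗ[ℝ] ℝ)
    (e f : OrthonormalBasis (Fin n) ℝ W) :
    o.volumeForm e * g e = o.volumeForm f * g f := by
  have hg : g e = g f * f.toBasis.det e := by
    conv_lhs => rw [AlternatingMap.eq_smul_basis_det f.toBasis g]
    simp
  have ho : o.volumeForm e = o.volumeForm f * f.toBasis.det e := by
    conv_lhs => rw [AlternatingMap.eq_smul_basis_det f.toBasis o.volumeForm]
    simp
  have hs : ∀ b : OrthonormalBasis (Fin n) ℝ W, o.volumeForm b * o.volumeForm b = 1 := by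
    intro b
    rw [← abs_mul_abs_self, o.abs_volumeForm_apply_of_orthonormal, one_mul]
  have h1 := hs e
  have h2 := hs f
  have h3 : f.toBasis.det e * f.toBasis.det e = 1 := by
    rw [ho] at h1
    linear_combination h1 - f.toBasis.det e * f.toBasis.det e * h2
  rw [hg, ho]
  linear_combination o.volumeForm f * g f * h3

variable {EM H M : Type*} [NormedAddCommGroup EM] [NormedSpace ℝ EM] [FiniteDimensional ℝ EM]
  [TopologicalSpace H] {I : ModelWithCorners ℝ EM H} [TopologicalSpace M] [ChartedSpace H M]
  {n : ℕ} {V : M → Type*} [TopologicalSpace (TotalSpace (EuclideanSpace ℝ (Fin n)) V)]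
  [∀ x, NormedAddCommGroup (V x)] [∀ x, InnerProductSpace ℝ (V x)]
  [FiberBundle (EuclideanSpace ℝ (Fin n)) V] [VectorBundle ℝ (EuclideanSpace ℝ (Fin n)) V]

theorem fiberIntegrand_eq_zero (o : ∀ x, Orientation ℝ (V x) (Fin n)) {l : ℕ}
    {α : DForm (totI I n) (Tot n V) (l + n)} (hα : α = 0) (x : M)
    (X : Fin l → TangentSpace I x) : fiberIntegrand I o α x X = fun _ => 0 := by
  subst hα
  funext v
  exact mul_zero _

/-- The component of degree `0` of the fibre integral only involves vertical vectors. The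
orthonormal basis used in the definition may be replaced by the frame at `x`. -/
theorem fiberIntegrand_zero (o : ∀ x, Orientation ℝ (V x) (Fin n))
    (α : ∀ k, DForm (totI I n) (Tot n V) k) (x : M) (X : Fin 0 → TangentSpace I x) (v : V x) :
    fiberIntegrand I o (α (0 + n)) x X v =
      frameSign o x x * α n ⟨x, v⟩ (fun i => vertLift I x v (orthoFrame x i x)) := by
  have : FiniteDimensional ℝ (V x) := fiber_finiteDimensional n x
  have : Fact (Module.finrank ℝ (V x) = n) := ⟨fiber_finrank x⟩
  -- the index type `Fin (0 + n)` of the definition is not syntactically `Fin n`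
  have h1 : ∀ (m : ℕ) (h : m = n) (w : Fin m → TangentSpace (totI I n) (⟨x, v⟩ : Tot n V)),
      α m ⟨x, v⟩ w = α n ⟨x, v⟩ (w ∘ Fin.cast h.symm) := by
    rintro _ rfl _
    rfl
  let L : V x →ₗ[ℝ] TangentSpace (totI I n) (⟨x, v⟩ : Tot n V) :=
    (mfderiv 𝓘(ℝ, V x) (totI I n) (fun u : V x => (⟨x, u⟩ : Tot n V)) v).toLinearMap
  have h2 := volumeForm_mul_apply (o x) ((α n ⟨x, v⟩).toAlternatingMap.compLinearMap L)
    ((stdOrthonormalBasis ℝ (V x)).reindex (finCongr (fiber_finrank x)))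
    (orthoBasis (mem_baseSet_trivializationAt _ _ x))
  rw [funext (orthoBasis_apply (mem_baseSet_trivializationAt _ _ x))] at h2
  refine Eq.trans ?_ h2
  change _ * _ = _ * _
  congr 1
  refine (h1 _ (Nat.zero_add n) _).trans ?_
  rw [Fin.append_left_nil _ _ rfl]
  rfl

variable [I.Boundaryless] [IsManifold I ∞ M]
  [ContMDiffVectorBundle ∞ (EuclideanSpace ℝ (Fin n)) V I]
  [IsContMDiffRiemannianBundle I ∞ (EuclideanSpace ℝ (Fin n)) V]
  {o : ∀ x, Orientation ℝ (V x) (Fin n)} {om : DForm I M 2}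
  {cov : CovariantDerivative I (EuclideanSpace ℝ (Fin n)) V} {Φ : ∀ x, V x →L[ℝ] V x}

/-- The restriction of the Thom form to the fibres. -/
theorem thomPair_vertLift (hmetric : cov.IsMetricCompatible) (x : M) (v : V x)
    (hD : (frameData I om cov Φ ⟨x, v⟩ x).IsRegularAt (coordBasis EM n) (fiberChart I x v)) :
    (thomPair I o om cov Φ).1 n ⟨x, v⟩ (fun i => vertLift I x v (orthoFrame x i x)) =
      (1 / (2 * Real.pi)) ^ ((n : ℝ) / 2) * frameSign o x x * Real.exp (-(1 / 2) * ‖v‖ ^ 2) := by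
  have hpt := pt_fiberChart (I := I) (n := n) x v v
  have hu : fiberChart I x v ∈ chartFrameSet I (⟨x, v⟩ : Tot n V) x := by
    refine ⟨fiberChart_mem_target x v v, ?_⟩
    rw [hpt]
    exact mem_baseSet_trivializationAt _ _ x
  have hW := sum_loc_thomPair (o := o) hmetric hu hD
  have hK := nilPart_pow_eq_zero hmetric hu hD
  set D := frameData I om cov Φ ⟨x, v⟩ x with hDdef
  set φ := ExteriorAlgebra.map (restrictGen (n := n)
    (vertCoord EM x fun i => orthoFrame (n := n) (V := V) x i x)) with hφ
  have hN : φ (D.nilPart (coordBasis EM n) (fiberChart I x v)) = ∑ i, dx n i * fr (Fin n) i :=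
    map_restrictGen_nilPart x v hD
  have hsq : D.halfSq (fiberChart I x v) = 1 / 2 * ‖v‖ ^ 2 :=
    (halfSq_frameData hu).trans (congrArg (fun q : Tot n V => 1 / 2 * ‖q.2‖ ^ 2) hpt)
  have hsign : frameSign o x (pt I (⟨x, v⟩ : Tot n V) (fiberChart I x v)).proj =
      frameSign o x x := congrArg (fun q : Tot n V => frameSign o x q.proj) hpt
  have hkap : φ (kap (Idx EM n) n) = 0 := by
    rw [hφ, ExteriorAlgebra.map_apply_ι, restrictGen_kapGen, map_zero]
  have hloc : loc I ⟨x, v⟩ ((thomPair I o om cov Φ).1 n) (fiberChart I x v) =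
      ∑ k ∈ Finset.range (Fintype.card (Idx EM n) + 1),
        loc I ⟨x, v⟩ ((thomPair I o om cov Φ).1 k) (fiberChart I x v) :=
    congrFun (loc_eq_locSum le_rfl fun j hj => thomPair_fst_eq_zero o om cov Φ hj) _
  have h1 := congrArg φ hW
  rw [map_add, map_mul, hkap, zero_mul, add_zero, ← hloc, map_smul, hφ, ← berez_map_restrictGen,
    ← hφ, map_smul, map_sum, hsq, hsign] at h1
  simp only [map_smul, map_pow, map_neg, hN] at h1
  rw [berez_exp_neg_sum (a := fun i => i) (by rw [← hN, ← map_pow, hK, map_zero])] at h1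
  rw [apply_vertLift x v fun i => orthoFrame (n := n) (V := V) x i x, ← hφ, h1, map_smul, map_smul,
    map_smul, detForm_ιMulti_self]
  · have h2 := neg_one_pow_mul_self_real (n * (n + 1) / 2)
    simp only [smul_eq_mul, mul_one, thomConst]
    rw [← neg_mul]
    linear_combination (1 / (2 * Real.pi)) ^ ((n : ℝ) / 2) * frameSign o x x *
      Real.exp (-(1 / 2) * ‖v‖ ^ 2) * h2
  · intro i j
    simp [formGen, Pi.single_apply]

/-- The sign of the frame cancels against the one in the Thom form, so the integrand is the Gaussian
density. -/
theorem fiberIntegrand_thomPair (hmetric : cov.IsMetricCompatible) (x : M)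
    (hD : ∀ v : V x, (frameData I om cov Φ ⟨x, v⟩ x).IsRegularAt (coordBasis EM n)
      (fiberChart I x v)) (X : Fin 0 → TangentSpace I x) :
    fiberIntegrand I o ((thomPair I o om cov Φ).1 (0 + n)) x X = fun v =>
      (1 / (2 * Real.pi)) ^ ((n : ℝ) / 2) * Real.exp (-(1 / 2) * ‖v‖ ^ 2) := by
  funext v
  rw [fiberIntegrand_zero, thomPair_vertLift hmetric x v (hD v)]
  have h := frameSign_mul_self o (mem_baseSet_trivializationAt (EuclideanSpace ℝ (Fin n)) V x)
  linear_combination (1 / (2 * Real.pi)) ^ ((n : ℝ) / 2) * Real.exp (-(1 / 2) * ‖v‖ ^ 2) * h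

end FiberIntegral

end MappingConeThom

theorem theorem1p1 {EM H M : Type*} [NormedAddCommGroup EM] [NormedSpace ℝ EM]
    [FiniteDimensional ℝ EM] [TopologicalSpace H] (I : ModelWithCorners ℝ EM H) [I.Boundaryless]
    [TopologicalSpace M] [T2Space M] [SecondCountableTopology M] [ChartedSpace H M]
    [IsManifold I ∞ M]
    (n : ℕ) {V : M → Type*} [TopologicalSpace (TotalSpace (EuclideanSpace ℝ (Fin n)) V)]
    [∀ x, NormedAddCommGroup (V x)] [∀ x, InnerProductSpace ℝ (V x)]
    [FiberBundle (EuclideanSpace ℝ (Fin n)) V] [VectorBundle ℝ (EuclideanSpace ℝ (Fin n)) V]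
    [ContMDiffVectorBundle ∞ (EuclideanSpace ℝ (Fin n)) V I]
    [IsContMDiffRiemannianBundle I ∞ (EuclideanSpace ℝ (Fin n)) V]
    (o : ∀ x, Orientation ℝ (V x) (Fin n)) (ho : MappingConeThom.IsBundleOrientation o)
    (om : MappingConeThom.DForm I M 2) (hom : MappingConeThom.IsSmoothForm I om)
    (hdom : MappingConeThom.extD I om = 0)
    (cov : CovariantDerivative I (EuclideanSpace ℝ (Fin n)) V)
    (hcov : CovariantDerivative.ContMDiffCovariantDerivative cov ∞) (hmetric : cov.IsMetricCompatible)
    (Φ : ∀ x, V x →L[ℝ] V x)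
    (hΦ : ContMDiff I (I.prod 𝓘(ℝ, EuclideanSpace ℝ (Fin n) →L[ℝ] EuclideanSpace ℝ (Fin n))) ∞
      fun x => TotalSpace.mk' (EuclideanSpace ℝ (Fin n) →L[ℝ] EuclideanSpace ℝ (Fin n))
        (E := fun x => V x →L[ℝ] V x) x (Φ x))
    (hskew : ∀ (x : M) (v w : V x), inner ℝ (Φ x v) w = -inner ℝ v (Φ x w)) :
    let U := MappingConeThom.thomPair I o om cov Φ
    MappingConeThom.IsPairOfDegree (MappingConeThom.totI I n) n U ∧
    MappingConeThom.coneD (MappingConeThom.totI I n) (MappingConeThom.pullForm I om) U = (0, 0) ∧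
    MappingConeThom.FiberIntegrable I o U.1 ∧ MappingConeThom.FiberIntegrable I o U.2 ∧
    MappingConeThom.fiberIntegral I o U.1 = (fun l _ _ => if l = 0 then 1 else 0) ∧
    MappingConeThom.fiberIntegral I o U.2 = (fun _ _ _ => 0) := by
  intro U
  have h1 : ∀ k, k ≠ n → U.1 k = 0 := fun k => MappingConeThom.thomPair_fst_eq_zero o om cov Φ
  have h2 : ∀ k, k + 1 ≠ n → U.2 k = 0 := fun k => MappingConeThom.thomPair_snd_eq_zero o om cov Φ
  have hs := fun (p₀ : MappingConeThom.Tot n V) u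
      (hu : u ∈ (extChartAt (MappingConeThom.totI I n) p₀).target) =>
    MappingConeThom.contDiffAt_locSum_thomPair ho hom hdom hcov hmetric hΦ hskew hu
  have hD : ∀ (x : M) (v : V x), (MappingConeThom.frameData I om cov Φ ⟨x, v⟩ x).IsRegularAt
      (MappingConeThom.coordBasis EM n) (MappingConeThom.fiberChart I x v) := by
    intro x v
    refine MappingConeThom.isRegularAt_frameData hom hdom hcov hmetric hΦ hskew
      ⟨MappingConeThom.fiberChart_mem_target x v v, ?_⟩
    rw [MappingConeThom.pt_fiberChart x v v]
    exact mem_baseSet_trivializationAt _ _ x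
  have hf1 : ∀ (l : ℕ), l ≠ 0 → ∀ (x : M) (X : Fin l → TangentSpace I x),
      MappingConeThom.fiberIntegrand I o (U.1 (l + n)) x X = fun _ => 0 := fun l hl x X =>
    MappingConeThom.fiberIntegrand_eq_zero o (h1 _ (by omega)) x X
  have hf0 : ∀ (x : M) (X : Fin 0 → TangentSpace I x),
      MappingConeThom.fiberIntegrand I o (U.1 (0 + n)) x X = fun v =>
        (1 / (2 * Real.pi)) ^ ((n : ℝ) / 2) * Real.exp (-(1 / 2) * ‖v‖ ^ 2) := fun x X =>
    MappingConeThom.fiberIntegrand_thomPair hmetric x (hD x) X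
  have hf2 : ∀ (l : ℕ) (x : M) (X : Fin l → TangentSpace I x),
      MappingConeThom.fiberIntegrand I o (U.2 (l + n)) x X = fun _ => 0 := fun l x X =>
    MappingConeThom.fiberIntegrand_eq_zero o (h2 _ (by omega)) x X
  refine ⟨MappingConeThom.isPairOfDegree_of_locSum h1 h2 fun p₀ u hu =>
      ⟨(hs p₀ u hu).1, (hs p₀ u hu).2.1⟩,
    MappingConeThom.coneD_eq_zero_of_locSum h1 h2 hs, fun l x X => ?_, fun l x X => ?_, ?_, ?_⟩
  · have : FiniteDimensional ℝ (V x) := MappingConeThom.fiber_finiteDimensional n x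
    letI : MeasurableSpace (V x) := borel (V x)
    have : BorelSpace (V x) := ⟨rfl⟩
    by_cases hl : l = 0
    · subst hl
      rw [hf0]
      exact MappingConeThom.integrable_gaussian (MappingConeThom.fiber_finrank x)
    · rw [hf1 l hl]
      exact MeasureTheory.integrable_zero _ _ _
  · rw [hf2]
    exact MeasureTheory.integrable_zero _ _ _
  · funext l x X
    have : FiniteDimensional ℝ (V x) := MappingConeThom.fiber_finiteDimensional n x
    letI : MeasurableSpace (V x) := borel (V x)
    have : BorelSpace (V x) := ⟨rfl⟩
    rw [MappingConeThom.fiberIntegral]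
    by_cases hl : l = 0
    · subst hl
      rw [hf0, if_pos rfl]
      exact MappingConeThom.integral_gaussian_eq_one (MappingConeThom.fiber_finrank x)
    · rw [hf1 l hl, if_neg hl]
      exact MeasureTheory.integral_zero _ _
  · funext l x X
    rw [MappingConeThom.fiberIntegral, hf2]
    exact MeasureTheory.integral_zero _ _
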